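/- **Conventions.** Let $R$ be a commutative ring and $\mathrm{Alg}_R$ the category of commutative $R$-algebras. Let $\mathbb S$ be the category of simplicial sets. A map in $\mathbb S$ is a fibration if it is a Kan fibration, a surjective fibration if it is moreover surjective in every simplicial degree, and a trivial fibration if it has the right lifting property with respect to all $\partial\Delta^n\to\Delta^n$. *Derived algebras.* $s\mathcal N^\flat_R$ is the category of simplicial commutative $R$-algebras $A$ such that $I_A:=\ker(A\to\pi_0A)$ is nilpotent and the normalisation satisfies $N_iA=0$ for $i\gg0$. If $R$ is a $\mathbb Q$-algebra, $dg_+\mathcal N^\flat_R$ is the category of differential graded-commutative $R$-algebras $A$ in non-negative chain degrees such that $I_A:=\ker(A\to \mathrm H_0A)$ is nilpotent and $A_i=0$ for $i\gg0$. We write $d\mathcal N^\flat_R$ for either $s\mathcal N^\flat_R$ ($R$ arbitrary) or $dg_+\mathcal N^\flat_R$ ($R$ a $\mathbb Q$-algebra). A square-zero extension (in $\mathrm{Alg}_R$ or in $d\mathcal N^\flat_R$) is a surjection $A\to B$ whose kernel $K$ satisfies $K\cdot K=0$. A tiny acyclic extension in $d\mathcal N^\flat_R$ is a surjection $A\to B$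 whose kernel $K$ satisfies $I_A\cdot K=0$ and such that $NK$ (respectively $K$) is the complex $M\xrightarrow{\ \sim\ }M$ in degrees $r+1$ and $r$, for some $\pi_0A$-module (respectively $\mathrm H_0A$-module) $M$ and some $r\ge0$. *Properties of functors.* A functor $F$ on $\mathrm{Alg}_R$ or $d\mathcal N^\flat_R$ is homogeneous if $F(A\times_BC)\to F(A)\times_{F(B)}F(C)$ is an isomorphism for every square-zero extension $A\to B$ and every $C\to B$. A functor $\mathrm{Alg}_R\to\mathrm{Set}$ is formally smooth if it sends square-zero extensions to surjections. A functor $F:d\mathcal N^\flat_R\to\mathbb S$ is homotopic (respectively pre-homotopic) if it sends tiny acyclic extensions to trivial fibrations (respectively surjective fibrations); it is formally quasi-presmooth if it sends square-zero extensions to fibrations; and it is formally quasi-smooth if it is formally quasi-presmooth and homotopic. *Quasi-comonoids.* A quasi-comonoid $E$ consists of sets $E^n$ ($n\ge0$), maps $\partial^i:E^n\to E^{n+1}$ ($1\le i\le n$) and $\sigma^i:E^{n+1}\to E^n$ ($0\le i\le n$), and an associative product $*:E^m\times E^n\to E^{m+n}$ with unit $1\in E^0$, such that $\partial^j\partial^i=\partial^i\partial^{j-1}$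 for $i<j$; $\sigma^j\sigma^i=\sigma^i\sigma^{j+1}$ for $i\le j$; $\sigma^j\partial^i$ equals $\partial^i\sigma^{j-1}$ for $i<j$, $\mathrm{id}$ for $i\in\{j,j+1\}$, and $\partial^{i-1}\sigma^j$ for $i>j+1$; and $\partial^i(e)*f=\partial^i(e*f)$, $\sigma^i(e)*f=\sigma^i(e*f)$, $e*\partial^i(f)=\partial^{i+m}(e*f)$, $e*\sigma^i(f)=\sigma^{i+m}(e*f)$ whenever the left-hand side is defined, with $e\in E^m$ in the last two. Morphisms preserve all the structure; the category is denoted $QM^*$, and $QM^*(\mathbb S)$ is the category of simplicial objects in $QM^*$. Limits in $QM^*$ are formed levelwise. *The Deligne functors.* For $E\in QM^*(\mathbb S)$ and $I=\Delta^1$, let $\mathfrak{mc}(E)\subset\prod_{n\ge0}(E^{n+1})^{I^n}$ be the simplicial set of those $\underline\omega$ with $$\omega_m(s_1,\dots,s_m)*\omega_n(t_1,\dots,t_n)=\omega_{m+n+1}(s_1,\dots,s_m,0,t_1,\dots,t_n),$$ $$\partial^i\omega_n(t_1,\dots,t_n)=\omega_{n+1}(t_1,\dots,t_{i-1},1,t_i,\dots,t_n)\quad(1\le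 i\le n+1),$$ $$\sigma^i\omega_n(t_1,\dots,t_n)=\omega_{n-1}(t_1,\dots,t_{i-1},\min\{t_i,t_{i+1}\},t_{i+2},\dots,t_n)\quad(1\le i<n),$$ $$\sigma^0\omega_n(t_1,\dots,t_n)=\omega_{n-1}(t_2,\dots,t_n),\quad \sigma^n\omega_n(t_1,\dots,t_n)=\omega_{n-1}(t_1,\dots,t_{n-1})\quad(n\ge1),\quad \sigma^0\omega_0=1.$$ Let $\mathrm{mc}(E)=\mathfrak{mc}(E)_0$. The simplicial group $(E^0)^\times$ of invertible elements of $E^0$ acts on $\mathfrak{mc}(E)$ by $(g\star\omega)_n=g*\omega_n*g^{-1}$ (where $g$ is viewed as constant along $I^n$). The derived Deligne groupoid $[\mathfrak{mc}(E)/(E^0)^\times]$ is the simplicial groupoid which in level $k$ is the action groupoid of $(E^0_k)^\times$ on $\mathfrak{mc}(E)_k$; the Deligne groupoid is its level $0$, $[\mathrm{mc}(E)/(E^0_0)^\times]$. For a simplicial groupoid $\Gamma$, $\bar W\Gamma$ is $\bar W$ of the bisimplicial set $(B_i\Gamma_j)_{i,j}$, where for a bisimplicial set $X$ $$(\bar WX)_p=\Big\{(x_0,\dots,x_p)\in\prod_{i=0}^pX_{i,p-i}\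 :\ \partial^v_0x_i=\partial^h_{i+1}x_{i+1}\ (0\le i<p)\Big\}$$ with $\partial_k(x_0,\dots,x_p)=(\partial^v_kx_0,\dots,\partial^v_1x_{k-1},\partial^h_kx_{k+1},\dots,\partial^h_kx_p)$ and $\sigma_k(x_0,\dots,x_p)=(\sigma^v_kx_0,\dots,\sigma^v_0x_k,\sigma^h_kx_k,\dots,\sigma^h_kx_p)$. *The extension $\underline E$.* For $E:\mathrm{Alg}_R\to QM^*$ and $A\in d\mathcal N^\flat_R$ let $\underline E(A)\in QM^*(\mathbb S)$ be given by $\underline E(A)_n=E((A^{\Delta^n})_0)$. Here $(A^{\Delta^n})_0=\mathrm{Hom}_{\mathbb S}(\Delta^n,A)=A_n$ for $A\in s\mathcal N^\flat_R$. For $A\in dg_+\mathcal N^\flat_R$, $A^{\Delta^n}=\tau_{\ge0}(A\otimes_{\mathbb Q}\Omega_n)$ is the good truncation, so $(A^{\Delta^n})_0=\mathrm Z_0(A\otimes_{\mathbb Q}\Omega_n)$, with $\Omega_n=\mathbb Q[t_0,\dots,t_n,dt_0,\dots,dt_n]/(\sum t_i-1,\sum dt_i)$ the rational differential forms on $\Delta^n$.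 **Theorem.** Let $E:\mathrm{Alg}_R\to QM^*$ be a homogeneous functor such that each $E^n:\mathrm{Alg}_R\to\mathrm{Set}$, $n\ge0$, is formally smooth. Then: 1. the functor $A\mapsto\bar W\big[\mathfrak{mc}(\underline E(A))/(\underline E(A)^0)^\times\big]$ from $d\mathcal N^\flat_R$ to $\mathbb S$ is homogeneous and formally quasi-smooth; 2. the functor $A\mapsto B\big[\mathrm{mc}(\underline E(A))/(\underline E(A)^0_0)^\times\big]$ from $d\mathcal N^\flat_R$ to $\mathbb S$ is homogeneous, pre-homotopic and formally quasi-presmooth. Both assertions hold for $d\mathcal N^\flat_R=s\mathcal N^\flat_R$ with $R$ any commutative ring, and for $d\mathcal N^\flat_R=dg_+\mathcal N^\flat_R$ with $R$ any commutative $\mathbb Q$-algebra. -/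

import Mathlib

open CategoryTheory Opposite Simplicial

universe w u

/-! ## Fibrations of simplicial sets, infinitesimal lifting properties -/

/-- Trivial (Kan) fibrations of simplicial sets: the right lifting property with respect to all
boundary inclusions `∂Δⁿ → Δⁿ`. -/
def IsTrivialKanFibration {X Y : SSet.{w}} (f : X ⟶ Y) : Prop :=
  SSet.modelCategoryQuillen.I.rlp f

/-- Kan fibrations of simplicial sets: the right lifting property with respect to all
horn inclusions. -/
def IsKanFibration {X Y : SSet.{w}} (f : X ⟶ Y) : Prop :=
  SSet.modelCategoryQuillen.J.rlp f

/-- Kan fibrations that are surjective in each simplicial degree. -/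
def IsSurjectiveKanFibration {X Y : SSet.{w}} (f : X ⟶ Y) : Prop :=
  IsKanFibration f ∧ ∀ k : SimplexCategoryᵒᵖ, Function.Surjective (f.app k)

section Functors

variable {C : Type*} [Category C] (sq tiny : MorphismProperty C)

/-- `F` is homogeneous: `F(A ×_B C) ≅ F(A) ×_{F(B)} F(C)` for every map `A ⟶ B` in the class `sq`
of square-zero extensions, and every `C ⟶ B`. -/
def IsHomogeneous {D : Type*} [Category D] (F : C ⥤ D) : Prop :=
  ∀ ⦃P A B C' : C⦄ ⦃fst : P ⟶ A⦄ ⦃snd : P ⟶ C'⦄ ⦃f : A ⟶ B⦄ ⦃g : C' ⟶ B⦄,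
    sq f → IsPullback fst snd f g → IsPullback (F.map fst) (F.map snd) (F.map f) (F.map g)

/-- `F` is homotopic: tiny acyclic extensions go to trivial fibrations. -/
def IsHomotopic (F : C ⥤ SSet.{w}) : Prop :=
  ∀ ⦃A B : C⦄ (f : A ⟶ B), tiny f → IsTrivialKanFibration (F.map f)

/-- `F` is pre-homotopic: tiny acyclic extensions go to surjective fibrations. -/
def IsPreHomotopic (F : C ⥤ SSet.{w}) : Prop :=
  ∀ ⦃A B : C⦄ (f : A ⟶ B), tiny f → IsSurjectiveKanFibration (F.map f)

/-- `F` is formally quasi-presmooth: square-zero extensions go to fibrations. -/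
def IsFormallyQuasiPresmooth (F : C ⥤ SSet.{w}) : Prop :=
  ∀ ⦃A B : C⦄ (f : A ⟶ B), sq f → IsKanFibration (F.map f)

/-- `F` is formally quasi-smooth: formally quasi-presmooth and homotopic. -/
def IsFormallyQuasiSmooth (F : C ⥤ SSet.{w}) : Prop :=
  IsFormallyQuasiPresmooth sq F ∧ IsHomotopic tiny F

end Functors

/-! ## The functor `W̄` from bisimplicial sets to simplicial sets -/

namespace BarW

/-- The restriction `{0, …, i} → {0, …, θ i}` of a monotone map `θ : [q] → [p]`, as a map
`[i] → [a]` where `a = θ i`. -/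
def initialPart {q p : ℕ} (θ : Fin (q + 1) →o Fin (p + 1)) (i a : ℕ) (hi : i < q + 1)
    (ha : (θ ⟨i, hi⟩ : ℕ) = a) : ⦋i⦌ ⟶ ⦋a⦌ :=
  SimplexCategory.mkHom
    { toFun := fun x => ⟨θ ⟨x, by omega⟩, by
        have h : θ ⟨x, by omega⟩ ≤ θ ⟨i, hi⟩ := θ.monotone (by
          simp only [Fin.mk_le_mk]; omega)
        rw [Fin.le_def] at h
        omega⟩
      monotone' := fun x y h => by
        simp only [Fin.mk_le_mk]
        exact θ.monotone (by simpa using h) }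

/-- The restriction `{i, …, q} → {θ i, …, p}` of a monotone map `θ : [q] → [p]`, reindexed as a
map `[j] → [b]` where `j = q - i`, `b = p - θ i`. -/
def finalPart {q p : ℕ} (θ : Fin (q + 1) →o Fin (p + 1)) (i j a b : ℕ) (hij : i + j = q)
    (hab : a + b = p) (ha : (θ ⟨i, by omega⟩ : ℕ) = a) : ⦋j⦌ ⟶ ⦋b⦌ :=
  SimplexCategory.mkHom
    { toFun := fun x => ⟨θ ⟨i + x, by omega⟩ - a, by omega⟩
      monotone' := fun x y h => by
        simp only [Fin.mk_le_mk]
        refine Nat.sub_le_sub_right ?_ a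
        exact θ.monotone (by simpa using h) }

/-- The simplicial operations on a bisimplicial set `X`. We write `X_{i,j}` for
`(X.obj (op ⦋j⦌)).obj (op ⦋i⦌)`: here `i` is the horizontal and `j` the vertical degree. -/
def act (X : SimplicialObject SSet.{w}) {i i' j j' : ℕ} (α : ⦋i'⦌ ⟶ ⦋i⦌) (β : ⦋j'⦌ ⟶ ⦋j⦌)
    (x : (X.obj (op ⦋j⦌)).obj (op ⦋i⦌)) : (X.obj (op ⦋j'⦌)).obj (op ⦋i'⦌) :=
  (X.obj (op ⦋j'⦌)).map α.op ((X.map β.op).app (op ⦋i⦌) x)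

lemma act_act (X : SimplicialObject SSet.{w}) {i i' i'' j j' j'' : ℕ} (α : ⦋i'⦌ ⟶ ⦋i⦌)
    (β : ⦋j'⦌ ⟶ ⦋j⦌) (α' : ⦋i''⦌ ⟶ ⦋i'⦌) (β' : ⦋j''⦌ ⟶ ⦋j'⦌)
    (x : (X.obj (op ⦋j⦌)).obj (op ⦋i⦌)) :
    act X α' β' (act X α β x) = act X (α' ≫ α) (β' ≫ β) x := by
  have := NatTrans.naturality_apply (X.map β'.op) α.op ((X.map β.op).app (op ⦋i⦌) x)
  simp only [act, op_comp, X.map_comp, Functor.map_comp_apply]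
  simp [this]

lemma act_id (X : SimplicialObject SSet.{w}) {i j : ℕ} (x : (X.obj (op ⦋j⦌)).obj (op ⦋i⦌)) :
    act X (𝟙 _) (𝟙 _) x = x := by
  simp [act]

end BarW

/-- The `p`-simplices of `W̄ X`, for a bisimplicial set `X`: families
`(x_0, …, x_p)` with `x_i ∈ X_{i, p - i}` and `∂ᵛ_0 x_i = ∂ʰ_{i+1} x_{i+1}` for `0 ≤ i < p`. -/
@[ext]
structure BarW (X : SimplicialObject SSet.{w}) (p : ℕ) : Type w where
  /-- `pt i j _` is the component `x_i ∈ X_{i, j}`, where `i + j = p` -/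
  pt : ∀ i j : ℕ, i + j = p → (X.obj (op ⦋j⦌)).obj (op ⦋i⦌)
  compat : ∀ (i j : ℕ) (h : i + (j + 1) = p),
    (X.map (SimplexCategory.δ (0 : Fin (j + 2))).op).app (op ⦋i⦌) (pt i (j + 1) h) =
      (X.obj (op ⦋j⦌)).map (SimplexCategory.δ (Fin.last (i + 1))).op
        (pt (i + 1) j (by omega))

namespace BarW

variable {X : SimplicialObject SSet.{w}}

/-- The inclusion `[a] → [c]` as an initial segment. -/
def incl {a c : ℕ} (h : a ≤ c) : ⦋a⦌ ⟶ ⦋c⦌ :=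
  SimplexCategory.mkHom
    { toFun := fun x => ⟨x, by omega⟩
      monotone' := fun x y h => by simpa using h }

/-- The inclusion `[d] → [b]`, `b = d + e`, as a final segment. -/
def shift {d b : ℕ} (e : ℕ) (h : d + e = b) : ⦋d⦌ ⟶ ⦋b⦌ :=
  SimplexCategory.mkHom
    { toFun := fun x => ⟨x + e, by omega⟩
      monotone' := fun x y h => by simpa using h }

lemma compat_act {p : ℕ} (x : BarW X p) (i j : ℕ) (h : i + (j + 1) = p) :
    act X (𝟙 _) (SimplexCategory.δ (0 : Fin (j + 2))) (x.pt i (j + 1) h) =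
      act X (SimplexCategory.δ (Fin.last (i + 1))) (𝟙 _) (x.pt (i + 1) j (by omega)) := by
  simpa [act] using x.compat i j h

lemma compat_general {p : ℕ} (x : BarW X p) (a b c d e : ℕ) (hb : d + e = b) (hc : a + e = c)
    (h : a + b = p) :
    act X (𝟙 _) (shift e hb) (x.pt a b h) =
      act X (incl (by omega)) (𝟙 _) (x.pt c d (by omega)) := by
  induction e generalizing a b with
  | zero => subst hb; subst hc; rfl
  | succ e ih =>
    obtain rfl : (d + e) + 1 = b := by omega
    have h1 := ih (a + 1) (d + e) rfl (by omega) (by omega)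
    have h2 := x.compat_act a (d + e) h
    have e1 : shift (e + 1) hb = shift e rfl ≫ SimplexCategory.δ (0 : Fin (d + e + 2)) := by
      ext y
      change (y : ℕ) + (e + 1) = (y + e) + 1
      omega
    have e2 : incl (show a ≤ c by omega) = SimplexCategory.δ (Fin.last (a + 1)) ≫
        incl (show a + 1 ≤ c by omega) := by
      ext y
      change (y : ℕ) = ((Fin.last (a + 1)).succAbove y : Fin (a + 2))
      simp
    have h3 := congrArg (act X (𝟙 _) (shift e rfl)) h2
    have h4 := congrArg (act X (SimplexCategory.δ (Fin.last (a + 1))) (𝟙 _)) h1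
    rw [act_act, act_act] at h3 h4
    rw [e1, e2]
    simp only [Category.id_comp, Category.comp_id] at h3 h4
    exact h3.trans h4

/-- The action of `θ : [q] → [p]` on `W̄ X`: the `i`-th component of `θ^* x` is obtained from
`x_{θ i}` by applying the restriction of `θ` to `{0, …, i}` horizontally and the restriction of `θ`
to `{i, …, q}` vertically. For faces and degeneracies this gives
`∂_k x = (∂ᵛ_k x_0, …, ∂ᵛ_1 x_{k-1}, ∂ʰ_k x_{k+1}, …, ∂ʰ_k x_p)` and
`σ_k x = (σᵛ_k x_0, …, σᵛ_0 x_k, σʰ_k x_k, …, σʰ_k x_p)`. -/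
def pull {p q : ℕ} (θ : Fin (q + 1) →o Fin (p + 1)) (x : BarW X p) : BarW X q where
  pt i j h := act X (initialPart θ i (θ ⟨i, by omega⟩) (by omega) rfl)
    (finalPart θ i j (θ ⟨i, by omega⟩) (p - θ ⟨i, by omega⟩) h (by omega) rfl)
    (x.pt (θ ⟨i, by omega⟩) (p - θ ⟨i, by omega⟩) (by omega))
  compat i j h := by
    have hle : (θ ⟨i, by omega⟩ : ℕ) ≤ θ ⟨i + 1, by omega⟩ := by
      have : θ ⟨i, by omega⟩ ≤ θ ⟨i + 1, by omega⟩ := θ.monotone (by simp [Fin.le_def])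
      exact this
    have hlt : (θ ⟨i + 1, by omega⟩ : ℕ) < p + 1 := (θ ⟨i + 1, by omega⟩).2
    have key := compat_general x (θ ⟨i, by omega⟩) (p - θ ⟨i, by omega⟩) (θ ⟨i + 1, by omega⟩)
      (p - θ ⟨i + 1, by omega⟩) (θ ⟨i + 1, by omega⟩ - θ ⟨i, by omega⟩) (by omega) (by omega)
      (by omega)
    suffices H : ∀ y z, act X (𝟙 _) (SimplexCategory.δ (0 : Fin (j + 2))) y =
        act X (SimplexCategory.δ (Fin.last (i + 1))) (𝟙 _) z →
        (X.map (SimplexCategory.δ (0 : Fin (j + 2))).op).app (op ⦋i⦌) y =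
          (X.obj (op ⦋j⦌)).map (SimplexCategory.δ (Fin.last (i + 1))).op z by
      apply H
      have key' := congrArg (act X (initialPart θ i (θ ⟨i, by omega⟩) (by omega) rfl)
        (finalPart θ (i + 1) j (θ ⟨i + 1, by omega⟩) (p - θ ⟨i + 1, by omega⟩)
          (by omega) (by omega) rfl)) key
      rw [act_act, act_act] at key'
      rw [act_act, act_act]
      simp only [Category.id_comp, Category.comp_id] at key' ⊢
      convert! key' using 2
      · ext y
        have h1 : θ ⟨i + 1, by omega⟩ ≤ θ ⟨i + 1 + y, by have := y.2; simp at this; omega⟩ :=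
          θ.monotone (by simp [Fin.le_def])
        rw [Fin.le_def] at h1
        have h2 : (⟨i + (y + 1), by have := y.2; simp at this; omega⟩ : Fin (q + 1)) =
          ⟨i + 1 + y, by have := y.2; simp at this; omega⟩ := by ext; simp; omega
        change (θ ⟨i + (y + 1), _⟩ : ℕ) - θ ⟨i, _⟩ =
          (θ ⟨i + 1 + y, _⟩ - θ ⟨i + 1, _⟩) + (θ ⟨i + 1, _⟩ - θ ⟨i, _⟩)
        rw [h2]
        omega
      · ext y
        have hy := y.2
        simp only [SimplexCategory.len_mk] at hy
        have h1 : (((Fin.last (i + 1)).succAbove y : Fin (i + 2)) : ℕ) = y := by simp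
        change (θ ⟨((Fin.last (i + 1)).succAbove y : Fin (i + 2)), _⟩ : ℕ) = θ ⟨y, _⟩
        simp only [h1]
    intro y z hyz
    simpa [act] using hyz

lemma pull_pt {p q : ℕ} (θ : Fin (q + 1) →o Fin (p + 1)) (x : BarW X p) (i j a b : ℕ)
    (h : i + j = q) (ha : (θ ⟨i, by omega⟩ : ℕ) = a) (hb : a + b = p) :
    (pull θ x).pt i j h = act X (initialPart θ i a (by omega) ha)
      (finalPart θ i j a b h hb ha) (x.pt a b hb) := by
  have hi : i < q + 1 := by clear hb; omega
  subst ha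
  obtain rfl : b = p - θ ⟨i, hi⟩ := by omega
  rfl

lemma pull_id {p : ℕ} (x : BarW X p) : pull OrderHom.id x = x := by
  ext i j h
  rw [pull_pt OrderHom.id x i j i j h rfl h]
  have e1 : initialPart (OrderHom.id : Fin (p + 1) →o Fin (p + 1)) i i (by omega) rfl = 𝟙 _ := by
    ext y
    rfl
  have e2 : finalPart (OrderHom.id : Fin (p + 1) →o Fin (p + 1)) i j i j h h rfl = 𝟙 _ := by
    ext y
    change i + (y : ℕ) - i = y
    omega
  rw [e1, e2, act_id]

lemma pull_comp {p q r : ℕ} (θ : Fin (q + 1) →o Fin (p + 1)) (φ : Fin (r + 1) →o Fin (q + 1))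
    (x : BarW X p) : pull (θ.comp φ) x = pull φ (pull θ x) := by
  ext i j h
  have h1 := (φ ⟨i, by omega⟩).2
  have h2 := (θ (φ ⟨i, by omega⟩)).2
  rw [pull_pt φ _ i j (φ ⟨i, by omega⟩) (q - φ ⟨i, by omega⟩) h rfl (by omega),
    pull_pt θ x (φ ⟨i, by omega⟩) (q - φ ⟨i, by omega⟩) (θ (φ ⟨i, by omega⟩))
      (p - θ (φ ⟨i, by omega⟩)) (by omega) rfl (by omega), act_act,
    pull_pt (θ.comp φ) x i j (θ (φ ⟨i, by omega⟩)) (p - θ (φ ⟨i, by omega⟩)) h rfl (by omega)]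
  congr 1
  ext y
  have h3 : φ ⟨i, by omega⟩ ≤ φ ⟨i + y, by have := y.2; simp at this; omega⟩ :=
    φ.monotone (by simp [Fin.le_def])
  rw [Fin.le_def] at h3
  have h4 : φ ⟨i + y, by have := y.2; simp at this; omega⟩ =
    ⟨φ ⟨i, by omega⟩ + (φ ⟨i + y, by have := y.2; simp at this; omega⟩ - φ ⟨i, by omega⟩),
      by omega⟩ := by
    ext
    simp only
    omega
  change (θ (φ ⟨i + y, _⟩) : ℕ) - _ = θ ⟨φ ⟨i, _⟩ + (φ ⟨i + y, _⟩ - φ ⟨i, _⟩), _⟩ - _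
  rw [← h4]

end BarW

lemma BarW.app_act {X Y : SimplicialObject SSet.{w}} (f : X ⟶ Y) {i i' j j' : ℕ} (α : ⦋i'⦌ ⟶ ⦋i⦌)
    (β : ⦋j'⦌ ⟶ ⦋j⦌) (x : (X.obj (op ⦋j⦌)).obj (op ⦋i⦌)) :
    (f.app (op ⦋j'⦌)).app (op ⦋i'⦌) (act X α β x) =
      act Y α β ((f.app (op ⦋j⦌)).app (op ⦋i⦌) x) := by
  have h1 := NatTrans.naturality_apply (f.app (op ⦋j'⦌)) α.op ((X.map β.op).app (op ⦋i⦌) x)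
  have h2 := ConcreteCategory.congr_hom (NatTrans.congr_app (f.naturality β.op) (op ⦋i⦌)) x
  refine h1.trans ?_
  exact congrArg ((Y.obj (op ⦋j'⦌)).map α.op) h2

/-- The functor `W̄` from bisimplicial sets to simplicial sets. -/
def barW : SimplicialObject SSet.{w} ⥤ SSet.{w} where
  obj X :=
    { obj m := BarW X m.unop.len
      map θ := TypeCat.ofHom (BarW.pull θ.unop.toOrderHom)
      map_id m := by
        refine ConcreteCategory.hom_ext _ _ fun x => ?_
        exact BarW.pull_id x
      map_comp θ φ := by
        refine ConcreteCategory.hom_ext _ _ fun x => ?_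
        exact BarW.pull_comp _ _ x }
  map {X Y} f :=
    { app m := TypeCat.ofHom fun x =>
        { pt := fun i j h => (f.app _).app _ (x.pt i j h)
          compat := fun i j h => by
            have h1 := NatTrans.naturality_apply (f.app (op ⦋j⦌))
              (SimplexCategory.δ (Fin.last (i + 1))).op (x.pt (i + 1) j (by omega))
            have h2 := ConcreteCategory.congr_hom (NatTrans.congr_app
              (f.naturality (SimplexCategory.δ (0 : Fin (j + 2))).op) (op ⦋i⦌)) (x.pt i (j + 1) h)
            have h3 := x.compat i j h
            rw [← h1, ← h3]
            exact h2.symm }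
      naturality m m' θ := by
        refine ConcreteCategory.hom_ext _ _ fun x => ?_
        apply BarW.ext
        funext i j h
        exact BarW.app_act f _ _ _ }
  map_id X := rfl
  map_comp f g := rfl

/-! ## Quasi-comonoids -/

/-- A quasi-comonoid: sets `E^n`, maps `∂^i : E^n → E^{n+1}` (`1 ≤ i ≤ n`) and
`σ^i : E^{n+1} → E^n` (`0 ≤ i ≤ n`), and an associative unital product `E^m × E^n → E^{m+n}`,
subject to the identities below. The product is given as a map `E^m × E^n → E^k` for each
`k` with `m + n = k`, so that no casts appear in the identities. -/
structure QuasiComonoid : Type (w + 1) where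
  /-- the set `E^n` -/
  X : ℕ → Type w
  /-- the operation `∂^i : E^n → E^{n+1}`, for `1 ≤ i ≤ n` -/
  d : ∀ {n : ℕ} (i : ℕ), 1 ≤ i → i ≤ n → X n → X (n + 1)
  /-- the operation `σ^i : E^{n+1} → E^n`, for `0 ≤ i ≤ n` -/
  s : ∀ {n : ℕ} (i : ℕ), i ≤ n → X (n + 1) → X n
  /-- the product `E^m × E^n → E^{m+n}` -/
  mul : ∀ {m n k : ℕ}, m + n = k → X m → X n → X k
  /-- the identity -/
  one : X 0
  mul_assoc : ∀ {a b c ab bc abc : ℕ} (h₁ : a + b = ab) (h₂ : ab + c = abc) (h₃ : b + c = bc)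
    (h₄ : a + bc = abc) (x : X a) (y : X b) (z : X c),
    mul h₂ (mul h₁ x y) z = mul h₄ x (mul h₃ y z)
  one_mul : ∀ {n : ℕ} (x : X n), mul (Nat.zero_add n) one x = x
  mul_one : ∀ {n : ℕ} (x : X n), mul (Nat.add_zero n) x one = x
  d_d : ∀ {n : ℕ} (i j : ℕ) (hi : 1 ≤ i) (hij : i < j) (hj : j ≤ n + 1) (x : X n),
    d j (by omega) hj (d i hi (by omega) x) =
      d i hi (by omega) (d (j - 1) (by omega) (by omega) x)
  s_s : ∀ {n : ℕ} (i j : ℕ) (hij : i ≤ j) (hj : j ≤ n) (x : X (n + 2)),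
    s j hj (s i (by omega) x) = s i (by omega) (s (j + 1) (by omega) x)
  s_d_lt : ∀ {n : ℕ} (i j : ℕ) (hij : i < j) (hi : 1 ≤ i) (hj : j ≤ n + 1) (x : X (n + 1)),
    s j hj (d i hi (by omega) x) = d i hi (by omega) (s (j - 1) (by omega) x)
  s_d_self : ∀ {n : ℕ} (i : ℕ) (hi : 1 ≤ i) (hi' : i ≤ n) (x : X n),
    s i hi' (d i hi hi' x) = x
  s_d_succ : ∀ {n : ℕ} (j : ℕ) (hj : j + 1 ≤ n) (x : X n),
    s j (by omega) (d (j + 1) (by omega) hj x) = x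
  s_d_gt : ∀ {n : ℕ} (i j : ℕ) (hij : j + 1 < i) (hi : i ≤ n + 1) (x : X (n + 1)),
    s j (by omega) (d i (by omega) hi x) = d (i - 1) (by omega) (by omega) (s j (by omega) x)
  d_mul : ∀ {m n k : ℕ} (h : m + n = k) (i : ℕ) (hi : 1 ≤ i) (hi' : i ≤ m) (e : X m) (f : X n),
    mul (show m + 1 + n = k + 1 by omega) (d i hi hi' e) f = d i hi (by omega) (mul h e f)
  mul_d : ∀ {m n k : ℕ} (h : m + n = k) (i : ℕ) (hi : 1 ≤ i) (hi' : i ≤ n) (e : X m) (f : X n),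
    mul (show m + (n + 1) = k + 1 by omega) e (d i hi hi' f) =
      d (i + m) (by omega) (by omega) (mul h e f)
  s_mul : ∀ {m n k : ℕ} (h : m + n = k) (i : ℕ) (hi : i ≤ m) (e : X (m + 1)) (f : X n),
    mul h (s i hi e) f = s i (by omega) (mul (show m + 1 + n = k + 1 by omega) e f)
  mul_s : ∀ {m n k : ℕ} (h : m + n = k) (i : ℕ) (hi : i ≤ n) (e : X m) (f : X (n + 1)),
    mul h e (s i hi f) = s (i + m) (by omega) (mul (show m + (n + 1) = k + 1 by omega) e f)

namespace QuasiComonoid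

/-- Morphisms of quasi-comonoids. -/
@[ext]
structure Hom (E F : QuasiComonoid.{w}) : Type w where
  /-- the map in level `n` -/
  app : ∀ n : ℕ, E.X n → F.X n
  map_d : ∀ {n : ℕ} (i : ℕ) (hi : 1 ≤ i) (hi' : i ≤ n) (x : E.X n),
    app (n + 1) (E.d i hi hi' x) = F.d i hi hi' (app n x)
  map_s : ∀ {n : ℕ} (i : ℕ) (hi : i ≤ n) (x : E.X (n + 1)),
    app n (E.s i hi x) = F.s i hi (app (n + 1) x)
  map_mul : ∀ {m n k : ℕ} (h : m + n = k) (x : E.X m) (y : E.X n),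
    app k (E.mul h x y) = F.mul h (app m x) (app n y)
  map_one : app 0 E.one = F.one

/-- The category `QM^*` of quasi-comonoids. -/
instance : Category QuasiComonoid.{w} where
  Hom := Hom
  id E :=
    { app := fun _ x => x
      map_d := fun _ _ _ _ => rfl
      map_s := fun _ _ _ => rfl
      map_mul := fun _ _ _ => rfl
      map_one := rfl }
  comp f g :=
    { app := fun n x => g.app n (f.app n x)
      map_d := fun i hi hi' x => by rw [f.map_d, g.map_d]
      map_s := fun i hi x => by rw [f.map_s, g.map_s]
      map_mul := fun h x y => by rw [f.map_mul, g.map_mul]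
      map_one := by rw [f.map_one, g.map_one] }

@[simp] lemma id_app (E : QuasiComonoid.{w}) (n : ℕ) (x : E.X n) : Hom.app (𝟙 E) n x = x := rfl

@[simp] lemma comp_app {E F G : QuasiComonoid.{w}} (f : E ⟶ F) (g : F ⟶ G) (n : ℕ) (x : E.X n) :
    Hom.app (f ≫ g) n x = Hom.app g n (Hom.app f n x) := rfl

/-- The functor `E ↦ E^n`. -/
def level (n : ℕ) : QuasiComonoid.{w} ⥤ Type w where
  obj E := E.X n
  map f := TypeCat.ofHom (Hom.app f n)

/-- The monoid `E^0`. -/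
instance (E : QuasiComonoid.{w}) : Monoid (E.X 0) where
  mul := E.mul rfl
  one := E.one
  mul_assoc := E.mul_assoc rfl rfl rfl rfl
  one_mul := E.one_mul
  mul_one := E.mul_one

/-- The homomorphism of monoids `E^0 → F^0` induced by a morphism `E → F`. -/
def Hom.zero {E F : QuasiComonoid.{w}} (f : E ⟶ F) : E.X 0 →* F.X 0 where
  toFun := Hom.app f 0
  map_one' := Hom.map_one f
  map_mul' := Hom.map_mul f rfl

/-- The functor `E ↦ (E^0)^×`, the group of invertible elements of `E^0`. -/
def unitsZero : QuasiComonoid.{w} ⥤ GrpCat.{w} where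
  obj E := GrpCat.of (E.X 0)ˣ
  map f := GrpCat.ofHom (Units.map (Hom.zero f))

/-- The conjugation `x ↦ g * x * g⁻¹` on `E^n` by an invertible element `g` of `E^0`. -/
def conj (E : QuasiComonoid.{w}) (g : (E.X 0)ˣ) {n : ℕ} (x : E.X n) : E.X n :=
  E.mul (Nat.add_zero n) (E.mul (Nat.zero_add n) (g : E.X 0) x) (g⁻¹ : (E.X 0)ˣ).val

lemma conj_mul (E : QuasiComonoid.{w}) (g : (E.X 0)ˣ) {m n k : ℕ} (h : m + n = k)
    (x : E.X m) (y : E.X n) : E.mul h (E.conj g x) (E.conj g y) = E.conj g (E.mul h x y) := by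
  have hg : E.mul (Nat.zero_add 0) (g⁻¹ : (E.X 0)ˣ).val (g : E.X 0) = E.one := g.inv_mul
  unfold conj
  rw [E.mul_assoc (Nat.add_zero m) h (Nat.zero_add n) h,
    E.mul_assoc (Nat.zero_add m) h h (Nat.zero_add k),
    ← E.mul_assoc (Nat.zero_add n) (Nat.add_zero n) (Nat.add_zero n) (Nat.zero_add n),
    ← E.mul_assoc (Nat.zero_add 0) (Nat.zero_add n) (Nat.zero_add n) (Nat.zero_add n), hg,
    E.one_mul, E.mul_assoc (Nat.zero_add k) (Nat.add_zero k) (Nat.add_zero k) (Nat.zero_add k),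
    E.mul_assoc h (Nat.add_zero k) (Nat.add_zero n) h]

lemma conj_d (E : QuasiComonoid.{w}) (g : (E.X 0)ˣ) {n : ℕ} (i : ℕ) (hi : 1 ≤ i) (hi' : i ≤ n)
    (x : E.X n) : E.d i hi hi' (E.conj g x) = E.conj g (E.d i hi hi' x) := by
  unfold conj
  rw [← E.d_mul (Nat.add_zero n) i hi hi']
  congr 1
  exact (E.mul_d (Nat.zero_add n) i hi hi' _ _).symm

lemma conj_s (E : QuasiComonoid.{w}) (g : (E.X 0)ˣ) {n : ℕ} (i : ℕ) (hi : i ≤ n)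
    (x : E.X (n + 1)) : E.s i hi (E.conj g x) = E.conj g (E.s i hi x) := by
  unfold conj
  rw [← E.s_mul (Nat.add_zero n) i hi]
  congr 1
  exact (E.mul_s (Nat.zero_add n) i hi _ _).symm

lemma conj_one (E : QuasiComonoid.{w}) (g : (E.X 0)ˣ) : E.conj g E.one = E.one := by
  change (g : E.X 0) * 1 * (g⁻¹ : (E.X 0)ˣ).val = 1
  simp

lemma one_conj (E : QuasiComonoid.{w}) {n : ℕ} (x : E.X n) : E.conj 1 x = x := by
  have : ((1 : (E.X 0)ˣ)⁻¹).val = E.one := by rw [inv_one]; rfl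
  unfold conj
  rw [this, E.mul_one]
  exact E.one_mul x

lemma mul_conj (E : QuasiComonoid.{w}) (g h : (E.X 0)ˣ) {n : ℕ} (x : E.X n) :
    E.conj (g * h) x = E.conj g (E.conj h x) := by
  have h1 : (g * h).val = E.mul (Nat.zero_add 0) g.val h.val := rfl
  have h2 : ((g * h)⁻¹).val = E.mul (Nat.zero_add 0) (h⁻¹).val (g⁻¹).val := by
    rw [mul_inv_rev]; rfl
  unfold conj
  rw [h1, h2, E.mul_assoc (Nat.zero_add 0) (Nat.zero_add n) (Nat.zero_add n) (Nat.zero_add n),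
    ← E.mul_assoc (Nat.add_zero n) (Nat.add_zero n) (Nat.zero_add 0) (Nat.add_zero n),
    ← E.mul_assoc (Nat.zero_add n) (Nat.add_zero n) (Nat.add_zero n) (Nat.zero_add n)]

lemma map_conj {E F : QuasiComonoid.{w}} (f : E ⟶ F) (g : (E.X 0)ˣ) {n : ℕ} (x : E.X n) :
    Hom.app f n (E.conj g x) = F.conj (Units.map (Hom.zero f) g) (Hom.app f n x) := by
  unfold conj
  rw [Hom.map_mul, Hom.map_mul]
  rfl

end QuasiComonoid

/-! ## The Maurer–Cartan space and the gauge action -/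

/-- The simplicial set `I = Δ^1` in degree `m`: the lattice of monotone maps `[m] → [1]`.
In particular `⊥` and `⊤` are the vertices `0` and `1`, and `⊓` is `min`. -/
abbrev StdInterval (m : SimplexCategory) : Type := Fin (m.len + 1) →o Fin 2

/-- The tuple `(t_1, …, t_{i-1}, min {t_i, t_{i+1}}, t_{i+2}, …, t_{n+2})`, where
`i` runs from `1` to `n + 1`, and is represented by `i - 1 : Fin (n + 1)`. -/
def mergeMin {T : Type} [Min T] {n : ℕ} (i : Fin (n + 1)) (t : Fin (n + 2) → T) :
    Fin (n + 1) → T :=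
  fun j => if j < i then t j.castSucc else if j = i then min (t i.castSucc) (t i.succ)
    else t j.succ

/-- The `k`-simplices of the Maurer–Cartan space of a simplicial quasi-comonoid `E`: families
`ω_n ∈ ((E^{n+1})^{I^n})_k = Hom(I^n × Δ^k, E^{n+1})`, `n ≥ 0`, satisfying the identities below. An
`m`-simplex of `I^n × Δ^k` is given by `t : Fin n → StdInterval m` and `f : m ⟶ k`. -/
@[ext]
structure MaurerCartan (E : SimplicialObject QuasiComonoid.{w}) (k : SimplexCategory) : Type w where
  /-- the value of `ω_n` on the `m`-simplex `(t, f)` of `I^n × Δ^k` -/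
  ω : ∀ (n : ℕ) (m : SimplexCategory), (Fin n → StdInterval m) → (m ⟶ k) →
    (E.obj (op m)).X (n + 1)
  /-- `ω_n` is a morphism of simplicial sets -/
  natural : ∀ (n : ℕ) {m m' : SimplexCategory} (θ : m' ⟶ m) (t : Fin n → StdInterval m) (f : m ⟶ k),
    QuasiComonoid.Hom.app (E.map θ.op) (n + 1) (ω n m t f) =
      ω n m' (fun i => (t i).comp θ.toOrderHom) (θ ≫ f)
  /-- `ω_p(s) * ω_n(t) = ω_{p+n+1}(s, 0, t)` -/
  mul : ∀ (p n : ℕ) (m : SimplexCategory) (s : Fin p → StdInterval m) (t : Fin n → StdInterval m)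
    (f : m ⟶ k),
    (E.obj (op m)).mul (by omega) (ω p m s f) (ω n m t f) =
      ω (p + (n + 1)) m (Fin.append s (Fin.cons ⊥ t)) f
  /-- `∂^i ω_n(t) = ω_{n+1}(t_1, …, t_{i-1}, 1, t_i, …, t_n)` for `1 ≤ i ≤ n + 1`
  (here `i` is replaced by `i + 1`) -/
  d : ∀ (n : ℕ) (m : SimplexCategory) (i : Fin (n + 1)) (t : Fin n → StdInterval m) (f : m ⟶ k),
    (E.obj (op m)).d (i + 1) (by omega) (by omega) (ω n m t f) = ω (n + 1) m (i.insertNth ⊤ t) f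
  /-- `σ^i ω_n(t) = ω_{n-1}(t_1, …, t_{i-1}, min {t_i, t_{i+1}}, t_{i+2}, …, t_n)` for `1 ≤ i < n`
  (here `n` is replaced by `n + 2` and `i` by `i + 1`) -/
  s : ∀ (n : ℕ) (m : SimplexCategory) (i : Fin (n + 1)) (t : Fin (n + 2) → StdInterval m) (f : m ⟶ k),
    (E.obj (op m)).s (i + 1) (by omega) (ω (n + 2) m t f) = ω (n + 1) m (mergeMin i t) f
  /-- `σ^0 ω_n(t) = ω_{n-1}(t_2, …, t_n)` -/
  s_first : ∀ (n : ℕ) (m : SimplexCategory) (t : Fin (n + 1) → StdInterval m) (f : m ⟶ k),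
    (E.obj (op m)).s 0 (by omega) (ω (n + 1) m t f) = ω n m (Fin.tail t) f
  /-- `σ^n ω_n(t) = ω_{n-1}(t_1, …, t_{n-1})` -/
  s_last : ∀ (n : ℕ) (m : SimplexCategory) (t : Fin (n + 1) → StdInterval m) (f : m ⟶ k),
    (E.obj (op m)).s (n + 1) (by omega) (ω (n + 1) m t f) = ω n m (Fin.init t) f
  /-- `σ^0 ω_0 = 1` -/
  s_zero : ∀ (m : SimplexCategory) (t : Fin 0 → StdInterval m) (f : m ⟶ k),
    (E.obj (op m)).s 0 (by omega) (ω 0 m t f) = (E.obj (op m)).one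

namespace MaurerCartan

variable {E F G : SimplicialObject QuasiComonoid.{w}} {k k' k'' : SimplexCategory}

/-- The simplicial operations on the Maurer–Cartan space. -/
def pull (θ : k' ⟶ k) (x : MaurerCartan E k) : MaurerCartan E k' where
  ω n m t f := x.ω n m t (f ≫ θ)
  natural n m m' φ t f := by rw [x.natural, Category.assoc]
  mul p n m s t f := x.mul p n m s t _
  d n m i t f := x.d n m i t _
  s n m i t f := x.s n m i t _
  s_first n m t f := x.s_first n m t _
  s_last n m t f := x.s_last n m t _
  s_zero m t f := x.s_zero m t _

/-- Functoriality of the Maurer–Cartan space. -/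
def push (φ : E ⟶ F) (x : MaurerCartan E k) : MaurerCartan F k where
  ω n m t f := QuasiComonoid.Hom.app (φ.app (op m)) (n + 1) (x.ω n m t f)
  natural n m m' θ t f := by
    rw [← x.natural, ← QuasiComonoid.comp_app, ← QuasiComonoid.comp_app, φ.naturality]
  mul p n m s t f := by
    rw [← x.mul]
    exact (QuasiComonoid.Hom.map_mul _ _ _ _).symm
  d n m i t f := by
    rw [← x.d]
    exact (QuasiComonoid.Hom.map_d _ _ _ _ _).symm
  s n m i t f := by
    rw [← x.s]
    exact (QuasiComonoid.Hom.map_s _ _ _ _).symm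
  s_first n m t f := by
    rw [← x.s_first]
    exact (QuasiComonoid.Hom.map_s _ _ _ _).symm
  s_last n m t f := by
    rw [← x.s_last]
    exact (QuasiComonoid.Hom.map_s _ _ _ _).symm
  s_zero m t f := by
    rw [← QuasiComonoid.Hom.map_one (φ.app (op m)), ← x.s_zero m t f]
    exact (QuasiComonoid.Hom.map_s _ _ _ _).symm

/-- The gauge action of `(E^0)^×` on the Maurer–Cartan space: the value of `g ⋆ ω` on `(t, f)` is
`f^*g * ω_n(t, f) * f^*g⁻¹`. -/
def gauge (g : ((E.obj (op k)).X 0)ˣ) (x : MaurerCartan E k) : MaurerCartan E k where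
  ω n m t f := (E.obj (op m)).conj
    (Units.map (QuasiComonoid.Hom.zero (E.map f.op)) g) (x.ω n m t f)
  natural n m m' θ t f := by
    rw [QuasiComonoid.map_conj, x.natural]
    congr 1
    rw [op_comp, E.map_comp]
    rfl
  mul p n m s t f := by rw [QuasiComonoid.conj_mul, x.mul]
  d n m i t f := by rw [QuasiComonoid.conj_d, x.d]
  s n m i t f := by rw [QuasiComonoid.conj_s, x.s]
  s_first n m t f := by rw [QuasiComonoid.conj_s, x.s_first]
  s_last n m t f := by rw [QuasiComonoid.conj_s, x.s_last]
  s_zero m t f := by rw [QuasiComonoid.conj_s, x.s_zero, QuasiComonoid.conj_one]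

instance : MulAction ((E.obj (op k)).X 0)ˣ (MaurerCartan E k) where
  smul := gauge
  one_smul x := by
    ext n m t f
    change (E.obj (op m)).conj (Units.map _ 1) _ = _
    rw [map_one, QuasiComonoid.one_conj]
  mul_smul g h x := by
    ext n m t f
    change (E.obj (op m)).conj (Units.map _ (g * h)) _ = _
    rw [map_mul, QuasiComonoid.mul_conj]
    rfl

lemma pull_smul (θ : k' ⟶ k) (g : ((E.obj (op k)).X 0)ˣ) (x : MaurerCartan E k) :
    pull θ (g • x) = Units.map (QuasiComonoid.Hom.zero (E.map θ.op)) g • pull θ x := by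
  ext n m t f
  change (E.obj (op m)).conj _ _ = (E.obj (op m)).conj _ _
  congr 1
  rw [op_comp, E.map_comp]
  rfl

lemma push_smul (φ : E ⟶ F) (g : ((E.obj (op k)).X 0)ˣ) (x : MaurerCartan E k) :
    push φ (g • x) = Units.map (QuasiComonoid.Hom.zero (φ.app (op k))) g • push φ x := by
  ext n m t f
  change QuasiComonoid.Hom.app _ _ ((E.obj (op m)).conj _ _) = (F.obj (op m)).conj _ _
  rw [QuasiComonoid.map_conj]
  congr 1
  ext
  change QuasiComonoid.Hom.app (E.map f.op ≫ φ.app (op m)) 0 _ =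
    QuasiComonoid.Hom.app (φ.app (op k) ≫ F.map f.op) 0 _
  rw [φ.naturality]

end MaurerCartan

/-- The Maurer–Cartan functor from simplicial quasi-comonoids to simplicial sets. -/
def maurerCartan : SimplicialObject QuasiComonoid.{w} ⥤ SSet.{w} where
  obj E :=
    { obj k := MaurerCartan E k.unop
      map θ := TypeCat.ofHom (MaurerCartan.pull θ.unop)
      map_id k := by
        refine ConcreteCategory.hom_ext _ _ fun x => ?_
        apply MaurerCartan.ext
        funext n m t f
        exact congrArg (x.ω n m t) (Category.comp_id f)
      map_comp θ φ := by
        refine ConcreteCategory.hom_ext _ _ fun x => ?_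
        apply MaurerCartan.ext
        funext n m t f
        exact congrArg (x.ω n m t) (Category.assoc f _ _).symm }
  map φ :=
    { app k := TypeCat.ofHom (MaurerCartan.push φ)
      naturality k k' θ := rfl }
  map_id E := rfl
  map_comp φ ψ := rfl

/-! ## The Deligne groupoids -/

/-- The `k`-th level of the derived Deligne groupoid `[MC(E)/(E^0)^×]`: the objects are
the `k`-simplices of the Maurer–Cartan space of `E`. -/
@[ext]
structure DeligneObj (E : SimplicialObject QuasiComonoid.{w}) (k : SimplexCategory) : Type w where
  /-- the underlying Maurer–Cartan element -/
  pt : MaurerCartan E k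

namespace DeligneObj

variable {E F G : SimplicialObject QuasiComonoid.{w}} {k k' k'' : SimplexCategory}

/-- A morphism `ω ⟶ ω'` in the Deligne groupoid is an invertible `g` with `g ⋆ ω = ω'`. -/
@[ext]
structure Hom (x y : DeligneObj E k) : Type w where
  /-- the gauge transformation -/
  g : ((E.obj (op k)).X 0)ˣ
  eq : g • x.pt = y.pt

instance : Category (DeligneObj E k) where
  Hom := Hom
  id x := ⟨1, one_smul _ _⟩
  comp f h := ⟨h.g * f.g, by rw [mul_smul, f.eq, h.eq]⟩
  id_comp f := Hom.ext (mul_one _)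
  comp_id f := Hom.ext (one_mul _)
  assoc f g h := Hom.ext (mul_assoc _ _ _).symm

lemma eqToHom_g {x y : DeligneObj E k} (h : x = y) : Hom.g (eqToHom h) = 1 := by
  subst h
  rfl

lemma comp_g {x y z : DeligneObj E k} (f : x ⟶ y) (h : y ⟶ z) :
    Hom.g (f ≫ h) = Hom.g h * Hom.g f := rfl

lemma functor_ext {C : Type w} [Category.{w} C] {S T : C ⥤ DeligneObj E k}
    (h : ∀ x, S.obj x = T.obj x) (h' : ∀ {x y : C} (f : x ⟶ y), Hom.g (S.map f) = Hom.g (T.map f)) :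
    S = T := by
  refine CategoryTheory.Functor.ext h fun x y f => Hom.ext ?_
  rw [comp_g, comp_g, eqToHom_g, eqToHom_g, h']
  simp

/-- The simplicial structure on the derived Deligne groupoid. -/
def pull (θ : k' ⟶ k) : DeligneObj E k ⥤ DeligneObj E k' where
  obj x := ⟨x.pt.pull θ⟩
  map f := ⟨Units.map (QuasiComonoid.Hom.zero (E.map θ.op)) f.g, by
    rw [← MaurerCartan.pull_smul, f.eq]⟩
  map_id x := Hom.ext (map_one _)
  map_comp f h := Hom.ext (map_mul _ _ _)

/-- Functoriality of the derived Deligne groupoid. -/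
def push (φ : E ⟶ F) (k : SimplexCategory) : DeligneObj E k ⥤ DeligneObj F k where
  obj x := ⟨x.pt.push φ⟩
  map f := ⟨Units.map (QuasiComonoid.Hom.zero (φ.app (op k))) f.g, by
    rw [← MaurerCartan.push_smul, f.eq]⟩
  map_id x := Hom.ext (map_one _)
  map_comp f h := Hom.ext (map_mul _ _ _)

end DeligneObj

/-- The derived Deligne groupoid `[MC(E)/(E^0)^×]` of a simplicial quasi-comonoid, a simplicial
object in groupoids. -/
def derivedDeligneGroupoid :
    SimplicialObject QuasiComonoid.{w} ⥤ SimplicialObject Cat.{w, w} where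
  obj E :=
    { obj k := Cat.of (DeligneObj E k.unop)
      map θ := (DeligneObj.pull θ.unop).toCatHom
      map_id k := by
        apply Cat.Hom.ext
        refine DeligneObj.functor_ext (fun x => ?_) (fun {x y} f => ?_)
        · have h : MaurerCartan.pull (𝟙 k.unop) x.pt = x.pt :=
            ConcreteCategory.congr_hom ((maurerCartan.obj E).map_id k) x.pt
          exact DeligneObj.ext h
        · ext
          change QuasiComonoid.Hom.app (E.map (𝟙 k)) 0 _ = _
          rw [E.map_id]
          rfl
      map_comp θ φ := by
        apply Cat.Hom.ext
        refine DeligneObj.functor_ext (fun x => ?_) (fun {x y} f => ?_)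
        · have h : MaurerCartan.pull (φ.unop ≫ θ.unop) x.pt =
              MaurerCartan.pull φ.unop (MaurerCartan.pull θ.unop x.pt) :=
            ConcreteCategory.congr_hom ((maurerCartan.obj E).map_comp θ φ) x.pt
          exact DeligneObj.ext h
        · ext
          change QuasiComonoid.Hom.app (E.map (θ ≫ φ)) 0 _ = _
          rw [E.map_comp]
          rfl }
  map φ :=
    { app k := (DeligneObj.push φ k.unop).toCatHom
      naturality k k' θ := by
        apply Cat.Hom.ext
        refine DeligneObj.functor_ext (fun x => rfl) (fun {x y} f => ?_)
        ext
        exact congrArg (fun h => QuasiComonoid.Hom.app h 0 (DeligneObj.Hom.g f).val)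
          (φ.naturality θ) }
  map_id E := rfl
  map_comp φ ψ := rfl

/-- The derived Deligne nerve `W̄[MC(E)/(E^0)^×]`: the functor `W̄` applied to
the levelwise nerve of the derived Deligne groupoid. -/
noncomputable def derivedDeligneNerve : SimplicialObject QuasiComonoid.{w} ⥤ SSet.{w} :=
  derivedDeligneGroupoid ⋙ (SimplicialObject.whiskering _ _).obj nerveFunctor ⋙ barW

/-- The Deligne nerve `B[mc(E)/(E^0_0)^×]`: the nerve of the `0`-th level of the derived Deligne
groupoid. -/
noncomputable def deligneNerve : SimplicialObject QuasiComonoid.{w} ⥤ SSet.{w} :=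
  derivedDeligneGroupoid ⋙ (evaluation _ _).obj (op ⦋0⦌) ⋙ nerveFunctor

/-! ## Square-zero extensions of algebras, and functors on them -/

section Algebras

variable (R : Type u) [CommRing R]

/-- Square-zero extensions of commutative `R`-algebras: surjections whose kernel `K` satisfies
`K · K = 0`. -/
def algSquareZero : MorphismProperty (CommAlgCat.{u} R) := fun _ _ f =>
  Function.Surjective f.hom ∧ ∀ x y, f.hom x = 0 → f.hom y = 0 → x * y = 0

/-- A functor from `R`-algebras to quasi-comonoids is homogeneous if it preserves the fibre products
`A ×_B C` with `A ⟶ B` a square-zero extension; fibre products of quasi-comonoids are formed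
levelwise. -/
def IsHomogeneousQM (E : CommAlgCat.{u} R ⥤ QuasiComonoid.{w}) : Prop :=
  ∀ n : ℕ, IsHomogeneous (algSquareZero R) (E ⋙ QuasiComonoid.level n)

/-- The set-valued functor `F` on `R`-algebras is formally smooth: it maps
square-zero extensions to surjections. -/
def IsFormallySmooth (F : CommAlgCat.{u} R ⥤ Type w) : Prop :=
  ∀ ⦃A B : CommAlgCat.{u} R⦄ (f : A ⟶ B), algSquareZero R f → Function.Surjective (F.map f)

end Algebras

/-! ## Simplicial algebras -/

namespace SimplicialAlg

variable {R : Type u} [CommRing R]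

/-- The ideal of `A_0` generated by the elements `∂_0 x - ∂_1 x`, `x ∈ A_1`, so that
`π_0 A = A_0 / boundaryIdeal A`. -/
def boundaryIdeal (A : SimplicialObject (CommAlgCat.{u} R)) : Ideal (A.obj (op ⦋0⦌)) :=
  Ideal.span (Set.range fun x : A.obj (op ⦋1⦌) => (A.δ 0).hom x - (A.δ 1).hom x)

/-- The kernel `I_A` of `A ⟶ π_0 A` in degree `n`; here `A_n → π_0 A` is induced by
a vertex `[0] → [n]` (all of them give the same map). -/
def augIdeal (A : SimplicialObject (CommAlgCat.{u} R)) (n : ℕ) : Ideal (A.obj (op ⦋n⦌)) :=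
  (boundaryIdeal A).comap (A.map (SimplexCategory.const ⦋0⦌ ⦋n⦌ 0).op).hom

/-- The normalisation `N_n A = ⋂_{i > 0} ker ∂_i ⊆ A_n`. -/
def normalized (A : SimplicialObject (CommAlgCat.{u} R)) (n : ℕ) :
    Submodule R (A.obj (op ⦋n⦌)) :=
  match n with
  | 0 => ⊤
  | n + 1 => ⨅ i : Fin (n + 1), LinearMap.ker (A.δ i.succ).hom.toLinearMap

/-- The normalisation `N_n K` of the kernel `K` of a map `f` of simplicial algebras. -/
def kerNormalized {A B : SimplicialObject (CommAlgCat.{u} R)} (f : A ⟶ B) (n : ℕ) :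
    Submodule R (A.obj (op ⦋n⦌)) :=
  normalized A n ⊓ LinearMap.ker (f.app (op ⦋n⦌)).hom.toLinearMap

/-- `A` lies in `sN^♭_R`: the kernel of `A ⟶ π_0 A` is nilpotent, and `N_i A = 0` for
all `i ≫ 0`. -/
def isNilpotentBounded : ObjectProperty (SimplicialObject (CommAlgCat.{u} R)) := fun A =>
  (∃ N : ℕ, ∀ n : ℕ, augIdeal A n ^ N = ⊥) ∧ ∃ N : ℕ, ∀ i : ℕ, N ≤ i → normalized A i = ⊥

end SimplicialAlg

open SimplicialAlg in
/-- The category `sN^♭_R` of simplicial commutative `R`-algebras `A` for which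
`A ⟶ π_0 A` has nilpotent kernel and `N_i A = 0` for all `i ≫ 0`. -/
abbrev SN (R : Type u) [CommRing R] := (isNilpotentBounded (R := R)).FullSubcategory

namespace SN

open SimplicialAlg

variable (R : Type u) [CommRing R]

/-- Square-zero extensions in `sN^♭_R`. -/
def squareZero : MorphismProperty (SN R) := fun _ _ f =>
  ∀ n : ℕ, algSquareZero R (f.hom.app (op ⦋n⦌))

/-- Tiny acyclic extensions in `sN^♭_R`: surjections `A ⟶ B` with kernel `K` such that
`I_A · K = 0`, and the complex `N K` of `π_0 A`-modules is of the form `cone(M)[-r]`, i.e. it is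
the complex `M → M` (the identity) in degrees `r + 1` and `r`. Equivalently, `N_i K = 0` for
`i ≠ r, r + 1`, and `∂_0 : N_{r+1} K → N_r K` is bijective. -/
def tinyAcyclic : MorphismProperty (SN R) := fun A _ f =>
  (∀ n : ℕ, Function.Surjective (f.hom.app (op ⦋n⦌)).hom) ∧
  (∀ (n : ℕ) (x y : A.obj.obj (op ⦋n⦌)), x ∈ augIdeal A.obj n →
    (f.hom.app (op ⦋n⦌)).hom y = 0 → x * y = 0) ∧
  ∃ r : ℕ, (∀ i : ℕ, i ≠ r → i ≠ r + 1 → kerNormalized f.hom i = ⊥) ∧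
    Set.BijOn (A.obj.δ 0).hom (kerNormalized f.hom (r + 1) : Set (A.obj.obj (op ⦋r + 1⦌)))
      (kerNormalized f.hom r : Set (A.obj.obj (op ⦋r⦌)))

/-- The simplicial quasi-comonoid `n ↦ E((A^{Δ^n})_0)` associated to `E` and `A ∈ sN^♭_R`; by
the Yoneda lemma `(A^{Δ^n})_0 = Hom(Δ^n, A) = A_n`. -/
def underline (E : CommAlgCat.{u} R ⥤ QuasiComonoid.{w}) :
    SN R ⥤ SimplicialObject QuasiComonoid.{w} :=
  ObjectProperty.ι _ ⋙ (SimplicialObject.whiskering _ _).obj E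

end SN

/-! ## Differential graded algebras -/

/-- A differential graded-commutative `R`-algebra `A = ⨁_{n ≥ 0} A_n` in
non-negative chain degrees, with differential `d : A_{n+1} → A_n`. -/
structure DGAlg (R : Type u) [CommRing R] : Type (u + 1) where
  /-- the underlying algebra -/
  carrier : Type u
  [ring : Ring carrier]
  [algebra : Algebra R carrier]
  /-- the piece of degree `n` -/
  gr : ℕ → Submodule R carrier
  [graded : GradedAlgebra gr]
  /-- the differential -/
  d : carrier →ₗ[R] carrier
  d_zero : ∀ a ∈ gr 0, d a = 0
  d_mem : ∀ (n : ℕ), ∀ a ∈ gr (n + 1), d a ∈ gr n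
  d_d : ∀ a, d (d a) = 0
  leibniz : ∀ (n : ℕ), ∀ a ∈ gr n, ∀ b, d (a * b) = d a * b + (-1 : R) ^ n • (a * d b)
  comm : ∀ (m n : ℕ), ∀ a ∈ gr m, ∀ b ∈ gr n, a * b = (-1 : R) ^ (m * n) • (b * a)

namespace DGAlg

attribute [instance] DGAlg.ring DGAlg.algebra DGAlg.graded

variable {R : Type u} [CommRing R]

/-- Morphisms of differential graded algebras. -/
@[ext]
structure Hom (A B : DGAlg R) : Type u where
  /-- the underlying algebra homomorphism -/
  hom : A.carrier →ₐ[R] B.carrier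
  map_mem : ∀ (n : ℕ), ∀ a ∈ A.gr n, hom a ∈ B.gr n
  map_d : ∀ a, hom (A.d a) = B.d (hom a)

instance : Category (DGAlg R) where
  Hom := Hom
  id A := ⟨AlgHom.id R _, fun _ _ h => h, fun _ => rfl⟩
  comp f g := ⟨g.hom.comp f.hom, fun n a h => g.map_mem n _ (f.map_mem n a h), fun a => by
    simp [f.map_d, g.map_d]⟩

/-- The kernel `I_A` of `A ⟶ H_0 A`: the elements whose component of degree `0` is
a boundary. -/
def augIdeal (A : DGAlg R) : Submodule R A.carrier :=
  ((A.gr 1).map A.d).comap (GradedAlgebra.proj A.gr 0)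

/-- `A` lies in `dg_+N^♭_R`: the kernel of `A ⟶ H_0 A` is nilpotent, and `A_i = 0`
for all `i ≫ 0`. -/
def isNilpotentBounded : ObjectProperty (DGAlg R) := fun A =>
  (∃ N : ℕ, A.augIdeal ^ N = ⊥) ∧ ∃ N : ℕ, ∀ i : ℕ, N ≤ i → A.gr i = ⊥

end DGAlg

/-- The category `dg_+N^♭_R` of differential graded-commutative `R`-algebras `A` in
non-negative chain degrees for which `A ⟶ H_0 A` has nilpotent kernel and `A_i = 0` for
all `i ≫ 0`. -/
abbrev DGN (R : Type u) [CommRing R] := (DGAlg.isNilpotentBounded (R := R)).FullSubcategory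

namespace DGN

variable (R : Type u) [CommRing R]

/-- Square-zero extensions in `dg_+N^♭_R`: surjections whose kernel `K` satisfies `K · K = 0`. -/
def squareZero : MorphismProperty (DGN R) := fun A _ f =>
  Function.Surjective (DGAlg.Hom.hom f.hom) ∧
    ∀ x y : A.obj.carrier, DGAlg.Hom.hom f.hom x = 0 → DGAlg.Hom.hom f.hom y = 0 → x * y = 0

/-- The degree `n` part of the kernel of a morphism of differential graded algebras. -/
def kerGr {R : Type u} [CommRing R] {A B : DGAlg R} (f : A ⟶ B) (n : ℕ) : Submodule R A.carrier :=
  A.gr n ⊓ LinearMap.ker (DGAlg.Hom.hom f).toLinearMap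

/-- Tiny acyclic extensions in `dg_+N^♭_R`: surjections `A ⟶ B` with kernel `K` such that
`I_A · K = 0`, and the complex `K` of `H_0 A`-modules is of the form `cone(M)[-r]`, i.e. it is
the complex `M → M` (the identity) in degrees `r + 1` and `r`. Equivalently, `K_i = 0` for
`i ≠ r, r + 1`, and `d : K_{r+1} → K_r` is bijective. -/
def tinyAcyclic : MorphismProperty (DGN R) := fun A _ f =>
  Function.Surjective (DGAlg.Hom.hom f.hom) ∧
  (∀ x y : A.obj.carrier, x ∈ A.obj.augIdeal → DGAlg.Hom.hom f.hom y = 0 → x * y = 0) ∧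
  ∃ r : ℕ, (∀ i : ℕ, i ≠ r → i ≠ r + 1 → kerGr f.hom i = ⊥) ∧
    Set.BijOn A.obj.d (kerGr f.hom (r + 1)) (kerGr f.hom r)

end DGN

/-! ## Polynomial differential forms on simplices -/

namespace PolyForms

open scoped TensorProduct DirectSum
open MvPolynomial

variable (R : Type u) [CommRing R]

/-- The algebra `Ω_n = R[t_0, …, t_n, dt_0, …, dt_n] / (∑ t_i - 1, ∑ dt_i)` of polynomial
differential forms on the `n`-simplex, with `t_i` of degree `0` and `dt_i` of degree `1`. We
eliminate `t_0 = 1 - t_1 - … - t_n` and `dt_0 = - dt_1 - … - dt_n`, so that `Ω_n` is the tensor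
product of the polynomial algebra on `t_1, …, t_n` and the exterior algebra on
`dt_1, …, dt_n`; the variable `t_i` corresponds to `i - 1 : Fin n`. -/
abbrev Ω (n : ℕ) : Type u :=
  MvPolynomial (Fin n) R ⊗[R] ExteriorAlgebra R (Fin n → R)

/-- The forms of degree `j`. -/
noncomputable def gr (n j : ℕ) : Submodule R (Ω R n) :=
  LinearMap.range ((⋀[R]^j (Fin n → R)).subtype.lTensor (MvPolynomial (Fin n) R))

variable {R}

lemma tmul_mem {n j : ℕ} (p : MvPolynomial (Fin n) R) {x : ExteriorAlgebra R (Fin n → R)}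
    (hx : x ∈ ⋀[R]^j (Fin n → R)) : p ⊗ₜ[R] x ∈ gr R n j :=
  ⟨p ⊗ₜ ⟨x, hx⟩, by simp⟩

lemma gr_eq_span (n j : ℕ) : gr R n j = Submodule.span R
    {y | ∃ (p : MvPolynomial (Fin n) R) (x : ExteriorAlgebra R (Fin n → R)),
      x ∈ ⋀[R]^j (Fin n → R) ∧ p ⊗ₜ[R] x = y} := by
  apply le_antisymm
  · rintro _ ⟨z, rfl⟩
    induction z with
    | zero => simp
    | tmul p x => exact Submodule.subset_span ⟨p, x, x.2, by simp⟩
    | add x y hx hy => rw [map_add]; exact Submodule.add_mem _ hx hy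
  · rw [Submodule.span_le]
    rintro _ ⟨p, x, hx, rfl⟩
    exact tmul_mem p hx

variable (R) in
/-- The map decomposing a form into its components of the different degrees. -/
noncomputable def decomp (n : ℕ) : Ω R n →ₗ[R] ⨁ j, gr R n j :=
  (DirectSum.lmap fun j =>
      ((⋀[R]^j (Fin n → R)).subtype.lTensor (MvPolynomial (Fin n) R)).codRestrict (gr R n j)
        fun z => ⟨z, rfl⟩) ∘ₗ
    (TensorProduct.directSumRight R R (MvPolynomial (Fin n) R)
      (fun j : ℕ => ⋀[R]^j (Fin n → R))).toLinearMap ∘ₗ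
    (DirectSum.decomposeLinearEquiv
      (fun j : ℕ => ⋀[R]^j (Fin n → R))).toLinearMap.lTensor (MvPolynomial (Fin n) R)

lemma decomp_tmul {n j : ℕ} (p : MvPolynomial (Fin n) R) {x : ExteriorAlgebra R (Fin n → R)}
    (hx : x ∈ ⋀[R]^j (Fin n → R)) :
    decomp R n (p ⊗ₜ[R] x) = DirectSum.lof R ℕ (fun j => gr R n j) j ⟨p ⊗ₜ x, tmul_mem p hx⟩ := by
  lift x to ⋀[R]^j (Fin n → R) using hx
  simp only [decomp, LinearMap.comp_apply, LinearMap.lTensor_tmul, LinearEquiv.coe_coe,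
    DirectSum.decomposeLinearEquiv_apply, DirectSum.decompose_coe]
  rw [← DirectSum.lof_eq_of R, TensorProduct.directSumRight_tmul_lof, DirectSum.lmap_lof]
  rfl

noncomputable instance gradedAlgebra (n : ℕ) : GradedAlgebra (gr R n) where
  one_mem := tmul_mem 1 (SetLike.GradedOne.one_mem (A := fun j : ℕ => ⋀[R]^j (Fin n → R)))
  mul_mem i j x y hx hy := by
    rw [gr_eq_span] at hx hy
    induction hx, hy using Submodule.span_induction₂ with
    | mem_mem x y hx hy =>
      obtain ⟨p, x, hx, rfl⟩ := hx
      obtain ⟨q, y, hy, rfl⟩ := hy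
      rw [Algebra.TensorProduct.tmul_mul_tmul]
      exact tmul_mem _ (SetLike.GradedMul.mul_mem (A := fun j : ℕ => ⋀[R]^j (Fin n → R)) hx hy)
    | zero_left y hy => simp
    | zero_right x hx => simp
    | add_left x y z _ _ _ hx hy => rw [add_mul]; exact Submodule.add_mem _ hx hy
    | add_right x y z _ _ _ hx hy => rw [mul_add]; exact Submodule.add_mem _ hx hy
    | smul_left r x y _ _ h => rw [smul_mul_assoc]; exact Submodule.smul_mem _ _ h
    | smul_right r x y _ _ h => rw [mul_smul_comm]; exact Submodule.smul_mem _ _ h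
  toDecomposition := DirectSum.Decomposition.ofLinearMap _ (decomp R n)
    (by
      refine TensorProduct.ext' fun p x => ?_
      induction x using DirectSum.Decomposition.inductionOn (fun j : ℕ => ⋀[R]^j (Fin n → R)) with
      | zero => simp
      | homogeneous x =>
        rw [LinearMap.comp_apply, decomp_tmul p x.2, DirectSum.coeLinearMap_lof]
        rfl
      | add x y hx hy => rw [TensorProduct.tmul_add, map_add, map_add, hx, hy])
    (by
      refine DirectSum.linearMap_ext R fun j => LinearMap.ext fun x => ?_
      obtain ⟨x, hx⟩ := x
      rw [LinearMap.comp_apply, LinearMap.comp_apply, DirectSum.coeLinearMap_lof]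
      have hx' := hx
      rw [gr_eq_span] at hx'
      induction hx' using Submodule.span_induction with
      | mem x h =>
        obtain ⟨p, x, h, rfl⟩ := h
        exact decomp_tmul p h
      | zero => exact (map_zero _).trans (map_zero _).symm
      | add x y h h' ih ih' =>
        rw [← gr_eq_span] at h h'
        have e := congrArg₂ (· + ·) (ih h) (ih' h')
        simp only [← map_add] at e
        exact e
      | smul r x h ih =>
        rw [← gr_eq_span] at h
        have e := congrArg (r • ·) (ih h)
        simp only [← map_smul] at e
        exact e)


open Finset in
/-- The barycentric coordinates `t_0, …, t_n`. -/
noncomputable def t (n : ℕ) : Fin (n + 1) → MvPolynomial (Fin n) R :=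
  Fin.cons (1 - ∑ i, X i) X

/-- The differentials `dt_0, …, dt_n` of the barycentric coordinates. -/
def dt (n : ℕ) : Fin (n + 1) → (Fin n → R) :=
  Fin.cons (fun _ => -1) (fun i => Pi.single i 1)

lemma sum_t (n : ℕ) : ∑ j, t (R := R) n j = 1 := by
  simp [Fin.sum_univ_succ, t]

lemma sum_dt (n : ℕ) : ∑ j, dt (R := R) n j = 0 := by
  ext k
  simp [Fin.sum_univ_succ, dt, Finset.sum_apply, Pi.single_apply]

lemma pderiv_t (n : ℕ) (k : Fin n) (j : Fin (n + 1)) :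
    pderiv k (t (R := R) n j) = C (dt n j k) := by
  refine Fin.cases ?_ (fun i => ?_) j
  · simp [t, dt, pderiv_X, Pi.single_apply]
  · simp [t, dt, pderiv_X, Pi.single_apply, eq_comm, apply_ite C]

variable {m n l : ℕ}

/-- The polynomial `θ^* t_i = ∑_{θ(j) = i} t_j`, for `i > 0`. -/
noncomputable def pullT (θ : Fin (m + 1) → Fin (n + 1)) (i : Fin n) : MvPolynomial (Fin m) R :=
  ∑ j with θ j = i.succ, t m j

/-- The linear map with `θ^* dt_i = ∑_{θ(j) = i} dt_j`. -/
noncomputable def pullDt (θ : Fin (m + 1) → Fin (n + 1)) : (Fin n → R) →ₗ[R] (Fin m → R) :=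
  Fintype.linearCombination R fun i => ∑ j with θ j = i.succ, dt m j

lemma aeval_pullT_t (θ : Fin (m + 1) → Fin (n + 1)) (i : Fin (n + 1)) :
    aeval (R := R) (pullT (R := R) θ) (t n i) = ∑ j with θ j = i, t m j := by
  have h : ∀ i : Fin n, aeval (R := R) (pullT (R := R) θ) (t n i.succ) = ∑ j with θ j = i.succ, t m j := by
    intro i; simp [t, pullT]
  refine Fin.cases ?_ h i
  have h1 := congrArg (aeval (R := R) (pullT (R := R) θ)) (sum_t (R := R) n)
  rw [map_sum, Fin.sum_univ_succ, Finset.sum_congr rfl fun i _ => h i, map_one] at h1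
  have h2 := Finset.sum_fiberwise (Finset.univ) θ (t (R := R) m)
  rw [Fin.sum_univ_succ, sum_t, ← h1] at h2
  exact (add_right_cancel h2).symm

lemma pullDt_single (θ : Fin (m + 1) → Fin (n + 1)) (i : Fin n) :
    pullDt (R := R) θ (Pi.single i 1) = ∑ j with θ j = i.succ, dt m j := by
  simp [pullDt, Fintype.linearCombination_apply_single]

lemma pullDt_dt (θ : Fin (m + 1) → Fin (n + 1)) (i : Fin (n + 1)) :
    pullDt (R := R) θ (dt n i) = ∑ j with θ j = i, dt m j := by
  have h : ∀ i : Fin n, pullDt (R := R) θ (dt n i.succ) = ∑ j with θ j = i.succ, dt m j := by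
    intro i; simp [dt, pullDt_single]
  refine Fin.cases ?_ h i
  have h1 := congrArg (pullDt (R := R) θ) (sum_dt (R := R) n)
  rw [map_sum, Fin.sum_univ_succ, Finset.sum_congr rfl fun i _ => h i, map_zero] at h1
  have h2 := Finset.sum_fiberwise (Finset.univ) θ (dt (R := R) m)
  rw [Fin.sum_univ_succ, sum_dt, ← h1] at h2
  exact (add_right_cancel h2).symm

variable (R) in
/-- The pullback `θ^* : Ω_n → Ω_m` along a map `θ : [m] → [n]`. -/
noncomputable def pull (θ : Fin (m + 1) → Fin (n + 1)) : Ω R n →ₐ[R] Ω R m :=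
  Algebra.TensorProduct.map (aeval (pullT θ)) (ExteriorAlgebra.map (pullDt θ))

lemma pull_tmul (θ : Fin (m + 1) → Fin (n + 1)) (p : MvPolynomial (Fin n) R)
    (x : ExteriorAlgebra R (Fin n → R)) :
    pull R θ (p ⊗ₜ x) = aeval (pullT θ) p ⊗ₜ ExteriorAlgebra.map (pullDt θ) x := rfl

lemma pull_id : pull R (id : Fin (n + 1) → Fin (n + 1)) = AlgHom.id R _ := by
  have h1 : aeval (R := R) (pullT (R := R) (id : Fin (n + 1) → Fin (n + 1))) = AlgHom.id R _ := by
    refine MvPolynomial.algHom_ext fun i => ?_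
    simp [pullT, t, Finset.filter_eq']
  have h2 : pullDt (R := R) (id : Fin (n + 1) → Fin (n + 1)) = LinearMap.id := by
    refine LinearMap.pi_ext' fun i => LinearMap.ext_ring ?_
    simp [pullDt_single, Finset.filter_eq', dt]
  rw [pull, h1, h2, ExteriorAlgebra.map_id, Algebra.TensorProduct.map_id]

lemma pull_comp (θ : Fin (m + 1) → Fin (n + 1)) (ψ : Fin (l + 1) → Fin (m + 1)) :
    pull R (θ ∘ ψ) = (pull R ψ).comp (pull R θ) := by
  have h1 : aeval (R := R) (pullT (R := R) (θ ∘ ψ)) = (aeval (pullT ψ)).comp (aeval (pullT θ)) := by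
    refine MvPolynomial.algHom_ext fun i => ?_
    rw [AlgHom.comp_apply, aeval_X, aeval_X, pullT, pullT, map_sum,
      Finset.sum_congr rfl fun j _ => aeval_pullT_t ψ j, Finset.sum_fiberwise_eq_sum_filter]
    simp
  have h2 : pullDt (R := R) (θ ∘ ψ) = pullDt ψ ∘ₗ pullDt θ := by
    refine LinearMap.pi_ext' fun i => LinearMap.ext_ring ?_
    simp only [LinearMap.comp_apply, LinearMap.coe_single]
    rw [pullDt_single, pullDt_single, map_sum,
      Finset.sum_congr rfl fun j _ => pullDt_dt ψ j, Finset.sum_fiberwise_eq_sum_filter]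
    simp
  rw [pull, h1, h2, ← ExteriorAlgebra.map_comp_map, Algebra.TensorProduct.map_comp]
  rfl

lemma map_mem_exteriorPower (f : (Fin n → R) →ₗ[R] (Fin m → R)) {j : ℕ}
    {x : ExteriorAlgebra R (Fin n → R)} (hx : x ∈ ⋀[R]^j (Fin n → R)) :
    ExteriorAlgebra.map f x ∈ ⋀[R]^j (Fin m → R) := by
  have h : Submodule.map (ExteriorAlgebra.map f).toLinearMap (⋀[R]^j (Fin n → R)) ≤
      ⋀[R]^j (Fin m → R) := by
    rw [Submodule.map_pow]
    refine pow_le_pow_left' ?_ j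
    rintro _ ⟨_, ⟨v, rfl⟩, rfl⟩
    exact ⟨f v, by simp⟩
  exact h ⟨x, hx, rfl⟩

lemma pull_mem (θ : Fin (m + 1) → Fin (n + 1)) {j : ℕ} {ω : Ω R n} (h : ω ∈ gr R n j) :
    pull R θ ω ∈ gr R m j := by
  rw [gr_eq_span] at h
  induction h using Submodule.span_induction with
  | mem x h =>
    obtain ⟨p, x, h, rfl⟩ := h
    exact tmul_mem _ (map_mem_exteriorPower _ h)
  | zero => simp
  | add x y _ _ hx hy => rw [map_add]; exact Submodule.add_mem _ hx hy
  | smul r x _ hx => rw [map_smul]; exact Submodule.smul_mem _ _ hx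

variable (R) in
/-- The de Rham differential `d(p ⊗ λ) = ∑ (∂p/∂t_i) ⊗ (dt_i ∧ λ)`. -/
noncomputable def dΩ (n : ℕ) : Ω R n →ₗ[R] Ω R n :=
  ∑ i, TensorProduct.map (pderiv i).toLinearMap
    (LinearMap.mulLeft R (ExteriorAlgebra.ι R (Pi.single i 1)))

lemma dΩ_tmul (p : MvPolynomial (Fin n) R) (x : ExteriorAlgebra R (Fin n → R)) :
    dΩ R n (p ⊗ₜ x) = ∑ i, pderiv i p ⊗ₜ (ExteriorAlgebra.ι R (Pi.single i 1) * x) := by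
  simp [dΩ, LinearMap.sum_apply]

lemma dΩ_mem {j : ℕ} {ω : Ω R n} (h : ω ∈ gr R n j) : dΩ R n ω ∈ gr R n (j + 1) := by
  rw [gr_eq_span] at h
  induction h using Submodule.span_induction with
  | mem x h =>
    obtain ⟨p, x, h, rfl⟩ := h
    rw [dΩ_tmul]
    refine Submodule.sum_mem _ fun i _ => tmul_mem _ ?_
    change _ ∈ LinearMap.range (ExteriorAlgebra.ι R) ^ (j + 1)
    rw [pow_succ']
    exact Submodule.mul_mem_mul ⟨_, rfl⟩ h
  | zero => simp
  | add x y _ _ hx hy => rw [map_add]; exact Submodule.add_mem _ hx hy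
  | smul r x _ hx => rw [map_smul]; exact Submodule.smul_mem _ _ hx

lemma pderiv_aeval (f : Fin n → MvPolynomial (Fin m) R) (k : Fin m)
    (p : MvPolynomial (Fin n) R) :
    pderiv k (aeval f p) = ∑ i, aeval f (pderiv i p) * pderiv k (f i) := by
  induction p using MvPolynomial.induction_on with
  | C a => simp [MvPolynomial.algebraMap_eq]
  | add p q hp hq => simp only [map_add, hp, hq, add_mul, Finset.sum_add_distrib]
  | mul_X p i hp =>
    simp only [map_mul, aeval_X, Derivation.leibniz, hp, smul_eq_mul, pderiv_X, map_add, add_mul,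
      Finset.sum_add_distrib, Finset.mul_sum]
    congr 1
    · simp [Pi.single_apply]
    · exact Finset.sum_congr rfl fun _ _ => by ring

lemma pull_dΩ (θ : Fin (m + 1) → Fin (n + 1)) (ω : Ω R n) :
    pull R θ (dΩ R n ω) = dΩ R m (pull R θ ω) := by
  induction ω using TensorProduct.induction_on with
  | zero => simp
  | add x y hx hy => simp only [map_add, hx, hy]
  | tmul p x =>
    have h1 : ∀ (k : Fin m) (i : Fin n), pderiv k (pullT (R := R) θ i) =
        C (pullDt θ (Pi.single i 1) k) := by
      intro k i
      rw [pullDt_single, pullT, map_sum, Finset.sum_congr rfl fun j _ => pderiv_t m k j,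
        Finset.sum_apply, map_sum]
    have h2 : ∀ v : Fin m → R, v = ∑ k, v k • Pi.single (M := fun _ => R) k 1 := fun v => by
      ext k; simp [Finset.sum_apply, Pi.single_apply]
    rw [dΩ_tmul, map_sum, pull_tmul, dΩ_tmul]
    simp only [pull_tmul, map_mul, ExteriorAlgebra.map_apply_ι, pderiv_aeval, h1,
      TensorProduct.sum_tmul]
    rw [Finset.sum_comm]
    refine Finset.sum_congr rfl fun i _ => ?_
    conv_lhs => rw [h2 (pullDt θ (Pi.single i 1))]
    rw [map_sum, Finset.sum_mul, TensorProduct.tmul_sum]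
    refine Finset.sum_congr rfl fun k _ => ?_
    rw [map_smul, smul_mul_assoc, mul_comm, ← MvPolynomial.smul_eq_C_mul,
      TensorProduct.tmul_smul, TensorProduct.smul_tmul']

section Exterior

variable {M : Type*} [AddCommGroup M] [Module R M]

lemma ι_mul_exteriorPower (v : M) {j : ℕ} {y : ExteriorAlgebra R M} (hy : y ∈ ⋀[R]^j M) :
    ExteriorAlgebra.ι R v * y = (-1 : R) ^ j • (y * ExteriorAlgebra.ι R v) := by
  change y ∈ LinearMap.range (ExteriorAlgebra.ι R) ^ j at hy
  induction hy using Submodule.pow_induction_on_left' with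
  | algebraMap r => simp [Algebra.commutes]
  | add x y i hx hy ihx ihy => rw [mul_add, add_mul, ihx, ihy, smul_add]
  | mem_mul w hw i x hx ih =>
    obtain ⟨w, rfl⟩ := hw
    have h := eq_neg_of_add_eq_zero_left (ExteriorAlgebra.ι_add_mul_swap (R := R) v w)
    rw [← mul_assoc, h, neg_mul, mul_assoc, ih, mul_smul_comm, ← mul_assoc, pow_succ,
      mul_neg_one, neg_smul]

lemma exteriorPower_mul_comm {i j : ℕ} {x y : ExteriorAlgebra R M} (hx : x ∈ ⋀[R]^i M)
    (hy : y ∈ ⋀[R]^j M) : x * y = (-1 : R) ^ (i * j) • (y * x) := by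
  change x ∈ LinearMap.range (ExteriorAlgebra.ι R) ^ i at hx
  induction hx using Submodule.pow_induction_on_left' with
  | algebraMap r => simp [Algebra.commutes]
  | add x z i hx hz ihx ihz => rw [mul_add, add_mul, ihx, ihz, smul_add]
  | mem_mul w hw i x hx ih =>
    obtain ⟨w, rfl⟩ := hw
    rw [mul_assoc, ih, mul_smul_comm, ← mul_assoc, ι_mul_exteriorPower w hy, smul_mul_assoc,
      smul_smul, mul_assoc, Nat.succ_mul, pow_add]

end Exterior

lemma gr_mul_comm {i j : ℕ} {ω η : Ω R n} (hω : ω ∈ gr R n i) (hη : η ∈ gr R n j) :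
    ω * η = (-1 : R) ^ (i * j) • (η * ω) := by
  rw [gr_eq_span] at hω hη
  induction hω, hη using Submodule.span_induction₂ with
  | mem_mem x y hx hy =>
    obtain ⟨p, x, hx, rfl⟩ := hx
    obtain ⟨q, y, hy, rfl⟩ := hy
    rw [Algebra.TensorProduct.tmul_mul_tmul, Algebra.TensorProduct.tmul_mul_tmul,
      exteriorPower_mul_comm hx hy, TensorProduct.tmul_smul, mul_comm p]
  | zero_left y hy => simp
  | zero_right x hx => simp
  | add_left x y z _ _ _ hx hy => rw [add_mul, mul_add, hx, hy, smul_add]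
  | add_right x y z _ _ _ hx hy => rw [add_mul, mul_add, hx, hy, smul_add]
  | smul_left r x y _ _ h => rw [smul_mul_assoc, mul_smul_comm, h, smul_comm]
  | smul_right r x y _ _ h => rw [smul_mul_assoc, mul_smul_comm, h, smul_comm]

lemma dΩ_mul {j : ℕ} {ω : Ω R n} (hω : ω ∈ gr R n j) (η : Ω R n) :
    dΩ R n (ω * η) = dΩ R n ω * η + (-1 : R) ^ j • (ω * dΩ R n η) := by
  rw [gr_eq_span] at hω
  induction hω using Submodule.span_induction with
  | zero => simp
  | add x y _ _ hx hy => simp only [add_mul, map_add, hx, hy, smul_add]; abel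
  | smul r x _ hx =>
    simp only [smul_mul_assoc, map_smul, hx, smul_add]
    rw [smul_comm]
  | mem ω h =>
    obtain ⟨p, x, hx, rfl⟩ := h
    induction η using TensorProduct.induction_on with
    | zero => simp
    | add y z hy hz => simp only [mul_add, map_add, hy, hz, smul_add]; abel
    | tmul q y =>
      simp only [Algebra.TensorProduct.tmul_mul_tmul, dΩ_tmul, Finset.sum_mul, Finset.mul_sum,
        Finset.smul_sum, Derivation.leibniz, smul_eq_mul, TensorProduct.add_tmul,
        Finset.sum_add_distrib]
      rw [add_comm]
      congr 1
      · exact Finset.sum_congr rfl fun i _ => by rw [mul_comm, mul_assoc]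
      · refine Finset.sum_congr rfl fun i _ => ?_
        rw [← mul_assoc, ι_mul_exteriorPower _ hx, smul_mul_assoc, TensorProduct.tmul_smul,
          mul_assoc]

end PolyForms

/-! ## The degree `0` cycles in `A ⊗ Ω_n` -/

namespace DGAlg

open scoped TensorProduct
open PolyForms

variable {R : Type u} [CommRing R] (A : DGAlg R) (n : ℕ)

/-- The graded algebra `A ⊗ Ω_n`, with the multiplication
`(a ⊗ ω)(b ⊗ η) = (-1)^{|ω||b|} ab ⊗ ωη`. -/
abbrev Forms : Type u := A.gr ᵍ⊗[R] PolyForms.gr R n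

/-- The linear map `a ↦ (-1)^{|a|} a`. -/
noncomputable def sign : A.carrier →ₗ[R] A.carrier :=
  DirectSum.coeLinearMap A.gr ∘ₗ
    DirectSum.lmap (fun i => (-1 : R) ^ i • (LinearMap.id : A.gr i →ₗ[R] A.gr i)) ∘ₗ
    (DirectSum.decomposeLinearEquiv A.gr).toLinearMap

lemma sign_apply {i : ℕ} {a : A.carrier} (ha : a ∈ A.gr i) : A.sign a = (-1 : R) ^ i • a := by
  lift a to A.gr i using ha
  simp only [sign, LinearMap.comp_apply, LinearEquiv.coe_coe,
    DirectSum.decomposeLinearEquiv_apply, DirectSum.decompose_coe]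
  rw [← DirectSum.lof_eq_of R, DirectSum.lmap_lof, DirectSum.coeLinearMap_lof]
  rfl

/-- The differential `D(a ⊗ ω) = da ⊗ ω + (-1)^{|a|} a ⊗ dω` of `A ⊗ Ω_n`. -/
noncomputable def totalD : A.Forms n →ₗ[R] A.Forms n :=
  (GradedTensorProduct.of R A.gr (PolyForms.gr R n)).toLinearMap ∘ₗ
    (TensorProduct.map A.d LinearMap.id + TensorProduct.map A.sign (dΩ R n)) ∘ₗ
    (GradedTensorProduct.of R A.gr (PolyForms.gr R n)).symm.toLinearMap

variable {A n}

lemma add_gtmul (a b : A.carrier) (ω : Ω R n) :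
    ((a + b) ᵍ⊗ₜ[R] ω : A.Forms n) = a ᵍ⊗ₜ[R] ω + b ᵍ⊗ₜ[R] ω := by
  rw [GradedTensorProduct.tmul, TensorProduct.add_tmul, map_add]

lemma gtmul_add (a : A.carrier) (ω η : Ω R n) :
    (a ᵍ⊗ₜ[R] (ω + η) : A.Forms n) = a ᵍ⊗ₜ[R] ω + a ᵍ⊗ₜ[R] η := by
  rw [GradedTensorProduct.tmul, TensorProduct.tmul_add, map_add]

lemma smul_gtmul (r : R) (a : A.carrier) (ω : Ω R n) :
    ((r • a) ᵍ⊗ₜ[R] ω : A.Forms n) = r • (a ᵍ⊗ₜ[R] ω) := by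
  rw [GradedTensorProduct.tmul, ← TensorProduct.smul_tmul', map_smul]

lemma gtmul_smul (r : R) (a : A.carrier) (ω : Ω R n) :
    (a ᵍ⊗ₜ[R] (r • ω) : A.Forms n) = r • (a ᵍ⊗ₜ[R] ω) := by
  rw [GradedTensorProduct.tmul, TensorProduct.tmul_smul, map_smul]

lemma zero_gtmul (ω : Ω R n) : ((0 : A.carrier) ᵍ⊗ₜ[R] ω : A.Forms n) = 0 := by
  rw [GradedTensorProduct.tmul, TensorProduct.zero_tmul, map_zero]

lemma gtmul_zero (a : A.carrier) : (a ᵍ⊗ₜ[R] (0 : Ω R n) : A.Forms n) = 0 := by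
  rw [GradedTensorProduct.tmul, TensorProduct.tmul_zero, map_zero]

lemma totalD_tmul {i : ℕ} {a : A.carrier} (ha : a ∈ A.gr i) (ω : Ω R n) :
    A.totalD n (a ᵍ⊗ₜ ω) = A.d a ᵍ⊗ₜ ω + (-1 : R) ^ i • (a ᵍ⊗ₜ dΩ R n ω) := by
  rw [← smul_gtmul, ← A.sign_apply ha]
  rfl

lemma tmul_mul_tmul' {i j : ℕ} (a : A.carrier) {ω : Ω R n} (hω : ω ∈ PolyForms.gr R n i) {b : A.carrier}
    (hb : b ∈ A.gr j) (η : Ω R n) :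
    (a ᵍ⊗ₜ[R] ω * b ᵍ⊗ₜ[R] η : A.Forms n) = (-1 : R) ^ (i * j) • ((a * b) ᵍ⊗ₜ[R] (ω * η)) := by
  lift ω to PolyForms.gr R n i using hω
  lift b to A.gr j using hb
  rw [GradedTensorProduct.tmul_coe_mul_coe_tmul, Units.smul_def, ← Int.cast_smul_eq_zsmul R]
  simp

variable (A n)

/-- The part of degree `0` of `A ⊗ Ω_n`, spanned by the `a ⊗ ω` with `a` of chain degree `i` and
`ω` an `i`-form. -/
noncomputable def degZero : Submodule R (A.Forms n) :=
  Submodule.span R {x | ∃ (i : ℕ) (a : A.carrier) (ω : Ω R n),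
    a ∈ A.gr i ∧ ω ∈ PolyForms.gr R n i ∧ a ᵍ⊗ₜ ω = x}

variable {A n}

lemma degZero_one : (1 : A.Forms n) ∈ A.degZero n :=
  Submodule.subset_span ⟨0, 1, 1, SetLike.GradedOne.one_mem, SetLike.GradedOne.one_mem, rfl⟩

lemma degZero_mul {x y : A.Forms n} (hx : x ∈ A.degZero n) (hy : y ∈ A.degZero n) :
    x * y ∈ A.degZero n := by
  induction hx, hy using Submodule.span_induction₂ with
  | mem_mem x y hx hy =>
    obtain ⟨i, a, ω, ha, hω, rfl⟩ := hx
    obtain ⟨j, b, η, hb, hη, rfl⟩ := hy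
    rw [tmul_mul_tmul' a hω hb η]
    exact Submodule.smul_mem _ _ (Submodule.subset_span ⟨i + j, _, _,
      SetLike.GradedMul.mul_mem ha hb, SetLike.GradedMul.mul_mem hω hη, rfl⟩)
  | zero_left y hy => rw [zero_mul]; exact Submodule.zero_mem _
  | zero_right x hx => rw [mul_zero]; exact Submodule.zero_mem _
  | add_left x y z _ _ _ hx hy => rw [add_mul]; exact Submodule.add_mem _ hx hy
  | add_right x y z _ _ _ hx hy => rw [mul_add]; exact Submodule.add_mem _ hx hy
  | smul_left r x y _ _ h => rw [smul_mul_assoc]; exact Submodule.smul_mem _ _ h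
  | smul_right r x y _ _ h => rw [mul_smul_comm]; exact Submodule.smul_mem _ _ h

lemma degZero_comm {x y : A.Forms n} (hx : x ∈ A.degZero n) (hy : y ∈ A.degZero n) :
    x * y = y * x := by
  induction hx, hy using Submodule.span_induction₂ with
  | mem_mem x y hx hy =>
    obtain ⟨i, a, ω, ha, hω, rfl⟩ := hx
    obtain ⟨j, b, η, hb, hη, rfl⟩ := hy
    rw [tmul_mul_tmul' a hω hb η, tmul_mul_tmul' b hη ha ω, A.comm i j a ha b hb,
      gr_mul_comm hω hη, gtmul_smul, smul_gtmul,
      smul_smul, smul_smul, mul_comm j i, ← pow_add, ← pow_add]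
    congr 1
    exact neg_one_pow_congr (by simp [Nat.even_add])
  | zero_left y hy => rw [zero_mul, mul_zero]
  | zero_right x hx => rw [zero_mul, mul_zero]
  | add_left x y z _ _ _ hx hy => rw [add_mul, mul_add, hx, hy]
  | add_right x y z _ _ _ hx hy => rw [add_mul, mul_add, hx, hy]
  | smul_left r x y _ _ h => rw [smul_mul_assoc, mul_smul_comm, h]
  | smul_right r x y _ _ h => rw [smul_mul_assoc, mul_smul_comm, h]

lemma totalD_one : A.totalD n 1 = 0 := by
  have h1 : A.d 1 = 0 := A.d_zero 1 SetLike.GradedOne.one_mem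
  have h2 : dΩ R n 1 = 0 := by
    rw [Algebra.TensorProduct.one_def, dΩ_tmul]
    simp
  have h := totalD_tmul (A := A) (n := n) (SetLike.GradedOne.one_mem : (1 : A.carrier) ∈ A.gr 0) 1
  rw [h1, h2] at h
  refine Eq.trans h ?_
  rw [zero_gtmul, gtmul_zero, smul_zero, add_zero]

lemma totalD_mul {x y : A.Forms n} (hx : x ∈ A.degZero n) (hy : y ∈ A.degZero n) :
    A.totalD n (x * y) = A.totalD n x * y + x * A.totalD n y := by
  induction hx, hy using Submodule.span_induction₂ with
  | mem_mem x y hx hy =>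
    obtain ⟨i, a, ω, ha, hω, rfl⟩ := hx
    obtain ⟨j, b, η, hb, hη, rfl⟩ := hy
    have hdb : (a ᵍ⊗ₜ[R] ω * A.d b ᵍ⊗ₜ[R] η : A.Forms n) =
        (-1 : R) ^ (i * j + i) • ((a * A.d b) ᵍ⊗ₜ[R] (ω * η)) := by
      rcases j with _ | j
      · rw [A.d_zero b hb, zero_gtmul η, mul_zero a, zero_gtmul (ω * η), smul_zero]
        exact mul_zero _
      · rw [tmul_mul_tmul' a hω (A.d_mem j b hb) η]
        congr 1
        rw [mul_add, mul_one, add_assoc, pow_add, ← two_mul, pow_mul _ 2]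
        simp
    rw [tmul_mul_tmul' a hω hb η, map_smul, totalD_tmul (SetLike.GradedMul.mul_mem ha hb),
      totalD_tmul ha, totalD_tmul hb, add_mul, mul_add, hdb, tmul_mul_tmul' _ hω hb,
      smul_mul_assoc, tmul_mul_tmul' _ (dΩ_mem hω) hb, mul_smul_comm, tmul_mul_tmul' _ hω hb,
      A.leibniz i a ha, dΩ_mul hω, gtmul_add, add_gtmul,
      gtmul_smul, smul_gtmul]
    simp only [smul_add, smul_smul, ← pow_add]
    rw [neg_one_pow_congr (R := R) (m := i + (i + 1) * j) (n := i * j + (i + j))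
      (by simp only [Nat.even_add, Nat.even_mul, Nat.not_even_one]; tauto),
      neg_one_pow_congr (R := R) (m := i * j + (i + j + i)) (n := j + i * j)
      (by simp only [Nat.even_add, Nat.even_mul]; tauto)]
    abel
  | zero_left y hy => simp
  | zero_right x hx => simp
  | add_left x y z _ _ _ hx hy => simp only [add_mul, map_add, hx, hy]; abel
  | add_right x y z _ _ _ hx hy => simp only [mul_add, map_add, hx, hy]; abel
  | smul_left r x y _ _ h => simp only [smul_mul_assoc, map_smul, h, smul_add]
  | smul_right r x y _ _ h => simp only [mul_smul_comm, map_smul, h, smul_add]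

variable (A n) in
/-- The algebra `Z_0(A ⊗ Ω_n)` of cycles of degree `0` in `A ⊗ Ω_n`. -/
noncomputable def cycles : Subalgebra R (A.Forms n) where
  carrier := {x | x ∈ A.degZero n ∧ A.totalD n x = 0}
  mul_mem' hx hy := ⟨degZero_mul hx.1 hy.1, by
    rw [totalD_mul hx.1 hy.1, hx.2, hy.2, zero_mul, mul_zero, add_zero]⟩
  add_mem' hx hy := ⟨Submodule.add_mem _ hx.1 hy.1, by rw [map_add, hx.2, hy.2, add_zero]⟩
  algebraMap_mem' r := by
    rw [Algebra.algebraMap_eq_smul_one]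
    exact ⟨Submodule.smul_mem _ _ degZero_one, by rw [map_smul, totalD_one, smul_zero]⟩

noncomputable instance : CommRing (A.cycles n) where
  mul_comm x y := Subtype.ext (degZero_comm x.2.1 y.2.1)

/-- The map `A ⊗ Ω_n → B ⊗ Ω_m` given by a morphism `A ⟶ B` and a map `[m] → [n]`. -/
noncomputable def formsMap {A B : DGAlg R} (f : A ⟶ B) {m n : ℕ} (θ : Fin (m + 1) → Fin (n + 1)) :
    A.Forms n →ₗ[R] B.Forms m :=
  (GradedTensorProduct.of R B.gr (PolyForms.gr R m)).toLinearMap ∘ₗ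
    TensorProduct.map (DGAlg.Hom.hom f).toLinearMap (pull R θ).toLinearMap ∘ₗ
    (GradedTensorProduct.of R A.gr (PolyForms.gr R n)).symm.toLinearMap

section

variable {A B C : DGAlg R} (f : A ⟶ B) (g : B ⟶ C) {m n l : ℕ}
  (θ : Fin (m + 1) → Fin (n + 1)) (ψ : Fin (l + 1) → Fin (m + 1))

lemma formsMap_tmul (a : A.carrier) (ω : Ω R n) :
    formsMap f θ (a ᵍ⊗ₜ ω) = DGAlg.Hom.hom f a ᵍ⊗ₜ pull R θ ω := rfl

lemma formsMap_id (x : A.Forms n) : formsMap (𝟙 A) (id : Fin (n + 1) → Fin (n + 1)) x = x := by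
  have : formsMap (𝟙 A) (id : Fin (n + 1) → Fin (n + 1)) = LinearMap.id := by
    refine GradedTensorProduct.hom_ext _ _ (TensorProduct.ext' fun a ω => ?_)
    rw [LinearMap.comp_apply, LinearMap.comp_apply]
    change formsMap _ _ (a ᵍ⊗ₜ ω) = _
    rw [formsMap_tmul, pull_id]
    rfl
  rw [this, LinearMap.id_apply]

lemma formsMap_comp (x : A.Forms n) :
    formsMap (f ≫ g) (θ ∘ ψ) x = formsMap g ψ (formsMap f θ x) := by
  have : formsMap (f ≫ g) (θ ∘ ψ) = formsMap g ψ ∘ₗ formsMap f θ := by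
    refine GradedTensorProduct.hom_ext _ _ (TensorProduct.ext' fun a ω => ?_)
    rw [LinearMap.comp_apply, LinearMap.comp_apply, LinearMap.comp_apply]
    change formsMap _ _ (a ᵍ⊗ₜ ω) = formsMap _ _ (formsMap _ _ (a ᵍ⊗ₜ ω))
    rw [formsMap_tmul, pull_comp]
    rfl
  rw [this, LinearMap.comp_apply]

lemma formsMap_mem {x : A.Forms n} (hx : x ∈ A.degZero n) : formsMap f θ x ∈ B.degZero m := by
  induction hx using Submodule.span_induction with
  | mem x h =>
    obtain ⟨i, a, ω, ha, hω, rfl⟩ := h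
    exact Submodule.subset_span ⟨i, _, _, f.map_mem i a ha, pull_mem θ hω, rfl⟩
  | zero => rw [map_zero]; exact Submodule.zero_mem _
  | add x y _ _ hx hy => rw [map_add]; exact Submodule.add_mem _ hx hy
  | smul r x _ hx => rw [map_smul]; exact Submodule.smul_mem _ _ hx

lemma formsMap_mul {x y : A.Forms n} (hx : x ∈ A.degZero n) (hy : y ∈ A.degZero n) :
    formsMap f θ (x * y) = formsMap f θ x * formsMap f θ y := by
  induction hx, hy using Submodule.span_induction₂ with
  | mem_mem x y hx hy =>
    obtain ⟨i, a, ω, ha, hω, rfl⟩ := hx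
    obtain ⟨j, b, η, hb, hη, rfl⟩ := hy
    rw [tmul_mul_tmul' a hω hb η, map_smul, formsMap_tmul, formsMap_tmul, formsMap_tmul,
      tmul_mul_tmul' _ (pull_mem θ hω) (f.map_mem j b hb), map_mul, map_mul]
  | zero_left y hy => simp
  | zero_right x hx => simp
  | add_left x y z _ _ _ hx hy => simp only [add_mul, map_add, hx, hy]
  | add_right x y z _ _ _ hx hy => simp only [mul_add, map_add, hx, hy]
  | smul_left r x y _ _ h => simp only [smul_mul_assoc, map_smul, h]
  | smul_right r x y _ _ h => simp only [mul_smul_comm, map_smul, h]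

lemma totalD_formsMap {x : A.Forms n} (hx : x ∈ A.degZero n) :
    B.totalD m (formsMap f θ x) = formsMap f θ (A.totalD n x) := by
  induction hx using Submodule.span_induction with
  | mem x h =>
    obtain ⟨i, a, ω, ha, hω, rfl⟩ := h
    rw [formsMap_tmul, totalD_tmul (f.map_mem i a ha), totalD_tmul ha, map_add, map_smul,
      formsMap_tmul, formsMap_tmul, f.map_d, pull_dΩ]
  | zero => simp
  | add x y _ _ hx hy => simp only [map_add, hx, hy]
  | smul r x _ hx => simp only [map_smul, hx]

/-- The map `Z_0(A ⊗ Ω_n) → Z_0(B ⊗ Ω_m)` given by a morphism `A ⟶ B` and a map `[m] → [n]`. -/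
noncomputable def cyclesMap : A.cycles n →ₐ[R] B.cycles m :=
  AlgHom.ofLinearMap
    ((formsMap f θ).restrict (p := Subalgebra.toSubmodule (A.cycles n))
      (q := Subalgebra.toSubmodule (B.cycles m)) fun x hx =>
        ⟨formsMap_mem f θ hx.1, by rw [totalD_formsMap f θ hx.1, hx.2, map_zero]⟩)
    (Subtype.ext (by
      change DGAlg.Hom.hom f 1 ᵍ⊗ₜ[R] pull R θ 1 = (1 : B.Forms m)
      rw [map_one, map_one]
      rfl))
    (fun x y => Subtype.ext (formsMap_mul f θ x.2.1 y.2.1))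

lemma cyclesMap_id : cyclesMap (𝟙 A) (id : Fin (n + 1) → Fin (n + 1)) = AlgHom.id R _ :=
  AlgHom.ext fun x => Subtype.ext (formsMap_id x.1)

lemma cyclesMap_comp :
    cyclesMap (f ≫ g) (θ ∘ ψ) = (cyclesMap g ψ).comp (cyclesMap f θ) :=
  AlgHom.ext fun x => Subtype.ext (formsMap_comp f g θ ψ x.1)

end

/-- The simplicial algebra `n ↦ (A^{Δ^n})_0 = Z_0(A ⊗ Ω_n)`, functorially in `A`. -/
noncomputable def simplicialCycles (R : Type u) [CommRing R] :
    DGAlg R ⥤ SimplicialObject (CommAlgCat.{u} R) where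
  obj A :=
    { obj n := CommAlgCat.of R (A.cycles n.unop.len)
      map θ := CommAlgCat.ofHom (cyclesMap (𝟙 A) θ.unop.toOrderHom)
      map_id _ := congrArg CommAlgCat.ofHom cyclesMap_id
      map_comp θ ψ := congrArg CommAlgCat.ofHom
        ((congrArg (cyclesMap · _) (Category.comp_id (𝟙 A)).symm).trans
          (cyclesMap_comp (𝟙 A) (𝟙 A) θ.unop.toOrderHom ψ.unop.toOrderHom)) }
  map {A B} f :=
    { app _ := CommAlgCat.ofHom (cyclesMap f id)
      naturality _ _ θ := congrArg CommAlgCat.ofHom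
        ((cyclesMap_comp (𝟙 A) f θ.unop.toOrderHom id).symm.trans
          ((congrArg (cyclesMap · _) ((Category.id_comp f).trans (Category.comp_id f).symm)).trans
            (cyclesMap_comp f (𝟙 B) id θ.unop.toOrderHom))) }
  map_id _ := NatTrans.ext (funext fun _ => congrArg CommAlgCat.ofHom cyclesMap_id)
  map_comp f g := NatTrans.ext (funext fun _ => congrArg CommAlgCat.ofHom
    (cyclesMap_comp f g id id))

end DGAlg

/-- The simplicial quasi-comonoid `n ↦ E((A^{Δ^n})_0)` associated to `E` and `A ∈ dg_+N^♭_R`,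
where `A^{Δ^n}` is the truncation of `A ⊗ Ω_n` to non-negative degrees, so that
`(A^{Δ^n})_0 = Z_0(A ⊗ Ω_n)`. -/
noncomputable def DGN.underline (R : Type u) [CommRing R]
    (E : CommAlgCat.{u} R ⥤ QuasiComonoid.{w}) : DGN R ⥤ SimplicialObject QuasiComonoid.{w} :=
  ObjectProperty.ι _ ⋙ DGAlg.simplicialCycles R ⋙ (SimplicialObject.whiskering _ _).obj E

section

/-! ## Filling families of faces -/

namespace SSet

variable {X Y Z : SSet.{w}}

/-- A family of `n`-simplices which are compatible as the faces with index in `S` of an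
`(n + 1)`-simplex. -/
def CompatibleFaces (X : SSet.{w}) (n : ℕ) (S : Set (Fin (n + 2)))
    (x : Fin (n + 2) → X.obj (op ⦋n⦌)) : Prop :=
  match n with
  | 0 => True
  | n + 1 => ∀ i j : Fin (n + 2), i ≤ j → i.castSucc ∈ S → j.succ ∈ S →
      X.δ i (x j.succ) = X.δ j (x i.castSucc)

/-- The map `p` has fillers for compatible families of faces with index in `S`. -/
def FaceFilling (p : X ⟶ Y) (n : ℕ) (S : Set (Fin (n + 2))) : Prop :=
  ∀ (x : Fin (n + 2) → X _⦋n⦌) (y : Y _⦋n + 1⦌), X.CompatibleFaces n S x →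
    (∀ i ∈ S, p.app _ (x i) = Y.δ i y) →
    ∃ z : X _⦋n + 1⦌, p.app _ z = y ∧ ∀ i ∈ S, X.δ i z = x i

lemma CompatibleFaces.map_eq {n : ℕ} {S : Set (Fin (n + 2))} {x : Fin (n + 2) → X _⦋n⦌}
    (hx : X.CompatibleFaces n S x) {m : SimplexCategory} {i j : Fin (n + 2)} (hi : i ∈ S)
    (hj : j ∈ S) (α β : m ⟶ ⦋n⦌)
    (h : α ≫ SimplexCategory.δ i = β ≫ SimplexCategory.δ j) :
    X.map α.op (x i) = X.map β.op (x j) := by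
  wlog hij : i < j generalizing i j α β
  · rcases eq_or_lt_of_le (not_lt.1 hij) with rfl | h'
    · rw [cancel_mono] at h
      rw [h]
    · exact (this hj hi β α h.symm h').symm
  cases n with
  | zero =>
    exfalso
    let f : ⦋0⦌ ⟶ m := SimplexCategory.const ⦋0⦌ m 0
    have h0 : f ≫ α ≫ SimplexCategory.δ i = f ≫ β ≫ SimplexCategory.δ j := by rw [h]
    rw [← Category.assoc, ← Category.assoc, Subsingleton.elim (f ≫ α) (𝟙 _),
      Subsingleton.elim (f ≫ β) (𝟙 _), Category.id_comp, Category.id_comp] at h0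
    exact hij.ne (SimplexCategory.δ_injective h0)
  | succ n =>
    obtain ⟨i, rfl⟩ : ∃ i' : Fin (n + 2), i = i'.castSucc :=
      ⟨⟨i, by omega⟩, rfl⟩
    obtain ⟨j, rfl⟩ : ∃ j' : Fin (n + 2), j = j'.succ :=
      Fin.exists_succ_eq.2 (by rintro rfl; simp at hij) |>.imp fun _ h => h.symm
    have hle : i ≤ j := by
      rw [Fin.lt_def] at hij
      rw [Fin.le_def]
      simpa using Nat.lt_succ_iff.1 hij
    obtain ⟨γ, rfl⟩ := SimplexCategory.eq_comp_δ_of_not_surjective' α j (by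
      intro x hx'
      have h0 : (SimplexCategory.δ i.castSucc).toOrderHom (α.toOrderHom x) =
        (SimplexCategory.δ j.succ).toOrderHom (β.toOrderHom x) :=
        congrArg (fun f => SimplexCategory.Hom.toOrderHom f x) h
      rw [hx'] at h0
      have h1 : (SimplexCategory.δ i.castSucc).toOrderHom j = j.succ :=
        Fin.succAbove_of_le_castSucc _ _ (by simpa using hle)
      rw [h1] at h0
      exact Fin.succAbove_ne _ _ h0.symm)
    obtain ⟨γ', rfl⟩ := SimplexCategory.eq_comp_δ_of_not_surjective' β i (by
      intro x hx'
      have h0 : (SimplexCategory.δ i.castSucc).toOrderHom ((γ ≫ SimplexCategory.δ j).toOrderHom x) =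
        (SimplexCategory.δ j.succ).toOrderHom (β.toOrderHom x) :=
        congrArg (fun f => SimplexCategory.Hom.toOrderHom f x) h
      rw [hx'] at h0
      have h1 : (SimplexCategory.δ j.succ).toOrderHom i = i.castSucc :=
        Fin.succAbove_of_castSucc_lt _ _ (by simpa using hij)
      rw [h1] at h0
      exact Fin.succAbove_ne _ _ h0)
    have h2 : γ = γ' := by
      rw [Category.assoc, Category.assoc, ← SimplexCategory.δ_comp_δ hle, ← Category.assoc,
        ← Category.assoc, cancel_mono, cancel_mono] at h
      exact h
    subst h2
    rw [op_comp, op_comp, Functor.map_comp_apply, Functor.map_comp_apply]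
    exact congrArg _ (hx i j hle hi hj).symm

/-- The element `δ i` of `Δ[n + 1]`. -/
def stdFace (n : ℕ) (i : Fin (n + 2)) : (Δ[n + 1] : SSet.{w}) _⦋n⦌ :=
  stdSimplex.objEquiv.symm (SimplexCategory.δ i)

lemma yonedaEquiv_symm_stdFace (x : X _⦋n + 1⦌) (i : Fin (n + 2)) :
    (yonedaEquiv.symm x).app _ (stdFace n i) = X.δ i x :=
  yonedaEquiv_symm_app_objEquiv_symm _ _

/-- The subcomplex `A` of `Δ[n + 1]` is the union of the faces with index in `S`. -/
def IsUnionOfFaces {n : ℕ} (A : (Δ[n + 1] : SSet.{w}).Subcomplex) (S : Set (Fin (n + 2))) : Prop :=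
  ∀ (m : SimplexCategory) (s : m ⟶ ⦋n + 1⦌), stdSimplex.objEquiv.symm s ∈ A.obj (op m) ↔
    ∃ i ∈ S, ∃ t : m ⟶ ⦋n⦌, s = t ≫ SimplexCategory.δ i

section

variable {n : ℕ} {A : (Δ[n + 1] : SSet.{w}).Subcomplex} {S : Set (Fin (n + 2))}

lemma IsUnionOfFaces.stdFace_mem (hA : IsUnionOfFaces A S) {i : Fin (n + 2)} (hi : i ∈ S) :
    stdFace n i ∈ A.obj _ :=
  (hA _ _).2 ⟨i, hi, 𝟙 _, (Category.id_comp _).symm⟩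

lemma IsUnionOfFaces.hom_ext (hA : IsUnionOfFaces A S) {f g : (A : SSet.{w}) ⟶ X}
    (h : ∀ i (hi : i ∈ S), f.app _ ⟨stdFace n i, hA.stdFace_mem hi⟩ =
      g.app _ ⟨stdFace n i, hA.stdFace_mem hi⟩) : f = g := by
  ext m ⟨s, hs⟩
  obtain ⟨s, rfl⟩ := stdSimplex.objEquiv.symm.surjective s
  obtain ⟨i, hi, t, ht⟩ := (hA _ _).1 hs
  have e : (⟨stdSimplex.objEquiv.symm s, hs⟩ : A.obj m) =
      (A : SSet.{w}).map t.op ⟨stdFace n i, hA.stdFace_mem hi⟩ := by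
    apply Subtype.ext
    change _ = (Δ[n + 1] : SSet.{w}).map t.op (stdFace n i)
    rw [stdFace, stdSimplex.map_objEquiv_symm]
    exact congrArg stdSimplex.objEquiv.symm ht
  rw [e]
  have h1 := NatTrans.naturality_apply f t.op ⟨stdFace n i, hA.stdFace_mem hi⟩
  have h2 := NatTrans.naturality_apply g t.op ⟨stdFace n i, hA.stdFace_mem hi⟩
  exact h1.trans ((congrArg _ (h i hi)).trans h2.symm)

lemma IsUnionOfFaces.exists_desc (hA : IsUnionOfFaces A S) {x : Fin (n + 2) → X _⦋n⦌}
    (hx : X.CompatibleFaces n S x) :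
    ∃ f : (A : SSet.{w}) ⟶ X, ∀ i (hi : i ∈ S), f.app _ ⟨stdFace n i, hA.stdFace_mem hi⟩ = x i := by
  have key : ∀ (m : SimplexCategory) (s : (A : SSet.{w}).obj (op m)), ∃ i, i ∈ S ∧
      ∃ t : m ⟶ ⦋n⦌, stdSimplex.objEquiv s.1 = t ≫ SimplexCategory.δ i := fun m s => by
    obtain ⟨i, hi, t, ht⟩ := (hA m (stdSimplex.objEquiv s.1)).1 (by simpa using s.2)
    exact ⟨i, hi, t, ht⟩
  choose i hi t ht using key
  have val : ∀ (m : SimplexCategory) (s : (A : SSet.{w}).obj (op m)) (j : Fin (n + 2)) (_ : j ∈ S)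
      (t' : m ⟶ ⦋n⦌), stdSimplex.objEquiv s.1 = t' ≫ SimplexCategory.δ j →
      X.map (t m s).op (x (i m s)) = X.map t'.op (x j) := fun m s j hj t' h' =>
    hx.map_eq (hi m s) hj _ _ ((ht m s).symm.trans h')
  refine ⟨{ app := fun m => TypeCat.ofHom fun s => X.map (t m.unop s).op (x (i m.unop s))
            naturality := fun m m' θ => ?_ }, fun j hj => ?_⟩
  · refine ConcreteCategory.hom_ext _ _ fun s => ?_
    refine (val m'.unop ((A : SSet.{w}).map θ s) (i m.unop s) (hi _ _) (θ.unop ≫ t m.unop s) ?_).trans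
      ?_
    · have h1 : stdSimplex.objEquiv ((A : SSet.{w}).map θ s).1 =
        θ.unop ≫ stdSimplex.objEquiv s.1 := rfl
      rw [h1, ht m.unop s, Category.assoc]
    · rw [op_comp, Functor.map_comp_apply]
      rfl
  · change X.map (t ⦋n⦌ _).op (x (i ⦋n⦌ _)) = x j
    rw [val ⦋n⦌ ⟨stdFace n j, hA.stdFace_mem hj⟩ j hj (𝟙 _) (by rw [Category.id_comp]; rfl)]
    simp

lemma IsUnionOfFaces.hasLiftingProperty_iff (hA : IsUnionOfFaces A S) (hS : S.Nonempty)
    (p : X ⟶ Y) : HasLiftingProperty A.ι p ↔ FaceFilling p n S := by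
  constructor
  · intro h x y hx hxy
    obtain ⟨f, hf⟩ := hA.exists_desc hx
    have sq : CommSq f A.ι p (yonedaEquiv.symm y) := ⟨hA.hom_ext fun i hi => by
      have h1 := (congrArg (p.app _) (hf i hi)).trans (hxy i hi)
      exact h1.trans (yonedaEquiv_symm_stdFace y i).symm⟩
    refine ⟨yonedaEquiv sq.lift, ?_, fun i hi => ?_⟩
    · rw [← yonedaEquiv_comp, sq.fac_right, Equiv.apply_symm_apply]
    · have h1 : (A.ι ≫ sq.lift).app _ ⟨stdFace n i, hA.stdFace_mem hi⟩ = x i := by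
        rw [sq.fac_left, hf i hi]
      rw [← h1, ← yonedaEquiv_symm_stdFace, Equiv.symm_apply_apply]
      rfl
  · intro h
    refine ⟨fun {f g} sq => ?_⟩
    classical
    obtain ⟨i₀, h₀⟩ := hS
    let x : Fin (n + 2) → X _⦋n⦌ := fun i => if hi : i ∈ S then
      f.app _ ⟨stdFace n i, hA.stdFace_mem hi⟩ else f.app _ ⟨stdFace n i₀, hA.stdFace_mem h₀⟩
    have hx : ∀ i (hi : i ∈ S), x i = f.app _ ⟨stdFace n i, hA.stdFace_mem hi⟩ :=
      fun i hi => dif_pos hi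
    obtain ⟨z, hz, hz'⟩ := h x (yonedaEquiv g) (by
      cases n with
      | zero => trivial
      | succ n =>
        intro i j hij hi hj
        rw [hx _ hi, hx _ hj]
        refine (NatTrans.naturality_apply f (SimplexCategory.δ i).op _).symm.trans
          (Eq.trans ?_ (NatTrans.naturality_apply f (SimplexCategory.δ j).op _))
        congr 1
        apply Subtype.ext
        change (Δ[n + 2] : SSet.{w}).map _ (stdFace _ _) = (Δ[n + 2] : SSet.{w}).map _ (stdFace _ _)
        rw [stdFace, stdFace, stdSimplex.map_objEquiv_symm, stdSimplex.map_objEquiv_symm]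
        exact congrArg _ (SimplexCategory.δ_comp_δ hij)) (fun i hi => by
      rw [hx i hi, ← yonedaEquiv_symm_stdFace, Equiv.symm_apply_apply]
      exact ConcreteCategory.congr_hom (NatTrans.congr_app sq.w _)
        ⟨stdFace n i, hA.stdFace_mem hi⟩)
    refine ⟨⟨⟨yonedaEquiv.symm z, hA.hom_ext fun i hi => ?_, ?_⟩⟩⟩
    · rw [← hx i hi, ← hz' i hi]
      exact yonedaEquiv_symm_stdFace z i
    · apply yonedaEquiv.injective
      rw [yonedaEquiv_comp, Equiv.apply_symm_apply, hz]

end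

lemma notMem_range_iff {n : ℕ} (m : SimplexCategory) (s : m ⟶ ⦋n + 1⦌) (i : Fin (n + 2)) :
    i ∉ Set.range s.toOrderHom ↔ ∃ t : m ⟶ ⦋n⦌, s = t ≫ SimplexCategory.δ i := by
  constructor
  · intro h
    exact SimplexCategory.eq_comp_δ_of_not_surjective' s i fun x hx => h ⟨x, hx⟩
  · rintro ⟨t, rfl⟩ ⟨x, hx⟩
    exact Fin.succAbove_ne _ _ hx

lemma isUnionOfFaces_horn {n : ℕ} (k : Fin (n + 2)) :
    IsUnionOfFaces (Λ[n + 1, k] : (Δ[n + 1] : SSet.{w}).Subcomplex) {k}ᶜ := by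
  intro m s
  simp only [← notMem_range_iff]
  refine (mem_horn_iff_notMem_range (d := m.len) (stdSimplex.objEquiv.symm s) k).trans ?_
  simp only [exists_prop]
  rfl

lemma isUnionOfFaces_boundary (n : ℕ) :
    IsUnionOfFaces (∂Δ[n + 1] : (Δ[n + 1] : SSet.{w}).Subcomplex) Set.univ := by
  intro m s
  simp only [← notMem_range_iff, Set.mem_univ, true_and]
  exact (mem_boundary_iff_notMem_range (d := m.len) (stdSimplex.objEquiv.symm s))

lemma rlp_J_iff (p : X ⟶ Y) :
    modelCategoryQuillen.J.rlp p ↔ ∀ (n : ℕ) (k : Fin (n + 2)), FaceFilling p n {k}ᶜ := by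
  have hS : ∀ (n : ℕ) (k : Fin (n + 2)), ({k}ᶜ : Set (Fin (n + 2))).Nonempty := fun n k => by
    obtain ⟨j, hj⟩ := exists_ne k
    exact ⟨j, hj⟩
  constructor
  · intro h n k
    exact ((isUnionOfFaces_horn k).hasLiftingProperty_iff (hS n k) p).1
      (h _ (modelCategoryQuillen.horn_ι_mem_J (n + 1) k))
  · intro h _ _ _ hi
    simp only [modelCategoryQuillen.J, MorphismProperty.iSup_iff] at hi
    obtain ⟨n, ⟨k⟩⟩ := hi
    exact ((isUnionOfFaces_horn k).hasLiftingProperty_iff (hS n k) p).2 (h n k)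

lemma hasLiftingProperty_boundary_zero_iff (p : X ⟶ Y) :
    HasLiftingProperty (∂Δ[0] : (Δ[0] : SSet.{w}).Subcomplex).ι p ↔
      Function.Surjective (p.app (op ⦋0⦌)) := by
  constructor
  · intro h y
    have hsub : ∀ (Z : SSet.{w}) (f g : (∂Δ[0] : SSet.{w}) ⟶ Z), f = g := fun _ _ _ =>
      boundary.hom_ext₀
    have : ∃ f : (∂Δ[0] : SSet.{w}) ⟶ X, True := by
      rw [boundary_zero]
      exact ⟨Subcomplex.isInitialBot.to _, trivial⟩
    obtain ⟨f, -⟩ := this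
    have sq : CommSq f (∂Δ[0] : (Δ[0] : SSet.{w}).Subcomplex).ι p (yonedaEquiv.symm y) :=
      ⟨hsub _ _ _⟩
    refine ⟨yonedaEquiv sq.lift, ?_⟩
    rw [← yonedaEquiv_comp, sq.fac_right, Equiv.apply_symm_apply]
  · intro h
    refine ⟨fun {f g} sq => ?_⟩
    obtain ⟨z, hz⟩ := h (yonedaEquiv g)
    refine ⟨⟨⟨yonedaEquiv.symm z, boundary.hom_ext₀, ?_⟩⟩⟩
    apply yonedaEquiv.injective
    rw [yonedaEquiv_comp, Equiv.apply_symm_apply, hz]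

lemma rlp_I_iff (p : X ⟶ Y) :
    modelCategoryQuillen.I.rlp p ↔ Function.Surjective (p.app (op ⦋0⦌)) ∧
      ∀ n : ℕ, FaceFilling p n Set.univ := by
  rw [← hasLiftingProperty_boundary_zero_iff]
  constructor
  · intro h
    exact ⟨h _ (modelCategoryQuillen.boundary_ι_mem_I 0), fun n =>
      ((isUnionOfFaces_boundary n).hasLiftingProperty_iff Set.univ_nonempty p).1
        (h _ (modelCategoryQuillen.boundary_ι_mem_I (n + 1)))⟩
  · rintro ⟨h0, h⟩ _ _ _ ⟨n⟩
    cases n with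
    | zero => exact h0
    | succ n =>
      exact ((isUnionOfFaces_boundary n).hasLiftingProperty_iff Set.univ_nonempty p).2 (h n)

end SSet

end

section

/-! ## Simplicial abelian groups and principal maps -/

namespace SimplicialAb

variable (V : SimplicialObject AddCommGrpCat.{w})

/-- The normalised complex of `V` is acyclic. -/
def IsAcyclic : Prop :=
  ∀ (n : ℕ) (z : V.obj (op ⦋n⦌)), (∀ m (_ : n = m + 1) (α : ⦋m⦌ ⟶ ⦋n⦌), Mono α → V.map α.op z = 0) →
    ∃ y : V.obj (op ⦋n + 1⦌), V.δ 0 y = z ∧ ∀ i : Fin (n + 1), V.δ i.succ y = 0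

/-- The underlying simplicial set. -/
abbrev toSSet : SSet.{w} := V ⋙ forget AddCommGrpCat

variable {V}

lemma δ_comp_δ {n : ℕ} {i j : Fin (n + 2)} (h : i ≤ j) (x : V.obj (op ⦋n + 2⦌)) :
    V.δ i (V.δ j.succ x) = V.δ j (V.δ i.castSucc x) :=
  ConcreteCategory.congr_hom (V.δ_comp_δ h) x

lemma δ_comp_σ_of_le {n : ℕ} {i : Fin (n + 2)} {j : Fin (n + 1)} (h : i ≤ j.castSucc)
    (x : V.obj (op ⦋n + 1⦌)) : V.δ i.castSucc (V.σ j.succ x) = V.σ j (V.δ i x) :=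
  ConcreteCategory.congr_hom (V.δ_comp_σ_of_le h) x

lemma δ_comp_σ_self {n : ℕ} (i : Fin (n + 1)) (x : V.obj (op ⦋n⦌)) :
    V.δ i.castSucc (V.σ i x) = x :=
  ConcreteCategory.congr_hom (V.δ_comp_σ_self (i := i)) x

lemma δ_comp_σ_succ {n : ℕ} (i : Fin (n + 1)) (x : V.obj (op ⦋n⦌)) :
    V.δ i.succ (V.σ i x) = x :=
  ConcreteCategory.congr_hom (V.δ_comp_σ_succ (i := i)) x

lemma δ_comp_σ_of_gt {n : ℕ} {i : Fin (n + 2)} {j : Fin (n + 1)} (h : j.castSucc < i)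
    (x : V.obj (op ⦋n + 1⦌)) : V.δ i.succ (V.σ j.castSucc x) = V.σ j (V.δ i x) :=
  ConcreteCategory.congr_hom (V.δ_comp_σ_of_gt h) x

lemma exists_fill_lt {n : ℕ} (k : Fin (n + 2)) (x : Fin (n + 2) → V.obj (op ⦋n⦌))
    (hx : (toSSet V).CompatibleFaces n {k}ᶜ x) (r : ℕ) (hr : r ≤ k) :
    ∃ z : V.obj (op ⦋n + 1⦌), ∀ i : Fin (n + 2), i.val < r → V.δ i z = x i := by
  induction r with
  | zero => exact ⟨0, fun i hi => absurd hi (Nat.not_lt_zero _)⟩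
  | succ r ih =>
    obtain ⟨z, hz⟩ := ih (by omega)
    let r' : Fin (n + 1) := ⟨r, by omega⟩
    refine ⟨z - V.σ r' (V.δ r'.castSucc z - x r'.castSucc), fun i hi => ?_⟩
    rcases (Nat.lt_succ_iff_lt_or_eq.1 hi) with hlt | heq
    · rw [map_sub, hz i hlt]
      cases n with
      | zero => omega
      | succ n =>
        obtain ⟨i, rfl⟩ : ∃ i' : Fin (n + 2), i = i'.castSucc := ⟨⟨i, by omega⟩, rfl⟩
        obtain ⟨r'', hr''⟩ : ∃ j : Fin (n + 1), r' = j.succ :=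
          ⟨⟨r - 1, by omega⟩, by ext; change r = r - 1 + 1; simp at hlt; omega⟩
        have hle : i ≤ r''.castSucc := by
          have := congrArg Fin.val hr''
          change r = r'' + 1 at this
          rw [Fin.le_def]
          simp at hlt ⊢
          omega
        have h1 : V.δ i (x r'.castSucc) = V.δ r''.castSucc (x i.castSucc) := by
          rw [hr'']
          exact hx i r''.castSucc hle (by simp [Fin.ext_iff] at hlt ⊢; omega)
            (by rw [← Fin.castSucc_succ, ← hr'']; simp [Fin.ext_iff, r']; omega)
        have h2 : V.δ i (V.δ r'.castSucc z) = V.δ r''.castSucc (V.δ i.castSucc z) := by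
          rw [hr'']
          exact δ_comp_δ hle z
        rw [hr'', δ_comp_σ_of_le hle, ← hr'', map_sub, h1, h2, hz _ hlt, sub_self, map_zero,
          sub_zero]
    · obtain rfl : i = r'.castSucc := Fin.ext heq
      rw [map_sub, δ_comp_σ_self]
      abel

lemma exists_fill {n : ℕ} (k : Fin (n + 2)) (x : Fin (n + 2) → V.obj (op ⦋n⦌))
    (hx : (toSSet V).CompatibleFaces n {k}ᶜ x) :
    ∃ z : V.obj (op ⦋n + 1⦌), ∀ i : Fin (n + 2), i ≠ k → V.δ i z = x i := by
  suffices H : ∀ r : ℕ, r ≤ n + 1 - k → ∃ z : V.obj (op ⦋n + 1⦌), ∀ i : Fin (n + 2),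
      i.val < k ∨ n + 1 < i + r → V.δ i z = x i by
    obtain ⟨z, hz⟩ := H _ le_rfl
    exact ⟨z, fun i hi => hz i (by have := Fin.val_ne_of_ne hi; omega)⟩
  intro r
  induction r with
  | zero =>
    intro _
    obtain ⟨z, hz⟩ := exists_fill_lt k x hx k le_rfl
    exact ⟨z, fun i hi => hz i (by omega)⟩
  | succ r ih =>
    intro hr
    obtain ⟨z, hz⟩ := ih (by omega)
    let r' : Fin (n + 1) := ⟨n - r, by omega⟩
    have hr' : (r' : ℕ) = n - r := rfl
    refine ⟨z - V.σ r' (V.δ r'.succ z - x r'.succ), fun i hi => ?_⟩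
    by_cases heq : i = r'.succ
    · subst heq
      rw [map_sub, δ_comp_σ_succ]
      abel
    · have heq' : i.val ≠ n - r + 1 := fun h => heq (Fin.ext h)
      have hi' : i.val < k ∨ n + 1 < i + r := by omega
      rw [map_sub, hz i hi']
      cases n with
      | zero => omega
      | succ n =>
        rcases hi' with hlt | hgt
        · obtain ⟨i, rfl⟩ : ∃ i' : Fin (n + 2), i = i'.castSucc := ⟨⟨i, by omega⟩, rfl⟩
          obtain ⟨r'', hr''⟩ : ∃ j : Fin (n + 1), r' = j.succ :=
            ⟨⟨n - r, by omega⟩, by ext; change n + 1 - r = n - r + 1; simp at hlt; omega⟩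
          have h0 := congrArg Fin.val hr''
          simp only [Fin.val_succ, hr'] at h0
          simp only [Fin.val_castSucc] at hlt
          have hle : i ≤ r''.castSucc := by
            rw [Fin.le_def, Fin.val_castSucc]
            omega
          have hle' : i ≤ r' := by
            rw [Fin.le_def]
            omega
          have h1 : V.δ i (x r'.succ) = V.δ r' (x i.castSucc) :=
            hx i r' hle' (by simp [Fin.ext_iff]; omega) (by simp [Fin.ext_iff]; omega)
          rw [hr'', δ_comp_σ_of_le hle, ← hr'', map_sub, h1, δ_comp_δ hle', hz _ (Or.inl hlt),
            sub_self, map_zero, sub_zero]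
        · obtain ⟨i, rfl⟩ : ∃ i' : Fin (n + 2), i = i'.succ :=
            ⟨⟨i - 1, by omega⟩, by ext; simp; omega⟩
          obtain ⟨r'', hr''⟩ : ∃ j : Fin (n + 1), r' = j.castSucc :=
            ⟨⟨n + 1 - r, by simp at hgt heq'; omega⟩, rfl⟩
          have h0 := congrArg Fin.val hr''
          simp only [Fin.val_castSucc, hr'] at h0
          simp only [Fin.val_succ] at hgt heq'
          have hlt : r''.castSucc < i := by
            rw [Fin.lt_def, Fin.val_castSucc]
            omega
          have hle : r''.succ ≤ i := by
            rw [Fin.le_def, Fin.val_succ]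
            omega
          have h2 : r'.succ = r''.succ.castSucc := by rw [hr'', Fin.castSucc_succ]
          have h1 : V.δ r''.succ (x i.succ) = V.δ i (x r'.succ) := by
            rw [h2]
            exact hx r''.succ i hle (by simp [Fin.ext_iff]; omega) (by simp [Fin.ext_iff]; omega)
          rw [hr'', δ_comp_σ_of_gt hlt, ← hr'', map_sub, ← h1, h2, ← δ_comp_δ hle,
            hz _ (Or.inr (by simp; omega)), sub_self, map_zero, sub_zero]

lemma exists_fill_boundary (hV : IsAcyclic V) {n : ℕ} (x : Fin (n + 2) → V.obj (op ⦋n⦌))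
    (hx : (toSSet V).CompatibleFaces n Set.univ x) :
    ∃ z : V.obj (op ⦋n + 1⦌), ∀ i : Fin (n + 2), V.δ i z = x i := by
  obtain ⟨z, hz⟩ := exists_fill 0 x (by
    cases n with
    | zero => trivial
    | succ n => exact fun i j hij _ _ => hx i j hij trivial trivial)
  obtain ⟨y, hy, hy'⟩ := hV n (x 0 - V.δ 0 z) (by
    rintro m rfl α hα
    obtain ⟨i, rfl⟩ := SimplexCategory.eq_δ_of_mono α
    change V.δ i _ = 0
    have h1 : V.δ i (x 0) = V.δ 0 (x i.succ) := (hx 0 i (Fin.zero_le _) trivial trivial).symm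
    have h2 : V.δ i (V.δ 0 z) = V.δ 0 (V.δ i.succ z) := (δ_comp_δ (Fin.zero_le _) z).symm
    rw [map_sub, h1, h2, hz _ (Fin.succ_ne_zero _), sub_self])
  refine ⟨z + y, fun i => ?_⟩
  rw [map_add]
  refine Fin.cases ?_ (fun i => ?_) i
  · rw [hy]; abel
  · rw [hy', hz _ (Fin.succ_ne_zero _), add_zero]

end SimplicialAb

namespace SSet

variable {X Y : SSet.{w}} (p : X ⟶ Y)

/-- An action of the simplicial abelian group `V` on the part of `X` over the simplex `y` of `Y`,
which is simply transitive on the fibres. -/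
structure PrincipalAction {k : SimplexCategory} (y : Y.obj (op k))
    (V : SimplicialObject AddCommGrpCat.{w}) where
  /-- the action -/
  act : ∀ m : SimplexCategory, V.obj (op m) → X.obj (op m) → X.obj (op m)
  map_act : ∀ {m m' : SimplexCategory} (θ : m' ⟶ m) (α : m ⟶ k) (v : V.obj (op m))
    (x : X.obj (op m)), p.app _ x = Y.map α.op y →
      X.map θ.op (act m v x) = act m' (V.map θ.op v) (X.map θ.op x)
  app_act : ∀ {m : SimplexCategory} (α : m ⟶ k) (v : V.obj (op m)) (x : X.obj (op m)),
    p.app _ x = Y.map α.op y → p.app _ (act m v x) = Y.map α.op y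
  exists_act_eq : ∀ {m : SimplexCategory} (α : m ⟶ k) (x x' : X.obj (op m)),
    p.app _ x = Y.map α.op y → p.app _ x' = Y.map α.op y → ∃ v, act m v x = x'
  act_injective : ∀ {m : SimplexCategory} (α : m ⟶ k) (v v' : V.obj (op m)) (x : X.obj (op m)),
    p.app _ x = Y.map α.op y → act m v x = act m v' x → v = v'

variable {p}

lemma PrincipalAction.exists_filler {n : ℕ} {y : Y _⦋n + 1⦌} {V : SimplicialObject AddCommGrpCat.{w}}
    (a : PrincipalAction p y V) {S : Set (Fin (n + 2))}
    (hV : ∀ v : Fin (n + 2) → V.obj (op ⦋n⦌), (SimplicialAb.toSSet V).CompatibleFaces n S v →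
      ∃ z : V.obj (op ⦋n + 1⦌), ∀ i ∈ S, V.δ i z = v i)
    (hy : ∃ x : X _⦋n + 1⦌, p.app _ x = y)
    {x : Fin (n + 2) → X _⦋n⦌} (hx : X.CompatibleFaces n S x)
    (hxy : ∀ i ∈ S, p.app _ (x i) = Y.δ i y) :
    ∃ z : X _⦋n + 1⦌, p.app _ z = y ∧ ∀ i ∈ S, X.δ i z = x i := by
  obtain ⟨z, hz⟩ := hy
  have hz' : ∀ {m : SimplexCategory} (α : m ⟶ ⦋n + 1⦌), p.app _ (X.map α.op z) = Y.map α.op y := by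
    intro m α
    rw [← hz]
    exact NatTrans.naturality_apply p α.op z
  have h1 : ∀ i, ∃ v : V.obj (op ⦋n⦌), i ∈ S → a.act _ v (X.δ i z) = x i := fun i => by
    by_cases hi : i ∈ S
    · obtain ⟨v, hv⟩ := a.exists_act_eq (SimplexCategory.δ i) (X.δ i z) (x i) (hz' _) (hxy i hi)
      exact ⟨v, fun _ => hv⟩
    · exact ⟨0, fun h => absurd h hi⟩
  choose v hv using h1
  obtain ⟨c, hc⟩ := hV v (by
    cases n with
    | zero => trivial
    | succ n =>
      intro i j hij hi hj
      have e1 : SimplexCategory.δ i ≫ SimplexCategory.δ j.succ =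
        SimplexCategory.δ j ≫ SimplexCategory.δ i.castSucc := SimplexCategory.δ_comp_δ hij
      have e2 : X.δ i (X.δ j.succ z) = X.δ j (X.δ i.castSucc z) := δ_comp_δ_apply hij z
      have h2 := (a.map_act (SimplexCategory.δ i) (SimplexCategory.δ j.succ) (v j.succ) _
        (hz' _)).symm.trans (congrArg _ (hv _ hj))
      have h3 := (a.map_act (SimplexCategory.δ j) (SimplexCategory.δ i.castSucc) (v i.castSucc) _
        (hz' _)).symm.trans (congrArg _ (hv _ hi))
      refine a.act_injective (SimplexCategory.δ i ≫ SimplexCategory.δ j.succ) _ _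
        (X.δ i (X.δ j.succ z)) ?_ (h2.trans ((hx i j hij hi hj).trans (h3.symm.trans ?_)))
      · rw [← hz' (SimplexCategory.δ i ≫ SimplexCategory.δ j.succ), op_comp,
          Functor.map_comp_apply]
        rfl
      · rw [e2]
        rfl)
  have hz0 : p.app _ z = Y.map (𝟙 ⦋n + 1⦌ : ⦋n + 1⦌ ⟶ ⦋n + 1⦌).op y := by simpa using hz
  refine ⟨a.act _ c z, ?_, fun i hi => ?_⟩
  · simpa using a.app_act (𝟙 _) c z hz0
  · rw [← hv i hi, ← hc i hi]
    exact a.map_act (SimplexCategory.δ i) (𝟙 _) c z hz0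

/-- A surjective map is a Kan fibration if all its restrictions to simplices are principal. -/
lemma rlp_J_of_principal (hp : ∀ n, Function.Surjective (p.app (op ⦋n⦌)))
    (h : ∀ (n : ℕ) (y : Y _⦋n + 1⦌), ∃ V, Nonempty (PrincipalAction p y V)) :
    modelCategoryQuillen.J.rlp p := by
  rw [rlp_J_iff]
  intro n k x y hx hxy
  obtain ⟨V, ⟨a⟩⟩ := h n y
  exact a.exists_filler (fun v hv => SimplicialAb.exists_fill k v hv) (hp _ y) hx hxy

/-- A surjective map is a trivial fibration if all its restrictions to simplices are principal under
acyclic simplicial abelian groups. -/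
lemma rlp_I_of_principal (hp : ∀ n, Function.Surjective (p.app (op ⦋n⦌)))
    (h : ∀ (n : ℕ) (y : Y _⦋n + 1⦌), ∃ V, SimplicialAb.IsAcyclic V ∧
      Nonempty (PrincipalAction p y V)) :
    modelCategoryQuillen.I.rlp p := by
  rw [rlp_I_iff]
  refine ⟨hp 0, fun n x y hx hxy => ?_⟩
  obtain ⟨V, hV, ⟨a⟩⟩ := h n y
  refine a.exists_filler (fun v hv => ?_) (hp _ y) hx hxy
  obtain ⟨z, hz⟩ := SimplicialAb.exists_fill_boundary hV v hv
  exact ⟨z, fun i _ => hz i⟩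

end SSet

end

section

/-! ## Sequences in the interval -/

namespace IntervalSeq

variable {T : Type*} [SemilatticeInf T] [OrderBot T]

/-- The sequence `t` is supported on `{1, …, n}`, and so represents an element of `T^n`. -/
def Supp (n : ℕ) (t : ℕ → T) : Prop := t 0 = ⊥ ∧ ∀ j, n < j → t j = ⊥

/-- The part of a sequence before the index `i`. -/
def lo (i : ℕ) (t : ℕ → T) : ℕ → T := fun j => if j < i then t j else ⊥

/-- The part of a sequence after the index `i`. -/
def hi (i : ℕ) (t : ℕ → T) : ℕ → T := fun j => t (j + i)

/-- Removal of the entry with index `i`. -/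
def rem (i : ℕ) (t : ℕ → T) : ℕ → T := fun j => if j < i then t j else t (j + 1)

/-- Replacing the entries with index `i` and `i + 1` by their minimum. -/
def del (i : ℕ) (t : ℕ → T) : ℕ → T := fun j =>
  if j < i then t j else if j = i then t i ⊓ t (i + 1) else t (j + 1)

variable {n p q i j : ℕ} {t : ℕ → T}

lemma Supp.lo (h : Supp n t) (hp : 1 ≤ p) : Supp (p - 1) (lo p t) :=
  ⟨by simp [IntervalSeq.lo, h.1], fun j hj => by simp [IntervalSeq.lo]; omega⟩

lemma Supp.hi (h : Supp n t) (hp : t p = ⊥) : Supp (n - p) (hi p t) :=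
  ⟨by simpa [IntervalSeq.hi], fun j hj => h.2 _ (by omega)⟩

lemma Supp.rem (h : Supp (n + 1) t) (hp : 1 ≤ p) (hp' : p ≤ n + 1) : Supp n (rem p t) :=
  ⟨by simp [IntervalSeq.rem, h.1]; omega, fun j hj => by
    simp only [IntervalSeq.rem]; split_ifs
    · exact h.2 _ (by omega)
    · exact h.2 _ (by omega)⟩

lemma Supp.del (h : Supp (n + 1) t) (hp : p ≤ n + 1) : Supp n (del p t) := by
  refine ⟨?_, fun j hj => ?_⟩
  · simp only [IntervalSeq.del]
    split_ifs with h1 h2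
    · exact h.1
    · subst h2; simp [h.1]
    · omega
  · simp only [IntervalSeq.del]
    split_ifs with h1 h2
    · exact h.2 _ (by omega)
    · subst h2; rw [h.2 (j + 1) (by omega)]; simp
    · exact h.2 _ (by omega)

lemma del_del (hij : i ≤ j) : del j (del i t) = del i (del (j + 1) t) := by
  funext a
  simp only [del]
  split_ifs <;> first
    | rfl | omega
    | (subst_vars; first
        | rfl | omega
        | (simp_all; done)
        | (rw [inf_assoc]))

lemma lo_lo (hij : i ≤ j) : lo i (lo j t) = lo i t := by
  funext a; simp only [lo]; split_ifs <;> first | rfl | omega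

lemma hi_hi : hi i (hi j t) = hi (i + j) t := by
  funext a; simp only [hi]; rw [add_assoc]

lemma lo_hi : lo i (hi j t) = hi j (lo (i + j) t) := by
  funext a; simp only [hi, lo]; split_ifs <;> first | rfl | omega

lemma rem_lo (hij : i ≤ j) : rem i (lo (j + 1) t) = lo j (rem i t) := by
  funext a; simp only [rem, lo]; split_ifs <;> first | rfl | omega

lemma lo_rem (hij : i ≤ j) : lo i (rem j t) = lo i t := by
  funext a; simp only [rem, lo]; split_ifs <;> first | rfl | omega

lemma hi_rem_add : hi i (rem (j + i) t) = rem j (hi i t) := by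
  funext a; simp only [rem, hi]; split_ifs <;> first | rfl | omega | (congr 1; omega)

lemma hi_rem (hij : i ≤ j) : hi j (rem i t) = hi (j + 1) t := by
  funext a; simp only [rem, hi]; split_ifs <;> first | rfl | omega | (congr 1; omega)

lemma rem_rem (hij : i ≤ j) : rem i (rem (j + 1) t) = rem j (rem i t) := by
  funext a; simp only [rem]; split_ifs <;> first | rfl | omega

lemma del_lo (hij : i ≤ j) : del i (lo (j + 1) t) = lo j (del i t) := by
  funext a; simp only [del, lo]
  split_ifs <;> first | rfl | omega | simp

lemma hi_del (hij : i ≤ j) (h : t (j + 1) = ⊥) : hi j (del i t) = hi (j + 1) t := by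
  funext a; simp only [del, hi]
  split_ifs <;> first
    | rfl | omega | (congr 1; omega)
    | (have : a = 0 := by omega
       subst this
       simp_all)

lemma del_zero (h : t 1 = ⊥) : del 0 t = hi 1 t := by
  funext a; simp only [del, hi]
  split_ifs <;> first | rfl | omega | simp_all

lemma lo_del (hij : i ≤ j) : lo i (del j t) = lo i t := by
  funext a; simp only [del, lo]; split_ifs <;> first | rfl | omega

lemma hi_del_add : hi i (del (j + i) t) = del j (hi i t) := by
  funext a; simp only [del, hi]; split_ifs <;> first | rfl | omega | (congr 1; omega) |
    (congr 2; omega)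

lemma Supp.del_last (h : Supp (p + 1) t) (ht : t (p + 1) = ⊥) : IntervalSeq.del (p + 1) t = IntervalSeq.lo (p + 1) t := by
  funext a; simp only [IntervalSeq.del, IntervalSeq.lo]
  split_ifs <;> first
    | rfl | omega | (simp_all; done) | exact h.2 _ (by omega)

lemma rem_del_of_lt (hij : i ≤ j) : rem i (del (j + 1) t) = del j (rem i t) := by
  funext a; simp only [del, rem]; split_ifs <;> first | rfl | omega

lemma rem_del_of_gt (hij : i < j) : rem j (del i t) = del i (rem (j + 1) t) := by
  funext a; simp only [del, rem]; split_ifs <;> first | rfl | omega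

end IntervalSeq

namespace IntervalSeq

variable {T : Type*} [SemilatticeInf T] [BoundedOrder T] {n i : ℕ} {t : ℕ → T}

lemma del_self_of_top (h : t i = ⊤) : del i t = rem i t := by
  funext a; simp only [del, rem]; split_ifs <;> first | rfl | omega | (subst_vars; simp [h])

lemma del_of_succ_top (h : t (i + 1) = ⊤) : del i t = rem (i + 1) t := by
  funext a; simp only [del, rem]; split_ifs <;> first | rfl | omega | (subst_vars; simp [h])

end IntervalSeq

end

section

/-! ## Maurer–Cartan families -/

open IntervalSeq

/-- Precomposition of a sequence of simplices of the interval. -/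
def seqComp {m m' : SimplexCategory} (θ : m' ⟶ m) (t : ℕ → StdInterval m) : ℕ → StdInterval m' :=
  fun i => (t i).comp θ.toOrderHom

section seqComp

variable {m m' : SimplexCategory} (θ : m' ⟶ m) (t : ℕ → StdInterval m) (n i : ℕ)

lemma seqComp_apply_bot (h : t i = ⊥) : seqComp θ t i = ⊥ := by
  simp only [seqComp, h]; rfl

lemma seqComp_apply_top (h : t i = ⊤) : seqComp θ t i = ⊤ := by
  simp only [seqComp, h]; rfl

lemma seqComp_lo : lo i (seqComp θ t) = seqComp θ (lo i t) := by
  funext j; simp only [lo, seqComp]; split_ifs <;> rfl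

lemma seqComp_hi : hi i (seqComp θ t) = seqComp θ (hi i t) := rfl

lemma seqComp_rem : rem i (seqComp θ t) = seqComp θ (rem i t) := by
  funext j; simp only [rem, seqComp]; split_ifs <;> rfl

lemma seqComp_del : del i (seqComp θ t) = seqComp θ (del i t) := by
  funext j; simp only [del, seqComp]; split_ifs <;> rfl

end seqComp

/-- The type of families of values `ω_n(t, f)`. -/
abbrev MCFamily (E : SimplicialObject QuasiComonoid.{w}) (k : SimplexCategory) : Type w :=
  ∀ (n : ℕ) (m : SimplexCategory), (ℕ → StdInterval m) → (m ⟶ k) → (E.obj (op m)).X (n + 1)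

/-- The Maurer–Cartan equations in degrees `< N`, over the simplices of `Δ^k` in `D`. -/
structure IsMCFamily {E : SimplicialObject QuasiComonoid.{w}} {k : SimplexCategory}
    (D : ∀ ⦃m : SimplexCategory⦄, (m ⟶ k) → Prop) (N : ℕ) (ω : MCFamily E k) : Prop where
  natural : ∀ (n : ℕ) (_ : n < N) {m m' : SimplexCategory} (θ : m' ⟶ m) (t : ℕ → StdInterval m)
    (f : m ⟶ k), D f → Supp n t →
    QuasiComonoid.Hom.app (E.map θ.op) (n + 1) (ω n m t f) = ω n m' (seqComp θ t) (θ ≫ f)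
  mul : ∀ (p q n : ℕ) (h : p + q + 1 = n) (_ : n < N) {m : SimplexCategory}
    (t : ℕ → StdInterval m) (f : m ⟶ k), D f → Supp n t → t (p + 1) = ⊥ →
    (E.obj (op m)).mul (by omega) (ω p m (lo (p + 1) t) f) (ω q m (hi (p + 1) t) f) = ω n m t f
  d : ∀ (n i : ℕ) (hi : i ≤ n) (_ : n + 1 < N) {m : SimplexCategory} (t : ℕ → StdInterval m)
    (f : m ⟶ k), D f → Supp (n + 1) t → t (i + 1) = ⊤ →
    (E.obj (op m)).d (i + 1) (by omega) (by omega) (ω n m (rem (i + 1) t) f) = ω (n + 1) m t f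
  s : ∀ (n i : ℕ) (hi : i ≤ n + 1) (_ : n + 1 < N) {m : SimplexCategory} (t : ℕ → StdInterval m)
    (f : m ⟶ k), D f → Supp (n + 1) t →
    (E.obj (op m)).s i hi (ω (n + 1) m t f) = ω n m (del i t) f
  s_zero : ∀ (_ : 0 < N) {m : SimplexCategory} (t : ℕ → StdInterval m) (f : m ⟶ k), D f → Supp 0 t →
    (E.obj (op m)).s 0 (by omega) (ω 0 m t f) = (E.obj (op m)).one

namespace MaurerCartan

variable {E F : SimplicialObject QuasiComonoid.{w}} {k : SimplexCategory}

/-- The family given by a simplex of the Maurer–Cartan space. -/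
def toFamily (x : MaurerCartan E k) : MCFamily E k :=
  fun n m t f => x.ω n m (fun i => t (i + 1)) f

lemma isMCFamily_toFamily (x : MaurerCartan E k) (N : ℕ) :
    IsMCFamily (fun _ _ => True) N x.toFamily where
  natural n _ m m' θ t f _ _ := x.natural n θ _ f
  mul p q n h _ m t f _ ht htp := by
    obtain rfl : n = p + (q + 1) := by omega
    refine (x.mul p q m _ _ f).trans ?_
    simp only [toFamily]
    congr 1
    funext i
    refine Fin.addCases (fun i => ?_) (fun i => ?_) i
    · rw [Fin.append_left]
      simp [lo]
    · rw [Fin.append_right]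
      refine Fin.cases ?_ (fun i => ?_) i
      · simp [htp]
      · simp only [Fin.cons_succ, hi]
        congr 1
        simp
        omega
  d n i hi _ m t f _ ht hti := by
    refine (x.d n m ⟨i, by omega⟩ _ f).trans ?_
    simp only [toFamily]
    congr 1
    funext j
    rcases lt_trichotomy (j : ℕ) i with h | h | h
    · rw [Fin.insertNth_apply_below (by rw [Fin.lt_def]; exact h)]
      simp [rem, h]
    · subst h
      rw [hti]
      exact Fin.insertNth_apply_same (α := fun _ => StdInterval m) j ⊤ _
    · rw [Fin.insertNth_apply_above (by rw [Fin.lt_def]; exact h)]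
      have : ¬ ((j : ℕ) - 1 + 1 < i + 1) := by omega
      simp only [rem, Fin.val_pred, this, if_false, eq_rec_constant]
      congr 1
      omega
  s n i hi _ m t f _ ht := by
    rcases Nat.eq_zero_or_pos i with rfl | hi0
    · refine (x.s_first n m _ f).trans ?_
      simp only [toFamily]
      congr 1
    · rcases Nat.lt_or_ge n i with h | h
      · obtain rfl : i = n + 1 := by omega
        refine (x.s_last n m _ f).trans ?_
        simp only [toFamily]
        congr 1
        funext j
        simp [Fin.init, del]
      · obtain ⟨n, rfl⟩ : ∃ n', n = n' + 1 := ⟨n - 1, by omega⟩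
        obtain ⟨i, rfl⟩ : ∃ i', i = i' + 1 := ⟨i - 1, by omega⟩
        refine (x.s n m ⟨i, by omega⟩ _ f).trans ?_
        simp only [toFamily]
        congr 1
        funext j
        simp only [mergeMin, del, Fin.lt_def, Fin.ext_iff, Fin.val_castSucc, Fin.val_succ]
        split_ifs <;> first | rfl | omega
  s_zero _ m t f _ _ := x.s_zero m _ f

/-- The sequence `(t_1, …, t_n)` as a function on `ℕ`. -/
noncomputable def extend {m : SimplexCategory} {n : ℕ} (t : Fin n → StdInterval m) : ℕ → StdInterval m :=
  fun j => if h : 1 ≤ j ∧ j ≤ n then t ⟨j - 1, by omega⟩ else ⊥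

lemma supp_extend {m : SimplexCategory} {n : ℕ} (t : Fin n → StdInterval m) :
    Supp n (extend t) :=
  ⟨by simp [extend], fun j hj => by simp [extend]; omega⟩

lemma extend_succ {m : SimplexCategory} {n : ℕ} (t : Fin n → StdInterval m) (i : Fin n) :
    extend t (i + 1) = t i := by
  simp [extend]

/-- A simplex of the Maurer–Cartan space from a family satisfying all the equations. -/
noncomputable def ofFamily (ω : MCFamily E k) (h : ∀ N, IsMCFamily (fun _ _ => True) N ω) : MaurerCartan E k where
  ω n m t f := ω n m (extend t) f
  natural n m m' θ t f := by
    refine ((h (n + 1)).natural n (by omega) θ _ f trivial (supp_extend t)).trans ?_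
    congr 1
    funext j
    simp only [seqComp, extend]
    split_ifs <;> rfl
  mul p n m s t f := by
    have h0 : extend (Fin.append s (Fin.cons ⊥ t)) (p + 1) = ⊥ := by
      have := extend_succ (Fin.append s (Fin.cons ⊥ t)) (Fin.natAdd p 0)
      rw [Fin.append_right, Fin.cons_zero] at this
      exact this
    refine Eq.trans ?_ ((h (p + (n + 1) + 1)).mul p n (p + (n + 1)) rfl (by omega) _ f trivial
      (supp_extend _) h0)
    congr 2
    · funext j
      simp only [extend, lo]
      split_ifs <;> first | rfl | omega | skip
      have := Fin.append_left s (Fin.cons ⊥ t) ⟨j - 1, by omega⟩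
      exact this.symm
    · funext j
      simp only [extend, hi]
      rcases Nat.eq_zero_or_pos j with rfl | hj
      · have h0' := h0
        simp only [extend] at h0'
        simp only [Nat.zero_add]
        rw [h0']
        simp
      · split_ifs <;> first | rfl | omega | skip
        have := Fin.append_right s (Fin.cons ⊥ t) ⟨j, by omega⟩
        have e : (⟨j + (p + 1) - 1, by omega⟩ : Fin (p + (n + 1))) = Fin.natAdd p ⟨j, by omega⟩ := by
          ext; simp; omega
        rw [e, this]
        have e' : (⟨j, by omega⟩ : Fin (n + 1)) = Fin.succ ⟨j - 1, by omega⟩ := by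
          ext; simp; omega
        rw [e', Fin.cons_succ]
  d n m i t f := by
    have h0 : extend (i.insertNth ⊤ t) (i + 1) = ⊤ := by
      rw [extend_succ, Fin.insertNth_apply_same]
    refine Eq.trans ?_ ((h (n + 2)).d n i (by omega) (by omega) _ f trivial (supp_extend _) h0)
    congr 2
    funext j
    simp only [rem]
    by_cases hj0 : j = 0
    · subst hj0; simp [extend]
    by_cases hj : j < i + 1
    · rw [if_pos hj]
      have := extend_succ (i.insertNth ⊤ t) ⟨j - 1, by omega⟩
      rw [Fin.insertNth_apply_below (by rw [Fin.lt_def]; simp; omega)] at this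
      simp only [Nat.sub_add_cancel (Nat.pos_of_ne_zero hj0)] at this
      rw [this]
      simp only [extend, eq_rec_constant]
      rw [dif_pos (by omega)]
      rfl
    · rw [if_neg hj]
      by_cases hjn : j ≤ n
      · have := extend_succ (i.insertNth ⊤ t) ⟨j, by omega⟩
        rw [Fin.insertNth_apply_above (by rw [Fin.lt_def]; simp; omega)] at this
        simp only at this
        rw [this]
        simp only [extend, eq_rec_constant]
        rw [dif_pos (by omega)]
        rfl
      · rw [(supp_extend _).2 j (by omega), (supp_extend _).2 (j + 1) (by omega)]
  s n m i t f := by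
    refine ((h (n + 3)).s (n + 1) (i + 1) (by omega) (by omega) _ f trivial (supp_extend _)).trans ?_
    congr 1
    funext j
    by_cases hj0 : j = 0
    · subst hj0; simp [extend, del]
    by_cases hjn : j ≤ n + 1
    · have e := extend_succ (mergeMin i t) ⟨j - 1, by omega⟩
      simp only [Nat.sub_add_cancel (Nat.pos_of_ne_zero hj0)] at e
      have e1 := extend_succ t ⟨j - 1, by omega⟩
      simp only [Nat.sub_add_cancel (Nat.pos_of_ne_zero hj0)] at e1
      have e2 := extend_succ t ⟨j, by omega⟩
      simp only at e2
      simp only [mergeMin] at e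
      rw [e]
      have hj' : (⟨j - 1, by omega⟩ : Fin (n + 1)).castSucc = (⟨j - 1, by omega⟩ : Fin (n + 2)) := rfl
      have hj'' : (⟨j - 1, by omega⟩ : Fin (n + 1)).succ = (⟨j, by omega⟩ : Fin (n + 2)) := by
        ext; simp; omega
      rw [hj', hj'', ← e1, ← e2]
      simp only [del, Fin.lt_def, Fin.ext_iff]
      split_ifs <;> first | rfl | omega | skip
      rw [← extend_succ t i.castSucc, ← extend_succ t i.succ]
      rfl
    · rw [(supp_extend (mergeMin i t)).2 j (by omega)]
      exact ((supp_extend t).del (by omega)).2 j (by omega)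
  s_first n m t f := by
    refine ((h (n + 2)).s n 0 (by omega) (by omega) _ f trivial (supp_extend _)).trans ?_
    congr 1
    funext j
    by_cases hj0 : j = 0
    · subst hj0
      rw [(supp_extend (Fin.tail t)).1]
      exact ((supp_extend t).del (by omega)).1
    by_cases hjn : j ≤ n
    · simp only [extend, del, Fin.tail]
      rw [if_neg (by omega), if_neg hj0, dif_pos (by omega), dif_pos (by omega)]
      congr 1
      ext; simp; omega
    · rw [(supp_extend (Fin.tail t)).2 j (by omega)]
      exact ((supp_extend t).del (by omega)).2 j (by omega)
  s_last n m t f := by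
    refine ((h (n + 2)).s n (n + 1) (by omega) (by omega) _ f trivial (supp_extend _)).trans ?_
    congr 1
    funext j
    by_cases hj0 : j = 0
    · subst hj0; simp [extend, del]
    by_cases hjn : j ≤ n
    · simp only [extend, del, Fin.init]
      rw [if_pos (by omega), dif_pos (by omega), dif_pos (by omega)]
      rfl
    · rw [(supp_extend (Fin.init t)).2 j (by omega)]
      exact ((supp_extend t).del (by omega)).2 j (by omega)
  s_zero m t f := (h 1).s_zero (by omega) _ f trivial (supp_extend t)

lemma extend_toFamily (x : MaurerCartan E k) (n : ℕ) (m : SimplexCategory)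
    (t : Fin n → StdInterval m) (f : m ⟶ k) : x.toFamily n m (extend t) f = x.ω n m t f := by
  simp only [toFamily, extend_succ]

end MaurerCartan

end

section

open IntervalSeq

lemma StdInterval.bot_ne_top {m : SimplexCategory} : (⊥ : StdInterval m) ≠ ⊤ := fun h =>
  absurd (DFunLike.congr_fun h 0) (by simp)

namespace QuasiComonoid

/-- The compatibility satisfied by the family of the `σ^i x`. -/
def Matching (E : QuasiComonoid.{w}) (N : ℕ) (r : ℕ → E.X N) : Prop :=
  match N with
  | 0 => True
  | n + 1 => ∀ (i j : ℕ) (hij : i ≤ j) (hj : j ≤ n), E.s j hj (r i) = E.s i (by omega) (r (j + 1))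

end QuasiComonoid

/-! ## Extension of Maurer–Cartan families by one degree -/

namespace IsMCFamily

variable {E F : SimplicialObject QuasiComonoid.{w}} {k : SimplexCategory}

lemma congr {D : ∀ ⦃m : SimplexCategory⦄, (m ⟶ k) → Prop} {N : ℕ} {ω ω' : MCFamily E k}
    (h : IsMCFamily D N ω) (hω : ∀ n < N, ω n = ω' n) : IsMCFamily D N ω' where
  natural n hn _ _ θ t f hf ht := by
    rw [← hω n hn]; exact h.natural n hn θ t f hf ht
  mul p q n hpq hn _ t f hf ht htp := by
    rw [← hω n hn, ← hω p (by omega), ← hω q (by omega)]; exact h.mul p q n hpq hn t f hf ht htp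
  d n i hi hn _ t f hf ht hti := by
    rw [← hω _ hn, ← hω n (by omega)]; exact h.d n i hi hn t f hf ht hti
  s n i hi hn _ t f hf ht := by
    rw [← hω _ hn, ← hω n (by omega)]; exact h.s n i hi hn t f hf ht
  s_zero hN _ t f hf ht := by
    rw [← hω _ hN]; exact h.s_zero hN t f hf ht

/-- The values of `ω_N` which are prescribed by those of `ω_n` for `n < N` and by the family `ωL`
over `D`. -/
inductive Prescribed (D : ∀ ⦃m : SimplexCategory⦄, (m ⟶ k) → Prop) (ωL ω : MCFamily E k)
    {m : SimplexCategory} (f : m ⟶ k) :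
    ∀ (N : ℕ) (_ : ℕ → StdInterval m) (_ : (E.obj (op m)).X (N + 1)), Prop where
  /-- the value over `D` -/
  | dom (N : ℕ) (t : ℕ → StdInterval m) (hf : D f) : Prescribed D ωL ω f N t (ωL N m t f)
  /-- the value on `t` with `t_{p+1} = 0` -/
  | bot (p q N : ℕ) (h : p + q + 1 = N) (t : ℕ → StdInterval m) (ht : t (p + 1) = ⊥) :
      Prescribed D ωL ω f N t ((E.obj (op m)).mul (by omega) (ω p m (lo (p + 1) t) f)
        (ω q m (hi (p + 1) t) f))
  /-- the value on `t` with `t_{i+1} = 1` -/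
  | top (n i : ℕ) (hi : i ≤ n) (t : ℕ → StdInterval m) (ht : t (i + 1) = ⊤) :
      Prescribed D ωL ω f (n + 1) t
        ((E.obj (op m)).d (i + 1) (by omega) (by omega) (ω n m (rem (i + 1) t) f))

section

variable {D : ∀ ⦃m : SimplexCategory⦄, (m ⟶ k) → Prop} {N : ℕ} {ωL ω : MCFamily E k}
  (hω : IsMCFamily (fun _ _ => True) N ω) (hL : IsMCFamily D (N + 1) ωL)
  (hωL : ∀ n < N, ∀ m t f, D f → Supp n t → ω n m t f = ωL n m t f)
  {m : SimplexCategory} {f : m ⟶ k} {t : ℕ → StdInterval m}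
include hω hL hωL

lemma prescribed_dom_eq (hf : D f) (ht : Supp N t) {e : (E.obj (op m)).X (N + 1)}
    (h : Prescribed D ωL ω f N t e) : e = ωL N m t f := by
  cases h with
  | dom => rfl
  | bot p q _ h _ h0 =>
    have h1 : Supp p (lo (p + 1) t) := ht.lo (p := p + 1) (by omega)
    have h2 : Supp q (hi (p + 1) t) := by
      have := ht.hi h0
      rwa [show N - (p + 1) = q by omega] at this
    rw [hωL p (by omega) _ _ _ hf h1, hωL q (by omega) _ _ _ hf h2]
    exact hL.mul p q N h (by omega) t f hf ht h0
  | top n i hi _ h0 =>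
    rw [hωL n (by omega) _ _ _ hf (ht.rem (by omega) (by omega))]
    exact hL.d n i hi (by omega) t f hf ht h0

lemma prescribed_bot_bot (ht : Supp N t) {p q p' q' : ℕ} (h : p + q + 1 = N) (h' : p' + q' + 1 = N)
    (h0 : t (p + 1) = ⊥) (h0' : t (p' + 1) = ⊥) (hpp : p < p') :
    (E.obj (op m)).mul (show p + 1 + (q + 1) = N + 1 by omega) (ω p m (lo (p + 1) t) f)
        (ω q m (hi (p + 1) t) f) =
      (E.obj (op m)).mul (by omega) (ω p' m (lo (p' + 1) t) f) (ω q' m (hi (p' + 1) t) f) := by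
  obtain ⟨r, rfl⟩ : ∃ r, p' = r + 1 + p := ⟨p' - p - 1, by omega⟩
  have h1 : Supp (r + 1 + p) (lo (r + 1 + p + 1) t) := ht.lo (p := r + 1 + p + 1) (by omega)
  have h2 : Supp q (hi (p + 1) t) := by
    have := ht.hi h0
    rwa [show N - (p + 1) = q by omega] at this
  have e1 := hω.mul p r (r + 1 + p) (by omega) (by omega) (lo (r + 1 + p + 1) t) f trivial h1
    (by simp only [lo]; rw [if_pos (by omega), h0])
  have e2 := hω.mul r q' q (by omega) (by omega) (hi (p + 1) t) f trivial h2
    (by simp only [hi]; rw [show r + 1 + (p + 1) = r + 1 + p + 1 by omega, h0'])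
  rw [lo_lo (by omega)] at e1
  rw [lo_hi, hi_hi, show r + 1 + (p + 1) = r + 1 + p + 1 by omega] at e2
  rw [← e1, ← e2]
  exact ((E.obj (op m)).mul_assoc _ _ _ _ _ _ _).symm

lemma prescribed_bot_top {n : ℕ} (hN : N = n + 1) (ht : Supp (n + 1) t) {p q i : ℕ}
    (h : p + q + 1 = n + 1) (h0 : t (p + 1) = ⊥) (hi' : i ≤ n) (h0' : t (i + 1) = ⊤) :
    (E.obj (op m)).mul (show p + 1 + (q + 1) = n + 1 + 1 by omega) (ω p m (lo (p + 1) t) f)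
        (ω q m (hi (p + 1) t) f) =
      (E.obj (op m)).d (i + 1) (by omega) (by omega) (ω n m (rem (i + 1) t) f) := by
  have h1 : Supp p (lo (p + 1) t) := ht.lo (p := p + 1) (by omega)
  have h2 : Supp q (hi (p + 1) t) := by
    have := ht.hi h0
    rwa [show n + 1 - (p + 1) = q by omega] at this
  have h3 : Supp n (rem (i + 1) t) := ht.rem (by omega) (by omega)
  rcases lt_trichotomy i p with hlt | rfl | hlt
  · obtain ⟨p, rfl⟩ : ∃ p', p = p' + 1 := ⟨p - 1, by omega⟩
    have e1 := hω.d p i (by omega) (by omega) (lo (p + 1 + 1) t) f trivial h1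
      (by simp only [lo]; rw [if_pos (by omega), h0'])
    have e2 := hω.mul p q n (by omega) (by omega) (rem (i + 1) t) f trivial h3
      (by simp only [rem]; rw [if_neg (by omega), h0])
    rw [rem_lo (by omega)] at e1
    rw [hi_rem (by omega)] at e2
    rw [← e1, ← e2]
    exact (E.obj (op m)).d_mul _ _ _ _ _ _
  · exact absurd (h0.symm.trans h0') StdInterval.bot_ne_top
  · obtain ⟨j, rfl⟩ : ∃ j, i = j + (p + 1) := ⟨i - (p + 1), by omega⟩
    obtain ⟨q, rfl⟩ : ∃ q', q = q' + 1 := ⟨q - 1, by omega⟩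
    have e1 := hω.d q j (by omega) (by omega) (hi (p + 1) t) f trivial h2
      (by simp only [hi]; rw [← h0']; congr 1; omega)
    have e2 := hω.mul p q n (by omega) (by omega) (rem (j + (p + 1) + 1) t) f trivial h3
      (by simp only [rem]; rw [if_pos (by omega), h0])
    rw [lo_rem (by omega), show j + (p + 1) + 1 = (j + 1) + (p + 1) by omega, hi_rem_add] at e2
    rw [← e1]
    simp only [show j + (p + 1) + 1 = (j + 1) + (p + 1) by omega]
    rw [← e2]
    exact (E.obj (op m)).mul_d _ _ _ _ _ _

lemma prescribed_top_top {n : ℕ} (hN : N = n + 1) (ht : Supp (n + 1) t) {i j : ℕ}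
    (hij : i < j) (h0 : t (i + 1) = ⊤) (hj : j ≤ n) (h0' : t (j + 1) = ⊤) :
    (E.obj (op m)).d (i + 1) (by omega) (by omega) (ω n m (rem (i + 1) t) f) =
      (E.obj (op m)).d (j + 1) (by omega) (by omega) (ω n m (rem (j + 1) t) f) := by
  obtain ⟨n, rfl⟩ : ∃ n', n = n' + 1 := ⟨n - 1, by omega⟩
  obtain ⟨j, rfl⟩ : ∃ j', j = j' + 1 := ⟨j - 1, by omega⟩
  have e1 := hω.d n j (by omega) (by omega) (rem (i + 1) t) f trivial
    (ht.rem (by omega) (by omega)) (by simp only [rem]; rw [if_neg (by omega), h0'])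
  have e2 := hω.d n i (by omega) (by omega) (rem (j + 1 + 1) t) f trivial
    (ht.rem (by omega) (by omega)) (by simp only [rem]; rw [if_pos (by omega), h0])
  rw [rem_rem (by omega)] at e2
  rw [← e1, ← e2]
  exact ((E.obj (op m)).d_d (i + 1) (j + 1 + 1) (by omega) (by omega) (by omega) _).symm

lemma prescribed_unique (ht : Supp N t) {e e' : (E.obj (op m)).X (N + 1)}
    (h : Prescribed D ωL ω f N t e) (h' : Prescribed D ωL ω f N t e') : e = e' := by
  by_cases hf : D f
  · rw [prescribed_dom_eq hω hL hωL hf ht h, prescribed_dom_eq hω hL hωL hf ht h']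
  cases h with
  | dom _ _ hf' => exact absurd hf' hf
  | bot p q _ h _ h0 =>
    cases h' with
    | dom _ _ hf' => exact absurd hf' hf
    | bot p' q' _ h' _ h0' =>
      rcases lt_trichotomy p p' with hlt | rfl | hlt
      · exact prescribed_bot_bot hω hL hωL ht h h' h0 h0' hlt
      · obtain rfl : q = q' := by omega
        rfl
      · exact (prescribed_bot_bot hω hL hωL ht h' h h0' h0 hlt).symm
    | top n i hi _ h0' => exact prescribed_bot_top hω hL hωL rfl ht h h0 hi h0'
  | top n i hi _ h0 =>
    cases h' with
    | dom _ _ hf' => exact absurd hf' hf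
    | bot p' q' _ h' _ h0' => exact (prescribed_bot_top hω hL hωL rfl ht h' h0' hi h0).symm
    | top _ j hj _ h0' =>
      rcases lt_trichotomy i j with hlt | rfl | hlt
      · exact prescribed_top_top hω hL hωL rfl ht hlt h0 hj h0'
      · rfl
      · exact (prescribed_top_top hω hL hωL rfl ht hlt h0' hi h0).symm

lemma prescribed_natural (hD : ∀ ⦃m m' : SimplexCategory⦄ (θ : m' ⟶ m) (f : m ⟶ k), D f → D (θ ≫ f))
    (ht : Supp N t) {m' : SimplexCategory} (θ : m' ⟶ m) {e : (E.obj (op m)).X (N + 1)}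
    (h : Prescribed D ωL ω f N t e) :
    Prescribed D ωL ω (θ ≫ f) N (seqComp θ t) (QuasiComonoid.Hom.app (E.map θ.op) (N + 1) e) := by
  cases h with
  | dom _ _ hf =>
    rw [hL.natural N (by omega) θ t f hf ht]
    exact .dom _ _ (hD _ _ hf)
  | bot p q _ h _ h0 =>
    have h1 : Supp p (lo (p + 1) t) := ht.lo (p := p + 1) (by omega)
    have h2 : Supp q (hi (p + 1) t) := by
      have := ht.hi h0
      rwa [show N - (p + 1) = q by omega] at this
    rw [QuasiComonoid.Hom.map_mul, hω.natural p (by omega) θ _ f trivial h1,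
      hω.natural q (by omega) θ _ f trivial h2, ← seqComp_lo, ← seqComp_hi]
    exact .bot p q _ h _ (seqComp_apply_bot θ t _ h0)
  | top n i hi _ h0 =>
    rw [QuasiComonoid.Hom.map_d, hω.natural n (by omega) θ _ f trivial
      (ht.rem (by omega) (by omega)), ← seqComp_rem]
    exact .top n i hi _ (seqComp_apply_top θ t _ h0)

lemma prescribed_app {p : E ⟶ F} {ωF : MCFamily F k} (hF : IsMCFamily (fun _ _ => True) (N + 1) ωF)
    (hωF : ∀ n < N, ∀ m t f, Supp n t →
      QuasiComonoid.Hom.app (p.app (op m)) (n + 1) (ω n m t f) = ωF n m t f)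
    (hLF : ∀ n m t f, D f → Supp n t →
      QuasiComonoid.Hom.app (p.app (op m)) (n + 1) (ωL n m t f) = ωF n m t f)
    (ht : Supp N t) {e : (E.obj (op m)).X (N + 1)} (h : Prescribed D ωL ω f N t e) :
    QuasiComonoid.Hom.app (p.app (op m)) (N + 1) e = ωF N m t f := by
  cases h with
  | dom _ _ hf => exact hLF _ _ _ _ hf ht
  | bot p q _ h _ h0 =>
    have h1 : Supp p (lo (p + 1) t) := ht.lo (p := p + 1) (by omega)
    have h2 : Supp q (hi (p + 1) t) := by
      have := ht.hi h0
      rwa [show N - (p + 1) = q by omega] at this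
    rw [QuasiComonoid.Hom.map_mul, hωF p (by omega) _ _ _ h1, hωF q (by omega) _ _ _ h2]
    exact hF.mul p q N h (by omega) t f trivial ht h0
  | top n i hi _ h0 =>
    rw [QuasiComonoid.Hom.map_d, hωF n (by omega) _ _ _ (ht.rem (by omega) (by omega))]
    exact hF.d n i hi (by omega) t f trivial ht h0

lemma prescribed_s {n : ℕ} (hN : N = n + 1) (ht : Supp (n + 1) t) {e : (E.obj (op m)).X (n + 1 + 1)}
    (h : Prescribed D ωL ω f (n + 1) t e) (a : ℕ) (ha : a ≤ n + 1) :
    (E.obj (op m)).s a ha e = ω n m (del a t) f := by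
  subst hN
  have hdel : Supp n (del a t) := ht.del ha
  cases h with
  | dom _ _ hf =>
    rw [hL.s n a ha (by omega) t f hf ht, hωL n (by omega) _ _ _ hf hdel]
  | bot p q _ h _ h0 =>
    have h1 : Supp p (lo (p + 1) t) := ht.lo (p := p + 1) (by omega)
    have h2 : Supp q (hi (p + 1) t) := by
      have := ht.hi h0
      rwa [show n + 1 - (p + 1) = q by omega] at this
    rcases Nat.lt_or_ge p a with hpa | hpa
    · obtain ⟨b, rfl⟩ : ∃ b, a = b + (p + 1) := ⟨a - (p + 1), by omega⟩
      rcases q with _ | q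
      · obtain rfl : p = n := by omega
        obtain rfl : b = 0 := by omega
        have e0 := (E.obj (op m)).mul_s (show p + 1 + 0 = p + 1 by omega) 0 (by omega)
          (ω p m (lo (p + 1) t) f) (ω 0 m (hi (p + 1) t) f)
        refine e0.symm.trans ?_
        rw [hω.s_zero (by omega) _ _ trivial h2]
        refine ((E.obj (op m)).mul_one _).trans ?_
        simp only [Nat.zero_add] at *
        rw [ht.del_last h0]
      · have e0 := (E.obj (op m)).mul_s (show p + 1 + (q + 1) = n + 1 by omega) b (by omega)
          (ω p m (lo (p + 1) t) f) (ω (q + 1) m (hi (p + 1) t) f)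
        refine e0.symm.trans ?_
        rw [hω.s q b (by omega) (by omega) _ _ trivial h2]
        rw [← hω.mul p q n (by omega) (by omega) (del (b + (p + 1)) t) f trivial hdel
          (by
            simp only [del]
            split_ifs
            · exact h0
            · rw [show b + (p + 1) = p + 1 by omega, h0]; exact bot_inf_eq _
            · omega), lo_del (by omega), hi_del_add]
    · rcases p with _ | p
      · obtain rfl : q = n := by omega
        obtain rfl : a = 0 := by omega
        have e0 := (E.obj (op m)).s_mul (show 0 + (q + 1) = q + 1 by omega) 0 (by omega)
          (ω 0 m (lo (0 + 1) t) f) (ω q m (hi (0 + 1) t) f)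
        refine e0.symm.trans ?_
        rw [hω.s_zero (by omega) _ _ trivial h1]
        refine ((E.obj (op m)).one_mul _).trans ?_
        rw [del_zero h0]
      · have e0 := (E.obj (op m)).s_mul (show p + 1 + (q + 1) = n + 1 by omega) a (by omega)
          (ω (p + 1) m (lo (p + 1 + 1) t) f) (ω q m (hi (p + 1 + 1) t) f)
        refine e0.symm.trans ?_
        rw [hω.s p a (by omega) (by omega) _ _ trivial h1]
        rw [← hω.mul p q n (by omega) (by omega) (del a t) f trivial hdel
          (by
            simp only [del]
            split_ifs with h3 h4
            · omega
            · rw [← h4, h0]; exact inf_bot_eq _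
            · exact h0), del_lo (by omega), hi_del (by omega) h0]
  | top _ i hi _ h0 =>
    have h3 : Supp n (rem (i + 1) t) := ht.rem (by omega) (by omega)
    rcases lt_trichotomy (i + 1) a with hlt | rfl | hlt
    · obtain ⟨n, rfl⟩ : ∃ n', n = n' + 1 := ⟨n - 1, by omega⟩
      obtain ⟨a, rfl⟩ : ∃ a', a = a' + 1 := ⟨a - 1, by omega⟩
      rw [(E.obj (op m)).s_d_lt (i + 1) (a + 1) hlt (by omega) (by omega)]
      simp only [Nat.add_sub_cancel]
      rw [hω.s n a (by omega) (by omega) _ _ trivial h3,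
        ← hω.d n i (by omega) (by omega) (del (a + 1) t) f trivial hdel
          (by simp only [del]; rw [if_pos hlt, h0]), rem_del_of_lt (by omega)]
    · rw [(E.obj (op m)).s_d_self, del_self_of_top h0]
    · rcases Nat.lt_or_ge a i with hlt' | hge
      · obtain ⟨n, rfl⟩ : ∃ n', n = n' + 1 := ⟨n - 1, by omega⟩
        obtain ⟨i, rfl⟩ : ∃ i', i = i' + 1 := ⟨i - 1, by omega⟩
        rw [(E.obj (op m)).s_d_gt (i + 1 + 1) a (by omega) (by omega)]
        simp only [Nat.add_sub_cancel]
        rw [hω.s n a (by omega) (by omega) _ _ trivial h3,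
          ← hω.d n i (by omega) (by omega) (del a t) f trivial hdel
            (by simp only [del]; rw [if_neg (by omega), if_neg (by omega), h0]),
          rem_del_of_gt (by omega)]
      · obtain rfl : a = i := by omega
        rw [(E.obj (op m)).s_d_succ a (by omega), del_of_succ_top h0]

end

end IsMCFamily

end

section

open IntervalSeq

/-! ## The simplicial sets `I^n × Δ^k` -/

namespace IntervalCube

open MonoidalCategory

/-- The simplicial set `I^n × Δ^k`. -/
noncomputable def cube (k : SimplexCategory) : ℕ → SSet.{w} := fun n => match n with
  | 0 => SSet.stdSimplex.obj k
  | n + 1 => Δ[1] ⊗ cube k n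

variable {k : SimplexCategory}

/-- The sequence `(t_1, …, t_n)` of coordinates of a simplex of `I^n × Δ^k`. -/
noncomputable def coords : ∀ (n : ℕ) {m : SimplexCategoryᵒᵖ}, (cube.{w} k n).obj m →
    ℕ → StdInterval m.unop := fun n => match n with
  | 0 => fun _ _ => ⊥
  | n + 1 => fun z j => if j = n + 1 then (SSet.stdSimplex.objEquiv z.1).toOrderHom
      else coords n z.2 j

/-- The component in `Δ^k` of a simplex of `I^n × Δ^k`. -/
noncomputable def base : ∀ (n : ℕ) {m : SimplexCategoryᵒᵖ}, (cube.{w} k n).obj m → (m.unop ⟶ k) :=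
  fun n => match n with
  | 0 => fun z => SSet.stdSimplex.objEquiv z
  | n + 1 => fun z => base n z.2

/-- The simplex of `I^n × Δ^k` with given coordinates. -/
noncomputable def pack : ∀ (n : ℕ) {m : SimplexCategory}, (ℕ → StdInterval m) → (m ⟶ k) →
    (cube.{w} k n).obj (op m) := fun n => match n with
  | 0 => fun _ f => SSet.stdSimplex.objEquiv.symm f
  | n + 1 => fun t f => ⟨SSet.stdSimplex.objEquiv.symm (SimplexCategory.Hom.mk (t (n + 1))),
      pack n t f⟩

lemma coords_map (n : ℕ) {m m' : SimplexCategoryᵒᵖ} (θ : m ⟶ m') (z : (cube.{w} k n).obj m) :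
    coords n ((cube.{w} k n).map θ z) = seqComp θ.unop (coords n z) := by
  induction n with
  | zero => rfl
  | succ n ih =>
    funext j
    have := congrFun (ih z.2) j
    simp only [seqComp, coords] at this ⊢
    split_ifs
    · rfl
    · exact this

lemma base_map (n : ℕ) {m m' : SimplexCategoryᵒᵖ} (θ : m ⟶ m') (z : (cube.{w} k n).obj m) :
    base n ((cube.{w} k n).map θ z) = θ.unop ≫ base n z := by
  induction n with
  | zero => rfl
  | succ n ih => exact ih z.2

lemma supp_coords (n : ℕ) {m : SimplexCategoryᵒᵖ} (z : (cube.{w} k n).obj m) :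
    Supp n (coords n z) := by
  induction n with
  | zero => exact ⟨rfl, fun _ _ => rfl⟩
  | succ n ih =>
    refine ⟨?_, fun j hj => ?_⟩
    · simp only [coords]
      rw [if_neg (by omega)]
      exact (ih z.2).1
    · simp only [coords]
      rw [if_neg (by omega)]
      exact (ih z.2).2 j (by omega)

lemma map_pack (n : ℕ) {m m' : SimplexCategory} (θ : m' ⟶ m) (t : ℕ → StdInterval m)
    (f : m ⟶ k) : (cube.{w} k n).map θ.op (pack n t f) = pack n (seqComp θ t) (θ ≫ f) := by
  induction n with
  | zero => rfl
  | succ n ih => exact Prod.ext rfl ih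

lemma base_pack (n : ℕ) {m : SimplexCategory} (t : ℕ → StdInterval m) (f : m ⟶ k) :
    base n (pack.{w} n t f) = f := by
  induction n with
  | zero => simp [base, pack]
  | succ n ih => exact ih

lemma coords_pack_apply (n : ℕ) {m : SimplexCategory} (t : ℕ → StdInterval m) (f : m ⟶ k) (j : ℕ)
    (h1 : 1 ≤ j) (h2 : j ≤ n) : coords n (pack.{w} n t f) j = t j := by
  induction n with
  | zero => omega
  | succ n ih =>
    simp only [coords, pack]
    split_ifs with h
    · subst h; simp
    · exact ih (by omega)

lemma coords_pack (n : ℕ) {m : SimplexCategory} {t : ℕ → StdInterval m} (ht : Supp n t)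
    (f : m ⟶ k) : coords n (pack.{w} n t f) = t := by
  funext j
  rcases Nat.eq_zero_or_pos j with rfl | h1
  · rw [ht.1, (supp_coords n _).1]
  · rcases Nat.lt_or_ge n j with h2 | h2
    · rw [ht.2 j h2, (supp_coords n _).2 j h2]
    · exact coords_pack_apply n t f j h1 h2

variable (L : (SSet.stdSimplex.{w}.obj k).Subcomplex)

/-- The union of `I^n × L` and of the boundary `∂(I^n) × Δ^k`. -/
noncomputable def cubeBoundary : ∀ (n : ℕ), (cube.{w} k n).Subcomplex := fun n => match n with
  | 0 => L
  | n + 1 => SSet.Subcomplex.unionProd (SSet.boundary 1) (cubeBoundary n)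

lemma mem_boundary_one_iff {m : SimplexCategory} (s : (Δ[1] : SSet.{w}).obj (op m)) :
    s ∈ (SSet.boundary.{w} 1).obj (op m) ↔
      ((SSet.stdSimplex.objEquiv s).toOrderHom : StdInterval m) = ⊥ ∨
        ((SSet.stdSimplex.objEquiv s).toOrderHom : StdInterval m) = ⊤ := by
  obtain ⟨m⟩ := m
  refine (SSet.mem_boundary_iff_notMem_range (n := 1) (d := m) s).trans ?_
  constructor
  · rintro ⟨j, hj⟩
    have hj' : ∀ i, (SSet.stdSimplex.objEquiv s).toOrderHom i ≠ j := fun i h => hj ⟨i, h⟩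
    fin_cases j
    · right
      ext i
      have := hj' i
      change ((SSet.stdSimplex.objEquiv s).toOrderHom i : ℕ) = ((⊤ : Fin 2) : ℕ)
      have h1 : ((SSet.stdSimplex.objEquiv s).toOrderHom i : ℕ) ≠ 0 := fun h => this (Fin.ext h)
      have h2 := ((SSet.stdSimplex.objEquiv s).toOrderHom i).2
      change _ = 1
      change _ < 2 at h2
      omega
    · left
      ext i
      have := hj' i
      have h1 : ((SSet.stdSimplex.objEquiv s).toOrderHom i : ℕ) ≠ 1 := fun h => this (Fin.ext h)
      have h2 := ((SSet.stdSimplex.objEquiv s).toOrderHom i).2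
      change _ = 0
      change _ < 2 at h2
      omega
  · rintro (h | h)
    · refine ⟨1, ?_⟩
      rintro ⟨i, hi⟩
      have := DFunLike.congr_fun h i
      have h2 : (⊥ : Fin 2) = 1 := this.symm.trans hi
      exact absurd h2 (by decide)
    · refine ⟨0, ?_⟩
      rintro ⟨i, hi⟩
      have := DFunLike.congr_fun h i
      have h2 : (⊤ : Fin 2) = 0 := this.symm.trans hi
      exact absurd h2 (by decide)

lemma mem_cubeBoundary_iff (n : ℕ) {m : SimplexCategory} (z : (cube.{w} k n).obj (op m)) :
    z ∈ (cubeBoundary L n).obj (op m) ↔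
      SSet.stdSimplex.objEquiv.symm (base n z) ∈ L.obj (op m) ∨
        ∃ i < n, coords n z (i + 1) = ⊥ ∨ coords n z (i + 1) = ⊤ := by
  induction n with
  | zero =>
    simp only [cubeBoundary, base, Nat.not_lt_zero, false_and, exists_false, or_false]
    exact iff_of_eq (congrArg (· ∈ L.obj (op m)) (SSet.stdSimplex.objEquiv.symm_apply_apply z).symm)
  | succ n ih =>
    refine (SSet.Subcomplex.mem_unionProd_iff (SSet.boundary 1) (cubeBoundary L n) z).trans ?_
    have e1 := ih z.2
    have e2 := mem_boundary_one_iff z.1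
    rw [e1, e2, or_assoc]
    refine or_congr Iff.rfl ?_
    have h1 : ∀ i < n, coords (n + 1) z (i + 1) = coords n z.2 (i + 1) := fun i hi => by
      simp only [coords]
      rw [if_neg (by omega)]
    have h2 : coords (n + 1) z (n + 1) = (SSet.stdSimplex.objEquiv z.1).toOrderHom := by
      simp only [coords, if_true]
    constructor
    · rintro (⟨i, hi, h⟩ | h)
      · exact ⟨i, by omega, by rwa [h1 i hi]⟩
      · exact ⟨n, by omega, by rwa [h2]⟩
    · rintro ⟨i, hi, h⟩
      rcases Nat.lt_succ_iff_lt_or_eq.1 hi with hi | rfl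
      · exact .inl ⟨i, hi, by rwa [← h1 i hi]⟩
      · exact .inr (by rwa [← h2])

lemma cubeBoundary_ι {W : MorphismProperty SSet.{w}}
    (hW : ∀ {X Y : SSet.{w}} (A : X.Subcomplex) (B : Y.Subcomplex), W B.ι → W (A.unionProd B).ι)
    (hL : W L.ι) (n : ℕ) : W (cubeBoundary L n).ι := by
  induction n with
  | zero => exact hL
  | succ n ih => exact hW _ _ ih

end IntervalCube

end

section

open IntervalSeq IntervalCube

/-! ## Lifting properties of maps of Maurer–Cartan spaces -/

section

variable {E F : SimplicialObject QuasiComonoid.{w}} {k : SimplexCategory}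

/-- The elements of `E^{N+1}` lying over values of the Maurer–Cartan element `x` can be naturally
corrected so as to have prescribed images under the `σ^i`. -/
def MaurerCartan.HasCorrector (p : E ⟶ F) (x : MaurerCartan F k) (N : ℕ) : Prop :=
  ∃ corr : ∀ m : SimplexCategory, (E.obj (op m)).X (N + 1) → (ℕ → (E.obj (op m)).X N) →
      (E.obj (op m)).X (N + 1),
    ∀ (m : SimplexCategory) (e : (E.obj (op m)).X (N + 1)) (r : ℕ → (E.obj (op m)).X N),
      (∃ t f, Supp N t ∧ QuasiComonoid.Hom.app (p.app (op m)) (N + 1) e = x.toFamily N m t f) →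
      (∀ i (hi : i ≤ N), QuasiComonoid.Hom.app (p.app (op m)) N (r i) =
        (F.obj (op m)).s i hi (QuasiComonoid.Hom.app (p.app (op m)) (N + 1) e)) →
      (E.obj (op m)).Matching N r →
      QuasiComonoid.Hom.app (p.app (op m)) (N + 1) (corr m e r) =
        QuasiComonoid.Hom.app (p.app (op m)) (N + 1) e ∧
      (∀ i (hi : i ≤ N), (E.obj (op m)).s i hi (corr m e r) = r i) ∧
      ((∀ i (hi : i ≤ N), (E.obj (op m)).s i hi e = r i) → corr m e r = e) ∧
      ∀ (m' : SimplexCategory) (θ : m' ⟶ m),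
        QuasiComonoid.Hom.app (E.map θ.op) (N + 1) (corr m e r) =
          corr m' (QuasiComonoid.Hom.app (E.map θ.op) (N + 1) e)
            (fun i => QuasiComonoid.Hom.app (E.map θ.op) N (r i))

namespace IsMCFamily

/-- The value of `σ^i ω_N(t)` prescribed by the Maurer–Cartan equations. -/
def codeg (ω : MCFamily E k) (N : ℕ) {m : SimplexCategory} (t : ℕ → StdInterval m) (f : m ⟶ k) :
    ℕ → (E.obj (op m)).X N :=
  match N with
  | 0 => fun _ => (E.obj (op m)).one
  | n + 1 => fun i => ω n m (del (min i (n + 1)) t) f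

section

variable {N : ℕ} {ω : MCFamily E k} (hω : IsMCFamily (fun _ _ => True) N ω) {m : SimplexCategory}
  {t : ℕ → StdInterval m} (f : m ⟶ k)
include hω

lemma codeg_natural (ht : Supp N t) {m' : SimplexCategory} (θ : m' ⟶ m) (i : ℕ) :
    QuasiComonoid.Hom.app (E.map θ.op) N (codeg ω N t f i) =
      codeg ω N (seqComp θ t) (θ ≫ f) i := by
  cases N with
  | zero => exact QuasiComonoid.Hom.map_one _
  | succ n =>
    simp only [codeg]
    rw [hω.natural n (by omega) θ _ f trivial (ht.del (by omega)), seqComp_del]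

lemma matching_codeg (ht : Supp N t) : (E.obj (op m)).Matching N (codeg ω N t f) := by
  cases N with
  | zero => trivial
  | succ n =>
    intro i j hij hj
    cases n with
    | zero =>
      obtain rfl : j = 0 := by omega
      obtain rfl : i = 0 := by omega
      exact (hω.s_zero (by omega) _ f trivial (ht.del (by omega))).trans
        (hω.s_zero (by omega) _ f trivial (ht.del (by omega))).symm
    | succ n =>
      refine (hω.s n j hj (by omega) _ f trivial (ht.del (by omega))).trans
        (Eq.trans ?_ (hω.s n i (by omega) (by omega) _ f trivial (ht.del (by omega))).symm)
      rw [min_eq_left (by omega), min_eq_left (by omega), del_del hij]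

lemma app_codeg {p : E ⟶ F} {ωF : MCFamily F k} (hF : IsMCFamily (fun _ _ => True) (N + 1) ωF)
    (hωF : ∀ n < N, ∀ m t f, Supp n t →
      QuasiComonoid.Hom.app (p.app (op m)) (n + 1) (ω n m t f) = ωF n m t f)
    (ht : Supp N t) (i : ℕ) (hi : i ≤ N) :
    QuasiComonoid.Hom.app (p.app (op m)) N (codeg ω N t f i) =
      (F.obj (op m)).s i hi (ωF N m t f) := by
  cases N with
  | zero =>
    obtain rfl : i = 0 := by omega
    exact (QuasiComonoid.Hom.map_one _).trans (hF.s_zero (by omega) _ f trivial ht).symm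
  | succ n =>
    simp only [codeg]
    rw [hωF n (by omega) _ _ _ (ht.del (by omega)), hF.s n i hi (by omega) _ f trivial ht,
      min_eq_left hi]

end

/-- A solution of the equations in degrees `< N`, lying over `ωF` and agreeing with `ωL` over
`D`. -/
def IsPartialLift (p : E ⟶ F) (D : ∀ ⦃m : SimplexCategory⦄, (m ⟶ k) → Prop) (ωL : MCFamily E k)
    (ωF : MCFamily F k) (N : ℕ) (ω : MCFamily E k) : Prop :=
  IsMCFamily (fun _ _ => True) N ω ∧
  (∀ n < N, ∀ m t f, D f → Supp n t → ω n m t f = ωL n m t f) ∧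
  (∀ n < N, ∀ m t f, Supp n t →
    QuasiComonoid.Hom.app (p.app (op m)) (n + 1) (ω n m t f) = ωF n m t f)

lemma prescribed_s_codeg {D : ∀ ⦃m : SimplexCategory⦄, (m ⟶ k) → Prop} {N : ℕ} {ωL ω : MCFamily E k}
    (hω : IsMCFamily (fun _ _ => True) N ω) (hL : IsMCFamily D (N + 1) ωL)
    (hωL : ∀ n < N, ∀ m t f, D f → Supp n t → ω n m t f = ωL n m t f)
    {m : SimplexCategory} {f : m ⟶ k} {t : ℕ → StdInterval m} (ht : Supp N t)
    {e : (E.obj (op m)).X (N + 1)} (h : Prescribed D ωL ω f N t e) (a : ℕ) (ha : a ≤ N) :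
    (E.obj (op m)).s a ha e = codeg ω N t f a := by
  cases N with
  | zero =>
    obtain rfl : a = 0 := by omega
    cases h with
    | dom _ _ hf => exact hL.s_zero (by omega) _ _ hf ht
    | bot p q _ h _ _ => exact absurd h (by omega)
  | succ n =>
    refine (prescribed_s hω hL hωL rfl ht h a ha).trans ?_
    simp only [codeg]
    rw [min_eq_left ha]

lemma exists_prescribed {D : ∀ ⦃m : SimplexCategory⦄, (m ⟶ k) → Prop} {N : ℕ} {ωL ω : MCFamily E k}
    {m : SimplexCategory} {f : m ⟶ k} {t : ℕ → StdInterval m}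
    (h : D f ∨ ∃ i < N, t (i + 1) = ⊥ ∨ t (i + 1) = ⊤) :
    ∃ e, Prescribed D ωL ω f N t e := by
  rcases h with h | ⟨i, hi, h | h⟩
  · exact ⟨_, .dom _ _ h⟩
  · exact ⟨_, .bot i (N - i - 1) N (by omega) _ h⟩
  · obtain ⟨n, rfl⟩ : ∃ n, N = n + 1 := ⟨N - 1, by omega⟩
    exact ⟨_, .top n i (by omega) _ h⟩

/-- The data of a lift in degree `N`, with prescribed values on the boundary. -/
lemma exists_lift_level {W : MorphismProperty SSet.{w}}
    (hW : ∀ {X Y : SSet.{w}} (A : X.Subcomplex) (B : Y.Subcomplex), W B.ι → W (A.unionProd B).ι)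
    {p : E ⟶ F} {N : ℕ} (hp : W.rlp (Functor.whiskerRight p (QuasiComonoid.level (N + 1))))
    {L : (SSet.stdSimplex.{w}.obj k).Subcomplex} (hL : W L.ι) {ωL ω : MCFamily E k} {ωF : MCFamily F k}
    (hωL : IsMCFamily (fun m f => SSet.stdSimplex.objEquiv.symm f ∈ L.obj (op m)) (N + 1) ωL)
    (hLF : ∀ n m t f, SSet.stdSimplex.objEquiv.symm f ∈ L.obj (op m) → Supp n t →
      QuasiComonoid.Hom.app (p.app (op m)) (n + 1) (ωL n m t f) = ωF n m t f)
    (hF : IsMCFamily (fun _ _ => True) (N + 1) ωF)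
    (hω : IsPartialLift p (fun m f => SSet.stdSimplex.objEquiv.symm f ∈ L.obj (op m)) ωL ωF N ω) :
    ∃ η : ∀ m : SimplexCategory, (ℕ → StdInterval m) → (m ⟶ k) → (E.obj (op m)).X (N + 1),
      (∀ {m m' : SimplexCategory} (θ : m' ⟶ m) (t : ℕ → StdInterval m) (f : m ⟶ k), Supp N t →
        QuasiComonoid.Hom.app (E.map θ.op) (N + 1) (η m t f) = η m' (seqComp θ t) (θ ≫ f)) ∧
      (∀ m t f e, Supp N t → Prescribed (fun m f => SSet.stdSimplex.objEquiv.symm f ∈ L.obj (op m))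
        ωL ω f N t e → η m t f = e) ∧
      (∀ m t f, Supp N t → QuasiComonoid.Hom.app (p.app (op m)) (N + 1) (η m t f) = ωF N m t f) := by
  obtain ⟨hω, hωL', hωF⟩ := hω
  have hmem : ∀ {m : SimplexCategoryᵒᵖ} (z : (cube.{w} k N).obj m),
      z ∈ (cubeBoundary L N).obj m → ∃ e, Prescribed (fun m f =>
        SSet.stdSimplex.objEquiv.symm f ∈ L.obj (op m)) ωL ω (base N z) N (coords N z) e :=
    fun {m} z hz => exists_prescribed ((mem_cubeBoundary_iff L N z).1 hz)
  choose v hv using @hmem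
  let a : ((cubeBoundary L N : (cube.{w} k N).Subcomplex) : SSet.{w}) ⟶
      E ⋙ QuasiComonoid.level (N + 1) :=
    { app := fun m => TypeCat.ofHom fun z => v z.1 z.2
      naturality := fun m m' θ => by
        refine ConcreteCategory.hom_ext _ _ fun z => ?_
        refine (prescribed_unique hω hωL hωL' (supp_coords N _) (hv _ _) ?_)
        have h1 := prescribed_natural hω hωL hωL' (fun m m' θ f hf => by
          exact L.map θ.op hf) (supp_coords N _) θ.unop (hv z.1 z.2)
        rw [← base_map, ← coords_map] at h1
        exact h1 }
  let b : cube.{w} k N ⟶ F ⋙ QuasiComonoid.level (N + 1) :=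
    { app := fun m => TypeCat.ofHom fun z => ωF N m.unop (coords N z) (base N z)
      naturality := fun m m' θ => by
        refine ConcreteCategory.hom_ext _ _ fun z => ?_
        change ωF N m'.unop (coords N ((cube.{w} k N).map θ z)) (base N ((cube.{w} k N).map θ z)) = _
        rw [coords_map, base_map]
        exact (hF.natural N (by omega) θ.unop _ _ trivial (supp_coords N z)).symm }
  have sq : CommSq a (cubeBoundary L N).ι
      (Functor.whiskerRight p (QuasiComonoid.level (N + 1))) b := ⟨by
    ext m z
    exact prescribed_app hω hωL hωL' hF hωF hLF (supp_coords N _) (hv z.1 z.2)⟩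
  have := hp _ (cubeBoundary_ι L hW hL N)
  refine ⟨fun m t f => sq.lift.app (op m) (pack N t f), fun {m m'} θ t f ht => ?_,
    fun m t f e ht he => ?_, fun m t f ht => ?_⟩
  · refine (NatTrans.naturality_apply sq.lift θ.op (pack N t f)).symm.trans ?_
    rw [map_pack]
  · have hz : pack.{w} N t f ∈ (cubeBoundary L N).obj (op m) := by
      rw [mem_cubeBoundary_iff, base_pack, coords_pack N ht]
      cases he with
      | dom _ _ hf => exact .inl hf
      | bot p q _ h _ h0 => exact .inr ⟨p, by omega, .inl h0⟩
      | top n i hi _ h0 => exact .inr ⟨i, by omega, .inr h0⟩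
    have h1 := ConcreteCategory.congr_hom (NatTrans.congr_app sq.fac_left (op m)) ⟨_, hz⟩
    refine h1.trans ?_
    have h2 := hv _ hz
    rw [base_pack, coords_pack N ht] at h2
    exact prescribed_unique hω hωL hωL' ht h2 he
  · have h1 := ConcreteCategory.congr_hom (NatTrans.congr_app sq.fac_right (op m)) (pack N t f)
    refine h1.trans ?_
    change ωF N m (coords N (pack N t f)) (base N (pack N t f)) = _
    rw [base_pack, coords_pack N ht]

variable {p : E ⟶ F} {D : ∀ ⦃m : SimplexCategory⦄, (m ⟶ k) → Prop} {N : ℕ} {ωL ω : MCFamily E k}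

lemma isPartialLift_update {x : MaurerCartan F k}
    (hL : IsMCFamily D (N + 1) ωL) (hω : IsPartialLift p D ωL x.toFamily N ω)
    (hx : x.HasCorrector p N)
    {η : ∀ m : SimplexCategory, (ℕ → StdInterval m) → (m ⟶ k) → (E.obj (op m)).X (N + 1)}
    (hη : ∀ {m m' : SimplexCategory} (θ : m' ⟶ m) (t : ℕ → StdInterval m) (f : m ⟶ k), Supp N t →
        QuasiComonoid.Hom.app (E.map θ.op) (N + 1) (η m t f) = η m' (seqComp θ t) (θ ≫ f))
    (hη' : ∀ m t f e, Supp N t → Prescribed D ωL ω f N t e → η m t f = e)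
    (hη'' : ∀ m t f, Supp N t →
      QuasiComonoid.Hom.app (p.app (op m)) (N + 1) (η m t f) = x.toFamily N m t f) :
    ∃ ω', IsPartialLift p D ωL x.toFamily (N + 1) ω' ∧ ∀ n < N, ω' n = ω n := by
  obtain ⟨hω, hωL, hωF⟩ := hω
  have hF := x.isMCFamily_toFamily (N + 1)
  obtain ⟨corr, hcorr⟩ := hx
  have key : ∀ {m : SimplexCategory} (t : ℕ → StdInterval m) (f : m ⟶ k) (ht : Supp N t), _ :=
    fun {m} t f ht => hcorr m (η m t f) (codeg ω N t f) ⟨t, f, ht, hη'' m t f ht⟩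
      (fun i hi => by rw [hη'' m t f ht]; exact app_codeg hω f hF hωF ht i hi)
      (matching_codeg hω f ht)
  let ωN : ∀ m : SimplexCategory, (ℕ → StdInterval m) → (m ⟶ k) → (E.obj (op m)).X (N + 1) :=
    fun m t f => corr m (η m t f) (codeg ω N t f)
  have hpre : ∀ {m : SimplexCategory} {t : ℕ → StdInterval m} {f : m ⟶ k}
      {e : (E.obj (op m)).X (N + 1)}, Supp N t → Prescribed D ωL ω f N t e → ωN m t f = e := by
    intro m t f e ht he
    rw [← hη' m t f e ht he]
    refine (key t f ht).2.2.1 fun i hi => ?_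
    rw [hη' m t f e ht he]
    exact prescribed_s_codeg hω hL hωL ht he i hi
  let ω' : MCFamily E k := Function.update (β := fun n => ∀ m : SimplexCategory,
    (ℕ → StdInterval m) → (m ⟶ k) → (E.obj (op m)).X (n + 1)) ω N ωN
  have e1 : ω' N = ωN := Function.update_self _ _ _
  have e2 : ∀ n < N, ω' n = ω n := fun n hn => Function.update_of_ne (by omega) _ _
  have hcases : ∀ {n}, n < N + 1 → n < N ∨ n = N := fun h => Nat.lt_succ_iff_lt_or_eq.1 h
  refine ⟨ω', ⟨⟨?_, ?_, ?_, ?_, ?_⟩, ?_, ?_⟩, e2⟩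
  · intro n hn m m' θ t f _ ht
    rcases hcases hn with hn | rfl
    · rw [e2 n hn]
      exact hω.natural n hn θ t f trivial ht
    · rw [e1]
      refine ((key t f ht).2.2.2 m' θ).trans ?_
      simp only [ωN]
      rw [hη θ t f ht]
      congr 1
      funext i
      exact codeg_natural hω f ht θ i
  · intro a b n hab hn m t f _ ht h0
    rw [e2 a (by omega), e2 b (by omega)]
    rcases hcases hn with hn | rfl
    · rw [e2 n hn]
      exact hω.mul a b n hab hn t f trivial ht h0
    · rw [e1]
      exact (hpre ht (.bot a b _ hab t h0)).symm
  · intro n i hi hn m t f _ ht h0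
    rw [e2 n (by omega)]
    rcases hcases hn with hn | rfl
    · rw [e2 _ hn]
      exact hω.d n i hi hn t f trivial ht h0
    · rw [e1]
      exact (hpre ht (.top n i hi t h0)).symm
  · intro n i hi hn m t f _ ht
    rw [e2 n (by omega)]
    rcases hcases hn with hn | rfl
    · rw [e2 _ hn]
      exact hω.s n i hi hn t f trivial ht
    · rw [e1]
      refine ((key t f ht).2.1 i hi).trans ?_
      simp only [codeg]
      rw [min_eq_left hi]
  · intro hN m t f _ ht
    rcases hcases hN with hN | rfl
    · rw [e2 0 hN]
      exact hω.s_zero hN t f trivial ht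
    · rw [e1]
      exact (key t f ht).2.1 0 le_rfl
  · intro n hn m t f hf ht
    rcases hcases hn with hn | rfl
    · rw [e2 n hn]
      exact hωL n hn m t f hf ht
    · rw [e1]
      exact hpre ht (.dom _ _ hf)
  · intro n hn m t f ht
    rcases hcases hn with hn | rfl
    · rw [e2 n hn]
      exact hωF n hn m t f ht
    · rw [e1]
      exact (key t f ht).1.trans (hη'' m t f ht)

lemma exists_lift {x : MaurerCartan F k} (ω₀ : MCFamily E k)
    (step : ∀ N ω, IsPartialLift p D ωL x.toFamily N ω →
      ∃ ω', IsPartialLift p D ωL x.toFamily (N + 1) ω' ∧ ∀ n < N, ω' n = ω n) :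
    ∃ ω, ∀ N, IsPartialLift p D ωL x.toFamily N ω := by
  have h0 : IsPartialLift p D ωL x.toFamily 0 ω₀ :=
    ⟨⟨fun n hn => absurd hn (by omega), fun a b n hab hn => absurd hn (by omega),
      fun n i hi hn => absurd hn (by omega), fun n i hi hn => absurd hn (by omega),
      fun hN => absurd hN (by omega)⟩, fun n hn => absurd hn (by omega),
      fun n hn => absurd hn (by omega)⟩
  choose! next hnext hnext' using step
  let Ω : ℕ → MCFamily E k := fun N => Nat.rec ω₀ (fun N ω => next N ω) N
  have hΩ : ∀ N, IsPartialLift p D ωL x.toFamily N (Ω N) := fun N => by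
    induction N with
    | zero => exact h0
    | succ N ih => exact hnext N _ ih
  have hΩ' : ∀ n N, n < N → Ω N n = Ω (n + 1) n := fun n N hn => by
    induction N with
    | zero => omega
    | succ N ih =>
      rcases Nat.lt_succ_iff_lt_or_eq.1 hn with h | rfl
      · exact (hnext' N _ (hΩ N) n h).trans (ih h)
      · rfl
  refine ⟨fun n => Ω (n + 1) n, fun N => ?_⟩
  obtain ⟨h1, h2, h3⟩ := hΩ N
  refine ⟨h1.congr fun n hn => hΩ' n N hn, fun n hn m t f hf ht => ?_, fun n hn m t f ht => ?_⟩
  · change Ω (n + 1) n m t f = _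
    rw [← hΩ' n N hn]; exact h2 n hn m t f hf ht
  · change QuasiComonoid.Hom.app _ _ (Ω (n + 1) n m t f) = _
    rw [← hΩ' n N hn]; exact h3 n hn m t f ht

end IsMCFamily

theorem MaurerCartan.hasLiftingProperty {W : MorphismProperty SSet.{w}}
    (hW : ∀ {X Y : SSet.{w}} (A : X.Subcomplex) (B : Y.Subcomplex), W B.ι → W (A.unionProd B).ι)
    {p : E ⟶ F} (hp : ∀ n, W.rlp (Functor.whiskerRight p (QuasiComonoid.level n)))
    (hsurj : ∀ n m, Function.Surjective (QuasiComonoid.Hom.app (p.app (op m)) n))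
    (hc : ∀ (x : MaurerCartan F k) (N : ℕ), x.HasCorrector p N)
    (L : (SSet.stdSimplex.{w}.obj k).Subcomplex) (hL : W L.ι) :
    HasLiftingProperty L.ι (maurerCartan.map p) := by
  classical
  refine ⟨fun {g b} sq => ?_⟩
  let x : MaurerCartan F k := b.app (op k) (SSet.stdSimplex.objEquiv.symm (𝟙 k))
  have hb : ∀ m (f : m ⟶ k), b.app (op m) (SSet.stdSimplex.objEquiv.symm f) = x.pull f :=
    fun m f => by
      refine Eq.trans ?_ (NatTrans.naturality_apply b f.op (SSet.stdSimplex.objEquiv.symm (𝟙 k)))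
      rw [SSet.stdSimplex.map_objEquiv_symm]
      exact congrArg _ (congrArg _ (Category.comp_id f).symm)
  let ω₀ : MCFamily E k := fun n m t f =>
    Function.surjInv (hsurj (n + 1) m) (x.toFamily n m t f)
  let G : ∀ m (f : m ⟶ k), SSet.stdSimplex.objEquiv.symm f ∈ L.obj (op m) → MaurerCartan E m :=
    fun m f hf => g.app (op m) ⟨_, hf⟩
  have hG : ∀ m m' (θ : m' ⟶ m) (f : m ⟶ k) hf, (G m f hf).pull θ =
      G m' (θ ≫ f) (L.map θ.op hf) := fun m m' θ f hf =>
    (NatTrans.naturality_apply g θ.op ⟨_, hf⟩).symm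
  have hGx : ∀ m (f : m ⟶ k) hf, (G m f hf).push p = x.pull f := fun m f hf =>
    (ConcreteCategory.congr_hom (NatTrans.congr_app sq.w (op m)) ⟨_, hf⟩).trans (hb m f)
  let D : ∀ ⦃m : SimplexCategory⦄, (m ⟶ k) → Prop := fun m f =>
    SSet.stdSimplex.objEquiv.symm f ∈ L.obj (op m)
  let ωL : MCFamily E k := fun n m t f =>
    if hf : D f then (G m f hf).toFamily n m t (𝟙 m) else ω₀ n m t f
  have hωL : ∀ n m t (f : m ⟶ k) (hf : D f), ωL n m t f = (G m f hf).toFamily n m t (𝟙 m) :=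
    fun n m t f hf => dif_pos hf
  have hL' : ∀ N, IsMCFamily D N ωL := fun N => by
    refine ⟨fun n hn m m' θ t f hf ht => ?_, fun a b n hab hn m t f hf ht h0 => ?_,
      fun n i hi hn m t f hf ht h0 => ?_, fun n i hi hn m t f hf ht => ?_,
      fun hN m t f hf ht => ?_⟩
    · have hf' : D (θ ≫ f) := L.map θ.op hf
      rw [hωL _ _ _ _ hf, hωL _ _ _ _ hf', ← hG m m' θ f hf]
      refine (((G m f hf).isMCFamily_toFamily N).natural n hn θ t _ trivial ht).trans ?_
      change (G m f hf).ω _ _ _ _ = (G m f hf).ω _ _ _ _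
      rw [Category.comp_id, Category.id_comp]
    · rw [hωL _ _ _ _ hf, hωL _ _ _ _ hf, hωL _ _ _ _ hf]
      exact ((G m f hf).isMCFamily_toFamily N).mul a b n hab hn t _ trivial ht h0
    · rw [hωL _ _ _ _ hf, hωL _ _ _ _ hf]
      exact ((G m f hf).isMCFamily_toFamily N).d n i hi hn t _ trivial ht h0
    · rw [hωL _ _ _ _ hf, hωL _ _ _ _ hf]
      exact ((G m f hf).isMCFamily_toFamily N).s n i hi hn t _ trivial ht
    · rw [hωL _ _ _ _ hf]
      exact ((G m f hf).isMCFamily_toFamily N).s_zero hN t _ trivial ht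
  have hLF : ∀ n m t f, D f → Supp n t →
      QuasiComonoid.Hom.app (p.app (op m)) (n + 1) (ωL n m t f) = x.toFamily n m t f := by
    intro n m t f hf ht
    rw [hωL _ _ _ _ hf]
    have := congrArg (fun y => y.toFamily n m t (𝟙 m)) (hGx m f hf)
    refine Eq.trans this ?_
    change x.ω _ _ _ _ = x.ω _ _ _ _
    rw [Category.id_comp]
  obtain ⟨ω, hω⟩ := IsMCFamily.exists_lift (p := p) (D := D) (ωL := ωL) (x := x) ω₀ fun N ω hω => by
    obtain ⟨η, h1, h2, h3⟩ := IsMCFamily.exists_lift_level hW (hp (N + 1)) hL (hL' (N + 1)) hLF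
      (x.isMCFamily_toFamily (N + 1)) hω
    exact IsMCFamily.isPartialLift_update (hL' (N + 1)) hω (hc x N) h1 h2 h3
  let z : MaurerCartan E k := .ofFamily ω fun N => (hω N).1
  let z' : (maurerCartan.obj E).obj (op k) := z
  let Z : SSet.stdSimplex.obj k ⟶ maurerCartan.obj E := SSet.yonedaEquiv.symm z'
  have hZ : ∀ m (f : m ⟶ k), Z.app (op m) (SSet.stdSimplex.objEquiv.symm f) = z.pull f :=
    fun m f => SSet.yonedaEquiv_symm_app_objEquiv_symm z' f
  refine ⟨⟨⟨Z, ?_, ?_⟩⟩⟩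
  · ext m l
    obtain ⟨f, hf⟩ := l
    obtain ⟨f, rfl⟩ := SSet.stdSimplex.objEquiv.symm.surjective f
    refine (hZ _ f).trans ?_
    change _ = G _ f hf
    apply MaurerCartan.ext
    funext n m' t f'
    change ω n m' (extend t) (f' ≫ f) = _
    have hf' : D (f' ≫ f) := L.map f'.op hf
    rw [(hω (n + 1)).2.1 n (by omega) _ _ _ hf' (supp_extend t), hωL _ _ _ _ hf', ← hG _ _ f' f hf,
      ← extend_toFamily]
    change (G _ f hf).ω _ _ _ _ = (G _ f hf).ω _ _ _ _
    rw [Category.id_comp]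
  · ext m f
    obtain ⟨f, rfl⟩ := SSet.stdSimplex.objEquiv.symm.surjective f
    refine (congrArg ((maurerCartan.map p).app m) (hZ _ f)).trans ((Eq.trans ?_ (hb _ f).symm))
    apply MaurerCartan.ext
    funext n m t f'
    change QuasiComonoid.Hom.app (p.app (op m)) (n + 1) (ω n m (extend t) (f' ≫ f)) = _
    rw [(hω (n + 1)).2.2 n (by omega) _ _ _ (supp_extend t), extend_toFamily]
    rfl

theorem MaurerCartan.map_rlp_J {p : E ⟶ F}
    (hp : ∀ n, SSet.modelCategoryQuillen.J.rlp (Functor.whiskerRight p (QuasiComonoid.level n)))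
    (hsurj : ∀ n m, Function.Surjective (QuasiComonoid.Hom.app (p.app (op m)) n))
    (hc : ∀ (k : SimplexCategory) (x : MaurerCartan F k) (N : ℕ), x.HasCorrector p N) :
    SSet.modelCategoryQuillen.J.rlp (maurerCartan.map p) := by
  intro _ _ i hi
  have hi' : SSet.anodyneExtensions i := by
    rw [SSet.anodyneExtensions_eq_llp_rlp]
    exact MorphismProperty.le_llp_rlp _ _ hi
  simp only [SSet.modelCategoryQuillen.J, MorphismProperty.iSup_iff] at hi
  obtain ⟨n, ⟨k⟩⟩ := hi
  refine MaurerCartan.hasLiftingProperty SSet.anodyneExtensions_unionProd_ι (fun n => ?_) hsurj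
    (hc _) _ hi'
  rw [SSet.anodyneExtensions_eq_llp_rlp, MorphismProperty.rlp_llp_rlp]
  exact hp n

theorem MaurerCartan.map_rlp_I {p : E ⟶ F}
    (hp : ∀ n, SSet.modelCategoryQuillen.I.rlp (Functor.whiskerRight p (QuasiComonoid.level n)))
    (hsurj : ∀ n m, Function.Surjective (QuasiComonoid.Hom.app (p.app (op m)) n))
    (hc : ∀ (k : SimplexCategory) (x : MaurerCartan F k) (N : ℕ), x.HasCorrector p N) :
    SSet.modelCategoryQuillen.I.rlp (maurerCartan.map p) := by
  rintro _ _ i ⟨n⟩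
  refine MaurerCartan.hasLiftingProperty (W := MorphismProperty.monomorphisms SSet)
    (fun A B _ => MorphismProperty.monomorphisms.infer_property _) (fun n => ?_) hsurj
    (hc _) _ (MorphismProperty.monomorphisms.infer_property _)
  rw [SSet.rlp_monomorphisms]
  exact hp n

end

end

section

/-! ## The simplices of the derived Deligne nerve -/

namespace DeligneObj

variable {E : SimplicialObject QuasiComonoid.{w}} {k : SimplexCategory}

lemma composableArrows_ext_succ {n : ℕ} {S T : ComposableArrows (DeligneObj E k) (n + 1)}
    (h0 : (S.obj 0).pt = (T.obj 0).pt) (h : S.δ₀ = T.δ₀)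
    (hg : Hom.g (S.map' 0 1) = Hom.g (T.map' 0 1)) : S = T := by
  refine ComposableArrows.ext_succ (DeligneObj.ext h0) h (Hom.ext ?_)
  rw [comp_g, comp_g, eqToHom_g, hg]
  erw [eqToHom_g]
  simp

lemma composableArrows_ext_zero {S T : ComposableArrows (DeligneObj E k) 0}
    (h0 : (S.obj 0).pt = (T.obj 0).pt) : S = T :=
  ComposableArrows.ext₀ (DeligneObj.ext h0)

lemma composableArrows_ext {n : ℕ} {S T : ComposableArrows (DeligneObj E k) n}
    (h : ∀ a, (S.obj a).pt = (T.obj a).pt)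
    (hg : ∀ a b (hab : a ≤ b), Hom.g (S.map (homOfLE hab)) = Hom.g (T.map (homOfLE hab))) :
    S = T := by
  refine CategoryTheory.Functor.ext (fun a => DeligneObj.ext (h a)) fun a b f => Hom.ext ?_
  rw [comp_g, comp_g, eqToHom_g, eqToHom_g]
  refine (hg a b (leOfHom f)).trans ?_
  rw [one_mul]
  exact (mul_one _).symm

lemma precomp_obj_pt {n : ℕ} (S : ComposableArrows (DeligneObj E k) n) {x : DeligneObj E k}
    (f : x ⟶ S.left) {c : Fin (n + 2)} {d : Fin (n + 1)} (h : c = d.succ) :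
    ((ComposableArrows.precomp S f).obj c).pt = (S.obj d).pt := by
  subst h; rfl

lemma precomp_map_g {n : ℕ} (S : ComposableArrows (DeligneObj E k) n) {x : DeligneObj E k}
    (f : x ⟶ S.left) {c c' : Fin (n + 2)} {d d' : Fin (n + 1)} (h : c = d.succ) (h' : c' = d'.succ)
    (hc : c ≤ c') (hd : d ≤ d') :
    Hom.g ((ComposableArrows.precomp S f).map (homOfLE hc)) = Hom.g (S.map (homOfLE hd)) := by
  subst h h'; rfl

lemma precomp_map_g_zero {n : ℕ} (S : ComposableArrows (DeligneObj E k) n) {x : DeligneObj E k}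
    (f : x ⟶ S.left) {c c' : Fin (n + 2)} (h : c = 0) (h' : c' = 1) (hc : c ≤ c') :
    Hom.g ((ComposableArrows.precomp S f).map (homOfLE hc)) = Hom.g f := by
  subst h h'; rfl

end DeligneObj

namespace DerivedDeligne

open BarW

variable (E : SimplicialObject QuasiComonoid.{w})

/-- The bisimplicial nerve of the derived Deligne groupoid. -/
noncomputable abbrev biNerve : SimplicialObject SSet.{w} :=
  ((SimplicialObject.whiskering _ _).obj nerveFunctor).obj (derivedDeligneGroupoid.obj E)

variable {E} {p q : ℕ}

lemma act_id_right (X : SimplicialObject SSet.{w}) {i i' j : ℕ} (α : ⦋i'⦌ ⟶ ⦋i⦌)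
    (x : (X.obj (op ⦋j⦌)).obj (op ⦋i⦌)) : act X α (𝟙 _) x = (X.obj (op ⦋j⦌)).map α.op x := by
  simp [act]

lemma act_id_left (X : SimplicialObject SSet.{w}) {i j j' : ℕ} (β : ⦋j'⦌ ⟶ ⦋j⦌)
    (x : (X.obj (op ⦋j⦌)).obj (op ⦋i⦌)) : act X (𝟙 _) β x = (X.map β.op).app (op ⦋i⦌) x := by
  simp [act]

/-- The operation on units. -/
abbrev res {k k' : SimplexCategory} (θ : k' ⟶ k) (g : ((E.obj (op k)).X 0)ˣ) :
    ((E.obj (op k')).X 0)ˣ := Units.map (QuasiComonoid.Hom.zero (E.map θ.op)) g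

lemma res_res {k k' k'' : SimplexCategory} (θ : k' ⟶ k) (φ : k'' ⟶ k')
    (g : ((E.obj (op k)).X 0)ˣ) : res φ (res θ g) = res (φ ≫ θ) g := by
  ext
  change QuasiComonoid.Hom.app (E.map φ.op) 0 (QuasiComonoid.Hom.app (E.map θ.op) 0 g.val) =
    QuasiComonoid.Hom.app (E.map (φ ≫ θ).op) 0 g.val
  rw [op_comp, E.map_comp]
  rfl

lemma res_id {k : SimplexCategory} (g : ((E.obj (op k)).X 0)ˣ) : res (𝟙 k) g = g := by
  ext
  change QuasiComonoid.Hom.app (E.map (𝟙 _)) 0 g.val = _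
  rw [E.map_id]
  rfl

lemma pull_pull {k k' k'' : SimplexCategory} (θ : k' ⟶ k) (φ : k'' ⟶ k')
    (x : MaurerCartan E k) : (x.pull θ).pull φ = x.pull (φ ≫ θ) :=
  (ConcreteCategory.congr_hom ((maurerCartan.obj E).map_comp θ.op φ.op) x).symm

lemma pull_id {k : SimplexCategory} (x : MaurerCartan E k) : x.pull (𝟙 k) = x :=
  ConcreteCategory.congr_hom ((maurerCartan.obj E).map_id (op k)) x

/-- The objects of the components of a simplex. -/
def ob (z : BarW (biNerve E) p) (i j : ℕ) (h : i + j = p) (a : Fin (i + 1)) :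
    MaurerCartan E ⦋j⦌ :=
  ((show ComposableArrows (DeligneObj E ⦋j⦌) i from z.pt i j h).obj a).pt

/-- The arrows of the components of a simplex. -/
def ar (z : BarW (biNerve E) p) (i j : ℕ) (h : i + j = p) {a b : Fin (i + 1)} (hab : a ≤ b) :
    ((E.obj (op ⦋j⦌)).X 0)ˣ :=
  DeligneObj.Hom.g ((show ComposableArrows (DeligneObj E ⦋j⦌) i from z.pt i j h).map (homOfLE hab))

lemma ar_smul (z : BarW (biNerve E) p) (i j : ℕ) (h : i + j = p) {a b : Fin (i + 1)} (hab : a ≤ b) :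
    ar z i j h hab • ob z i j h a = ob z i j h b :=
  DeligneObj.Hom.eq
    ((show ComposableArrows (DeligneObj E ⦋j⦌) i from z.pt i j h).map (homOfLE hab))

lemma ar_comp (z : BarW (biNerve E) p) (i j : ℕ) (h : i + j = p) {a b c : Fin (i + 1)} (hab : a ≤ b)
    (hbc : b ≤ c) : ar z i j h (hab.trans hbc) = ar z i j h hbc * ar z i j h hab := by
  refine Eq.trans ?_ (DeligneObj.comp_g
    ((show ComposableArrows (DeligneObj E ⦋j⦌) i from z.pt i j h).map (homOfLE hab))
    ((show ComposableArrows (DeligneObj E ⦋j⦌) i from z.pt i j h).map (homOfLE hbc)))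
  rw [← Functor.map_comp]
  rfl

lemma ob_pull (θ : Fin (q + 1) →o Fin (p + 1)) (z : BarW (biNerve E) p) (i j a b : ℕ)
    (h : i + j = q) (ha : (θ ⟨i, by omega⟩ : ℕ) = a) (hb : a + b = p) (c : Fin (i + 1)) :
    ob (pull θ z) i j h c =
      (ob z a b hb ((initialPart θ i a (by omega) ha).toOrderHom c)).pull
        (finalPart θ i j a b h hb ha) := by
  simp only [ob]
  rw [pull_pt θ z i j a b h ha hb]
  rfl

lemma ar_pull (θ : Fin (q + 1) →o Fin (p + 1)) (z : BarW (biNerve E) p) (i j a b : ℕ)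
    (h : i + j = q) (ha : (θ ⟨i, by omega⟩ : ℕ) = a) (hb : a + b = p) {c d : Fin (i + 1)}
    (hcd : c ≤ d) :
    ar (pull θ z) i j h hcd = res (finalPart θ i j a b h hb ha)
      (ar z a b hb ((initialPart θ i a (by omega) ha).toOrderHom.monotone hcd)) := by
  simp only [ar]
  rw [pull_pt θ z i j a b h ha hb]
  rfl

lemma ob_compat (z : BarW (biNerve E) p) (i j : ℕ) (h : i + (j + 1) = p) (a : Fin (i + 1)) :
    (ob z i (j + 1) h a).pull (SimplexCategory.δ 0) = ob z (i + 1) j (by omega) a.castSucc := by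
  have := congrArg (fun S : ComposableArrows (DeligneObj E ⦋j⦌) i => (S.obj a).pt) (z.compat i j h)
  refine this.trans ?_
  change ob z (i + 1) j _ ((Fin.last (i + 1)).succAbove a) = _
  rw [Fin.succAbove_last]

lemma ar_compat (z : BarW (biNerve E) p) (i j : ℕ) (h : i + (j + 1) = p) {a b : Fin (i + 1)}
    (hab : a ≤ b) : res (SimplexCategory.δ 0) (ar z i (j + 1) h hab) =
      ar z (i + 1) j (by omega) (show a.castSucc ≤ b.castSucc from hab) := by
  have key : ∀ S T : ComposableArrows (DeligneObj E ⦋j⦌) i, S = T →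
      DeligneObj.Hom.g (S.map (homOfLE hab)) = DeligneObj.Hom.g (T.map (homOfLE hab)) := by
    rintro S _ rfl; rfl
  have := key _ _ (z.compat i j h)
  refine this.trans ?_
  have e : ∀ (c d c' d' : Fin (i + 2)) (h1 : c ≤ d) (h2 : c' ≤ d'), c = c' → d = d' →
      ar z (i + 1) j (by omega) h1 = ar z (i + 1) j (by omega) h2 := by
    rintro c d _ _ _ _ rfl rfl; rfl
  exact e ((Fin.last (i + 1)).succAbove a) ((Fin.last (i + 1)).succAbove b) _ _
    ((Fin.strictMono_succAbove _).monotone hab) _ (by rw [Fin.succAbove_last])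
    (by rw [Fin.succAbove_last])

/-- The initial object of a simplex. -/
def base (z : BarW (biNerve E) p) : MaurerCartan E ⦋p⦌ := ob z 0 p (Nat.zero_add p) 0

/-- The first arrow of a simplex. -/
def first (z : BarW (biNerve E) (p + 1)) : ((E.obj (op ⦋p⦌)).X 0)ˣ :=
  ar z 1 p (by omega) (show (0 : Fin 2) ≤ 1 by decide)

/-- The map of ordered sets omitting `i`. -/
def faceHom (i : Fin (p + 2)) : Fin (p + 1) →o Fin (p + 2) := (SimplexCategory.δ i).toOrderHom

/-- The face operations. -/
noncomputable def face (i : Fin (p + 2)) (z : BarW (biNerve E) (p + 1)) : BarW (biNerve E) p :=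
  pull (faceHom i) z

lemma base_face_succ (i : Fin (p + 1)) (z : BarW (biNerve E) (p + 1)) :
    base (face i.succ z) = (base z).pull (SimplexCategory.δ i.succ) := by
  have h0 : ((faceHom i.succ) ⟨0, by omega⟩ : ℕ) = 0 := by
    change ((i.succ.succAbove 0 : Fin (p + 2)) : ℕ) = 0
    simp
  refine (ob_pull _ z 0 p 0 (p + 1) _ h0 (by omega) 0).trans ?_
  congr 1
  ext a
  change ((faceHom i.succ) ⟨0 + a, _⟩ : ℕ) - 0 = _
  simp only [Nat.zero_add]
  rfl

lemma base_face_zero (z : BarW (biNerve E) (p + 1)) :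
    base (face 0 z) = first z • (base z).pull (SimplexCategory.δ 0) := by
  have h1 := ob_compat z 0 p (by omega) 0
  change (base z).pull _ = _ at h1
  rw [h1]
  refine Eq.trans ?_ (ar_smul z 1 p (by omega) (show (0 : Fin 2) ≤ 1 by decide)).symm
  have h0 : ((faceHom (0 : Fin (p + 2))) ⟨0, by omega⟩ : ℕ) = 1 := rfl
  refine (ob_pull _ z 0 p 1 p _ h0 (by omega) 0).trans ?_
  have e : finalPart (faceHom (0 : Fin (p + 2))) 0 p 1 p (by omega) (by omega)
      h0 = 𝟙 _ := by
    ext a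
    change ((faceHom (0 : Fin (p + 2))) ⟨0 + a, _⟩ : ℕ) - 1 = _
    simp only [Nat.zero_add]
    change (a : ℕ) + 1 - 1 = a
    omega
  rw [e, pull_id]
  rfl

lemma first_face_succ_succ (i : Fin (p + 1)) (z : BarW (biNerve E) (p + 2)) :
    first (face i.succ.succ z) = res (SimplexCategory.δ i.succ) (first z) := by
  have h0 : ((faceHom i.succ.succ) ⟨0, by omega⟩ : ℕ) = 0 := by
    change ((i.succ.succ.succAbove 0 : Fin (p + 3)) : ℕ) = 0
    simp
  have h1 : ((faceHom i.succ.succ) ⟨1, by omega⟩ : ℕ) = 1 := by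
    change ((i.succ.succ.succAbove (Fin.succ 0) : Fin (p + 3)) : ℕ) = 1
    rw [Fin.succ_succAbove_succ]
    simp
  refine (ar_pull _ z 1 p 1 (p + 1) _ h1 (by omega) _).trans ?_
  have e : finalPart (faceHom i.succ.succ) 1 p 1 (p + 1) (by omega) (by omega)
      h1 = SimplexCategory.δ i.succ := by
    ext a
    have e2 : (⟨1 + a, by have := a.2; simp at this; omega⟩ : Fin (p + 2)) = Fin.succ a := by
      ext; simp [Nat.add_comm]
    change ((i.succ.succ.succAbove ⟨1 + a, _⟩ : Fin (p + 3)) : ℕ) - 1 = (i.succ.succAbove a : Fin (p + 2))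
    rw [e2, Fin.succ_succAbove_succ]
    simp
  rw [e]
  have e : ∀ (c d c' d' : Fin 2) (h1 : c ≤ d) (h2 : c' ≤ d'), c = c' → d = d' →
      ar z 1 (p + 1) (by omega) h1 = ar z 1 (p + 1) (by omega) h2 := by
    rintro c d _ _ _ _ rfl rfl; rfl
  exact congrArg _ (e _ _ _ _ _ _ (Fin.ext h0) (Fin.ext h1))

lemma first_face_one (z : BarW (biNerve E) (p + 2)) :
    first (face 1 z) = first (face 0 z) * res (SimplexCategory.δ 0) (first z) := by
  have h0 : ((faceHom (1 : Fin (p + 3))) ⟨0, by omega⟩ : ℕ) = 0 := rfl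
  have h1 : ((faceHom (1 : Fin (p + 3))) ⟨1, by omega⟩ : ℕ) = 2 := by
    change (((Fin.succ 0).succAbove (Fin.succ 0) : Fin (p + 3)) : ℕ) = 2
    rw [Fin.succ_succAbove_succ]
    simp
  have h2 : ((faceHom (0 : Fin (p + 3))) ⟨1, by omega⟩ : ℕ) = 2 := rfl
  have e1 : finalPart (faceHom (1 : Fin (p + 3))) 1 p 2 p (by omega) (by omega)
      h1 = 𝟙 _ := by
    ext a
    have e2 : (⟨1 + a, by have := a.2; simp at this; omega⟩ : Fin (p + 2)) = Fin.succ a := by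
      ext; simp [Nat.add_comm]
    change (((Fin.succ 0).succAbove ⟨1 + a, _⟩ : Fin (p + 3)) : ℕ) - 2 = a
    rw [e2, Fin.succ_succAbove_succ]
    simp
  have e0 : finalPart (faceHom (0 : Fin (p + 3))) 1 p 2 p (by omega) (by omega)
      h2 = 𝟙 _ := by
    ext a
    change 1 + (a : ℕ) + 1 - 2 = a
    omega
  have e : ∀ (c d c' d' : Fin 3) (h1 : c ≤ d) (h2 : c' ≤ d'), c = c' → d = d' →
      ar z 2 p (by omega) h1 = ar z 2 p (by omega) h2 := by
    rintro c d _ _ _ _ rfl rfl; rfl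
  have f1 : first (face 1 z) = ar z 2 p (by omega) (show (0 : Fin 3) ≤ 2 by decide) := by
    refine (ar_pull _ z 1 p 2 p _ h1 (by omega) _).trans ?_
    rw [e1, res_id]
    exact e _ _ _ _ _ _ (Fin.ext h0) (Fin.ext h1)
  have f0 : first (face 0 z) = ar z 2 p (by omega) (show (1 : Fin 3) ≤ 2 by decide) := by
    refine (ar_pull _ z 1 p 2 p _ h2 (by omega) _).trans ?_
    rw [e0, res_id]
    exact e _ _ _ _ _ _ (Fin.ext rfl) (Fin.ext h2)
  have f2 := ar_compat z 1 p (by omega) (show (0 : Fin 2) ≤ 1 by decide)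
  change res _ (first z) = _ at f2
  rw [f1, f0, f2]
  exact ar_comp z 2 p (by omega) (show (0 : Fin 3) ≤ 1 by decide) (show (1 : Fin 3) ≤ 2 by decide)

lemma ob_zero_eq (z : BarW (biNerve E) p) (i j : ℕ) (h : i + j = p) :
    ob z i j h 0 = (base z).pull (shift i (by omega)) := by
  have := compat_general z 0 p i j i (by omega) (by omega) (by omega)
  rw [act_id_left, act_id_right] at this
  exact (congrArg (fun S : ComposableArrows (DeligneObj E ⦋j⦌) 0 => (S.obj 0).pt) this).symm

lemma ar_zero_one_eq (z : BarW (biNerve E) (p + 1)) (i j : ℕ) (h : i + 1 + j = p + 1) :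
    ar z (i + 1) j h (show (0 : Fin (i + 2)) ≤ 1 from Fin.zero_le _) =
      res (shift i (by omega)) (first z) := by
  have key : ∀ S T : ComposableArrows (DeligneObj E ⦋j⦌) 1, S = T →
      DeligneObj.Hom.g (S.map (homOfLE (show (0 : Fin 2) ≤ 1 by decide))) =
        DeligneObj.Hom.g (T.map (homOfLE (show (0 : Fin 2) ≤ 1 by decide))) := by
    rintro S _ rfl; rfl
  have h1 := compat_general z 1 p (i + 1) j i (by omega) (by omega) (by omega)
  rw [act_id_left, act_id_right] at h1
  refine Eq.trans ?_ (key _ _ h1).symm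
  have e : ∀ (c d c' d' : Fin (i + 2)) (h1 : c ≤ d) (h2 : c' ≤ d'), c = c' → d = d' →
      ar z (i + 1) j h h1 = ar z (i + 1) j h h2 := by
    rintro c d _ _ _ _ rfl rfl; rfl
  exact e 0 1 ((incl (show 1 ≤ i + 1 by omega)).toOrderHom 0)
    ((incl (show 1 ≤ i + 1 by omega)).toOrderHom 1) _
    ((incl (show 1 ≤ i + 1 by omega)).toOrderHom.monotone (by decide)) rfl
    (Fin.ext (show 1 % (i + 2) = 1 from Nat.mod_eq_of_lt (by omega)))

lemma pt_succ_δ₀ (z : BarW (biNerve E) (p + 1)) (i j : ℕ) (h : i + 1 + j = p + 1) :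
    (show ComposableArrows (DeligneObj E ⦋j⦌) (i + 1) from z.pt (i + 1) j h).δ₀ =
      (face 0 z).pt i j (by omega) := by
  have h0 : ((faceHom (0 : Fin (p + 2))) ⟨i, by omega⟩ : ℕ) = i + 1 := rfl
  have e1 := pull_pt (faceHom (0 : Fin (p + 2))) z i j (i + 1) j (by omega) h0 h
  have e : finalPart (faceHom (0 : Fin (p + 2))) i j (i + 1) j (by omega) (by omega)
      h0 = 𝟙 _ := by
    ext a
    change i + (a : ℕ) + 1 - (i + 1) = a
    omega
  rw [e] at e1
  refine Eq.trans ?_ e1.symm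
  rw [act_id_right]
  exact DeligneObj.composableArrows_ext (fun a => rfl) fun a b f => rfl

lemma ext_simplex {z z' : BarW (biNerve E) (p + 1)} (hb : base z = base z')
    (hf : first z = first z') (h : face 0 z = face 0 z') : z = z' := by
  apply BarW.ext
  funext i j hij
  cases i with
  | zero =>
    refine DeligneObj.composableArrows_ext_zero ?_
    change ob z 0 j hij 0 = ob z' 0 j hij 0
    rw [ob_zero_eq, ob_zero_eq, hb]
  | succ i =>
    refine DeligneObj.composableArrows_ext_succ ?_ ?_ ?_
    · change ob z (i + 1) j hij 0 = ob z' (i + 1) j hij 0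
      rw [ob_zero_eq, ob_zero_eq, hb]
    · refine (pt_succ_δ₀ z i j hij).trans (Eq.trans ?_ (pt_succ_δ₀ z' i j hij).symm)
      rw [h]
    · change ar z (i + 1) j hij _ = ar z' (i + 1) j hij _
      exact (ar_zero_one_eq z i j hij).trans
        ((congrArg _ hf).trans (ar_zero_one_eq z' i j hij).symm)

lemma ext_vertex {z z' : BarW (biNerve E) 0} (hb : base z = base z') : z = z' := by
  apply BarW.ext
  funext i j hij
  obtain rfl : i = 0 := by omega
  refine DeligneObj.composableArrows_ext_zero ?_
  change ob z 0 j hij 0 = ob z' 0 j hij 0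
  rw [ob_zero_eq, ob_zero_eq, hb]

/-- The vertex with given object. -/
noncomputable def mkVertex (x : MaurerCartan E ⦋0⦌) : BarW (biNerve E) 0 where
  pt i j h := match i with
    | 0 => (show ComposableArrows (DeligneObj E ⦋j⦌) 0 from
        ComposableArrows.mk₀ ⟨x.pull (shift 0 (by omega))⟩)
    | i + 1 => absurd h (by omega)
  compat i j h := absurd h (by omega)

lemma base_mkVertex (x : MaurerCartan E ⦋0⦌) : base (mkVertex x) = x :=
  pull_id x

section mk

variable (x : MaurerCartan E ⦋p + 1⦌) (g : ((E.obj (op ⦋p⦌)).X 0)ˣ) (w : BarW (biNerve E) p)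
  (hw : g • x.pull (SimplexCategory.δ 0) = base w)

/-- The first arrow of the components. -/
noncomputable def mkArrow (i j : ℕ) (h : i + j = p) :
    (⟨x.pull (shift (i + 1) (by omega))⟩ : DeligneObj E ⦋j⦌) ⟶
      (show ComposableArrows (DeligneObj E ⦋j⦌) i from w.pt i j h).left :=
  ⟨res (shift i (by omega)) g, by
    change _ = ob w i j h 0
    rw [ob_zero_eq, ← hw, MaurerCartan.pull_smul, pull_pull]
    rfl⟩

/-- The simplex with given object, first arrow and initial face. -/
noncomputable def mk : BarW (biNerve E) (p + 1) where
  pt i j h := match i with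
    | 0 => (show ComposableArrows (DeligneObj E ⦋j⦌) 0 from
        ComposableArrows.mk₀ ⟨x.pull (shift 0 (by omega))⟩)
    | i + 1 => (show ComposableArrows (DeligneObj E ⦋j⦌) (i + 1) from
        ComposableArrows.precomp _ (mkArrow x g w hw i j (by omega)))
  compat i j h := by
    cases i with
    | zero =>
      refine DeligneObj.composableArrows_ext_zero ?_
      change (x.pull (shift 0 _)).pull (SimplexCategory.δ 0) = x.pull (shift 1 _)
      rw [pull_pull]
      rfl
    | succ i =>
      refine DeligneObj.composableArrows_ext_succ ?_ ?_ ?_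
      · change (x.pull (shift (i + 1) _)).pull (SimplexCategory.δ 0) = x.pull (shift (i + 2) _)
        rw [pull_pull]
        congr 1
        ext a
        change (a : ℕ) + 1 + (i + 1) = a + (i + 1 + 1)
        omega
      · refine Eq.trans ?_ ((w.compat i j (by omega)).trans ?_)
        · exact DeligneObj.composableArrows_ext (fun a => rfl) fun a b f => rfl
        · refine DeligneObj.composableArrows_ext (fun a => ?_) fun a b hab => ?_
          · refine (DeligneObj.precomp_obj_pt (w.pt (i + 1) j (by omega))
              (mkArrow x g w hw (i + 1) j (by omega)) ?_).symm
            change (Fin.last (i + 2)).succAbove a.succ = ((Fin.last (i + 1)).succAbove a).succ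
            rw [Fin.succAbove_last, Fin.succAbove_last, Fin.succ_castSucc]
          · refine (DeligneObj.precomp_map_g (w.pt (i + 1) j (by omega))
              (mkArrow x g w hw (i + 1) j (by omega)) ?_ ?_
              ((Fin.strictMono_succAbove _).monotone (Fin.succ_le_succ_iff.2 hab)) _).symm
            · change (Fin.last (i + 2)).succAbove a.succ = ((Fin.last (i + 1)).succAbove a).succ
              rw [Fin.succAbove_last, Fin.succAbove_last, Fin.succ_castSucc]
            · change (Fin.last (i + 2)).succAbove b.succ = ((Fin.last (i + 1)).succAbove b).succ
              rw [Fin.succAbove_last, Fin.succAbove_last, Fin.succ_castSucc]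
      · refine Eq.trans ?_ (DeligneObj.precomp_map_g_zero (w.pt (i + 1) j (by omega))
          (mkArrow x g w hw (i + 1) j (by omega)) (c := (Fin.last (i + 2)).succAbove 0) (c' := (Fin.last (i + 2)).succAbove 1) ?_ ?_
          ((Fin.strictMono_succAbove _).monotone (Fin.zero_le _))).symm
        · change res (SimplexCategory.δ 0) (res (shift i _) g) = res (shift (i + 1) _) g
          rw [res_res]
          congr 1
          ext a
          change (a : ℕ) + 1 + i = a + (i + 1)
          omega
        · rw [Fin.succAbove_last]; rfl
        · rw [Fin.succAbove_last]; rfl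

lemma base_mk : base (mk x g w hw) = x := pull_id x

lemma first_mk : first (mk x g w hw) = g := by
  refine (DeligneObj.precomp_map_g_zero _ (mkArrow x g w hw 0 p (by omega)) rfl rfl _).trans ?_
  exact res_id g

lemma face_zero_mk : face 0 (mk x g w hw) = w := by
  apply BarW.ext
  funext i j h
  refine (pt_succ_δ₀ _ i j (by omega)).symm.trans ?_
  exact DeligneObj.composableArrows_ext (fun a => rfl) fun a b f => rfl

end mk

end DerivedDeligne

end

section

open SSet

/-! ## Homotopy quotients of simplicial sets by simplicial groups -/

/-- A simplicial set `M` with an action of a simplicial group `U`, and a simplicial set `W` whose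
`(p + 1)`-simplices `z` correspond to triples consisting of `base z ∈ M_{p+1}`, `first z ∈ U_p`
and `∂_0 z`, as for `W = W̄[M/U]`. -/
structure HomotopyQuotient where
  /-- the simplicial set -/
  M : SSet.{w}
  /-- the simplicial group -/
  U : SSet.{w}
  /-- the quotient -/
  W : SSet.{w}
  [group : ∀ p : ℕ, Group (U _⦋p⦌)]
  [action : ∀ p : ℕ, MulAction (U _⦋p⦌) (M _⦋p⦌)]
  δ_mul : ∀ {p : ℕ} (i : Fin (p + 2)) (g h : U _⦋p + 1⦌), U.δ i (g * h) = U.δ i g * U.δ i h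
  δ_smul : ∀ {p : ℕ} (i : Fin (p + 2)) (g : U _⦋p + 1⦌) (x : M _⦋p + 1⦌),
    M.δ i (g • x) = U.δ i g • M.δ i x
  /-- the initial object of a simplex -/
  base : ∀ {p : ℕ}, W _⦋p⦌ → M _⦋p⦌
  /-- the first arrow of a simplex -/
  first : ∀ {p : ℕ}, W _⦋p + 1⦌ → U _⦋p⦌
  δ_base : ∀ {p : ℕ} (i : Fin (p + 1)) (z : W _⦋p + 1⦌), M.δ i.succ (base z) = base (W.δ i.succ z)
  smul_δ_base : ∀ {p : ℕ} (z : W _⦋p + 1⦌), first z • M.δ 0 (base z) = base (W.δ 0 z)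
  δ_first : ∀ {p : ℕ} (i : Fin (p + 1)) (z : W _⦋p + 2⦌),
    U.δ i.succ (first z) = first (W.δ i.succ.succ z)
  mul_δ_first : ∀ {p : ℕ} (z : W _⦋p + 2⦌), first (W.δ 0 z) * U.δ 0 (first z) = first (W.δ 1 z)
  ext_vertex : ∀ {z z' : W _⦋0⦌}, base z = base z' → z = z'
  ext_simplex : ∀ {p : ℕ} {z z' : W _⦋p + 1⦌}, base z = base z' → first z = first z' →
    W.δ 0 z = W.δ 0 z' → z = z'
  exists_vertex : ∀ x : M _⦋0⦌, ∃ z, base z = x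
  exists_simplex : ∀ {p : ℕ} (x : M _⦋p + 1⦌) (g : U _⦋p⦌) (w : W _⦋p⦌), g • M.δ 0 x = base w →
    ∃ z : W _⦋p + 1⦌, base z = x ∧ first z = g ∧ W.δ 0 z = w

namespace HomotopyQuotient

attribute [instance] HomotopyQuotient.group HomotopyQuotient.action

/-- Morphisms of homotopy quotients. -/
structure Hom (A B : HomotopyQuotient.{w}) where
  /-- the map of simplicial sets -/
  M : A.M ⟶ B.M
  /-- the map of simplicial groups -/
  U : A.U ⟶ B.U
  /-- the map of quotients -/
  W : A.W ⟶ B.W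
  map_mul : ∀ {p : ℕ} (g h : A.U _⦋p⦌), U.app _ (g * h) = U.app _ g * U.app _ h
  map_smul : ∀ {p : ℕ} (g : A.U _⦋p⦌) (x : A.M _⦋p⦌), M.app _ (g • x) = U.app _ g • M.app _ x
  base_map : ∀ {p : ℕ} (z : A.W _⦋p⦌), B.base (W.app _ z) = M.app _ (A.base z)
  first_map : ∀ {p : ℕ} (z : A.W _⦋p + 1⦌), B.first (W.app _ z) = U.app _ (A.first z)

variable {A B : HomotopyQuotient.{w}} {p : ℕ}

/-- The face operations on `M`. -/
def dM (i : Fin (p + 2)) (x : A.M _⦋p + 1⦌) : A.M _⦋p⦌ := A.M.δ i x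

/-- The face operations on `U`. -/
def dU (i : Fin (p + 2)) : A.U _⦋p + 1⦌ →* A.U _⦋p⦌ := MonoidHom.mk' (fun g => A.U.δ i g) (A.δ_mul i)

/-- The face operations on `W`. -/
def face (i : Fin (p + 2)) (z : A.W _⦋p + 1⦌) : A.W _⦋p⦌ := A.W.δ i z

lemma dM_smul (i : Fin (p + 2)) (g : A.U _⦋p + 1⦌) (x : A.M _⦋p + 1⦌) :
    dM i (g • x) = dU i g • dM i x := A.δ_smul _ _ _

lemma dM_dM {i j : Fin (p + 2)} (h : i ≤ j) (x : A.M _⦋p + 2⦌) :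
    dM i (dM j.succ x) = dM j (dM i.castSucc x) := δ_comp_δ_apply h x

lemma dU_dU {i j : Fin (p + 2)} (h : i ≤ j) (x : A.U _⦋p + 2⦌) :
    dU i (dU j.succ x) = dU j (dU i.castSucc x) := δ_comp_δ_apply (S := A.U) h x

lemma face_face {i j : Fin (p + 2)} (h : i ≤ j) (z : A.W _⦋p + 2⦌) :
    face i (face j.succ z) = face j (face i.castSucc z) := δ_comp_δ_apply h z

lemma dM_base (i : Fin (p + 1)) (z : A.W _⦋p + 1⦌) :
    dM i.succ (A.base z) = A.base (face i.succ z) := A.δ_base i z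

lemma smul_dM_base (z : A.W _⦋p + 1⦌) :
    A.first z • dM 0 (A.base z) = A.base (face 0 z) := A.smul_δ_base z

lemma dU_first (i : Fin (p + 1)) (z : A.W _⦋p + 2⦌) :
    dU i.succ (A.first z) = A.first (face i.succ.succ z) := A.δ_first i z

lemma mul_dU_first (z : A.W _⦋p + 2⦌) :
    A.first (face 0 z) * dU 0 (A.first z) = A.first (face 1 z) := A.mul_δ_first z

variable (f : Hom A B)

/-- The map on `M`. -/
def Hom.hM (p : ℕ) (x : A.M _⦋p⦌) : B.M _⦋p⦌ := f.M.app _ x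

/-- The map on `U`. -/
def Hom.hU (p : ℕ) : A.U _⦋p⦌ →* B.U _⦋p⦌ := MonoidHom.mk' (fun g => f.U.app _ g) f.map_mul

/-- The map on `W`. -/
def Hom.hW (z : A.W _⦋p⦌) : B.W _⦋p⦌ := f.W.app _ z

lemma Hom.hM_smul (g : A.U _⦋p⦌) (x : A.M _⦋p⦌) : f.hM p (g • x) = f.hU p g • f.hM p x :=
  f.map_smul g x

lemma Hom.hU_dU (i : Fin (p + 2)) (g : A.U _⦋p + 1⦌) : f.hU p (dU i g) = dU i (f.hU (p + 1) g) :=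
  NatTrans.naturality_apply f.U (SimplexCategory.δ i).op g

lemma Hom.hM_dM (i : Fin (p + 2)) (g : A.M _⦋p + 1⦌) : f.hM p (dM i g) = dM i (f.hM (p + 1) g) :=
  NatTrans.naturality_apply f.M (SimplexCategory.δ i).op g

lemma Hom.face_hW (i : Fin (p + 2)) (z : A.W _⦋p + 1⦌) : face i (f.hW z) = f.hW (face i z) :=
  (NatTrans.naturality_apply f.W (SimplexCategory.δ i).op z).symm

lemma Hom.base_hW (z : A.W _⦋p⦌) : B.base (f.hW z) = f.hM p (A.base z) := f.base_map z

lemma Hom.first_hW (z : A.W _⦋p + 1⦌) : B.first (f.hW z) = f.hU p (A.first z) := f.first_map z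

/-- The filling property for `M`, written out. -/
lemma exists_fill_mc {S : Set (Fin (p + 2))} (h : FaceFilling f.M p S)
    (x : Fin (p + 2) → A.M _⦋p⦌) (y : B.M _⦋p + 1⦌)
    (hx : A.M.CompatibleFaces p S x) (hxy : ∀ i ∈ S, f.hM p (x i) = dM i y) :
    ∃ z : A.M _⦋p + 1⦌, f.hM (p + 1) z = y ∧ ∀ i ∈ S, dM i z = x i :=
  h x y hx hxy

lemma exists_fill_units {S : Set (Fin (p + 2))} (h : FaceFilling f.U p S)
    (x : Fin (p + 2) → A.U _⦋p⦌) (y : B.U _⦋p + 1⦌)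
    (hx : A.U.CompatibleFaces p S x) (hxy : ∀ i ∈ S, f.hU p (x i) = dU i y) :
    ∃ z : A.U _⦋p + 1⦌, f.hU (p + 1) z = y ∧ ∀ i ∈ S, dU i z = x i :=
  h x y hx hxy

/-- The faces of the object of a filler, in terms of the A.first arrow `g`. -/
def objFace (g : A.U _⦋p⦌) (x : Fin (p + 2) → A.W _⦋p⦌) :
    Fin (p + 2) → A.M _⦋p⦌ :=
  Fin.cons (g⁻¹ • A.base (x 0)) fun i => A.base (x i.succ)

/-- The faces of the A.first arrow of a filler. -/
def arrFace (x : Fin (p + 3) → A.W _⦋p + 1⦌) :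
    Fin (p + 2) → A.U _⦋p⦌ :=
  Fin.cons ((A.first (x 0))⁻¹ * A.first (x 1)) fun i => A.first (x i.succ.succ)

lemma exists_fill_of_arrow {S : Set (Fin (p + 2))} (h0 : 0 ∈ S)
    (hM : FaceFilling (f.M) p S) (x : Fin (p + 2) → A.W _⦋p⦌)
    (y : B.W _⦋p + 1⦌) (hxy : ∀ i ∈ S, f.hW (x i) = face i y)
    (g : A.U _⦋p⦌) (hg : f.hU p g = B.first y)
    (hc : A.M.CompatibleFaces p S (objFace g x)) :
    ∃ z : A.W _⦋p + 1⦌, f.hW z = y ∧ A.first z = g ∧ face 0 z = x 0 ∧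
      ∀ i : Fin (p + 1), i.succ ∈ S → A.base (face i.succ z) = A.base (x i.succ) := by
  obtain ⟨m, hm, hm'⟩ := exists_fill_mc f hM (objFace g x) (B.base y) hc fun i hi => by
    refine Fin.cases (fun hi => ?_) (fun i hi => ?_) i hi
    · change f.hM p (g⁻¹ • A.base (x 0)) = _
      rw [f.hM_smul, ← f.base_hW, hxy 0 hi, ← smul_dM_base, ← hg]
      change (f.hU p g⁻¹) • _ = _
      rw [map_inv, inv_smul_smul]
    · change f.hM p (A.base (x i.succ)) = _
      rw [← f.base_hW, hxy _ hi, dM_base]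
  have hw : g • dM 0 m = A.base (x 0) := by
    rw [hm' 0 h0]
    exact smul_inv_smul _ _
  obtain ⟨z, hb, hf, hz⟩ : ∃ z, A.base z = m ∧ A.first z = g ∧ face 0 z = x 0 :=
    A.exists_simplex m g (x 0) hw
  refine ⟨z, B.ext_simplex ?_ ?_ ?_, hf, hz, fun i hi => ?_⟩
  · rw [f.base_hW, hb, hm]
  · rw [f.first_hW, hf, hg]
  · refine (f.face_hW 0 z).trans ?_
    rw [hz, hxy 0 h0]
    rfl
  · rw [← dM_base, hb, hm' _ hi]
    rfl

lemma compatibleFaces_objFace {S : Set (Fin (p + 3))} (x : Fin (p + 3) → A.W _⦋p + 1⦌)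
    (hx : ∀ i j : Fin (p + 2), i ≤ j → i.castSucc ∈ S → j.succ ∈ S →
      face i (x j.succ) = face j (x i.castSucc))
    (g : A.U _⦋p + 1⦌)
    (hg : ∀ i : Fin (p + 2), i.succ ∈ S → dU i g = arrFace x i) :
    A.M.CompatibleFaces (p + 1) S (objFace g x) := by
  intro i j hij hi hj
  change dM i (A.base (x j.succ)) = dM j (objFace g x i.castSucc)
  have h1 := congrArg A.base (hx i j hij hi hj)
  revert h1 hi hij
  refine Fin.cases (fun hij hi h1 => ?_) (fun i hij hi h1 => ?_) i
  · change _ = dM j (g⁻¹ • A.base (x 0))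
    rw [dM_smul, map_inv, eq_inv_smul_iff, hg j hj]
    change A.base (face 0 _) = A.base (face j (x 0)) at h1
    rw [← smul_dM_base] at h1
    revert h1
    refine Fin.cases (fun h1 => ?_) (fun j h1 => ?_) j
    · rw [← smul_dM_base] at h1
      change ((A.first (x 0))⁻¹ * A.first (x 1)) • _ = _
      rw [mul_smul, inv_smul_eq_iff]
      exact h1
    · rw [dM_base]
      exact h1
  · obtain ⟨j, rfl⟩ : ∃ j', j = Fin.succ j' := ⟨j.pred (by rintro rfl; simp at hij), by simp⟩
    change _ = dM j.succ (A.base (x i.castSucc.succ))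
    rw [dM_base, dM_base]
    exact h1

lemma compatibleFaces_arrFace {S : Set (Fin (p + 4))} (h0 : 0 ∈ S)
    (x : Fin (p + 4) → A.W _⦋p + 2⦌)
    (hx : ∀ i j : Fin (p + 3), i ≤ j → i.castSucc ∈ S → j.succ ∈ S →
      face i (x j.succ) = face j (x i.castSucc)) :
    A.U.CompatibleFaces (p + 1) (Fin.succ ⁻¹' S) (arrFace x) := by
  intro i j hij hi hj
  change dU i (A.first (x j.succ.succ)) = dU j (arrFace x i.castSucc)
  have h1 := congrArg A.first (hx i.succ j.succ (Fin.succ_le_succ_iff.2 hij) hi hj)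
  revert h1 hi hij
  refine Fin.cases (fun hij hi h1 => ?_) (fun i hij hi h1 => ?_) i
  · change _ = dU j ((A.first (x 0))⁻¹ * A.first (x 1))
    have h2 := congrArg A.first (hx 0 j.succ (Fin.zero_le _) h0 hj)
    have h3 := congrArg A.first (hx 0 0 le_rfl h0 hi)
    change A.first (face 1 _) = A.first (face j.succ (x 1)) at h1
    change A.first (face 0 _) = A.first (face j.succ (x 0)) at h2
    change A.first (face 0 (x 1)) = A.first (face 0 (x 0)) at h3
    rw [map_mul, map_inv, eq_inv_mul_iff_mul_eq]
    rw [← mul_dU_first, h2] at h1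
    revert h1
    refine Fin.cases (fun h1 => ?_) (fun j h1 => ?_) j
    · change A.first (face 1 (x 0)) * _ = A.first (face 1 (x 1)) at h1
      rw [← mul_dU_first, ← mul_dU_first, h3, mul_assoc, mul_right_inj] at h1
      exact h1
    · rw [dU_first, dU_first]
      exact h1
  · obtain ⟨j, rfl⟩ : ∃ j', j = Fin.succ j' := ⟨j.pred (by rintro rfl; simp at hij), by simp⟩
    change _ = dU j.succ (A.first (x i.castSucc.succ.succ))
    rw [dU_first, dU_first]
    exact h1

lemma faceFilling_zero_of_mem {S : Set (Fin 2)} (h0 : 0 ∈ S)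
    (hM : FaceFilling (f.M) 0 S)
    (hU : ∀ g : B.U _⦋0⦌, ∃ g', f.hU 0 g' = g) :
    FaceFilling (f.W) 0 S := by
  intro (x : Fin 2 → A.W _⦋0⦌) (y : B.W _⦋1⦌) hx hxy
  obtain ⟨g, hg⟩ := hU (B.first y)
  obtain ⟨z, hz, -, hz0, hzi⟩ := exists_fill_of_arrow f h0 hM x y hxy g hg trivial
  refine ⟨z, hz, fun i hi => ?_⟩
  revert hi
  refine Fin.cases (fun _ => hz0) (fun i hi => ?_) i
  exact A.ext_vertex (hzi i hi)

lemma faceFilling_succ_of_mem {q : ℕ} {S : Set (Fin (q + 3))} (h0 : 0 ∈ S)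
    (hM : FaceFilling (f.M) (q + 1) S)
    (hU : FaceFilling (f.U) q (Fin.succ ⁻¹' S)) :
    FaceFilling (f.W) (q + 1) S := by
  intro (x : Fin (q + 3) → A.W _⦋q + 1⦌) (y : B.W _⦋q + 2⦌)
    (hx : ∀ i j : Fin (q + 2), i ≤ j → i.castSucc ∈ S → j.succ ∈ S →
      face i (x j.succ) = face j (x i.castSucc)) (hxy : ∀ i ∈ S, f.hW (x i) = face i y)
  obtain ⟨g, hg, hg'⟩ := exists_fill_units f hU (arrFace x) (B.first y)
    (by
      cases q with
      | zero => trivial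
      | succ q => exact compatibleFaces_arrFace h0 x hx) fun i hi => by
    revert hi
    refine Fin.cases (fun hi => ?_) (fun i hi => ?_) i
    · change f.hU q ((A.first (x 0))⁻¹ * A.first (x 1)) = _
      have h2 := (f.first_hW _).symm.trans (congrArg B.first (hxy 0 h0))
      have h3 := (f.first_hW _).symm.trans (congrArg B.first (hxy 1 hi))
      change f.hU q (A.first (x 0)) = B.first (face 0 y) at h2
      change f.hU q (A.first (x 1)) = B.first (face 1 y) at h3
      rw [map_mul, map_inv, h2, h3, ← mul_dU_first, inv_mul_cancel_left]
    · rw [dU_first]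
      exact (f.first_hW _).symm.trans (congrArg B.first (hxy _ hi))
  obtain ⟨z, hz, hzg, hz0, hzi⟩ := exists_fill_of_arrow f h0 hM x y hxy g hg
    (compatibleFaces_objFace x hx g fun i hi => hg' i hi)
  refine ⟨z, hz, fun i hi => ?_⟩
  change face i z = x i
  revert hi
  refine Fin.cases (fun _ => hz0) (fun i hi => ?_) i
  refine A.ext_simplex (hzi i hi) ?_ ?_
  · have h1 := hg' i hi
    revert hi h1
    refine Fin.cases (fun hi h1 => ?_) (fun i hi h1 => ?_) i
    · change A.first (face 1 z) = _
      rw [← mul_dU_first, hz0, hzg, h1]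
      exact mul_inv_cancel_left _ _
    · rw [← dU_first, hzg, h1]
      rfl
  · refine (face_face (Fin.zero_le i) z).trans ?_
    change face i (face 0 z) = _
    rw [hz0]
    exact (hx 0 i (Fin.zero_le i) h0 hi).symm

lemma mem_compl_zero {n : ℕ} {i : Fin (n + 1)} (hi : i ∈ ({0}ᶜ : Set (Fin (n + 1)))) : i ≠ 0 := hi

lemma succ_mem_compl_zero {n : ℕ} (i : Fin n) : i.succ ∈ ({0}ᶜ : Set (Fin (n + 1))) :=
  Fin.succ_ne_zero i

lemma castSucc_succ_mem_compl_zero {n : ℕ} (i : Fin n) :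
    i.succ.castSucc ∈ ({0}ᶜ : Set (Fin (n + 2))) :=
  succ_mem_compl_zero i.castSucc

lemma faceFilling_zero_compl_zero (hM : FaceFilling (f.M) 0 {0}ᶜ)
    (hU : ∀ g : B.U _⦋0⦌, ∃ g', f.hU 0 g' = g) :
    FaceFilling (f.W) 0 {0}ᶜ := by
  intro (x : Fin 2 → A.W _⦋0⦌) (y : B.W _⦋1⦌) hx hxy
  have hxy' : ∀ i : Fin 1, f.hW (x i.succ) = face i.succ y :=
    fun i => hxy _ (succ_mem_compl_zero i)
  obtain ⟨m, hm, hm'⟩ := exists_fill_mc f hM (fun i => A.base (x i)) (B.base y) trivial fun i hi => by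
    obtain ⟨i, rfl⟩ := Fin.exists_succ_eq.2 (mem_compl_zero hi)
    rw [← f.base_hW, hxy' i, dM_base]
  have hms : ∀ i : Fin 1, dM i.succ m = A.base (x i.succ) := fun i =>
    hm' _ (succ_mem_compl_zero i)
  obtain ⟨g, hg⟩ := hU (B.first y)
  obtain ⟨v, hv⟩ := A.exists_vertex (g • dM 0 m)
  obtain ⟨z, hb, hf, hz⟩ : ∃ z, A.base z = m ∧ A.first z = g ∧ face 0 z = v :=
    A.exists_simplex m g v hv.symm
  refine ⟨z, B.ext_simplex ?_ ?_ ?_, fun i hi => ?_⟩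
  · exact (f.base_hW _).trans (by rw [hb, hm])
  · exact (f.first_hW _).trans (by rw [hf]; exact hg)
  · refine (f.face_hW 0 _).trans ?_
    rw [hz]
    change f.hW v = face 0 y
    refine B.ext_vertex ?_
    rw [f.base_hW, hv, f.hM_smul, ← smul_dM_base, ← hm, hg, f.hM_dM]
  · obtain ⟨i, rfl⟩ := Fin.exists_succ_eq.2 (mem_compl_zero hi)
    refine A.ext_vertex ?_
    refine (dM_base i _).symm.trans ?_
    rw [hb]
    exact hms i

lemma faceFilling_succ_compl_zero {q : ℕ} (hM : FaceFilling (f.M) (q + 1) {0}ᶜ)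
    (hU : FaceFilling (f.U) q {0}ᶜ) :
    FaceFilling (f.W) (q + 1) {0}ᶜ := by
  intro (x : Fin (q + 3) → A.W _⦋q + 1⦌) (y : B.W _⦋q + 2⦌)
    (hx : ∀ i j : Fin (q + 2), i ≤ j → i.castSucc ∈ ({0}ᶜ : Set (Fin (q + 3))) →
      j.succ ∈ ({0}ᶜ : Set (Fin (q + 3))) → face i (x j.succ) = face j (x i.castSucc)) hxy
  have hxy' : ∀ i : Fin (q + 2), f.hW (x i.succ) = face i.succ y :=
    fun i => hxy _ (succ_mem_compl_zero i)
  have hx' : ∀ i j : Fin (q + 1), i ≤ j → face i.succ (x j.succ.succ) =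
      face j.succ (x i.castSucc.succ) := fun i j hij =>
    hx i.succ j.succ (Fin.succ_le_succ_iff.2 hij) (castSucc_succ_mem_compl_zero i)
      (succ_mem_compl_zero _)
  obtain ⟨m, hm, hm'⟩ := exists_fill_mc f hM (fun i => A.base (x i)) (B.base y)
    (by
      intro i j hij hi hj
      obtain ⟨i, rfl⟩ : ∃ i', Fin.succ i' = i := Fin.exists_succ_eq.2 (by rintro rfl; exact hi rfl)
      obtain ⟨j, rfl⟩ : ∃ j', Fin.succ j' = j := Fin.exists_succ_eq.2 (by rintro rfl; simp at hij)
      change dM i.succ (A.base (x j.succ.succ)) = dM j.succ (A.base (x i.castSucc.succ))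
      rw [dM_base, dM_base, hx' i j (Fin.succ_le_succ_iff.1 hij)]) fun i hi => by
    obtain ⟨i, rfl⟩ := Fin.exists_succ_eq.2 (mem_compl_zero hi)
    rw [← f.base_hW, hxy' i, dM_base]
  have hms : ∀ i : Fin (q + 2), dM i.succ m = A.base (x i.succ) := fun i =>
    hm' _ (succ_mem_compl_zero i)
  obtain ⟨g, hg, hg'⟩ := exists_fill_units f hU (fun i => A.first (x i.succ)) (B.first y)
    (by
      cases q with
      | zero => trivial
      | succ q =>
        intro i j hij hi hj
        obtain ⟨i, rfl⟩ : ∃ i', Fin.succ i' = i :=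
          Fin.exists_succ_eq.2 (by rintro rfl; exact hi rfl)
        obtain ⟨j, rfl⟩ : ∃ j', Fin.succ j' = j := Fin.exists_succ_eq.2 (by rintro rfl; simp at hij)
        change dU i.succ (A.first (x j.succ.succ.succ)) = dU j.succ (A.first (x i.castSucc.succ.succ))
        rw [dU_first, dU_first]
        exact congrArg A.first (hx' i.succ j.succ hij)) fun i hi => by
      obtain ⟨i, rfl⟩ := Fin.exists_succ_eq.2 (mem_compl_zero hi)
      rw [dU_first, ← hxy' i.succ]
      exact (f.first_hW _).symm
  have hgs : ∀ i : Fin (q + 1), dU i.succ g = A.first (x i.succ.succ) := fun i =>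
    hg' _ (succ_mem_compl_zero i)
  have hv : (A.first (x 1) * (dU 0 g)⁻¹) • dM 0 (g • dM 0 m) = A.base (face 0 (x 1)) := by
    rw [dM_smul, mul_smul, inv_smul_smul, ← smul_dM_base]
    congr 1
    refine (dM_dM (le_refl (0 : Fin (q + 2))) m).symm.trans ?_
    exact congrArg _ (hms 0)
  obtain ⟨v, hvb, hvf, hvz⟩ : ∃ v : A.W _⦋q + 1⦌, A.base v = g • dM 0 m ∧
      A.first v = A.first (x 1) * (dU 0 g)⁻¹ ∧ face 0 v = face 0 (x 1) :=
    A.exists_simplex _ _ _ hv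
  obtain ⟨z, hb, hf, hz⟩ : ∃ z : A.W _⦋q + 2⦌, A.base z = m ∧ A.first z = g ∧ face 0 z = v :=
    A.exists_simplex _ _ _ hvb.symm
  refine ⟨z, B.ext_simplex ?_ ?_ ?_, fun i hi => ?_⟩
  · exact (f.base_hW _).trans (by rw [hb, hm])
  · exact (f.first_hW _).trans (by rw [hf]; exact hg)
  · refine (f.face_hW 0 _).trans ?_
    rw [hz]
    change f.hW v = face 0 y
    refine B.ext_simplex ?_ ?_ ?_
    · rw [f.base_hW, hvb, f.hM_smul, ← smul_dM_base, ← hm, hg, f.hM_dM]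
    · rw [f.first_hW, hvf]
      change f.hU q _ = _
      rw [map_mul, map_inv]
      have h1 : f.hU q (A.first (x 1)) = B.first (face 1 y) := (f.first_hW _).symm.trans (congrArg B.first (hxy' 0))
      have h2 : f.hU q (dU 0 g) = dU 0 (B.first y) := by
        rw [← hg]
        exact f.hU_dU _ g
      rw [h1, h2, ← mul_dU_first, mul_inv_cancel_right]
    · change face 0 (f.hW v) = face 0 (face 0 y)
      rw [f.face_hW, hvz, ← f.face_hW]
      refine (congrArg (face 0) (hxy' 0)).trans ?_
      exact face_face (le_refl (0 : Fin (q + 2))) y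
  · obtain ⟨i, rfl⟩ := Fin.exists_succ_eq.2 (mem_compl_zero hi)
    change face i.succ z = x i.succ
    refine A.ext_simplex ?_ ?_ ?_
    · rw [← dM_base, hb, hms]
    · refine Fin.cases ?_ (fun i => ?_) i
      · change A.first (face 1 _) = A.first (x 1)
        rw [← mul_dU_first, hz, hf, hvf, inv_mul_cancel_right]
      · rw [← dU_first, hf, hgs]
    · refine (face_face (Fin.zero_le i) _).trans ?_
      change face i (face 0 _) = _
      rw [hz]
      refine Fin.cases hvz (fun i => ?_) i
      have hbi : A.base (face i.succ v) = A.base (face 0 (x i.succ.succ)) := by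
        rw [← dM_base, hvb, dM_smul, hgs, ← smul_dM_base, ← hms]
        congr 1
        exact (dM_dM (Fin.zero_le i.succ) m).symm
      have h10 : face 1 (x i.succ.succ) = face i.succ (x 1) := hx' 0 i (Fin.zero_le i)
      cases q with
      | zero => exact A.ext_vertex hbi
      | succ q =>
        refine A.ext_simplex hbi ?_ ?_
        · have h2 := congrArg A.first h10
          rw [← mul_dU_first] at h2
          rw [← hgs i] at h2
          have h3 : dU 0 (dU i.succ g) = dU i (dU 0 g) := dU_dU (Fin.zero_le i) g
          rw [h3] at h2
          revert h2
          refine Fin.cases (fun h2 => ?_) (fun i h2 => ?_) i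
          · change A.first (face 1 v) = _
            change _ = A.first (face 1 (x 1)) at h2
            rw [← mul_dU_first, hvz, hvf, map_mul, map_inv, ← mul_assoc, mul_dU_first]
            rw [← h2, mul_inv_cancel_right]
            rfl
          · rw [← dU_first, hvf, map_mul, map_inv, dU_first, ← h2, mul_inv_cancel_right]
            rfl
        · refine (face_face (Fin.zero_le i) v).trans ?_
          change face i (face 0 v) = _
          rw [hvz]
          refine (face_face (Fin.zero_le i) (x 1)).symm.trans ?_
          rw [← h10]
          exact face_face (le_refl (0 : Fin (q + 2))) (x i.succ.succ)

theorem rlp_J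
    (hM : modelCategoryQuillen.J.rlp (f.M))
    (hU : modelCategoryQuillen.J.rlp (f.U))
    (hU0 : ∀ g : B.U _⦋0⦌, ∃ g', f.hU 0 g' = g) :
    modelCategoryQuillen.J.rlp (f.W) := by
  rw [rlp_J_iff] at hM hU ⊢
  intro n k
  refine Fin.cases ?_ (fun k => ?_) k
  · cases n with
    | zero => exact faceFilling_zero_compl_zero f (hM 0 0) hU0
    | succ q => exact faceFilling_succ_compl_zero f (hM (q + 1) 0) (hU q 0)
  · have h0 : (0 : Fin (n + 2)) ∈ ({k.succ}ᶜ : Set (Fin (n + 2))) := (Fin.succ_ne_zero k).symm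
    cases n with
    | zero => exact faceFilling_zero_of_mem f h0 (hM 0 _) hU0
    | succ q =>
      refine faceFilling_succ_of_mem f h0 (hM (q + 1) _) ?_
      have : Fin.succ ⁻¹' ({k.succ}ᶜ : Set (Fin (q + 3))) = {k}ᶜ := by
        ext i; simp
      rw [this]
      exact hU q k

theorem rlp_I
    (hM : modelCategoryQuillen.I.rlp (f.M))
    (hU : modelCategoryQuillen.I.rlp (f.U)) :
    modelCategoryQuillen.I.rlp (f.W) := by
  rw [rlp_I_iff] at hM hU ⊢
  refine ⟨fun (y : B.W _⦋0⦌) => ?_, fun n => ?_⟩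
  · obtain ⟨m, hm⟩ := hM.1 (B.base y)
    obtain ⟨v, rfl⟩ := A.exists_vertex m
    exact ⟨v, B.ext_vertex ((f.base_hW _).trans hm)⟩
  · cases n with
    | zero => exact faceFilling_zero_of_mem f (Set.mem_univ _) (hM.2 0) hU.1
    | succ q => exact faceFilling_succ_of_mem f (Set.mem_univ _) (hM.2 (q + 1)) (hU.2 q)


end HomotopyQuotient

end

section

open SSet

namespace HomotopyQuotient

variable {A B : HomotopyQuotient.{w}} {p : ℕ}

/-- Homotopy quotients preserve levelwise surjections, if the square formed by the bases and their
last faces can be filled. -/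
theorem Hom.surjective (f : Hom A B) (hM : ∀ x : B.M _⦋0⦌, ∃ x', f.hM 0 x' = x)
    (hU : ∀ (p : ℕ) (g : B.U _⦋p⦌), ∃ g', f.hU p g' = g)
    (hd : ∀ (p : ℕ) (x : A.M _⦋p⦌) (y : B.M _⦋p + 1⦌), f.hM p x = dM 0 y →
      ∃ x' : A.M _⦋p + 1⦌, dM 0 x' = x ∧ f.hM (p + 1) x' = y) :
    ∀ (p : ℕ) (z : B.W _⦋p⦌), ∃ z', f.hW z' = z := by
  intro p
  induction p with
  | zero =>
    intro z
    obtain ⟨x, hx⟩ := hM (B.base z)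
    obtain ⟨v, rfl⟩ := A.exists_vertex x
    exact ⟨v, B.ext_vertex ((f.base_hW _).trans hx)⟩
  | succ p ih =>
    intro z
    obtain ⟨w, hw⟩ := ih (face 0 z)
    obtain ⟨g, hg⟩ := hU p (B.first z)
    obtain ⟨x, hx, hx'⟩ := hd p (g⁻¹ • A.base w) (B.base z) (by
      rw [f.hM_smul, map_inv, hg, ← f.base_hW, hw, ← smul_dM_base, inv_smul_smul])
    obtain ⟨v, hv, hv', hv0⟩ := A.exists_simplex x g w (by
      change g • dM 0 x = _
      rw [hx, smul_inv_smul])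
    refine ⟨v, B.ext_simplex ?_ ?_ ?_⟩
    · rw [f.base_hW, hv, hx']
    · rw [f.first_hW, hv', hg]
    · refine (f.face_hW 0 v).trans ?_
      exact (congrArg f.hW hv0).trans hw

/-- Homotopy quotients preserve cartesian squares. -/
theorem isPullback {P A C B : HomotopyQuotient.{w}} {a : Hom P A} {c : Hom P C} {f : Hom A B}
    {g : Hom C B} (hM : IsPullback a.M c.M f.M g.M) (hU : IsPullback a.U c.U f.U g.U)
    (hw : a.W ≫ f.W = c.W ≫ g.W) : IsPullback a.W c.W f.W g.W := by
  have hM' := fun p : ℕ => (Limits.Types.isPullback_iff _ _ _ _).1 (hM.app (op ⦋p⦌))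
  have hU' := fun p : ℕ => (Limits.Types.isPullback_iff _ _ _ _).1 (hU.app (op ⦋p⦌))
  have eM : ∀ (p : ℕ) (x y : P.M _⦋p⦌), a.hM p x = a.hM p y → c.hM p x = c.hM p y → x = y :=
    fun p x y h h' => (hM' p).2.1 x y ⟨h, h'⟩
  have eU : ∀ (p : ℕ) (x y : P.U _⦋p⦌), a.hU p x = a.hU p y → c.hU p x = c.hU p y → x = y :=
    fun p x y h h' => (hU' p).2.1 x y ⟨h, h'⟩
  have xM : ∀ (p : ℕ) (x : A.M _⦋p⦌) (y : C.M _⦋p⦌), f.hM p x = g.hM p y →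
      ∃ z, a.hM p z = x ∧ c.hM p z = y := fun p => (hM' p).2.2
  have xU : ∀ (p : ℕ) (x : A.U _⦋p⦌) (y : C.U _⦋p⦌), f.hU p x = g.hU p y →
      ∃ z, a.hU p z = x ∧ c.hU p z = y := fun p => (hU' p).2.2
  have eW : ∀ (p : ℕ) (x y : P.W _⦋p⦌), a.hW x = a.hW y → c.hW x = c.hW y → x = y := by
    intro p
    induction p with
    | zero =>
      intro x y h h'
      refine P.ext_vertex (eM _ _ _ ?_ ?_)
      · rw [← a.base_hW, ← a.base_hW, h]
      · rw [← c.base_hW, ← c.base_hW, h']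
    | succ p ih =>
      intro x y h h'
      refine P.ext_simplex (eM _ _ _ ?_ ?_) (eU _ _ _ ?_ ?_) (ih (face 0 x) (face 0 y) ?_ ?_)
      · rw [← a.base_hW, ← a.base_hW, h]
      · rw [← c.base_hW, ← c.base_hW, h']
      · rw [← a.first_hW, ← a.first_hW, h]
      · rw [← c.first_hW, ← c.first_hW, h']
      · rw [← a.face_hW, ← a.face_hW, h]
      · rw [← c.face_hW, ← c.face_hW, h']
  refine IsPullback.of_forall_isPullback_app fun ⟨n⟩ => ?_
  obtain ⟨p, rfl⟩ : ∃ p, n = ⦋p⦌ := ⟨n.len, rfl⟩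
  refine (Limits.Types.isPullback_iff _ _ _ _).2 ⟨NatTrans.congr_app hw _,
    fun x y h => eW p x y h.1 h.2, ?_⟩
  change ∀ (x : A.W _⦋p⦌) (y : C.W _⦋p⦌), f.hW x = g.hW y → ∃ z, a.hW z = x ∧ c.hW z = y
  induction p with
  | zero =>
    intro x y h
    obtain ⟨m, hm, hm'⟩ := xM 0 (A.base x) (C.base y) (by rw [← f.base_hW, h, g.base_hW])
    obtain ⟨v, rfl⟩ := P.exists_vertex m
    exact ⟨v, A.ext_vertex ((a.base_hW _).trans hm), C.ext_vertex ((c.base_hW _).trans hm')⟩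
  | succ p ih =>
    intro x y h
    obtain ⟨m, hm, hm'⟩ := xM _ (A.base x) (C.base y) (by rw [← f.base_hW, h, g.base_hW])
    obtain ⟨u, hu, hu'⟩ := xU _ (A.first x) (C.first y) (by rw [← f.first_hW, h, g.first_hW])
    obtain ⟨w, hw, hw'⟩ := ih (face 0 x) (face 0 y) (by rw [← f.face_hW, h, g.face_hW])
    obtain ⟨v, hv, hv', hv0⟩ := P.exists_simplex m u w (by
      change u • dM 0 m = _
      refine eM _ _ _ ?_ ?_
      · rw [a.hM_smul, hu, a.hM_dM, hm, ← a.base_hW, hw, smul_dM_base]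
      · rw [c.hM_smul, hu', c.hM_dM, hm', ← c.base_hW, hw', smul_dM_base])
    refine ⟨v, A.ext_simplex ?_ ?_ ?_, C.ext_simplex ?_ ?_ ?_⟩
    · rw [a.base_hW, hv, hm]
    · rw [a.first_hW, hv', hu]
    · exact (a.face_hW 0 v).trans ((congrArg a.hW hv0).trans hw)
    · rw [c.base_hW, hv, hm']
    · rw [c.first_hW, hv', hu']
    · exact (c.face_hW 0 v).trans ((congrArg c.hW hv0).trans hw')

end HomotopyQuotient

/-- The simplicial set of invertible elements of `E^0`. -/
def unitsSSet : SimplicialObject QuasiComonoid.{w} ⥤ SSet.{w} :=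
  (SimplicialObject.whiskering _ _).obj (QuasiComonoid.unitsZero ⋙ forget GrpCat)

variable {E F : SimplicialObject QuasiComonoid.{w}}

/-- The derived Deligne nerve as a homotopy quotient. -/
noncomputable def derivedDeligneQuotient (E : SimplicialObject QuasiComonoid.{w}) :
    HomotopyQuotient.{w} where
  M := maurerCartan.obj E
  U := unitsSSet.obj E
  W := derivedDeligneNerve.obj E
  group p := inferInstanceAs (Group ((E.obj (op ⦋p⦌)).X 0)ˣ)
  action p := inferInstanceAs (MulAction ((E.obj (op ⦋p⦌)).X 0)ˣ (MaurerCartan E ⦋p⦌))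
  δ_mul i := map_mul (Units.map (QuasiComonoid.Hom.zero (E.map (SimplexCategory.δ i).op)))
  δ_smul i := MaurerCartan.pull_smul (SimplexCategory.δ i)
  base := DerivedDeligne.base
  first := DerivedDeligne.first
  δ_base i z := (DerivedDeligne.base_face_succ i z).symm
  smul_δ_base z := (DerivedDeligne.base_face_zero z).symm
  δ_first i z := (DerivedDeligne.first_face_succ_succ i z).symm
  mul_δ_first z := (DerivedDeligne.first_face_one z).symm
  ext_vertex := DerivedDeligne.ext_vertex
  ext_simplex := DerivedDeligne.ext_simplex
  exists_vertex x := ⟨_, DerivedDeligne.base_mkVertex x⟩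
  exists_simplex x g w h := ⟨DerivedDeligne.mk x g w h, DerivedDeligne.base_mk ..,
    DerivedDeligne.first_mk .., DerivedDeligne.face_zero_mk ..⟩

/-- Functoriality of `derivedDeligneQuotient`. -/
noncomputable def derivedDeligneQuotientMap (f : E ⟶ F) :
    (derivedDeligneQuotient E).Hom (derivedDeligneQuotient F) where
  M := maurerCartan.map f
  U := unitsSSet.map f
  W := derivedDeligneNerve.map f
  map_mul {p} := map_mul (Units.map (QuasiComonoid.Hom.zero (f.app (op ⦋p⦌))))
  map_smul := MaurerCartan.push_smul f
  base_map _ := rfl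
  first_map _ := rfl

/-- The Deligne nerve as a homotopy quotient of a constant simplicial set. -/
noncomputable def deligneQuotient (E : SimplicialObject QuasiComonoid.{w}) :
    HomotopyQuotient.{w} where
  M := (Functor.const _).obj (MaurerCartan E ⦋0⦌)
  U := (Functor.const _).obj ((E.obj (op ⦋0⦌)).X 0)ˣ
  W := deligneNerve.obj E
  group p := inferInstanceAs (Group ((E.obj (op ⦋0⦌)).X 0)ˣ)
  action p := inferInstanceAs (MulAction ((E.obj (op ⦋0⦌)).X 0)ˣ (MaurerCartan E ⦋0⦌))
  δ_mul i _ _ := rfl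
  δ_smul i _ _ := rfl
  base {p} (z : ComposableArrows (DeligneObj E ⦋0⦌) p) := (z.obj 0).pt
  first {p} (z : ComposableArrows (DeligneObj E ⦋0⦌) (p + 1)) := DeligneObj.Hom.g (z.map' 0 1)
  δ_base {p} i (z : ComposableArrows (DeligneObj E ⦋0⦌) (p + 1)) := rfl
  smul_δ_base {p} (z : ComposableArrows (DeligneObj E ⦋0⦌) (p + 1)) :=
    (z.map' 0 1).eq
  δ_first {p} i (z : ComposableArrows (DeligneObj E ⦋0⦌) (p + 2)) := rfl
  mul_δ_first {p} (z : ComposableArrows (DeligneObj E ⦋0⦌) (p + 2)) :=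
    (DeligneObj.comp_g (z.map' 0 1) (z.map' 1 2)).symm.trans
      (congrArg DeligneObj.Hom.g (z.map_comp _ _).symm)
  ext_vertex {z z'} h := DeligneObj.composableArrows_ext_zero h
  ext_simplex {p z z'} h h' h0 := DeligneObj.composableArrows_ext_succ h h0 h'
  exists_vertex x := ⟨ComposableArrows.mk₀ ⟨x⟩, rfl⟩
  exists_simplex {p} x g (w : ComposableArrows (DeligneObj E ⦋0⦌) p) h :=
    ⟨ComposableArrows.precomp w (⟨g, h⟩ : DeligneObj.Hom ⟨x⟩ w.left), rfl, rfl, rfl⟩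

/-- Functoriality of `deligneQuotient`. -/
noncomputable def deligneQuotientMap (f : E ⟶ F) :
    (deligneQuotient E).Hom (deligneQuotient F) where
  M := (Functor.const _).map (TypeCat.ofHom (MaurerCartan.push f))
  U := (Functor.const _).map
    (TypeCat.ofHom (Units.map (QuasiComonoid.Hom.zero (f.app (op ⦋0⦌)))))
  W := deligneNerve.map f
  map_mul {p} := map_mul (Units.map (QuasiComonoid.Hom.zero (f.app (op ⦋0⦌))))
  map_smul := MaurerCartan.push_smul f
  base_map _ := rfl
  first_map _ := rfl

lemma SSet.rlp_J_const {X Y : Type w} (f : X ⟶ Y) :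
    modelCategoryQuillen.J.rlp
      ((Functor.const SimplexCategoryᵒᵖ).map f : (Functor.const _).obj X ⟶ _) := by
  rw [rlp_J_iff]
  intro n k (x : Fin (n + 2) → X) (y : Y) hx (hxy : ∀ i ∈ ({k}ᶜ : Set (Fin (n + 2))), f (x i) = y)
  obtain ⟨j, hj⟩ : ∃ j, j ∈ ({k}ᶜ : Set (Fin (n + 2))) := exists_ne k
  refine ⟨x j, hxy j hj, fun i hi => ?_⟩
  change x j = x i
  cases n with
  | zero =>
    congr 1
    simp only [Set.mem_compl_iff, Set.mem_singleton_iff] at hi hj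
    omega
  | succ n =>
    have key : ∀ i j : Fin (n + 3), i < j → i ∈ ({k}ᶜ : Set (Fin (n + 3))) →
        j ∈ ({k}ᶜ : Set (Fin (n + 3))) → x j = x i := by
      intro i j hij hi hj
      obtain ⟨i, rfl⟩ := Fin.exists_castSucc_eq.2 (Fin.ne_last_of_lt hij)
      obtain ⟨j, rfl⟩ := Fin.exists_succ_eq.2 (Fin.ne_zero_of_lt hij)
      exact hx i j (Fin.castSucc_lt_succ_iff.1 hij) hi hj
    rcases lt_trichotomy i j with h | h | h
    · exact key _ _ h hi hj
    · rw [h]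
    · exact (key _ _ h hj hi).symm

theorem derivedDeligneNerve_rlp_J (f : E ⟶ F)
    (hM : modelCategoryQuillen.J.rlp (maurerCartan.map f))
    (hU : modelCategoryQuillen.J.rlp (unitsSSet.map f))
    (hU0 : Function.Surjective (Units.map (QuasiComonoid.Hom.zero (f.app (op ⦋0⦌))))) :
    modelCategoryQuillen.J.rlp (derivedDeligneNerve.map f) :=
  HomotopyQuotient.rlp_J (derivedDeligneQuotientMap f) hM hU hU0

theorem derivedDeligneNerve_rlp_I (f : E ⟶ F)
    (hM : modelCategoryQuillen.I.rlp (maurerCartan.map f))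
    (hU : modelCategoryQuillen.I.rlp (unitsSSet.map f)) :
    modelCategoryQuillen.I.rlp (derivedDeligneNerve.map f) :=
  HomotopyQuotient.rlp_I (derivedDeligneQuotientMap f) hM hU

theorem deligneNerve_rlp_J (f : E ⟶ F)
    (hU0 : Function.Surjective (Units.map (QuasiComonoid.Hom.zero (f.app (op ⦋0⦌))))) :
    modelCategoryQuillen.J.rlp (deligneNerve.map f) :=
  HomotopyQuotient.rlp_J (deligneQuotientMap f) (SSet.rlp_J_const _) (SSet.rlp_J_const _) hU0

theorem deligneNerve_surjective (f : E ⟶ F)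
    (hM : Function.Surjective ((maurerCartan.map f).app (op ⦋0⦌)))
    (hU0 : Function.Surjective (Units.map (QuasiComonoid.Hom.zero (f.app (op ⦋0⦌)))))
    (k : SimplexCategoryᵒᵖ) : Function.Surjective ((deligneNerve.map f).app k) :=
  HomotopyQuotient.Hom.surjective (deligneQuotientMap f) hM (fun _ => hU0)
    (fun _ x _ h => ⟨x, rfl, h⟩) k.unop.len

section Pullback

variable {P A C B : SimplicialObject QuasiComonoid.{w}} {a : P ⟶ A} {c : P ⟶ C} {f : A ⟶ B}
  {g : C ⟶ B}

/-- Levelwise cartesian squares of simplicial quasi-comonoids. -/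
def IsLevelwisePullback (a : P ⟶ A) (c : P ⟶ C) (f : A ⟶ B) (g : C ⟶ B) : Prop :=
  ∀ (n : ℕ) (k : SimplexCategory), IsPullback
    ((QuasiComonoid.level n).map (a.app (op k))) ((QuasiComonoid.level n).map (c.app (op k)))
    ((QuasiComonoid.level n).map (f.app (op k))) ((QuasiComonoid.level n).map (g.app (op k)))

namespace IsLevelwisePullback

variable (h : IsLevelwisePullback a c f g)

include h

lemma w : a ≫ f = c ≫ g := by
  ext k
  refine QuasiComonoid.Hom.ext ?_
  funext n x
  exact ConcreteCategory.congr_hom (h n k.unop).w x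

lemma ext {n : ℕ} {k : SimplexCategory} {x y : (P.obj (op k)).X n}
    (h1 : QuasiComonoid.Hom.app (a.app (op k)) n x = QuasiComonoid.Hom.app (a.app (op k)) n y)
    (h2 : QuasiComonoid.Hom.app (c.app (op k)) n x = QuasiComonoid.Hom.app (c.app (op k)) n y) :
    x = y :=
  ((Limits.Types.isPullback_iff _ _ _ _).1 (h n k)).2.1 x y ⟨h1, h2⟩

lemma exists_lift {n : ℕ} {k : SimplexCategory} (x : (A.obj (op k)).X n) (y : (C.obj (op k)).X n)
    (hxy : QuasiComonoid.Hom.app (f.app (op k)) n x = QuasiComonoid.Hom.app (g.app (op k)) n y) :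
    ∃ z, QuasiComonoid.Hom.app (a.app (op k)) n z = x ∧
      QuasiComonoid.Hom.app (c.app (op k)) n z = y :=
  ((Limits.Types.isPullback_iff _ _ _ _).1 (h n k)).2.2 x y hxy

lemma isPullback_maurerCartan : IsPullback (maurerCartan.map a) (maurerCartan.map c)
    (maurerCartan.map f) (maurerCartan.map g) := by
  refine IsPullback.of_forall_isPullback_app fun ⟨k⟩ => ?_
  refine (Limits.Types.isPullback_iff _ _ _ _).2 ⟨?_, ?_, ?_⟩
  · exact NatTrans.congr_app (((maurerCartan.map_comp a f).symm.trans
      (congrArg maurerCartan.map h.w)).trans (maurerCartan.map_comp c g)) _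
  · rintro (x : MaurerCartan P k) (y : MaurerCartan P k) ⟨h1, h2⟩
    refine MaurerCartan.ext ?_
    funext n m t θ
    exact h.ext (congrFun (congrFun (congrFun (congrFun (congrArg MaurerCartan.ω h1) n) m) t) θ)
      (congrFun (congrFun (congrFun (congrFun (congrArg MaurerCartan.ω h2) n) m) t) θ)
  · intro (x : MaurerCartan A k) (y : MaurerCartan C k) hxy
    choose z hx hy using fun n m t θ => h.exists_lift (x.ω n m t θ) (y.ω n m t θ)
      (congrFun (congrFun (congrFun (congrFun (congrArg MaurerCartan.ω hxy) n) m) t) θ)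
    refine ⟨(⟨z, ?_, ?_, ?_, ?_, ?_, ?_, ?_⟩ : MaurerCartan P k), MaurerCartan.ext ?_,
      MaurerCartan.ext ?_⟩
    · intro n m m' θ t f
      refine h.ext ?_ ?_
      · rw [← QuasiComonoid.comp_app, a.naturality, QuasiComonoid.comp_app, hx, hx, x.natural]
      · rw [← QuasiComonoid.comp_app, c.naturality, QuasiComonoid.comp_app, hy, hy, y.natural]
    · intros
      refine h.ext ?_ ?_
      · rw [QuasiComonoid.Hom.map_mul, hx, hx, hx, x.mul]
      · rw [QuasiComonoid.Hom.map_mul, hy, hy, hy, y.mul]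
    · intros
      refine h.ext ?_ ?_
      · rw [QuasiComonoid.Hom.map_d, hx, hx, x.d]
      · rw [QuasiComonoid.Hom.map_d, hy, hy, y.d]
    · intros
      refine h.ext ?_ ?_
      · rw [QuasiComonoid.Hom.map_s, hx, hx, x.s]
      · rw [QuasiComonoid.Hom.map_s, hy, hy, y.s]
    · intros
      refine h.ext ?_ ?_
      · rw [QuasiComonoid.Hom.map_s, hx, hx, x.s_first]
      · rw [QuasiComonoid.Hom.map_s, hy, hy, y.s_first]
    · intros
      refine h.ext ?_ ?_
      · rw [QuasiComonoid.Hom.map_s, hx, hx, x.s_last]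
      · rw [QuasiComonoid.Hom.map_s, hy, hy, y.s_last]
    · intros
      refine h.ext ?_ ?_
      · rw [QuasiComonoid.Hom.map_s, hx, x.s_zero, QuasiComonoid.Hom.map_one]
      · rw [QuasiComonoid.Hom.map_s, hy, y.s_zero, QuasiComonoid.Hom.map_one]
    · funext n m t θ
      exact hx n m t θ
    · funext n m t θ
      exact hy n m t θ

lemma isPullback_unitsZero (k : SimplexCategory) : IsPullback
    (TypeCat.ofHom (Units.map (QuasiComonoid.Hom.zero (a.app (op k)))))
    (TypeCat.ofHom (Units.map (QuasiComonoid.Hom.zero (c.app (op k)))))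
    (TypeCat.ofHom (Units.map (QuasiComonoid.Hom.zero (f.app (op k)))))
    (TypeCat.ofHom (Units.map (QuasiComonoid.Hom.zero (g.app (op k))))) := by
  refine (Limits.Types.isPullback_iff _ _ _ _).2 ⟨?_, ?_, ?_⟩
  · refine ConcreteCategory.hom_ext _ _ fun x => Units.ext ?_
    exact ConcreteCategory.congr_hom (h 0 k).w x.val
  · rintro x y ⟨h1, h2⟩
    exact Units.ext (h.ext (congrArg Units.val h1) (congrArg Units.val h2))
  · intro x y hxy
    obtain ⟨z, hz, hz'⟩ := h.exists_lift x.val y.val (congrArg Units.val hxy)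
    have hxy' : Units.map (QuasiComonoid.Hom.zero (f.app (op k))) x⁻¹ =
        Units.map (QuasiComonoid.Hom.zero (g.app (op k))) y⁻¹ := by
      rw [map_inv, map_inv]
      exact congrArg _ hxy
    obtain ⟨z', hw, hw'⟩ := h.exists_lift x⁻¹.val y⁻¹.val (congrArg Units.val hxy')
    refine ⟨⟨z, z', h.ext ?_ ?_, h.ext ?_ ?_⟩, Units.ext hz, Units.ext hz'⟩
    all_goals
      change QuasiComonoid.Hom.zero _ _ = QuasiComonoid.Hom.zero _ _
      rw [map_mul, map_one]
    · exact (congrArg₂ (· * ·) hz hw).trans x.mul_inv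
    · exact (congrArg₂ (· * ·) hz' hw').trans y.mul_inv
    · exact (congrArg₂ (· * ·) hw hz).trans x.inv_mul
    · exact (congrArg₂ (· * ·) hw' hz').trans y.inv_mul

lemma isPullback_derivedDeligneNerve : IsPullback (derivedDeligneNerve.map a)
    (derivedDeligneNerve.map c) (derivedDeligneNerve.map f) (derivedDeligneNerve.map g) :=
  HomotopyQuotient.isPullback (a := derivedDeligneQuotientMap a) (c := derivedDeligneQuotientMap c)
    (f := derivedDeligneQuotientMap f) (g := derivedDeligneQuotientMap g)
    h.isPullback_maurerCartan
    (IsPullback.of_forall_isPullback_app fun k => h.isPullback_unitsZero k.unop)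
    (((derivedDeligneNerve.map_comp a f).symm.trans
      (congrArg derivedDeligneNerve.map h.w)).trans (derivedDeligneNerve.map_comp c g))

lemma isPullback_deligneNerve : IsPullback (deligneNerve.map a)
    (deligneNerve.map c) (deligneNerve.map f) (deligneNerve.map g) :=
  HomotopyQuotient.isPullback (a := deligneQuotientMap a) (c := deligneQuotientMap c)
    (f := deligneQuotientMap f) (g := deligneQuotientMap g)
    (IsPullback.of_forall_isPullback_app fun _ => h.isPullback_maurerCartan.app (op ⦋0⦌))
    (IsPullback.of_forall_isPullback_app fun _ => h.isPullback_unitsZero ⦋0⦌)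
    (((deligneNerve.map_comp a f).symm.trans
      (congrArg deligneNerve.map h.w)).trans (deligneNerve.map_comp c g))

end IsLevelwisePullback

end Pullback

end

section

/-! ## Square-zero extensions of algebras by modules, tangent spaces of functors -/

lemma CommAlgCat.isPullback_of_forall {R : Type u} [CommRing R] {P A B C : CommAlgCat.{u} R}
    {fst : P ⟶ A} {snd : P ⟶ C} {f : A ⟶ B} {g : C ⟶ B} (w : fst ≫ f = snd ≫ g)
    (ext : ∀ x y : P, fst.hom x = fst.hom y → snd.hom x = snd.hom y → x = y)
    (ex : ∀ a c, f.hom a = g.hom c → ∃ z, fst.hom z = a ∧ snd.hom z = c) :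
    IsPullback fst snd f g := by
  refine ⟨⟨w⟩, ⟨Limits.PullbackCone.IsLimit.mk w (fun s => ?_) (fun s => ?_) (fun s => ?_)
    (fun s m h1 h2 => ?_)⟩⟩
  · have h : ∀ x : s.pt, ∃ z, fst.hom z = s.fst.hom x ∧ snd.hom z = s.snd.hom x := fun x =>
      ex _ _ (ConcreteCategory.congr_hom s.condition x)
    choose z h1 h2 using h
    exact CommAlgCat.ofHom
      { toFun := z
        map_one' := ext _ _ (by rw [h1]; simp) (by rw [h2]; simp)
        map_mul' := fun x y => ext _ _ (by rw [h1]; simp [h1]) (by rw [h2]; simp [h2])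
        map_zero' := ext _ _ (by rw [h1]; simp) (by rw [h2]; simp)
        map_add' := fun x y => ext _ _ (by rw [h1]; simp [h1]) (by rw [h2]; simp [h2])
        commutes' := fun r => ext _ _ (by rw [h1]; simp) (by rw [h2]; simp) }
  · refine CommAlgCat.hom_ext (AlgHom.ext fun x => ?_)
    exact (ex _ _ (ConcreteCategory.congr_hom s.condition x)).choose_spec.1
  · refine CommAlgCat.hom_ext (AlgHom.ext fun x => ?_)
    exact (ex _ _ (ConcreteCategory.congr_hom s.condition x)).choose_spec.2
  · refine CommAlgCat.hom_ext (AlgHom.ext fun x => ext _ _ ?_ ?_)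
    · exact (ConcreteCategory.congr_hom h1 x).trans
        (ex _ _ (ConcreteCategory.congr_hom s.condition x)).choose_spec.1.symm
    · exact (ConcreteCategory.congr_hom h2 x).trans
        (ex _ _ (ConcreteCategory.congr_hom s.condition x)).choose_spec.2.symm

/-- The trivial square-zero extension `Q ⊕ M` of a commutative ring `Q` by a `Q`-module `M`. -/
@[ext]
structure SqExt (Q M : Type u) : Type u where
  /-- the component in `Q` -/
  fst : Q
  /-- the component in `M` -/
  snd : M

namespace SqExt

variable {R Q M N : Type u} [CommRing R] [CommRing Q] [Algebra R Q] [AddCommGroup M] [Module Q M]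
  [AddCommGroup N] [Module Q N]

instance : Zero (SqExt Q M) := ⟨⟨0, 0⟩⟩

instance : One (SqExt Q M) := ⟨⟨1, 0⟩⟩

instance : Add (SqExt Q M) := ⟨fun x y => ⟨x.fst + y.fst, x.snd + y.snd⟩⟩

instance : Neg (SqExt Q M) := ⟨fun x => ⟨-x.fst, -x.snd⟩⟩

instance : Mul (SqExt Q M) := ⟨fun x y => ⟨x.fst * y.fst, x.fst • y.snd + y.fst • x.snd⟩⟩

instance : CommRing (SqExt Q M) where
  nsmul := nsmulRec
  zsmul := zsmulRec
  add_assoc _ _ _ := SqExt.ext (add_assoc _ _ _) (add_assoc _ _ _)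
  zero_add _ := SqExt.ext (zero_add _) (zero_add _)
  add_zero _ := SqExt.ext (add_zero _) (add_zero _)
  add_comm _ _ := SqExt.ext (add_comm _ _) (add_comm _ _)
  neg_add_cancel _ := SqExt.ext (neg_add_cancel _) (neg_add_cancel _)
  mul_assoc x y z := SqExt.ext (mul_assoc _ _ _) (by
    change (x.fst * y.fst) • z.snd + z.fst • (x.fst • y.snd + y.fst • x.snd) =
      x.fst • (y.fst • z.snd + z.fst • y.snd) + (y.fst * z.fst) • x.snd
    simp only [mul_smul, smul_add, smul_comm z.fst, add_assoc])
  one_mul x := SqExt.ext (one_mul _) (by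
    change (1 : Q) • x.snd + x.fst • (0 : M) = x.snd
    simp)
  mul_one x := SqExt.ext (mul_one _) (by
    change x.fst • (0 : M) + (1 : Q) • x.snd = x.snd
    simp)
  mul_comm x y := SqExt.ext (mul_comm _ _) (add_comm _ _)
  zero_mul x := SqExt.ext (zero_mul _) (by
    change (0 : Q) • x.snd + x.fst • (0 : M) = 0
    simp)
  mul_zero x := SqExt.ext (mul_zero _) (by
    change x.fst • (0 : M) + (0 : Q) • x.snd = 0
    simp)
  left_distrib x y z := SqExt.ext (mul_add _ _ _) (by
    change x.fst • (y.snd + z.snd) + (y.fst + z.fst) • x.snd =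
      (x.fst • y.snd + y.fst • x.snd) + (x.fst • z.snd + z.fst • x.snd)
    rw [smul_add, add_smul, add_add_add_comm])
  right_distrib x y z := SqExt.ext (add_mul _ _ _) (by
    change (x.fst + y.fst) • z.snd + z.fst • (x.snd + y.snd) =
      (x.fst • z.snd + z.fst • x.snd) + (y.fst • z.snd + z.fst • y.snd)
    rw [smul_add, add_smul, add_add_add_comm])

lemma mul_snd (x y : SqExt Q M) : (x * y).snd = x.fst • y.snd + y.fst • x.snd := rfl

instance : Algebra R (SqExt Q M) :=
  RingHom.toAlgebra
    { toFun := fun r => ⟨algebraMap R Q r, 0⟩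
      map_one' := SqExt.ext (map_one _) rfl
      map_zero' := SqExt.ext (map_zero _) rfl
      map_add' := fun x y => SqExt.ext (map_add _ _ _) (add_zero (0 : M)).symm
      map_mul' := fun x y => SqExt.ext (map_mul _ _ _) (by rw [mul_snd]; simp) }

variable (R Q M)

/-- The projection `Q ⊕ M → Q`. -/
def fstHom : SqExt Q M →ₐ[R] Q where
  toFun := fst
  map_one' := rfl
  map_zero' := rfl
  map_add' _ _ := rfl
  map_mul' _ _ := rfl
  commutes' _ := rfl

/-- The inclusion `Q → Q ⊕ M`. -/
def inlHom : Q →ₐ[R] SqExt Q M where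
  toFun q := ⟨q, 0⟩
  map_one' := rfl
  map_zero' := rfl
  map_add' _ _ := SqExt.ext rfl (add_zero (0 : M)).symm
  map_mul' _ _ := SqExt.ext rfl (by rw [mul_snd]; simp)
  commutes' _ := rfl

variable {Q M}

/-- The map `Q ⊕ M → Q' ⊕ M'` induced by a homomorphism `Q → Q'` and a semilinear map
`M → M'`. -/
def mapHom {Q' M' : Type u} [CommRing Q'] [Algebra R Q'] [AddCommGroup M'] [Module Q' M']
    (α : Q →ₐ[R] Q') (φ : M →+ M') (h : ∀ q m, φ (q • m) = α q • φ m) :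
    SqExt Q M →ₐ[R] SqExt Q' M' where
  toFun x := ⟨α x.fst, φ x.snd⟩
  map_one' := SqExt.ext (map_one _) (map_zero _)
  map_zero' := SqExt.ext (map_zero _) (map_zero _)
  map_add' _ _ := SqExt.ext (map_add _ _ _) (map_add _ _ _)
  map_mul' x y := SqExt.ext (map_mul _ _ _) (by
    change φ (x.fst • y.snd + y.fst • x.snd) = α x.fst • φ y.snd + α y.fst • φ x.snd
    rw [map_add, h, h])
  commutes' r := SqExt.ext (α.commutes r) (map_zero _)

/-- The map `Q ⊕ M → Q ⊕ N` induced by a linear map `M → N`. -/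
def mapLin (φ : M →ₗ[Q] N) : SqExt Q M →ₐ[R] SqExt Q N :=
  mapHom R (AlgHom.id R Q) φ.toAddMonoidHom (φ.map_smul)

/-- The map `(a, m) ↦ a + j m` from `Q ⊕ M` to `Q`, for `j` linear with image of square zero. -/
def addHom (j : M →ₗ[Q] Q) (hj : ∀ m m', j m * j m' = 0) : SqExt Q M →ₐ[R] Q where
  toFun x := x.fst + j x.snd
  map_one' := by
    change (1 : Q) + j 0 = 1
    simp
  map_zero' := by
    change (0 : Q) + j 0 = 0
    simp
  map_add' x y := by
    change x.fst + y.fst + j (x.snd + y.snd) = _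
    rw [map_add, add_add_add_comm]
  map_mul' x y := by
    change x.fst * y.fst + j (x.fst • y.snd + y.fst • x.snd) = _
    rw [map_add, map_smul, map_smul, smul_eq_mul, smul_eq_mul]
    linear_combination - hj x.snd y.snd
  commutes' r := by
    change algebraMap R Q r + j 0 = _
    simp

end SqExt

/-- Functors on algebras preserving fibre products with square-zero extensions. -/
class HomogeneousFunctor {R : Type u} [CommRing R] (F : CommAlgCat.{u} R ⥤ Type w) : Prop where
  out : IsHomogeneous (algSquareZero R) F

section Glue

variable {R P A B C : Type u} [CommRing R] [CommRing P] [Algebra R P] [CommRing A] [Algebra R A]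
  [CommRing B] [Algebra R B] [CommRing C] [Algebra R C]

/-- Cartesian squares of algebras with one side a square-zero extension. -/
structure IsSqZeroPullback (fst : P →ₐ[R] A) (snd : P →ₐ[R] C) (f : A →ₐ[R] B) (g : C →ₐ[R] B) :
    Prop where
  surj : Function.Surjective f
  sq : ∀ x y, f x = 0 → f y = 0 → x * y = 0
  w : ∀ z, f (fst z) = g (snd z)
  ext : ∀ x y, fst x = fst y → snd x = snd y → x = y
  ex : ∀ a c, f a = g c → ∃ z, fst z = a ∧ snd z = c

/-- The map `F(A) → F(B)` induced by a homomorphism of algebras. -/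
def algMap (F : CommAlgCat.{u} R ⥤ Type w) (f : A →ₐ[R] B) :
    F.obj (.of R A) → F.obj (.of R B) :=
  F.map (CommAlgCat.ofHom f)

variable (F : CommAlgCat.{u} R ⥤ Type w)

lemma algMap_comp (f : A →ₐ[R] B) (g : B →ₐ[R] C) (x : F.obj (.of R A)) :
    algMap F g (algMap F f x) = algMap F (g.comp f) x :=
  (ConcreteCategory.congr_hom (F.map_comp (CommAlgCat.ofHom f) (CommAlgCat.ofHom g)) x).symm

lemma algMap_id (x : F.obj (.of R A)) : algMap F (AlgHom.id R A) x = x :=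
  ConcreteCategory.congr_hom (F.map_id (.of R A)) x

variable [HomogeneousFunctor F] {fst : P →ₐ[R] A} {snd : P →ₐ[R] C} {f : A →ₐ[R] B}
  {g : C →ₐ[R] B}

lemma IsSqZeroPullback.isPullback (h : IsSqZeroPullback fst snd f g) :
    IsPullback (F.map (CommAlgCat.ofHom fst)) (F.map (CommAlgCat.ofHom snd))
      (F.map (CommAlgCat.ofHom f)) (F.map (CommAlgCat.ofHom g)) :=
  HomogeneousFunctor.out (F := F) ⟨h.surj, h.sq⟩ (CommAlgCat.isPullback_of_forall
    (CommAlgCat.hom_ext (AlgHom.ext h.w)) h.ext h.ex)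

lemma IsSqZeroPullback.map_ext (h : IsSqZeroPullback fst snd f g) {x y : F.obj (.of R P)}
    (h1 : algMap F fst x = algMap F fst y) (h2 : algMap F snd x = algMap F snd y) : x = y :=
  ((Limits.Types.isPullback_iff _ _ _ _).1 (h.isPullback F)).2.1 x y ⟨h1, h2⟩

lemma IsSqZeroPullback.exists_map (h : IsSqZeroPullback fst snd f g) (a : F.obj (.of R A))
    (c : F.obj (.of R C)) (hac : algMap F f a = algMap F g c) :
    ∃ z, algMap F fst z = a ∧ algMap F snd z = c :=
  ((Limits.Types.isPullback_iff _ _ _ _).1 (h.isPullback F)).2.2 a c hac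

end Glue

/-- The tangent space of `F` at `u ∈ F(Q)`, with coefficients in a `Q`-module `M`: the fibre
of `F(Q ⊕ M) → F(Q)` over `u`. -/
def Tan {R Q : Type u} [CommRing R] [CommRing Q] [Algebra R Q] (F : CommAlgCat.{u} R ⥤ Type w)
    (u : F.obj (.of R Q)) (M : Type u) [AddCommGroup M] [Module Q M] : Type w :=
  {x : F.obj (.of R (SqExt Q M)) // algMap F (SqExt.fstHom R Q M) x = u}

namespace Tan

variable {R Q : Type u} [CommRing R] [CommRing Q] [Algebra R Q] {F : CommAlgCat.{u} R ⥤ Type w}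
  {u : F.obj (.of R Q)} {L M N P : Type u} [AddCommGroup M] [Module Q M] [AddCommGroup N]
  [Module Q N] [AddCommGroup P] [Module Q P] [AddCommGroup L] [Module Q L]

/-- The functoriality in `M`. -/
def map (φ : M →ₗ[Q] N) (x : Tan F u M) : Tan F u N :=
  ⟨algMap F (SqExt.mapLin R φ) x.1, (algMap_comp F _ _ _).trans x.2⟩

lemma map_map (φ : M →ₗ[Q] N) (ψ : N →ₗ[Q] P) (x : Tan F u M) :
    map ψ (map φ x) = map (ψ ∘ₗ φ) x :=
  Subtype.ext (algMap_comp F _ _ _)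

lemma map_id (x : Tan F u M) : map LinearMap.id x = x := Subtype.ext (algMap_id F x.1)

variable (F u M) in
/-- The zero vector. -/
def zero : Tan F u M := ⟨algMap F (SqExt.inlHom R Q M) u, (algMap_comp F _ _ _).trans (algMap_id F u)⟩

lemma map_zero_lin (x : Tan F u M) : map (0 : M →ₗ[Q] N) x = zero F u N := by
  refine Subtype.ext (Eq.trans ?_ (congrArg (algMap F (SqExt.inlHom R Q N)) x.2))
  exact (algMap_comp F (SqExt.fstHom R Q M) (SqExt.inlHom R Q N) x.1).symm

lemma map_zero_vec (φ : M →ₗ[Q] N) : map φ (zero F u M) = zero F u N := by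
  rw [← map_zero_lin (N := M) (zero F u M), map_map, LinearMap.comp_zero, map_zero_lin]

lemma isSqZeroPullback_prod : IsSqZeroPullback (SqExt.mapLin R (LinearMap.fst Q M N))
    (SqExt.mapLin R (LinearMap.snd Q M N)) (SqExt.fstHom R Q M) (SqExt.fstHom R Q N) where
  surj q := ⟨⟨q, 0⟩, rfl⟩
  sq x y (hx : x.fst = 0) (hy : y.fst = 0) := by
    refine SqExt.ext ?_ ?_
    · change x.fst * y.fst = 0
      rw [hx, zero_mul]
    · rw [SqExt.mul_snd, hx, hy, zero_smul, zero_smul, add_zero]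
      rfl
  w z := rfl
  ext x y h1 h2 := by
    have e1 := congrArg SqExt.fst h1
    have e2 := congrArg SqExt.snd h1
    have e3 := congrArg SqExt.snd h2
    exact SqExt.ext e1 (Prod.ext e2 e3)
  ex a c h := ⟨⟨a.fst, (a.snd, c.snd)⟩, rfl, SqExt.ext h rfl⟩

section

variable [HomogeneousFunctor F]

lemma prod_ext {x y : Tan F u (M × N)} (h1 : map (LinearMap.fst Q M N) x = map (LinearMap.fst Q M N) y)
    (h2 : map (LinearMap.snd Q M N) x = map (LinearMap.snd Q M N) y) : x = y :=
  Subtype.ext (isSqZeroPullback_prod.map_ext F (congrArg Subtype.val h1) (congrArg Subtype.val h2))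

lemma exists_pair (x : Tan F u M) (y : Tan F u N) : ∃ z : Tan F u (M × N),
    map (LinearMap.fst Q M N) z = x ∧ map (LinearMap.snd Q M N) z = y := by
  obtain ⟨z, h1, h2⟩ := isSqZeroPullback_prod.exists_map F x.1 y.1 (x.2.trans y.2.symm)
  refine ⟨⟨z, Eq.trans ?_ x.2⟩, Subtype.ext h1, Subtype.ext h2⟩
  rw [← h1]
  exact (algMap_comp F (SqExt.mapLin R (LinearMap.fst Q M N)) (SqExt.fstHom R Q M) z).symm

/-- The vector of `M × N` with given components. -/
noncomputable def pair (x : Tan F u M) (y : Tan F u N) : Tan F u (M × N) := (exists_pair x y).choose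

/-- The sum of two vectors. -/
noncomputable def add (x y : Tan F u M) : Tan F u M :=
  map (LinearMap.fst Q M M + LinearMap.snd Q M M) (pair x y)

lemma add_map (φ ψ : M →ₗ[Q] N) (x : Tan F u M) : add (map φ x) (map ψ x) = map (φ + ψ) x := by
  have h : pair (map φ x) (map ψ x) = map (φ.prod ψ) x := by
    refine prod_ext ?_ ?_
    · rw [map_map]
      exact (exists_pair (map φ x) (map ψ x)).choose_spec.1
    · rw [map_map]
      exact (exists_pair (map φ x) (map ψ x)).choose_spec.2
  rw [add, h, map_map]
  rfl

noncomputable instance : Zero (Tan F u M) := ⟨zero F u M⟩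

noncomputable instance : Add (Tan F u M) := ⟨add⟩

noncomputable instance : Neg (Tan F u M) := ⟨map (-LinearMap.id)⟩

noncomputable instance : AddCommGroup (Tan F u M) where
  nsmul := nsmulRec
  zsmul := zsmulRec
  add_assoc x y z := by
    obtain ⟨v, rfl, hv⟩ := exists_pair x y
    obtain ⟨v, rfl, rfl⟩ := exists_pair v z
    subst hv
    change add (add _ _) _ = add _ (add _ _)
    rw [map_map, map_map, add_map, add_map, add_map, add_map, add_assoc]
  zero_add x := by
    change add (zero F u M) x = x
    rw [← map_zero_lin x]
    nth_rw 2 [← map_id x]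
    rw [add_map, zero_add, map_id]
  add_zero x := by
    change add x (zero F u M) = x
    rw [← map_zero_lin x]
    nth_rw 1 [← map_id x]
    rw [add_map, add_zero, map_id]
  add_comm x y := by
    obtain ⟨v, rfl, rfl⟩ := exists_pair x y
    change add _ _ = add _ _
    rw [add_map, add_map, add_comm]
  neg_add_cancel x := by
    change add (map (-LinearMap.id) x) x = zero F u M
    nth_rw 2 [← map_id x]
    rw [add_map, neg_add_cancel, map_zero_lin]

lemma map_add_map (φ ψ : M →ₗ[Q] N) (x : Tan F u M) : map φ x + map ψ x = map (φ + ψ) x :=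
  add_map φ ψ x

variable (F u) in
/-- Maps between tangent spaces which are compatible with the functoriality. -/
def IsNatural {G : CommAlgCat.{u} R ⥤ Type w} {v : G.obj (.of R Q)}
    (τ : ∀ (M : Type u) [AddCommGroup M] [Module Q M], Tan F u M → Tan G v M) : Prop :=
  ∀ (M N : Type u) [AddCommGroup M] [Module Q M] [AddCommGroup N] [Module Q N] (φ : M →ₗ[Q] N)
    (x : Tan F u M), τ N (map φ x) = map φ (τ M x)

lemma IsNatural.map_add {G : CommAlgCat.{u} R ⥤ Type w} [HomogeneousFunctor G]
    {v : G.obj (.of R Q)}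
    {τ : ∀ (M : Type u) [AddCommGroup M] [Module Q M], Tan F u M → Tan G v M}
    (h : IsNatural F u τ) (x y : Tan F u M) : τ M (x + y) = τ M x + τ M y := by
  obtain ⟨z, rfl, rfl⟩ := exists_pair x y
  rw [map_add_map, h, h, h, map_add_map]

/-- The functoriality in `M` as a homomorphism. -/
noncomputable def mapAdd (φ : M →ₗ[Q] N) : Tan F u M →+ Tan F u N :=
  AddMonoidHom.mk' (map φ) fun x y => by
    obtain ⟨z, rfl, rfl⟩ := exists_pair x y
    rw [map_add_map, map_map, map_map, map_map, map_add_map, LinearMap.comp_add]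

lemma map_injective {ι : M →ₗ[Q] N} (hι : Function.Injective ι) :
    Function.Injective (map (F := F) (u := u) ι) := by
  have h : IsSqZeroPullback (SqExt.mapLin R ι) (SqExt.fstHom R Q M)
      (SqExt.mapLin R (LinearMap.range ι).mkQ) (SqExt.inlHom R Q (N ⧸ LinearMap.range ι)) :=
    { surj := fun x => by
        obtain ⟨n, hn⟩ := Submodule.mkQ_surjective _ x.snd
        exact ⟨⟨x.fst, n⟩, SqExt.ext rfl hn⟩
      sq := fun x y hx hy => by
        have hx' : x.fst = 0 := congrArg SqExt.fst hx
        have hy' : y.fst = 0 := congrArg SqExt.fst hy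
        refine SqExt.ext ?_ ?_
        · change x.fst * y.fst = 0
          rw [hx', zero_mul]
        · rw [SqExt.mul_snd, hx', hy', zero_smul, zero_smul, add_zero]
          rfl
      w := fun z => SqExt.ext rfl ((Submodule.Quotient.mk_eq_zero _).2 ⟨z.snd, rfl⟩)
      ext := fun x y h1 h2 => SqExt.ext h2 (hι (congrArg SqExt.snd h1))
      ex := fun a c hac => by
        obtain ⟨m, hm⟩ := (Submodule.Quotient.mk_eq_zero _).1 (congrArg SqExt.snd hac)
        exact ⟨⟨c, m⟩, SqExt.ext (congrArg SqExt.fst hac).symm hm, rfl⟩ }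
  intro x y hxy
  exact Subtype.ext (h.map_ext F (congrArg Subtype.val hxy) (x.2.trans y.2.symm))

lemma exists_map_eq_of_surjective (hs : IsFormallySmooth R F) {φ : M →ₗ[Q] N}
    (hφ : Function.Surjective φ) (x : Tan F u N) : ∃ y, map φ y = x := by
  obtain ⟨y, hy⟩ := hs (CommAlgCat.ofHom (SqExt.mapLin R φ)) ⟨fun x => by
    obtain ⟨n, hn⟩ := hφ x.snd
    exact ⟨⟨x.fst, n⟩, SqExt.ext rfl hn⟩, fun x y hx hy => by
      have hx' : x.fst = 0 := congrArg SqExt.fst hx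
      have hy' : y.fst = 0 := congrArg SqExt.fst hy
      refine SqExt.ext ?_ ?_
      · change x.fst * y.fst = 0
        rw [hx', zero_mul]
      · rw [SqExt.mul_snd, hx', hy', zero_smul, zero_smul, add_zero]
        rfl⟩ x.1
  refine ⟨⟨y, Eq.trans ?_ x.2⟩, Subtype.ext hy⟩
  rw [← hy]
  exact (algMap_comp F (SqExt.mapLin R φ) (SqExt.fstHom R Q N) y).symm

lemma exists_map_ker {φ : M →ₗ[Q] N} (x : Tan F u M) (hx : map φ x = 0) :
    ∃ y : Tan F u (LinearMap.ker φ), map (LinearMap.ker φ).subtype y = x := by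
  have h : IsSqZeroPullback (SqExt.mapLin R (LinearMap.ker φ).subtype)
      (SqExt.fstHom R Q (LinearMap.ker φ))
      (SqExt.mapLin R φ.rangeRestrict) (SqExt.inlHom R Q (LinearMap.range φ)) :=
    { surj := fun x => by
        obtain ⟨n, hn⟩ := φ.surjective_rangeRestrict x.snd
        exact ⟨⟨x.fst, n⟩, SqExt.ext rfl hn⟩
      sq := fun x y hx hy => by
        have hx' : x.fst = 0 := congrArg SqExt.fst hx
        have hy' : y.fst = 0 := congrArg SqExt.fst hy
        refine SqExt.ext ?_ ?_
        · change x.fst * y.fst = 0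
          rw [hx', zero_mul]
        · rw [SqExt.mul_snd, hx', hy', zero_smul, zero_smul, add_zero]
          rfl
      w := fun z => SqExt.ext rfl (Subtype.ext z.snd.2)
      ext := fun x y h1 h2 => SqExt.ext h2 (Subtype.ext (congrArg SqExt.snd h1))
      ex := fun a c hac => ⟨⟨c, ⟨a.snd, congrArg Subtype.val (congrArg SqExt.snd hac)⟩⟩,
        SqExt.ext (congrArg SqExt.fst hac).symm rfl, rfl⟩ }
  have hx' : map φ.rangeRestrict x = zero F u _ := by
    refine map_injective (LinearMap.range φ).injective_subtype ?_
    rw [map_map, map_zero_vec]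
    exact hx
  obtain ⟨y, hy, hy'⟩ := h.exists_map F x.1 u (congrArg Subtype.val hx')
  exact ⟨⟨y, hy'⟩, Subtype.ext hy⟩

end

end Tan

end

section

/-! ## Small extensions act simply transitively on the fibres -/

namespace Tan

variable {R Q : Type u} [CommRing R] [CommRing Q] [Algebra R Q] {F : CommAlgCat.{u} R ⥤ Type w}
  {u : F.obj (.of R Q)} {M N : Type u} [AddCommGroup M] [Module Q M] [AddCommGroup N]
  [Module Q N] [HomogeneousFunctor F]

lemma exists_map_of_forall_map_eq_zero {ι : Type*} [Fintype ι] (φ : ι → M →ₗ[Q] N) (x : Tan F u M)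
    (hx : ∀ i, map (φ i) x = 0) (Z : Submodule Q M) (hZ : ∀ m, (∀ i, φ i m = 0) → m ∈ Z) :
    ∃ y : Tan F u Z, map Z.subtype y = x := by
  classical
  have key : ∀ s : Finset ι, ∃ L : Submodule Q M, (∀ i ∈ s, ∀ m ∈ L, φ i m = 0) ∧
      ∃ y : Tan F u L, map L.subtype y = x := by
    intro s
    induction s using Finset.induction_on with
    | empty =>
      refine ⟨⊤, by simp, map (LinearMap.id.codRestrict ⊤ fun _ => trivial) x, ?_⟩
      rw [map_map]
      exact map_id x
    | insert a s _ ih =>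
      obtain ⟨L, hL, y, rfl⟩ := ih
      obtain ⟨y, rfl⟩ := exists_map_ker (φ := φ a ∘ₗ L.subtype) y (by
        rw [← map_map]
        exact hx a)
      refine ⟨(LinearMap.ker (φ a ∘ₗ L.subtype)).map L.subtype, ?_,
        map ((L.subtype ∘ₗ Submodule.subtype _).codRestrict _ fun z => ⟨z.1, z.2, rfl⟩) y, ?_⟩
      · rintro i hi _ ⟨m, hm, rfl⟩
        rcases Finset.mem_insert.1 hi with rfl | hi
        · exact hm
        · exact hL i hi _ m.2
      · rw [map_map, map_map]
        rfl
  obtain ⟨L, hL, y, rfl⟩ := key Finset.univ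
  refine ⟨map (L.subtype.codRestrict Z fun m => hZ _ fun i => hL i (Finset.mem_univ i) _ m.2) y, ?_⟩
  rw [map_map]
  rfl

end Tan

section

variable {R A B Q : Type u} [CommRing R] [CommRing A] [Algebra R A] [CommRing B] [Algebra R B]
  [CommRing Q] [Algebra R Q]

/-- Surjections `p : A → B` whose kernel is a module over the quotient `Q` of `B`. -/
structure SmallExt (p : A →ₐ[R] B) (β : B →ₐ[R] Q) : Prop where
  surj : Function.Surjective p
  surj' : Function.Surjective β
  ann : ∀ a k, β (p a) = 0 → p k = 0 → a * k = 0

/-- The kernel of a small extension, as a module. -/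
def KerMod {p : A →ₐ[R] B} {β : B →ₐ[R] Q} (_ : SmallExt p β) : Type u := RingHom.ker p

namespace KerMod

variable {p : A →ₐ[R] B} {β : B →ₐ[R] Q} {h : SmallExt p β}

instance : AddCommGroup (KerMod h) := inferInstanceAs (AddCommGroup (RingHom.ker p))

instance : Module A (KerMod h) := inferInstanceAs (Module A (RingHom.ker p))

/-- The underlying element of `A`. -/
def val : KerMod h →ₗ[A] A := (RingHom.ker p).subtype

lemma p_val (k : KerMod h) : p (val k) = 0 := k.2

lemma val_injective : Function.Injective (val : KerMod h → A) := Subtype.val_injective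

variable (h) in
/-- The element of the kernel given by an element of `A`. -/
def mk (a : A) (ha : p a = 0) : KerMod h := ⟨a, ha⟩

@[simp] lemma val_mk (a : A) (ha : p a = 0) : val (mk h a ha) = a := rfl

noncomputable instance : SMul Q (KerMod h) :=
  ⟨fun q k => Function.surjInv (h.surj'.comp h.surj) q • k⟩

lemma smul_eq (a : A) (k : KerMod h) : β (p a) • k = a • k := by
  refine val_injective ?_
  change val (Function.surjInv (h.surj'.comp h.surj) (β (p a)) • k) = _
  rw [map_smul, map_smul, smul_eq_mul, smul_eq_mul, ← sub_eq_zero, ← sub_mul]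
  refine h.ann _ _ ?_ (p_val k)
  rw [map_sub, map_sub, sub_eq_zero]
  exact Function.surjInv_eq (h.surj'.comp h.surj) _

noncomputable instance : Module Q (KerMod h) :=
  (h.surj'.comp h.surj).moduleLeft (β.comp p).toRingHom smul_eq

lemma val_smul (a : A) (k : KerMod h) : val (β (p a) • k) = a * val k := by
  rw [smul_eq, map_smul, smul_eq_mul]

lemma val_mul_val (k k' : KerMod h) : val k * val k' = 0 :=
  h.ann _ _ (by rw [p_val, map_zero]) (p_val k')

/-- The map of kernels induced by a map of small extensions. -/
def map {A' B' : Type u} [CommRing A'] [Algebra R A'] [CommRing B'] [Algebra R B']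
    {p' : A' →ₐ[R] B'} {β' : B' →ₐ[R] Q} {h' : SmallExt p' β'} (a : A →ₐ[R] A') (b : B →ₐ[R] B')
    (hp : p'.comp a = b.comp p) (hβ : β'.comp b = β) : KerMod h →ₗ[Q] KerMod h' where
  toFun k := mk h' (a (val k)) (by
    rw [← AlgHom.comp_apply, hp, AlgHom.comp_apply, p_val, map_zero])
  map_add' k k' := val_injective (by simp)
  map_smul' q k := val_injective (by
    obtain ⟨x, rfl⟩ := (h.surj'.comp h.surj) q
    have hx : β (p x) = β' (p' (a x)) := by
      rw [← hβ, AlgHom.comp_apply, ← AlgHom.comp_apply b, ← hp, AlgHom.comp_apply]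
    change a (val (β (p x) • k)) = val (β (p x) • mk h' (a (val k)) _)
    rw [val_smul, hx, val_smul, val_mk, map_mul])

@[simp] lemma val_map {A' B' : Type u} [CommRing A'] [Algebra R A'] [CommRing B'] [Algebra R B']
    {p' : A' →ₐ[R] B'} {β' : B' →ₐ[R] Q} {h' : SmallExt p' β'} (a : A →ₐ[R] A') (b : B →ₐ[R] B')
    (hp : p'.comp a = b.comp p) (hβ : β'.comp b = β) (k : KerMod h) :
    val (map (h' := h') a b hp hβ k) = a (val k) := rfl

variable (h) in
/-- The projection `A ⊕ K → Q ⊕ K`. -/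
noncomputable def toQ : SqExt A (KerMod h) →ₐ[R] SqExt Q (KerMod h) :=
  SqExt.mapHom R (β.comp p) (AddMonoidHom.id _) fun a k => (smul_eq a k).symm

variable (h) in
/-- The map `(a, k) ↦ a + k`. -/
def addHom : SqExt A (KerMod h) →ₐ[R] A := SqExt.addHom R val val_mul_val

lemma isSqZeroPullback_toQ : IsSqZeroPullback (toQ h) (SqExt.fstHom R A (KerMod h))
    (SqExt.fstHom R Q (KerMod h)) (β.comp p) where
  surj q := ⟨⟨q, 0⟩, rfl⟩
  sq x y (hx : x.fst = 0) (hy : y.fst = 0) := by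
    refine SqExt.ext ?_ ?_
    · change x.fst * y.fst = 0
      rw [hx, zero_mul]
    · rw [SqExt.mul_snd, hx, hy, zero_smul, zero_smul, add_zero]
      rfl
  w z := rfl
  ext x y h1 h2 := by
    have e := congrArg SqExt.snd h1
    exact SqExt.ext h2 e
  ex x a hxa := ⟨⟨a, x.snd⟩, SqExt.ext hxa.symm rfl, rfl⟩

lemma isSqZeroPullback_addHom : IsSqZeroPullback (addHom h) (SqExt.fstHom R A (KerMod h)) p p where
  surj := h.surj
  sq x y hx hy := h.ann x y (by rw [hx, map_zero]) hy
  w z := by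
    change p (z.fst + val z.snd) = p z.fst
    rw [map_add, p_val, add_zero]
  ext x y h1 h2 := by
    have e : x.fst + val x.snd = y.fst + val y.snd := h1
    have e' : x.fst = y.fst := h2
    rw [e', add_right_inj] at e
    exact SqExt.ext e' (val_injective e)
  ex a c hac := ⟨⟨c, mk h (a - c) (by rw [map_sub, hac, sub_self])⟩, add_sub_cancel c a, rfl⟩

end KerMod

namespace SmallExt

open KerMod

variable {p : A →ₐ[R] B} {β : B →ₐ[R] Q} (h : SmallExt p β)
  (F : CommAlgCat.{u} R ⥤ Type w) [HomogeneousFunctor F] {u : F.obj (.of R Q)}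

variable {F}

lemma exists_pair (v : Tan F u (KerMod h)) {x : F.obj (.of R A)} (hx : algMap F (β.comp p) x = u) :
    ∃ z, algMap F (toQ h) z = v.1 ∧ algMap F (SqExt.fstHom R A (KerMod h)) z = x :=
  isSqZeroPullback_toQ.exists_map F v.1 x (v.2.trans hx.symm)

open Classical in
/-- The action of the tangent space on the points over `u`. -/
noncomputable def act (v : Tan F u (KerMod h)) (x : F.obj (.of R A)) : F.obj (.of R A) :=
  if hx : algMap F (β.comp p) x = u then algMap F (addHom h) (h.exists_pair v hx).choose else x

lemma act_eq {v : Tan F u (KerMod h)} {x : F.obj (.of R A)} (hx : algMap F (β.comp p) x = u)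
    {z : F.obj (.of R (SqExt A (KerMod h)))} (h1 : algMap F (toQ h) z = v.1)
    (h2 : algMap F (SqExt.fstHom R A (KerMod h)) z = x) : h.act v x = algMap F (addHom h) z := by
  rw [act, dif_pos hx]
  congr 1
  have hc := (h.exists_pair v hx).choose_spec
  exact isSqZeroPullback_toQ.map_ext F (hc.1.trans h1.symm) (hc.2.trans h2.symm)

lemma map_act_base (v : Tan F u (KerMod h)) {x : F.obj (.of R A)}
    (hx : algMap F (β.comp p) x = u) : algMap F p (h.act v x) = algMap F p x := by
  obtain ⟨z, h1, h2⟩ := h.exists_pair v hx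
  rw [h.act_eq hx h1 h2, ← h2, algMap_comp, algMap_comp]
  congr 1
  exact AlgHom.ext (isSqZeroPullback_addHom (h := h)).w

lemma exists_act_eq {x x' : F.obj (.of R A)} (hx : algMap F (β.comp p) x = u)
    (hxx' : algMap F p x' = algMap F p x) : ∃ v : Tan F u (KerMod h), h.act v x = x' := by
  obtain ⟨z, h1, h2⟩ := (isSqZeroPullback_addHom (h := h)).exists_map F x' x hxx'
  refine ⟨⟨algMap F (toQ h) z, ?_⟩, ?_⟩
  · rw [← hx, ← h2, algMap_comp, algMap_comp]
    rfl
  · rw [← h1]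
    exact h.act_eq hx rfl h2

lemma act_injective {v v' : Tan F u (KerMod h)} {x : F.obj (.of R A)}
    (hx : algMap F (β.comp p) x = u) (hv : h.act v x = h.act v' x) : v = v' := by
  obtain ⟨z, h1, h2⟩ := h.exists_pair v hx
  obtain ⟨z', h1', h2'⟩ := h.exists_pair v' hx
  rw [h.act_eq hx h1 h2, h.act_eq hx h1' h2'] at hv
  have : z = z' := isSqZeroPullback_addHom.map_ext F hv (h2.trans h2'.symm)
  subst this
  exact Subtype.ext (h1.symm.trans h1')

lemma act_zero {x : F.obj (.of R A)} (hx : algMap F (β.comp p) x = u) :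
    h.act (0 : Tan F u (KerMod h)) x = x := by
  rw [h.act_eq hx (z := algMap F (SqExt.inlHom R A (KerMod h)) x), algMap_comp]
  · refine Eq.trans ?_ (algMap_id F x)
    congr 1
    ext a
    change a + val (0 : KerMod h) = a
    rw [map_zero, add_zero]
  · change _ = algMap F _ _
    rw [← hx, algMap_comp, algMap_comp]
    rfl
  · rw [algMap_comp]
    exact algMap_id F x

/-- The action is compatible with natural transformations. -/
lemma map_act_natTrans {G : CommAlgCat.{u} R ⥤ Type w} [HomogeneousFunctor G] (τ : F ⟶ G)
    {v : Tan F u (KerMod h)} {x : F.obj (.of R A)} (hx : algMap F (β.comp p) x = u)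
    {u' : G.obj (.of R Q)} (v' : Tan G u' (KerMod h))
    (hv : v'.1 = τ.app _ v.1) : τ.app _ (h.act v x) = h.act v' (τ.app _ x) := by
  have nat : ∀ {C D : Type u} [CommRing C] [Algebra R C] [CommRing D] [Algebra R D] (f : C →ₐ[R] D)
      (y : F.obj (.of R C)), τ.app _ (algMap F f y) = algMap G f (τ.app _ y) :=
    fun f y => NatTrans.naturality_apply τ (CommAlgCat.ofHom f) y
  have hu : u' = τ.app _ u := by
    rw [← v'.2, ← v.2, hv, nat]
  obtain ⟨z, h1, h2⟩ := h.exists_pair v hx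
  rw [h.act_eq hx h1 h2, nat]
  refine (h.act_eq ?_ ?_ ?_).symm
  · rw [← nat, hx, hu]
  · rw [← nat, h1, hv]
  · rw [← nat, h2]

/-- The action is compatible with maps of small extensions. -/
lemma map_act {A' B' : Type u} [CommRing A'] [Algebra R A'] [CommRing B'] [Algebra R B']
    {p' : A' →ₐ[R] B'} {β' : B' →ₐ[R] Q} (h' : SmallExt p' β') (a : A →ₐ[R] A') (b : B →ₐ[R] B')
    (hp : p'.comp a = b.comp p) (hβ : β'.comp b = β) (v : Tan F u (KerMod h)) {x : F.obj (.of R A)}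
    (hx : algMap F (β.comp p) x = u) :
    algMap F a (h.act v x) = h'.act (Tan.map (KerMod.map a b hp hβ) v) (algMap F a x) := by
  obtain ⟨z, h1, h2⟩ := h.exists_pair v hx
  have e : (β'.comp p').comp a = β.comp p := by
    rw [AlgHom.comp_assoc, hp, ← AlgHom.comp_assoc, hβ]
  have hk : ∀ (c : A) (k : KerMod h), KerMod.map (h' := h') a b hp hβ (c • k) =
      a c • KerMod.map a b hp hβ k := fun c k => val_injective (by simp)
  rw [h.act_eq hx h1 h2, algMap_comp]
  refine Eq.trans ?_ (h'.act_eq (z := algMap F (SqExt.mapHom R a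
    (KerMod.map (h' := h') a b hp hβ).toAddMonoidHom hk) z) ?_ ?_ ?_).symm
  · rw [algMap_comp]
    congr 1
    refine AlgHom.ext fun z => ?_
    change a (z.fst + val z.snd) = a z.fst + a (val z.snd)
    rw [map_add]
  · rw [algMap_comp, e, hx]
  · refine Eq.trans ?_ (congrArg (algMap F (SqExt.mapLin R _)) h1)
    rw [algMap_comp, algMap_comp]
    congr 1
    refine AlgHom.ext fun z => SqExt.ext ?_ rfl
    exact AlgHom.congr_fun e z.fst
  · rw [algMap_comp, ← h2, algMap_comp]
    rfl

end SmallExt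

end

end

section

/-! ## Small extensions of simplicial algebras -/

variable {R : Type u} [CommRing R]

/-- Augmentations of a simplicial algebra over a constant one. -/
structure SimplicialAlg.Augmentation (B : SimplicialObject (CommAlgCat.{u} R)) (Q : Type u)
    [CommRing Q] [Algebra R Q] where
  /-- the map in each degree -/
  hom : ∀ m, B.obj m →ₐ[R] Q
  hom_comp_map : ∀ {m m' : SimplexCategoryᵒᵖ} (θ : m ⟶ m'),
    (hom m').comp (B.map θ).hom = hom m

namespace SimplicialAlg

variable {A B : SimplicialObject (CommAlgCat.{u} R)} {Q : Type u} [CommRing Q] [Algebra R Q]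

/-- Surjections `A → B` of simplicial algebras whose kernel is a module over a constant quotient `Q`
of `B`. -/
def IsSmall (p : A ⟶ B) (β : Augmentation B Q) : Prop :=
  ∀ m, SmallExt (p.app m).hom (β.hom m)

/-- The normalised complex of the kernel of `A → B` is acyclic. -/
def IsKerAcyclic (p : A ⟶ B) : Prop :=
  ∀ (n : ℕ) (z : A.obj (op ⦋n⦌)), (p.app _).hom z = 0 →
    (∀ m (_ : n = m + 1) (α : ⦋m⦌ ⟶ ⦋n⦌), Mono α → (A.map α.op).hom z = 0) →
    ∃ y : A.obj (op ⦋n + 1⦌), (p.app _).hom y = 0 ∧ (A.δ 0).hom y = z ∧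
      ∀ i : Fin (n + 1), (A.δ i.succ).hom y = 0

namespace IsSmall

variable {p : A ⟶ B} {β : Augmentation B Q} (h : IsSmall p β)

/-- The simplicial structure on the kernel. -/
def kerMap {m m' : SimplexCategoryᵒᵖ} (θ : m ⟶ m') : KerMod (h m) →ₗ[Q] KerMod (h m') :=
  KerMod.map (A.map θ).hom (B.map θ).hom
    (congrArg CommAlgCat.Hom.hom (p.naturality θ)) (β.hom_comp_map θ)

variable (F : CommAlgCat.{u} R ⥤ Type w) [HomogeneousFunctor F] (u : F.obj (.of R Q))

/-- The tangent space with coefficients in the kernel of a small extension of simplicial algebras. -/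
noncomputable def tan : SimplicialObject AddCommGrpCat.{w} where
  obj m := .of (Tan F u (KerMod (h m)))
  map θ := AddCommGrpCat.ofHom (Tan.mapAdd (h.kerMap θ))
  map_id m := by
    refine AddCommGrpCat.hom_ext (AddMonoidHom.ext fun x => ?_)
    refine Eq.trans ?_ (Tan.map_id x)
    change Tan.map _ x = _
    congr 1
    refine LinearMap.ext fun k => KerMod.val_injective ?_
    change (A.map (𝟙 m)).hom (KerMod.val k) = KerMod.val k
    rw [A.map_id]
    rfl
  map_comp θ φ := by
    refine AddCommGrpCat.hom_ext (AddMonoidHom.ext fun x => ?_)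
    refine Eq.trans ?_ (Tan.map_map _ _ x).symm
    change Tan.map _ x = _
    congr 1
    refine LinearMap.ext fun k => KerMod.val_injective ?_
    change (A.map (θ ≫ φ)).hom (KerMod.val k) = (A.map φ).hom ((A.map θ).hom (KerMod.val k))
    rw [A.map_comp]
    rfl

lemma isAcyclic_tan (hF : IsFormallySmooth R F) (hA : IsKerAcyclic p) :
    SimplicialAb.IsAcyclic (h.tan F u) := by
  intro n (z : Tan F u (KerMod (h _))) hz
  let Z : Submodule Q (KerMod (h (op ⦋n⦌))) :=
    ⨅ (m : ℕ) (_ : n = m + 1) (α : ⦋m⦌ ⟶ ⦋n⦌) (_ : Mono α), LinearMap.ker (h.kerMap α.op)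
  obtain ⟨z, rfl⟩ : ∃ y : Tan F u Z, Tan.map Z.subtype y = z := by
    cases n with
    | zero =>
      refine ⟨Tan.map (LinearMap.id.codRestrict Z fun k => ?_) z, ?_⟩
      · simp only [Z, Submodule.mem_iInf]
        intro m hm
        omega
      · rw [Tan.map_map]
        exact Tan.map_id z
    | succ m =>
      refine Tan.exists_map_of_forall_map_eq_zero
        (fun i : Fin (m + 2) => h.kerMap (SimplexCategory.δ i).op) z
        (fun i => hz m rfl (SimplexCategory.δ i) inferInstance) Z fun k hk => ?_
      simp only [Z, Submodule.mem_iInf]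
      intro m' hm' α hα
      obtain rfl : m = m' := by omega
      obtain ⟨i, rfl⟩ := SimplexCategory.eq_δ_of_mono α
      exact hk i
  let W : Submodule Q (KerMod (h (op ⦋n + 1⦌))) :=
    Z.comap (h.kerMap (SimplexCategory.δ 0).op) ⊓
      ⨅ i : Fin (n + 1), LinearMap.ker (h.kerMap (SimplexCategory.δ i.succ).op)
  obtain ⟨y, hy⟩ := Tan.exists_map_eq_of_surjective hF
    (φ := (h.kerMap (SimplexCategory.δ (0 : Fin (n + 2))).op).restrict
      (p := W) (q := Z) fun k hk => hk.1) (fun k => by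
    obtain ⟨y, hy, hy0, hyi⟩ := hA n (KerMod.val k.1) (KerMod.p_val k.1) fun m hm α hα => by
      have := k.2
      simp only [Z, Submodule.mem_iInf] at this
      exact congrArg KerMod.val (this m hm α hα)
    have hk : h.kerMap (SimplexCategory.δ (0 : Fin (n + 2))).op (KerMod.mk (h _) y hy) = k.1 :=
      KerMod.val_injective hy0
    refine ⟨⟨KerMod.mk _ y hy, ?_, ?_⟩, Subtype.ext hk⟩
    · change h.kerMap (SimplexCategory.δ (0 : Fin (n + 2))).op (KerMod.mk (h _) y hy) ∈ Z
      rw [hk]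
      exact k.2
    · rw [SetLike.mem_coe, Submodule.mem_iInf]
      exact fun i => KerMod.val_injective (hyi i)) z
  refine ⟨Tan.map W.subtype y, ?_, fun i => ?_⟩
  · rw [← hy]
    refine (Tan.map_map _ _ _).trans ((Tan.map_map _ _ _).trans ?_).symm
    rfl
  · refine (Tan.map_map _ _ _).trans ?_
    have : h.kerMap (SimplexCategory.δ i.succ).op ∘ₗ W.subtype = 0 := by
      refine LinearMap.ext fun k => ?_
      have := k.2.2
      rw [SetLike.mem_coe, Submodule.mem_iInf] at this
      exact this i
    rw [this, Tan.map_zero_lin]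
    rfl

lemma algMap_eq {k : SimplexCategory} {y : F.obj (B.obj (op k))} {m : SimplexCategory} (α : m ⟶ k)
    {x : F.obj (A.obj (op m))} (hx : F.map (p.app (op m)) x = F.map (B.map α.op) y) :
    algMap F ((β.hom (op m)).comp (p.app (op m)).hom) x = algMap F (β.hom (op k)) y := by
  rw [← algMap_comp, ← β.hom_comp_map α.op, ← algMap_comp]
  exact congrArg (algMap F (β.hom (op m))) hx

/-- The simply transitive action on the simplices over `y`. -/
noncomputable def principalAction {k : SimplexCategory} (y : F.obj (B.obj (op k))) :
    SSet.PrincipalAction (Functor.whiskerRight p F : (A ⋙ F : SSet.{w}) ⟶ B ⋙ F) (k := k) y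
      (h.tan F (algMap F (β.hom (op k)) y)) where
  act m v x := (h (op m)).act v x
  map_act {m m'} θ α v x hx := (h (op m)).map_act (h (op m')) (A.map θ.op).hom (B.map θ.op).hom
    (congrArg CommAlgCat.Hom.hom (p.naturality θ.op)) (β.hom_comp_map θ.op) v (algMap_eq F α hx)
  app_act {m} α v x hx := ((h (op m)).map_act_base v (algMap_eq F α hx)).trans hx
  exists_act_eq {m} α x x' hx hx' :=
    (h (op m)).exists_act_eq (algMap_eq F α hx) (hx'.trans hx.symm)
  act_injective {m} α v v' x hx hv := (h (op m)).act_injective (algMap_eq F α hx) hv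

include h in
lemma surjective_map {F : CommAlgCat.{u} R ⥤ Type w} (hF : IsFormallySmooth R F)
    (m : SimplexCategoryᵒᵖ) : Function.Surjective (F.map (p.app m)) :=
  hF _ ⟨(h m).surj, fun x y hx hy => (h m).ann x y (by
    change β.hom m ((p.app m).hom x) = 0
    rw [hx, map_zero]) hy⟩

include h in
theorem rlp_J (hF : IsFormallySmooth R F) :
    SSet.modelCategoryQuillen.J.rlp
      (Functor.whiskerRight p F : (A ⋙ F : SSet.{w}) ⟶ B ⋙ F) :=
  SSet.rlp_J_of_principal (fun n => h.surjective_map hF (op ⦋n⦌))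
    fun _ y => ⟨_, ⟨h.principalAction F y⟩⟩

include h in
theorem rlp_I (hF : IsFormallySmooth R F) (hA : IsKerAcyclic p) :
    SSet.modelCategoryQuillen.I.rlp
      (Functor.whiskerRight p F : (A ⋙ F : SSet.{w}) ⟶ B ⋙ F) :=
  SSet.rlp_I_of_principal (fun n => h.surjective_map hF (op ⦋n⦌))
    fun _ y => ⟨_, h.isAcyclic_tan F _ hF hA, ⟨h.principalAction F y⟩⟩

end IsSmall

end SimplicialAlg

end

section

/-! ## Codegeneracies and correction terms -/

/-- Abelian groups `C^n` with operations `s^i : C^{n+1} → C^n` and `d^{i+1} : C^n → C^{n+1}` satisfying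
the identities used to solve the matching problem for the `s^i`. -/
structure CodegeneracySystem where
  /-- the group in degree `n` -/
  C : ℕ → Type w
  [group : ∀ n, AddCommGroup (C n)]
  /-- the operation `s^i` -/
  s : ∀ n : ℕ, ℕ → C (n + 1) →+ C n
  /-- the operation `d^i` -/
  d : ∀ n : ℕ, ℕ → C n →+ C (n + 1)
  s_d_self : ∀ (n j : ℕ), j ≤ n → ∀ x, s n j (d n (j + 1) x) = x
  s_d_lt : ∀ (n i j : ℕ), i < j → j ≤ n + 1 → ∀ x,
    s (n + 1) i (d (n + 1) (j + 1) x) = d n j (s n i x)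
  s_s : ∀ (n i j : ℕ), i ≤ j → j ≤ n → ∀ x, s n j (s (n + 1) i x) = s n i (s (n + 1) (j + 1) x)

namespace CodegeneracySystem

attribute [instance] CodegeneracySystem.group

variable (S : CodegeneracySystem.{w}) (N : ℕ)

/-- The partial solutions of the matching problem. -/
def solve (δ : ℕ → S.C N) : ℕ → S.C (N + 1) :=
  fun j => Nat.rec 0 (fun j x => x + S.d N (j + 1) (δ j - S.s N j x)) j

lemma solve_succ (δ : ℕ → S.C N) (j : ℕ) : S.solve N δ (j + 1) =
    S.solve N δ j + S.d N (j + 1) (δ j - S.s N j (S.solve N δ j)) := rfl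

variable {N}

lemma s_solve {δ : ℕ → S.C N} (hδ : ∀ n (h : N = n + 1) (i j : ℕ), i ≤ j → j ≤ n →
    S.s n j (h ▸ δ i) = S.s n i (h ▸ δ (j + 1))) (j : ℕ) (hj : j ≤ N + 1) :
    ∀ i < j, S.s N i (S.solve N δ j) = δ i := by
  induction j with
  | zero => intro i hi; omega
  | succ j ih =>
    intro i hi
    have ih := ih (by omega)
    rw [solve_succ, map_add]
    rcases Nat.lt_succ_iff_lt_or_eq.1 hi with h | rfl
    · obtain ⟨n, rfl⟩ : ∃ n, N = n + 1 := ⟨N - 1, by omega⟩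
      obtain ⟨j, rfl⟩ : ∃ j', j = j' + 1 := ⟨j - 1, by omega⟩
      rw [S.s_d_lt n i (j + 1) h (by omega), map_sub,
        ← S.s_s n i j (by omega) (by omega), ih i h, ← hδ n rfl i j (by omega) (by omega), sub_self,
        map_zero, add_zero]
    · rw [S.s_d_self N i (by omega), add_sub_cancel]

lemma solve_congr {δ δ' : ℕ → S.C N} (j : ℕ) (h : ∀ i < j, δ i = δ' i) :
    S.solve N δ j = S.solve N δ' j := by
  induction j with
  | zero => rfl
  | succ j ih => rw [solve_succ, solve_succ, ih fun i hi => h i (by omega), h j (by omega)]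

lemma solve_eq_zero {δ : ℕ → S.C N} (j : ℕ) (h : ∀ i < j, δ i = 0) : S.solve N δ j = 0 := by
  induction j with
  | zero => rfl
  | succ j ih => rw [solve_succ, ih fun i hi => h i (by omega), h j (by omega)]; simp

lemma map_solve {S S' : CodegeneracySystem.{w}} (φ : ∀ n, S.C n →+ S'.C n)
    (hs : ∀ n i x, φ n (S.s n i x) = S'.s n i (φ (n + 1) x))
    (hd : ∀ n i x, φ (n + 1) (S.d n i x) = S'.d n i (φ n x)) (δ : ℕ → S.C N) (j : ℕ) :
    φ (N + 1) (S.solve N δ j) = S'.solve N (fun i => φ N (δ i)) j := by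
  induction j with
  | zero => exact map_zero _
  | succ j ih => rw [solve_succ, solve_succ, map_add, hd, map_sub, hs, ih]

end CodegeneracySystem

/-- Elements `u_n ∈ E^n` compatible with all operations. -/
structure QuasiComonoid.Point (E : QuasiComonoid.{w}) where
  /-- the element in degree `n` -/
  u : ∀ n, E.X n
  u_zero : u 0 = E.one
  d_u : ∀ {n : ℕ} (i : ℕ) (hi : 1 ≤ i) (hi' : i ≤ n), E.d i hi hi' (u n) = u (n + 1)
  s_u : ∀ {n : ℕ} (i : ℕ) (hi : i ≤ n), E.s i hi (u (n + 1)) = u n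
  mul_u : ∀ n, E.mul rfl (u n) (u 1) = u (n + 1)

namespace QuasiComonoid

variable {E F : QuasiComonoid.{w}}

/-- The image of a point under a morphism. -/
def Point.map (f : E ⟶ F) (x : E.Point) : F.Point where
  u n := Hom.app f n (x.u n)
  u_zero := by rw [x.u_zero, Hom.map_one]
  d_u i hi hi' := by rw [← Hom.map_d, x.d_u]
  s_u i hi := by rw [← Hom.map_s, x.s_u]
  mul_u n := by rw [← Hom.map_mul, x.mul_u]

/-- The operation `∂^i`, extended by `(-) * u_1` for `i = n + 1`. -/
def dExt (x : E.Point) {n : ℕ} (i : ℕ) (e : E.X n) : E.X (n + 1) :=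
  if h : 1 ≤ i ∧ i ≤ n then E.d i h.1 h.2 e else E.mul rfl e (x.u 1)

/-- The operation `σ^i`, extended by `σ^0`. -/
def sExt {n : ℕ} (i : ℕ) (e : E.X (n + 1)) : E.X n :=
  if h : i ≤ n then E.s i h e else E.s 0 (Nat.zero_le n) e

lemma dExt_u (x : E.Point) (n i : ℕ) : dExt x i (x.u n) = x.u (n + 1) := by
  unfold dExt
  split_ifs
  · exact x.d_u _ _ _
  · exact x.mul_u n

lemma sExt_u (x : E.Point) (n i : ℕ) : sExt i (x.u (n + 1)) = x.u n := by
  unfold sExt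
  split_ifs
  · exact x.s_u _ _
  · exact x.s_u _ _

lemma map_dExt (f : E ⟶ F) (x : E.Point) {n : ℕ} (i : ℕ) (e : E.X n) :
    Hom.app f (n + 1) (dExt x i e) = dExt (x.map f) i (Hom.app f n e) := by
  unfold dExt
  split_ifs
  · exact Hom.map_d _ _ _ _ _
  · exact Hom.map_mul _ _ _ _

lemma map_sExt (f : E ⟶ F) {n : ℕ} (i : ℕ) (e : E.X (n + 1)) :
    Hom.app f n (sExt i e) = sExt i (Hom.app f (n + 1) e) := by
  unfold sExt
  split_ifs
  · exact Hom.map_s _ _ _ _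
  · exact Hom.map_s _ _ _ _

lemma sExt_dExt_self (x : E.Point) {n j : ℕ} (hj : j ≤ n) (e : E.X n) :
    sExt j (dExt x (j + 1) e) = e := by
  unfold sExt dExt
  rw [dif_pos hj]
  split_ifs with h
  · exact E.s_d_succ j h.2 e
  · obtain rfl : j = n := by omega
    have h1 := E.mul_s (Nat.add_zero j) 0 le_rfl e (x.u 1)
    rw [x.s_u, x.u_zero, E.mul_one] at h1
    simp only [Nat.zero_add] at h1
    exact h1.symm

lemma sExt_dExt_lt (x : E.Point) {n i j : ℕ} (hij : i < j) (hj : j ≤ n + 1) (e : E.X (n + 1)) :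
    sExt i (dExt x (j + 1) e) = dExt x j (sExt i e) := by
  unfold sExt dExt
  rw [dif_pos (by omega : i ≤ n + 1), dif_pos (by omega : i ≤ n)]
  by_cases h : j ≤ n
  · rw [dif_pos (by omega), dif_pos (by omega)]
    exact E.s_d_gt (j + 1) i (by omega) (by omega) e
  · rw [dif_neg (by omega), dif_neg (by omega)]
    exact (E.s_mul rfl i (by omega) e (x.u 1)).symm

lemma sExt_sExt {n i j : ℕ} (hij : i ≤ j) (hj : j ≤ n) (e : E.X (n + 2)) :
    sExt j (sExt i e) = sExt i (sExt (j + 1) e) := by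
  unfold sExt
  rw [dif_pos hj, dif_pos (by omega : i ≤ n + 1), dif_pos (by omega : i ≤ n),
    dif_pos (by omega : j + 1 ≤ n + 1)]
  exact E.s_s i j hij hj e

end QuasiComonoid

namespace Tan

open QuasiComonoid

variable {R Q : Type u} [CommRing R] [CommRing Q] [Algebra R Q]
  (E : CommAlgCat.{u} R ⥤ QuasiComonoid.{w}) [∀ n, HomogeneousFunctor (E ⋙ level n)]
  (y : (E.obj (.of R Q)).Point) (M : Type u) [AddCommGroup M] [Module Q M]

variable {E} in
/-- The component of a point in degree `n`. -/
def base (n : ℕ) : (E ⋙ level n).obj (.of R Q) := y.u n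

/-- The maps induced by the `σ^i`. -/
def sTan (n i : ℕ) (M : Type u) [AddCommGroup M] [Module Q M]
    (x : Tan (E ⋙ level (n + 1)) (base y (n + 1)) M) : Tan (E ⋙ level n) (base y n) M :=
  ⟨sExt (E := E.obj (.of R (SqExt Q M))) i x.1, (map_sExt _ i _).trans
    ((congrArg (sExt (E := E.obj (.of R Q)) i) x.2).trans (sExt_u y n i))⟩

lemma isNatural_sTan (n i : ℕ) : IsNatural (E ⋙ level (n + 1)) (base y (n + 1)) (sTan E y n i) :=
  fun _ _ _ _ _ _ _ _ => Subtype.ext (map_sExt _ i _).symm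

/-- The image of a point of `E(Q)` in `E(Q ⊕ M)`. -/
def inl : (E.obj (.of R (SqExt Q M))).Point := y.map (E.map (CommAlgCat.ofHom (SqExt.inlHom R Q M)))

lemma inl_map {A : Type u} [CommRing A] [Algebra R A] (f : SqExt Q M →ₐ[R] A) :
    (inl E y M).map (E.map (CommAlgCat.ofHom f)) =
      y.map (E.map (CommAlgCat.ofHom (f.comp (SqExt.inlHom R Q M)))) := by
  unfold inl Point.map
  congr 1
  funext n
  exact algMap_comp (E ⋙ level n) (SqExt.inlHom R Q M) f (y.u n)

/-- The maps induced by the `∂^i`. -/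
def dTan (n i : ℕ) (M : Type u) [AddCommGroup M] [Module Q M]
    (x : Tan (E ⋙ level n) (base y n) M) : Tan (E ⋙ level (n + 1)) (base y (n + 1)) M :=
  ⟨dExt (inl E y M) i x.1, by
    refine (map_dExt (E.map (CommAlgCat.ofHom (SqExt.fstHom R Q M))) _ i _).trans ?_
    rw [inl_map]
    have h : y.map (E.map (CommAlgCat.ofHom ((SqExt.fstHom R Q M).comp (SqExt.inlHom R Q M)))) = y := by
      have h : CommAlgCat.ofHom ((SqExt.fstHom R Q M).comp (SqExt.inlHom R Q M)) = 𝟙 _ := rfl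
      rw [h, E.map_id]
      rfl
    rw [h]
    exact (congrArg (dExt y i) x.2).trans (dExt_u y n i)⟩

lemma isNatural_dTan (n i : ℕ) : IsNatural (E ⋙ level n) (base y n) (dTan E y n i) := by
  intro M N _ _ _ _ φ x
  refine Subtype.ext (Eq.trans ?_
    (map_dExt (E.map (CommAlgCat.ofHom (SqExt.mapLin R φ))) (inl E y M) i x.1).symm)
  rw [inl_map]
  have h : (SqExt.mapLin R φ).comp (SqExt.inlHom R Q M) = SqExt.inlHom R Q N :=
    AlgHom.ext fun q => SqExt.ext rfl (map_zero φ)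
  rw [h]
  rfl

/-- The tangent spaces at a point of the quasi-comonoid `E(Q)`. -/
noncomputable def system : CodegeneracySystem.{w} where
  C n := Tan (E ⋙ level n) (base y n) M
  s n i := AddMonoidHom.mk' (sTan E y n i M) (isNatural_sTan E y n i).map_add
  d n i := AddMonoidHom.mk' (dTan E y n i M) (isNatural_dTan E y n i).map_add
  s_d_self n j hj x := Subtype.ext (sExt_dExt_self _ hj _)
  s_d_lt n i j hij hj x := Subtype.ext (sExt_dExt_lt _ hij hj _)
  s_s n i j hij hj x := Subtype.ext (sExt_sExt hij hj _)

lemma map_solve_system {N' : Type u} [AddCommGroup N'] [Module Q N'] (φ : M →ₗ[Q] N') {N : ℕ}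
    (δ : ℕ → Tan (E ⋙ level N) (base y N) M) (j : ℕ) :
    map φ ((system E y M).solve N δ j) = (system E y N').solve N (fun i => map φ (δ i)) j :=
  CodegeneracySystem.map_solve (S := system E y M) (S' := system E y N') (fun _ => mapAdd φ)
    (fun n i x => (isNatural_sTan E y n i _ _ φ x).symm)
    (fun n i x => (isNatural_dTan E y n i _ _ φ x).symm) δ j

end Tan

end

section

/-! ## Fibrations induced by small extensions -/

namespace SimplicialAlg

open QuasiComonoid

variable {R : Type u} [CommRing R] {A B : SimplicialObject (CommAlgCat.{u} R)} {Q : Type u}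
  [CommRing Q] [Algebra R Q] (E : CommAlgCat.{u} R ⥤ QuasiComonoid.{w})

section Point

variable (β : Augmentation B Q) {k : SimplexCategory} (x : MaurerCartan (B ⋙ E) k)

/-- The image in `E(Q)` of a value of a Maurer–Cartan element. -/
def Augmentation.value (n : ℕ) (m : SimplexCategory) (t : Fin n → StdInterval m) (f : m ⟶ k) :
    (E.obj (.of R Q)).X (n + 1) :=
  Hom.app (E.map (CommAlgCat.ofHom (β.hom (op m)))) (n + 1) (x.ω n m t f)

lemma Augmentation.value_comp {n : ℕ} {m m' : SimplexCategory} (θ : m' ⟶ m)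
    (t : Fin n → StdInterval m) (f : m ⟶ k) :
    β.value E x n m' (fun i => (t i).comp θ.toOrderHom) (θ ≫ f) = β.value E x n m t f := by
  unfold value
  rw [← x.natural]
  refine (algMap_comp (E ⋙ level (n + 1)) (B.map θ.op).hom (β.hom (op m')) _).trans ?_
  rw [β.hom_comp_map]
  rfl

lemma Augmentation.value_eq_bot {n : ℕ} {m : SimplexCategory} (t : Fin n → StdInterval m)
    (f : m ⟶ k) : β.value E x n m t f = β.value E x n k (fun _ => ⊥) (𝟙 k) := by
  let θ : ⦋0⦌ ⟶ m := SimplexCategory.const ⦋0⦌ m 0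
  let τ : Fin n → StdInterval ⦋1⦌ := fun i =>
    { toFun := fun j => if j = 0 then 0 else t i 0
      monotone' := fun a b hab => by
        by_cases ha : a = 0
        · simp [ha]
        · have hb : b ≠ 0 := fun hb => ha (le_antisymm (hb ▸ hab) (Fin.zero_le _))
          simp [ha, hb] }
  have h1 := β.value_comp E x θ t f
  have h2 := β.value_comp E x (SimplexCategory.δ (1 : Fin 2)) τ (SimplexCategory.σ 0 ≫ θ ≫ f)
  have h3 := β.value_comp E x (SimplexCategory.δ (0 : Fin 2)) τ (SimplexCategory.σ 0 ≫ θ ≫ f)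
  have h4 := β.value_comp E x (θ ≫ f) (n := n) (fun _ => ⊥) (𝟙 k)
  have e1 : SimplexCategory.δ (1 : Fin 2) ≫ SimplexCategory.σ (0 : Fin 1) = 𝟙 ⦋0⦌ :=
    SimplexCategory.δ_comp_σ_succ (i := (0 : Fin 1))
  have e0 : SimplexCategory.δ (0 : Fin 2) ≫ SimplexCategory.σ (0 : Fin 1) = 𝟙 ⦋0⦌ :=
    SimplexCategory.δ_comp_σ_self (i := (0 : Fin 1))
  rw [← Category.assoc, e1, Category.id_comp] at h2
  rw [← Category.assoc, e0, Category.id_comp] at h3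
  rw [Category.comp_id] at h4
  have t0 : (fun i => (τ i).comp (SimplexCategory.δ (0 : Fin 2)).toOrderHom) =
      fun i => (t i).comp θ.toOrderHom := by
    funext i
    ext j
    rfl
  have t1 : (fun i => (τ i).comp (SimplexCategory.δ (1 : Fin 2)).toOrderHom) =
      fun i => (⊥ : StdInterval k).comp (θ ≫ f).toOrderHom := by
    funext i
    refine OrderHom.ext _ _ (funext fun j => ?_)
    obtain rfl : j = 0 := Subsingleton.elim (α := Fin 1) _ _
    rfl
  rw [t0] at h3
  rw [t1] at h2
  exact h1.symm.trans (h3.trans (h2.symm.trans h4))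

/-- The point of `E(Q)` determined by a Maurer–Cartan element. -/
noncomputable def Augmentation.point : (E.obj (.of R Q)).Point where
  u := fun n => match n with
    | 0 => (E.obj (.of R Q)).one
    | n + 1 => β.value E x n k (fun _ => ⊥) (𝟙 k)
  u_zero := rfl
  d_u {n} i hi hi' := by
    obtain ⟨n, rfl⟩ : ∃ n', n = n' + 1 := ⟨n - 1, by omega⟩
    obtain ⟨i, rfl⟩ : ∃ i', i = i' + 1 := ⟨i - 1, by omega⟩
    have h := x.d n k ⟨i, by omega⟩ (fun _ => ⊥) (𝟙 k)
    refine (Hom.map_d _ _ _ _ _).symm.trans ?_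
    refine (congrArg (Hom.app (E.map (CommAlgCat.ofHom (β.hom (op k)))) (n + 2)) h).trans ?_
    exact β.value_eq_bot E x _ _
  s_u {n} i hi := by
    refine (Hom.map_s _ _ _ _).symm.trans ?_
    cases n with
    | zero =>
      obtain rfl : i = 0 := by omega
      refine Eq.trans ?_ (Hom.map_one (E.map (CommAlgCat.ofHom (β.hom (op k)))))
      exact congrArg (Hom.app (E.map (CommAlgCat.ofHom (β.hom (op k)))) 0) (x.s_zero k _ _)
    | succ n =>
      rcases Nat.eq_zero_or_pos i with rfl | hi0
      · refine (congrArg (Hom.app (E.map (CommAlgCat.ofHom (β.hom (op k)))) (n + 1))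
          (x.s_first n k _ _)).trans ?_
        exact β.value_eq_bot E x _ _
      · rcases Nat.lt_or_ge i (n + 1) with h | h
        · obtain ⟨n, rfl⟩ : ∃ n', n = n' + 1 := ⟨n - 1, by omega⟩
          obtain ⟨i, rfl⟩ : ∃ i', i = i' + 1 := ⟨i - 1, by omega⟩
          refine (congrArg (Hom.app (E.map (CommAlgCat.ofHom (β.hom (op k)))) (n + 2))
            (x.s n k ⟨i, by omega⟩ _ _)).trans ?_
          exact β.value_eq_bot E x _ _
        · obtain rfl : i = n + 1 := by omega
          refine (congrArg (Hom.app (E.map (CommAlgCat.ofHom (β.hom (op k)))) (n + 1))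
            (x.s_last n k _ _)).trans ?_
          exact β.value_eq_bot E x _ _
  mul_u n := by
    cases n with
    | zero => exact (E.obj (.of R Q)).one_mul _
    | succ n =>
      refine (Hom.map_mul _ _ _ _).symm.trans ?_
      refine (congrArg (Hom.app (E.map (CommAlgCat.ofHom (β.hom (op k)))) (n + 2))
        (x.mul n 0 k (fun _ => ⊥) (fun _ => ⊥) (𝟙 k))).trans ?_
      exact β.value_eq_bot E x _ _

lemma Augmentation.value_eq_point {n : ℕ} {m : SimplexCategory} (t : Fin n → StdInterval m)
    (f : m ⟶ k) : β.value E x n m t f = (β.point E x).u (n + 1) := β.value_eq_bot E x t f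

end Point

variable {E} [∀ n, HomogeneousFunctor (E ⋙ level n)] {p : A ⟶ B} {β : Augmentation B Q}

section

variable (h : IsSmall p β) (y : (E.obj (.of R Q)).Point)

open Classical in
/-- The vectors measuring the difference between `σ^i e` and `r_i`. -/
noncomputable def IsSmall.diff (N : ℕ) (m : SimplexCategory) (e : ((A ⋙ E).obj (op m)).X (N + 1))
    (r : ℕ → ((A ⋙ E).obj (op m)).X N) (i : ℕ) :
    Tan (E ⋙ level N) (Tan.base y N) (KerMod (h (op m))) :=
  if hv : ∃ v : Tan (E ⋙ level N) (Tan.base y N) (KerMod (h (op m))),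
    (h (op m)).act v (sExt i e) = r i then hv.choose else 0

lemma IsSmall.diff_eq {N : ℕ} {m : SimplexCategory} {e : ((A ⋙ E).obj (op m)).X (N + 1)}
    {r : ℕ → ((A ⋙ E).obj (op m)).X N} {i : ℕ}
    (hs : algMap (E ⋙ level N) ((β.hom (op m)).comp (p.app (op m)).hom) (sExt i e) = y.u N)
    (v : Tan (E ⋙ level N) (Tan.base y N) (KerMod (h (op m))))
    (hv : (h (op m)).act v (sExt i e) = r i) : h.diff y N m e r i = v := by
  have hx : ∃ v : Tan (E ⋙ level N) (Tan.base y N) (KerMod (h (op m))),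
    (h (op m)).act v (sExt i e) = r i := ⟨v, hv⟩
  rw [diff, dif_pos hx]
  exact (h (op m)).act_injective hs (hx.choose_spec.trans hv.symm)

lemma IsSmall.act_sTan {N : ℕ} {m : SimplexCategory} {e : ((A ⋙ E).obj (op m)).X (N + 1)}
    (he : algMap (E ⋙ level (N + 1)) ((β.hom (op m)).comp (p.app (op m)).hom) e = y.u (N + 1))
    (i : ℕ) (v : Tan (E ⋙ level (N + 1)) (Tan.base y (N + 1)) (KerMod (h (op m)))) :
    sExt i ((h (op m)).act v e : ((A ⋙ E).obj (op m)).X (N + 1)) =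
      (h (op m)).act (F := E ⋙ level N) (Tan.sTan E y N i _ v) (sExt i e) :=
  (h (op m)).map_act_natTrans (F := E ⋙ level (N + 1)) (G := E ⋙ level N)
    { app := fun C => TypeCat.ofHom (sExt (E := E.obj C) i)
      naturality := fun C D f => by
        refine ConcreteCategory.hom_ext _ _ fun z => ?_
        exact (map_sExt (E.map f) i z).symm } he (Tan.sTan E y N i _ v) rfl

end

theorem IsSmall.hasCorrector (h : IsSmall p β) {k : SimplexCategory}
    (x : MaurerCartan (B ⋙ E) k) (N : ℕ) :
    x.HasCorrector (Functor.whiskerRight p E : A ⋙ E ⟶ B ⋙ E) N := by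
  obtain ⟨y, hy⟩ : ∃ y, y = β.point E x := ⟨_, rfl⟩
  refine ⟨fun m e r => (h (op m)).act (F := E ⋙ level (N + 1)) (u := Tan.base y (N + 1))
    ((Tan.system E y (KerMod (h (op m)))).solve N (h.diff y N m e r) (N + 1)) e, ?_⟩
  intro m e r ⟨t, f, _, he⟩ hr hr'
  have he' : ∀ {m' : SimplexCategory} (θ : m' ⟶ m), algMap (E ⋙ level (N + 1))
      ((β.hom (op m')).comp (p.app (op m')).hom) (Hom.app ((A ⋙ E).map θ.op) (N + 1) e) =
        y.u (N + 1) := by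
    intro m' θ
    have e1 : ((β.hom (op m')).comp (p.app (op m')).hom).comp (A.map θ.op).hom =
        (β.hom (op m)).comp (p.app (op m)).hom := by
      rw [← β.hom_comp_map θ.op, AlgHom.comp_assoc, AlgHom.comp_assoc]
      exact congrArg _ (congrArg CommAlgCat.Hom.hom (p.naturality θ.op))
    refine (algMap_comp (E ⋙ level (N + 1)) (A.map θ.op).hom _ e).trans ?_
    rw [e1]
    refine (algMap_comp (E ⋙ level (N + 1)) (p.app (op m)).hom (β.hom (op m)) e).symm.trans ?_
    refine (congrArg (algMap (E ⋙ level (N + 1)) (β.hom (op m))) he).trans ?_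
    exact (β.value_eq_point E x _ _).trans (by rw [hy])
  have he0 : algMap (E ⋙ level (N + 1)) ((β.hom (op m)).comp (p.app (op m)).hom) e =
      y.u (N + 1) := by
    have := he' (𝟙 m)
    rwa [op_id, (A ⋙ E).map_id] at this
  have hs : ∀ {m' : SimplexCategory} (θ : m' ⟶ m) (i : ℕ), algMap (E ⋙ level N)
      ((β.hom (op m')).comp (p.app (op m')).hom)
        (sExt i (Hom.app ((A ⋙ E).map θ.op) (N + 1) e)) = y.u N := by
    intro m' θ i
    refine (map_sExt (E.map (CommAlgCat.ofHom ((β.hom (op m')).comp (p.app (op m')).hom)))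
      i _).trans ?_
    exact (congrArg (sExt i) (he' θ)).trans (sExt_u y N i)
  have hs0 : ∀ i : ℕ, algMap (E ⋙ level N) ((β.hom (op m)).comp (p.app (op m)).hom)
      (sExt i e) = y.u N := by
    intro i
    have := hs (𝟙 m) i
    rwa [op_id, (A ⋙ E).map_id] at this
  have hd : ∀ i ≤ N, (h (op m)).act (F := E ⋙ level N) (u := Tan.base y N)
      (h.diff y N m e r i) (sExt i e) = r i := by
    intro i hi
    obtain ⟨v, hv⟩ := (h (op m)).exists_act_eq (F := E ⋙ level N) (u := Tan.base y N) (hs0 i)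
      (x' := r i) ((hr i hi).trans (by
        have := map_sExt ((Functor.whiskerRight p E).app (op m)) i e
        simp only [sExt, dif_pos hi] at this ⊢
        exact this.symm))
    rw [h.diff_eq y (hs0 i) v hv]
    exact hv
  have hsolve : ∀ i ≤ N, Tan.sTan E y N i _
      ((Tan.system E y (KerMod (h (op m)))).solve N (h.diff y N m e r) (N + 1)) =
        h.diff y N m e r i := by
    intro i hi
    refine CodegeneracySystem.s_solve (S := Tan.system E y (KerMod (h (op m)))) ?_ (N + 1) le_rfl i
      (by omega)
    intro n hn i j hij hj
    cases N with
    | zero => cases hn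
    | succ N => ?_
    obtain rfl : N = n := by omega
    change (Tan.system E y (KerMod (h (op m)))).s N j (h.diff y (N + 1) m e r i) =
      (Tan.system E y (KerMod (h (op m)))).s N i (h.diff y (N + 1) m e r (j + 1))
    have h1 := h.act_sTan y (hs0 i) j (h.diff y (N + 1) m e r i)
    have h2 := h.act_sTan y (hs0 (j + 1)) i (h.diff y (N + 1) m e r (j + 1))
    rw [hd i (by omega)] at h1
    rw [hd (j + 1) (by omega)] at h2
    have h3 := hr' i j hij hj
    refine (h (op m)).act_injective (F := E ⋙ level N) (u := Tan.base y N)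
      (x := sExt j (sExt i e)) ?_ ?_
    · refine (map_sExt (E.map (CommAlgCat.ofHom ((β.hom (op m)).comp (p.app (op m)).hom)))
        j _).trans ?_
      exact (congrArg (sExt j) (hs0 i)).trans (sExt_u y N j)
    · refine h1.symm.trans (Eq.trans ?_ (h2.trans ?_))
      · have h4 : sExt i (r (j + 1)) = ((A ⋙ E).obj (op m)).s i (hij.trans hj) (r (j + 1)) :=
          dif_pos (hij.trans hj)
        exact (dif_pos hj).trans (h3.trans h4.symm)
      · rw [sExt_sExt hij hj]
        rfl
  refine ⟨?_, fun i hi => ?_, fun hi => ?_, fun m' θ => ?_⟩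
  · exact (h (op m)).map_act_base _ he0
  · have h1 := h.act_sTan y he0 i
      ((Tan.system E y (KerMod (h (op m)))).solve N (h.diff y N m e r) (N + 1))
    rw [hsolve i hi, hd i hi] at h1
    exact (dif_pos hi).symm.trans h1
  · have h0 : (Tan.system E y (KerMod (h (op m)))).solve N (h.diff y N m e r) (N + 1) = 0 := by
      refine CodegeneracySystem.solve_eq_zero _ _ fun i hi' => ?_
      refine h.diff_eq y (hs0 i) 0 ?_
      refine ((h (op m)).act_zero (hs0 i)).trans (Eq.trans ?_ (hi i (by omega)))
      exact dif_pos (by omega : i ≤ N)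
    refine (congrArg (fun v => (h (op m)).act v e) h0).trans ?_
    exact (h (op m)).act_zero he0
  · refine ((h (op m)).map_act (F := E ⋙ level (N + 1)) (h (op m')) (A.map θ.op).hom
      (B.map θ.op).hom (congrArg CommAlgCat.Hom.hom (p.naturality θ.op)) (β.hom_comp_map θ.op) _
      he0).trans ?_
    refine congrArg (fun v => (h (op m')).act (F := E ⋙ level (N + 1)) (u := Tan.base y (N + 1)) v
      (Hom.app ((A ⋙ E).map θ.op) (N + 1) e)) ?_
    refine (Tan.map_solve_system E y (KerMod (h (op m))) _ _ _).trans ?_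
    refine CodegeneracySystem.solve_congr _ _ fun i hi => ?_
    refine (h.diff_eq y (hs θ i) _ ?_).symm
    refine Eq.trans ?_ (congrArg (Hom.app ((A ⋙ E).map θ.op) N) (hd i (by omega)))
    refine Eq.trans ?_ ((h (op m)).map_act (F := E ⋙ level N) (h (op m')) (A.map θ.op).hom
      (B.map θ.op).hom (congrArg CommAlgCat.Hom.hom (p.naturality θ.op)) (β.hom_comp_map θ.op) _
      (hs0 i)).symm
    refine congrArg ((h (op m')).act _) ?_
    exact (map_sExt ((A ⋙ E).map θ.op) i e).symm

end SimplicialAlg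

end

section

/-! ## Invertible elements and small extensions -/

namespace Tan

open QuasiComonoid

variable {R Q : Type u} [CommRing R] [CommRing Q] [Algebra R Q]
  (E : CommAlgCat.{u} R ⥤ QuasiComonoid.{w})
  {M N : Type u} [AddCommGroup M] [Module Q M] [AddCommGroup N] [Module Q N]

variable (R Q) in
/-- The identity as a point of `E^0(Q)`. -/
def one : (E ⋙ level 0).obj (.of R Q) := (E.obj (.of R Q)).one

variable {E}

/-- The product on the tangent space at the identity. -/
def mul (x y : Tan (E ⋙ level 0) (one R Q E) M) : Tan (E ⋙ level 0) (one R Q E) M :=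
  ⟨(E.obj (.of R (SqExt Q M))).mul rfl x.1 y.1, by
    refine (Hom.map_mul (E.map (CommAlgCat.ofHom (SqExt.fstHom R Q M))) rfl x.1 y.1).trans ?_
    refine (congrArg₂ ((E.obj (.of R Q)).mul rfl) x.2 y.2).trans ?_
    exact (E.obj (.of R Q)).one_mul _⟩

lemma map_mul (φ : M →ₗ[Q] N) (x y : Tan (E ⋙ level 0) (one R Q E) M) :
    map φ (mul x y) = mul (map φ x) (map φ y) :=
  Subtype.ext (Hom.map_mul (E.map (CommAlgCat.ofHom (SqExt.mapLin R φ))) rfl x.1 y.1)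

lemma zero_val : (zero (E ⋙ level 0) (one R Q E) M).1 = (E.obj (.of R (SqExt Q M))).one :=
  Hom.map_one (E.map (CommAlgCat.ofHom (SqExt.inlHom R Q M)))

lemma mul_zero (x : Tan (E ⋙ level 0) (one R Q E) M) : mul x (zero _ _ _) = x :=
  Subtype.ext ((congrArg ((E.obj (.of R (SqExt Q M))).mul rfl x.1) zero_val).trans
    ((E.obj (.of R (SqExt Q M))).mul_one x.1))

lemma zero_mul (x : Tan (E ⋙ level 0) (one R Q E) M) : mul (zero _ _ _) x = x :=
  Subtype.ext ((congrArg (fun z => (E.obj (.of R (SqExt Q M))).mul rfl z x.1) zero_val).trans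
    ((E.obj (.of R (SqExt Q M))).one_mul x.1))

variable [HomogeneousFunctor (E ⋙ level 0)]

lemma mul_eq_add (x y : Tan (E ⋙ level 0) (one R Q E) M) : mul x y = x + y := by
  obtain ⟨v, rfl, rfl⟩ := exists_pair x y
  have h : mul (map (LinearMap.inl Q M M ∘ₗ LinearMap.fst Q M M) v)
      (map (LinearMap.inr Q M M ∘ₗ LinearMap.snd Q M M) v) = v := by
    refine prod_ext ?_ ?_
    · rw [map_mul, map_map, map_map, ← LinearMap.comp_assoc, ← LinearMap.comp_assoc,
        LinearMap.fst_comp_inl, LinearMap.fst_comp_inr, LinearMap.id_comp, LinearMap.zero_comp,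
        map_zero_lin, mul_zero]
    · rw [map_mul, map_map, map_map, ← LinearMap.comp_assoc, ← LinearMap.comp_assoc,
        LinearMap.snd_comp_inl, LinearMap.snd_comp_inr, LinearMap.id_comp, LinearMap.zero_comp,
        map_zero_lin, zero_mul]
  rw [map_add_map]
  nth_rw 3 [← h]
  rw [map_mul, map_map, map_map, ← LinearMap.comp_assoc, ← LinearMap.comp_assoc]
  congr 1
  · congr 1
    ext <;> simp
  · congr 1
    ext <;> simp

end Tan

namespace SmallExt

open QuasiComonoid KerMod

variable {R A B Q : Type u} [CommRing R] [CommRing A] [Algebra R A] [CommRing B] [Algebra R B]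
  [CommRing Q] [Algebra R Q] {p : A →ₐ[R] B} {β : B →ₐ[R] Q} (h : SmallExt p β)
  {E : CommAlgCat.{u} R ⥤ QuasiComonoid.{w}} [HomogeneousFunctor (E ⋙ level 0)]

include h

lemma exists_mul_eq_one {c : (E.obj (.of R A)).X 0}
    (hc : Hom.zero (E.map (CommAlgCat.ofHom p)) c = 1) : ∃ c', c * c' = 1 := by
  obtain ⟨z, hz, hz'⟩ := (isSqZeroPullback_addHom (h := h)).exists_map (E ⋙ level 0) c
    (E.obj (.of R A)).one (hc.trans (Hom.map_one (E.map (CommAlgCat.ofHom p))).symm)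
  have hone : algMap (E ⋙ level 0) (β.comp p) (E.obj (.of R A)).one = Tan.one R Q E :=
    Hom.map_one (E.map (CommAlgCat.ofHom (β.comp p)))
  let v : Tan (E ⋙ level 0) (Tan.one R Q E) (KerMod h) :=
    ⟨algMap (E ⋙ level 0) (toQ h) z, by
      rw [← hone, ← hz', algMap_comp, algMap_comp]
      rfl⟩
  obtain ⟨w, hw, hw'⟩ := h.exists_pair (-v) hone
  have hv : Tan.mul v (-v) = 0 := by rw [Tan.mul_eq_add, add_neg_cancel]
  have hzw : (E.obj (.of R (SqExt A (KerMod h)))).mul rfl z w =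
      (E.obj (.of R (SqExt A (KerMod h)))).one := by
    refine isSqZeroPullback_toQ.map_ext (E ⋙ level 0) ?_ ?_
    · refine (Hom.map_mul (E.map (CommAlgCat.ofHom (toQ h))) rfl z w).trans ?_
      refine (congrArg ((E.obj (.of R (SqExt Q (KerMod h)))).mul rfl v.1) hw).trans ?_
      refine (congrArg Subtype.val hv).trans ?_
      exact Tan.zero_val.trans (Hom.map_one (E.map (CommAlgCat.ofHom (toQ h)))).symm
    · refine (Hom.map_mul (E.map (CommAlgCat.ofHom (SqExt.fstHom R A (KerMod h)))) rfl z w).trans ?_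
      refine (congrArg₂ ((E.obj (.of R A)).mul rfl) hz' hw').trans ?_
      refine ((E.obj (.of R A)).one_mul _).trans ?_
      exact (Hom.map_one (E.map (CommAlgCat.ofHom (SqExt.fstHom R A (KerMod h))))).symm
  refine ⟨algMap (E ⋙ level 0) (addHom h) w, ?_⟩
  rw [← hz]
  refine (Hom.map_mul (E.map (CommAlgCat.ofHom (addHom h))) rfl z w).symm.trans ?_
  refine (congrArg (Hom.app (E.map (CommAlgCat.ofHom (addHom h))) 0) hzw).trans ?_
  exact Hom.map_one (E.map (CommAlgCat.ofHom (addHom h)))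

lemma isUnit_of_map_isUnit (hs : IsFormallySmooth R (E ⋙ level 0)) {g : (E.obj (.of R A)).X 0}
    (hg : IsUnit (Hom.zero (E.map (CommAlgCat.ofHom p)) g)) : IsUnit g := by
  obtain ⟨b, hb, hb'⟩ := isUnit_iff_exists.1 hg
  obtain ⟨g', rfl⟩ : ∃ g', Hom.zero (E.map (CommAlgCat.ofHom p)) g' = b :=
    hs (CommAlgCat.ofHom p) ⟨h.surj, fun x y hx hy => h.ann x y (by
      change β (p x) = 0
      rw [show p x = 0 from hx, map_zero]) hy⟩ b
  rw [← _root_.map_mul] at hb hb'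
  have key : ∀ c : (E.obj (.of R A)).X 0, Hom.zero (E.map (CommAlgCat.ofHom p)) c = 1 →
      IsUnit c := by
    intro c hc
    obtain ⟨d, hd⟩ := h.exists_mul_eq_one hc
    have hd' := congrArg (Hom.zero (E.map (CommAlgCat.ofHom p))) hd
    rw [_root_.map_mul, hc, _root_.one_mul, map_one] at hd'
    obtain ⟨e, he⟩ := h.exists_mul_eq_one hd'
    have : c = e := left_inv_eq_right_inv hd he
    subst this
    exact isUnit_iff_exists.2 ⟨d, hd, he⟩
  obtain ⟨u, hu, -⟩ := isUnit_iff_exists.1 (key _ hb)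
  obtain ⟨v, -, hv⟩ := isUnit_iff_exists.1 (key _ hb')
  have h1 : g * (g' * u) = 1 := by rw [← _root_.mul_assoc, hu]
  have h2 : v * g' * g = 1 := by rw [_root_.mul_assoc, hv]
  refine isUnit_iff_exists.2 ⟨g' * u, h1, ?_⟩
  rw [← left_inv_eq_right_inv h2 h1, h2]

end SmallExt

lemma isPullback_unitsSSet {E F : SimplicialObject QuasiComonoid.{w}} (f : E ⟶ F)
    (hf : ∀ k (g : (E.obj k).X 0), IsUnit (QuasiComonoid.Hom.zero (f.app k) g) → IsUnit g) :
    ∃ (a : unitsSSet.obj E ⟶ (E ⋙ QuasiComonoid.level 0 : SSet.{w}))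
      (b : unitsSSet.obj F ⟶ (F ⋙ QuasiComonoid.level 0 : SSet.{w})),
      IsPullback a (unitsSSet.map f) (Functor.whiskerRight f (QuasiComonoid.level 0)) b := by
  refine ⟨{ app := fun k => TypeCat.ofHom (Units.val : ((E.obj k).X 0)ˣ → _) },
    { app := fun k => TypeCat.ofHom (Units.val : ((F.obj k).X 0)ˣ → _) },
    IsPullback.of_forall_isPullback_app fun k => (Limits.Types.isPullback_iff _ _ _ _).2
      ⟨rfl, ?_, ?_⟩⟩
  · rintro (x : ((E.obj k).X 0)ˣ) (y : ((E.obj k).X 0)ˣ) ⟨h1, -⟩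
    exact Units.ext h1
  · rintro (x : (E.obj k).X 0) (y : ((F.obj k).X 0)ˣ) (hxy : QuasiComonoid.Hom.zero (f.app k) x = y)
    obtain ⟨g, rfl⟩ := hf k x (hxy ▸ y.isUnit)
    exact ⟨g, rfl, Units.ext hxy⟩

namespace SimplicialAlg.IsSmall

open QuasiComonoid

variable {R : Type u} [CommRing R] {A B : SimplicialObject (CommAlgCat.{u} R)} {Q : Type u}
  [CommRing Q] [Algebra R Q] {E : CommAlgCat.{u} R ⥤ QuasiComonoid.{w}}
  [∀ n, HomogeneousFunctor (E ⋙ level n)] (hs : ∀ n, IsFormallySmooth R (E ⋙ level n))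
  {p : A ⟶ B} {β : Augmentation B Q} (h : IsSmall p β)

include hs h

lemma surjective_app (k : SimplexCategoryᵒᵖ) (n : ℕ) :
    Function.Surjective (Hom.app ((Functor.whiskerRight p E).app k) n) :=
  h.surjective_map (hs n) k

theorem maurerCartan_rlp_J :
    SSet.modelCategoryQuillen.J.rlp (maurerCartan.map (Functor.whiskerRight p E)) :=
  MaurerCartan.map_rlp_J (fun n => h.rlp_J (E ⋙ level n) (hs n))
    (fun n m => h.surjective_app hs (op m) n) fun _ x N => h.hasCorrector x N

theorem maurerCartan_rlp_I (hA : IsKerAcyclic p) :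
    SSet.modelCategoryQuillen.I.rlp (maurerCartan.map (Functor.whiskerRight p E)) :=
  MaurerCartan.map_rlp_I (fun n => h.rlp_I (E ⋙ level n) (hs n) hA)
    (fun n m => h.surjective_app hs (op m) n) fun _ x N => h.hasCorrector x N

lemma isUnit (k : SimplexCategoryᵒᵖ) (g : ((A ⋙ E).obj k).X 0)
    (hg : IsUnit (Hom.zero ((Functor.whiskerRight p E).app k) g)) : IsUnit g :=
  (h k).isUnit_of_map_isUnit (hs 0) hg

theorem unitsSSet_rlp_J :
    SSet.modelCategoryQuillen.J.rlp (unitsSSet.map (Functor.whiskerRight p E)) := by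
  obtain ⟨a, b, hab⟩ := isPullback_unitsSSet _ (h.isUnit hs)
  exact MorphismProperty.of_isPullback hab (h.rlp_J (E ⋙ level 0) (hs 0))

theorem unitsSSet_rlp_I (hA : IsKerAcyclic p) :
    SSet.modelCategoryQuillen.I.rlp (unitsSSet.map (Functor.whiskerRight p E)) := by
  obtain ⟨a, b, hab⟩ := isPullback_unitsSSet _ (h.isUnit hs)
  exact MorphismProperty.of_isPullback hab (h.rlp_I (E ⋙ level 0) (hs 0) hA)

theorem surjective_units (k : SimplexCategoryᵒᵖ) :
    Function.Surjective (Units.map (Hom.zero ((Functor.whiskerRight p E).app k))) := by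
  intro y
  obtain ⟨x, hx⟩ := h.surjective_app hs k 0 y.val
  obtain ⟨g, rfl⟩ := h.isUnit hs k x (by
    rw [show Hom.zero ((Functor.whiskerRight p E).app k) x = y.val from hx]
    exact y.isUnit)
  exact ⟨g, Units.ext hx⟩

theorem derivedDeligneNerve_rlp_J :
    SSet.modelCategoryQuillen.J.rlp (derivedDeligneNerve.map (Functor.whiskerRight p E)) :=
  _root_.derivedDeligneNerve_rlp_J _ (h.maurerCartan_rlp_J hs) (h.unitsSSet_rlp_J hs)
    (h.surjective_units hs _)

theorem derivedDeligneNerve_rlp_I (hA : IsKerAcyclic p) :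
    SSet.modelCategoryQuillen.I.rlp (derivedDeligneNerve.map (Functor.whiskerRight p E)) :=
  _root_.derivedDeligneNerve_rlp_I _ (h.maurerCartan_rlp_I hs hA) (h.unitsSSet_rlp_I hs hA)

theorem deligneNerve_rlp_J :
    SSet.modelCategoryQuillen.J.rlp (deligneNerve.map (Functor.whiskerRight p E)) :=
  _root_.deligneNerve_rlp_J _ (h.surjective_units hs _)

end SimplicialAlg.IsSmall

end

section

/-! ## Filtrations by small extensions -/

lemma Ideal.sup_pow_le_pow_sup {S : Type*} [CommRing S] (I K : Ideal S) (N : ℕ) :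
    (I ⊔ K) ^ N ≤ I ^ N ⊔ K := by
  induction N with
  | zero => simp
  | succ N ih =>
    rw [pow_succ, pow_succ]
    refine (Ideal.mul_mono ih le_rfl).trans ?_
    rw [Ideal.sup_mul, Ideal.mul_sup]
    exact sup_le (sup_le le_sup_left (Ideal.mul_le_right.trans le_sup_right))
      (Ideal.mul_le_left.trans le_sup_right)

lemma Ideal.map_mk_pow_mul_map_mk {S : Type*} [CommRing S] (J K : Ideal S) (N : ℕ) :
    J.map (Ideal.Quotient.mk (J ^ N * K)) ^ N * K.map (Ideal.Quotient.mk (J ^ N * K)) = ⊥ := by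
  rw [← Ideal.map_pow, ← Ideal.map_mul]
  exact Ideal.map_quotient_self _

variable {R : Type u} [CommRing R]

namespace SimplicialAlg

section Quotient

variable {A B : SimplicialObject (CommAlgCat.{u} R)} (I : ∀ m, Ideal (A.obj m))
  (hI : ∀ {m m'} (θ : m ⟶ m'), I m ≤ (I m').comap (A.map θ).hom)

/-- The quotient of a simplicial algebra by a simplicial ideal. -/
def quot : SimplicialObject (CommAlgCat.{u} R) where
  obj m := .of R (A.obj m ⧸ I m)
  map θ := CommAlgCat.ofHom (Ideal.quotientMapₐ _ (A.map θ).hom (hI θ))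
  map_id m := CommAlgCat.hom_ext (Ideal.Quotient.algHom_ext _ (AlgHom.ext fun x => by
    change Ideal.Quotient.mk (I m) ((A.map (𝟙 m)).hom x) = Ideal.Quotient.mk _ x
    rw [A.map_id]
    rfl))
  map_comp {m m' m''} θ φ := CommAlgCat.hom_ext (Ideal.Quotient.algHom_ext _ (AlgHom.ext fun x => by
    change Ideal.Quotient.mk (I m'') ((A.map (θ ≫ φ)).hom x) =
      Ideal.Quotient.mk _ ((A.map φ).hom ((A.map θ).hom x))
    rw [A.map_comp]
    rfl))

/-- The projection to the quotient. -/
def quotMk : A ⟶ quot I hI where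
  app m := CommAlgCat.ofHom (Ideal.Quotient.mkₐ R (I m))
  naturality _ _ _ := rfl

/-- Maps out of the quotient. -/
def quotLift (p : A ⟶ B) (hp : ∀ m, I m ≤ RingHom.ker (p.app m).hom) : quot I hI ⟶ B where
  app m := CommAlgCat.ofHom (Ideal.Quotient.liftₐ (I m) (p.app m).hom fun _ ha => hp m ha)
  naturality m m' θ := CommAlgCat.hom_ext (Ideal.Quotient.algHom_ext _
    (congrArg CommAlgCat.Hom.hom (p.naturality θ)))

lemma quotMk_quotLift (p : A ⟶ B) (hp : ∀ m, I m ≤ RingHom.ker (p.app m).hom) :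
    quotMk I hI ≫ quotLift I hI p hp = p := rfl

end Quotient

variable {A B : SimplicialObject (CommAlgCat.{u} R)} {Q : Type u} [CommRing Q] [Algebra R Q]

/-- The pullback of an augmentation. -/
def Augmentation.comap (β : Augmentation B Q) (p : A ⟶ B) : Augmentation A Q where
  hom m := (β.hom m).comp (p.app m).hom
  hom_comp_map {m m'} θ := by
    rw [← β.hom_comp_map θ, AlgHom.comp_assoc, AlgHom.comp_assoc]
    exact congrArg _ (congrArg CommAlgCat.Hom.hom (p.naturality θ))

lemma isIso_of_bijective (p : A ⟶ B) (hp : ∀ m, Function.Bijective (p.app m).hom) : IsIso p := by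
  have : ∀ m, IsIso (p.app m) := fun m =>
    ⟨CommAlgCat.ofHom (AlgEquiv.ofBijective (p.app m).hom (hp m)).symm.toAlgHom,
      CommAlgCat.hom_ext (AlgHom.ext fun x =>
        (AlgEquiv.ofBijective (p.app m).hom (hp m)).symm_apply_apply x),
      CommAlgCat.hom_ext (AlgHom.ext fun x =>
        (AlgEquiv.ofBijective (p.app m).hom (hp m)).apply_symm_apply x)⟩
  exact NatIso.isIso_of_isIso_app p

variable (W : MorphismProperty (SimplicialObject (CommAlgCat.{u} R))) [W.IsMultiplicative]
  [W.RespectsIso]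

theorem of_pow_mul_ker_eq_bot (N : ℕ) {A B : SimplicialObject (CommAlgCat.{u} R)} (p : A ⟶ B)
    (β : Augmentation B Q)
    (hW : ∀ {A B : SimplicialObject (CommAlgCat.{u} R)} (p : A ⟶ B) (β : Augmentation B Q),
      IsSmall p β → W p)
    (hp : ∀ m, Function.Surjective (p.app m).hom) (hβ : ∀ m, Function.Surjective (β.hom m))
    (h : ∀ m, RingHom.ker ((β.hom m).comp (p.app m).hom) ^ N * RingHom.ker (p.app m).hom = ⊥) :
    W p := by
  induction N generalizing A with
  | zero =>
    have := isIso_of_bijective p fun m => ⟨by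
      rw [RingHom.injective_iff_ker_eq_bot]
      simpa using h m, hp m⟩
    exact W.of_isIso p
  | succ N ih =>
    let J : ∀ m, Ideal (A.obj m) := fun m => RingHom.ker ((β.hom m).comp (p.app m).hom)
    let K : ∀ m, Ideal (A.obj m) := fun m => RingHom.ker (p.app m).hom
    let I : ∀ m, Ideal (A.obj m) := fun m => J m ^ N * K m
    have hJ : ∀ {m m'} (θ : m ⟶ m'), (J m).map (A.map θ).hom ≤ J m' := by
      intro m m' θ
      refine Ideal.map_le_iff_le_comap.2 fun x (hx : β.hom m ((p.app m).hom x) = 0) => ?_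
      change β.hom m' ((p.app m').hom ((A.map θ).hom x)) = 0
      rw [← hx]
      exact AlgHom.congr_fun ((β.comap p).hom_comp_map θ) x
    have hK : ∀ {m m'} (θ : m ⟶ m'), (K m).map (A.map θ).hom ≤ K m' := by
      intro m m' θ
      refine Ideal.map_le_iff_le_comap.2 fun x (hx : (p.app m).hom x = 0) => ?_
      change (p.app m').hom ((A.map θ).hom x) = 0
      refine (AlgHom.congr_fun (congrArg CommAlgCat.Hom.hom (p.naturality θ)) x).trans ?_
      change (B.map θ).hom ((p.app m).hom x) = 0
      rw [hx, map_zero]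
    have hI : ∀ {m m'} (θ : m ⟶ m'), I m ≤ (I m').comap (A.map θ).hom := by
      intro m m' θ
      refine Ideal.map_le_iff_le_comap.1 ?_
      rw [Ideal.map_mul, Ideal.map_pow]
      exact Ideal.mul_mono (Ideal.pow_right_mono (hJ θ) N) (hK θ)
    have hIK : ∀ m, I m ≤ RingHom.ker (p.app m).hom := fun m => Ideal.mul_le_right
    rw [← quotMk_quotLift I hI p hIK]
    refine W.comp_mem _ _ (hW _ (β.comap (quotLift I hI p hIK)) fun m => ?_) (ih _ ?_ ?_)
    · refine ⟨Ideal.Quotient.mk_surjective, ?_, fun a k ha hk => ?_⟩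
      · exact (hβ m).comp (Ideal.Quotient.lift_surjective_of_surjective (I m) (fun _ ha => hIK m ha) (hp m))
      · have hk' : k ∈ J m ^ N * K m := Ideal.Quotient.eq_zero_iff_mem.1 hk
        have := Ideal.mul_mem_mul (show a ∈ J m from ha) hk'
        rwa [← mul_assoc, ← pow_succ', h m] at this
    · exact fun m => Ideal.Quotient.lift_surjective_of_surjective (I m) (fun _ ha => hIK m ha) (hp m)
    · intro m
      have e1 : RingHom.ker ((quotLift I hI p hIK).app m).hom ≤
          (K m).map (Ideal.Quotient.mk (I m)) := by
        intro x hx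
        obtain ⟨x, rfl⟩ := Ideal.Quotient.mk_surjective x
        exact Ideal.mem_map_of_mem _ hx
      have e2 : RingHom.ker ((β.hom m).comp ((quotLift I hI p hIK).app m).hom) ≤
          (J m).map (Ideal.Quotient.mk (I m)) := by
        intro x hx
        obtain ⟨x, rfl⟩ := Ideal.Quotient.mk_surjective x
        exact Ideal.mem_map_of_mem _ hx
      refine le_bot_iff.1 ((Ideal.mul_mono (Ideal.pow_right_mono e2 N) e1).trans ?_)
      exact (Ideal.map_mk_pow_mul_map_mk (J m) (K m) N).le

theorem of_squareZero (N : ℕ) (p : A ⟶ B) (β : Augmentation B Q)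
    (hW : ∀ {A B : SimplicialObject (CommAlgCat.{u} R)} (p : A ⟶ B) (β : Augmentation B Q),
      IsSmall p β → W p)
    (hp : ∀ m, Function.Surjective (p.app m).hom) (hβ : ∀ m, Function.Surjective (β.hom m))
    (hsq : ∀ m x y, (p.app m).hom x = 0 → (p.app m).hom y = 0 → x * y = 0)
    (I : ∀ m, Ideal (A.obj m)) (hI : ∀ m, I m ^ N = ⊥)
    (h : ∀ m, RingHom.ker ((β.hom m).comp (p.app m).hom) ≤ I m ⊔ RingHom.ker (p.app m).hom) :
    W p := by
  refine of_pow_mul_ker_eq_bot W N p β hW hp hβ fun m => le_bot_iff.1 ?_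
  have h1 : RingHom.ker ((β.hom m).comp (p.app m).hom) ^ N ≤ RingHom.ker (p.app m).hom := by
    refine (Ideal.pow_right_mono (h m) N).trans ?_
    have h2 := Ideal.sup_pow_le_pow_sup (I m) (RingHom.ker (p.app m).hom) N
    rwa [hI m, bot_sup_eq] at h2
  exact Ideal.mul_le.2 fun x hx y hy => hsq m x y (h1 hx) hy

/-! ### Augmentations over quotients of `π_0` -/

lemma map_vertex_sub_mem {n : SimplexCategory} (v v' : ⦋0⦌ ⟶ n) (x : B.obj (op n)) :
    (B.map v.op).hom x - (B.map v'.op).hom x ∈ boundaryIdeal B := by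
  wlog h : v.toOrderHom 0 ≤ v'.toOrderHom 0 generalizing v v'
  · rw [← neg_mem_iff, neg_sub]
    exact this v' v (le_of_not_ge h)
  let e : ⦋1⦌ ⟶ n := SimplexCategory.mkOfLe (v.toOrderHom 0) (v'.toOrderHom 0) h
  have e1 : SimplexCategory.δ (1 : Fin 2) ≫ e = v := by
    refine SimplexCategory.Hom.ext _ _ (OrderHom.ext _ _ (funext fun j => ?_))
    obtain rfl : j = 0 := Subsingleton.elim (α := Fin 1) _ _
    rfl
  have e0 : SimplexCategory.δ (0 : Fin 2) ≫ e = v' := by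
    refine SimplexCategory.Hom.ext _ _ (OrderHom.ext _ _ (funext fun j => ?_))
    obtain rfl : j = 0 := Subsingleton.elim (α := Fin 1) _ _
    rfl
  rw [← neg_mem_iff, neg_sub]
  refine Ideal.subset_span ⟨(B.map e.op).hom x, ?_⟩
  rw [← e1, ← e0, op_comp, op_comp, B.map_comp, B.map_comp]
  rfl

/-- The augmentation of `B` over a quotient of `π_0 B`. -/
def augmentation (B : SimplicialObject (CommAlgCat.{u} R)) (L : Ideal (B.obj (op ⦋0⦌)))
    (hL : boundaryIdeal B ≤ L) : Augmentation B (B.obj (op ⦋0⦌) ⧸ L) where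
  hom m := (Ideal.Quotient.mkₐ R L).comp (B.map (SimplexCategory.const ⦋0⦌ m.unop 0).op).hom
  hom_comp_map {m m'} θ := by
    refine AlgHom.ext fun x => (Ideal.Quotient.mk_eq_mk_iff_sub_mem _ _).2 (hL ?_)
    have := map_vertex_sub_mem (SimplexCategory.const ⦋0⦌ m'.unop 0 ≫ θ.unop)
      (SimplexCategory.const ⦋0⦌ m.unop 0) x
    rw [op_comp, B.map_comp] at this
    exact this

lemma map_vertex_map_const (m : SimplexCategoryᵒᵖ) (b : B.obj (op ⦋0⦌)) :
    (B.map (SimplexCategory.const ⦋0⦌ m.unop 0).op).hom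
      ((B.map (SimplexCategory.const m.unop ⦋0⦌ 0).op).hom b) = b := by
  have h : SimplexCategory.const ⦋0⦌ m.unop 0 ≫ SimplexCategory.const m.unop ⦋0⦌ 0 = 𝟙 _ :=
    Subsingleton.elim _ _
  have h2 := B.map_comp (SimplexCategory.const m.unop ⦋0⦌ 0).op
    (SimplexCategory.const ⦋0⦌ m.unop 0).op
  rw [← op_comp, h, op_id, B.map_id] at h2
  exact (AlgHom.congr_fun (congrArg CommAlgCat.Hom.hom h2) b).symm

lemma augmentation_surjective (L : Ideal (B.obj (op ⦋0⦌))) (hL : boundaryIdeal B ≤ L)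
    (m : SimplexCategoryᵒᵖ) : Function.Surjective ((augmentation B L hL).hom m) := by
  intro q
  obtain ⟨b, rfl⟩ := Ideal.Quotient.mk_surjective q
  exact ⟨(B.map (SimplexCategory.const m.unop ⦋0⦌ 0).op).hom b,
    congrArg _ (map_vertex_map_const m b)⟩

lemma augmentation_hom_eq_zero_iff {L : Ideal (B.obj (op ⦋0⦌))} {hL : boundaryIdeal B ≤ L}
    {m : SimplexCategoryᵒᵖ} {x : B.obj m} : (augmentation B L hL).hom m x = 0 ↔
      (B.map (SimplexCategory.const ⦋0⦌ m.unop 0).op).hom x ∈ L :=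
  Ideal.Quotient.eq_zero_iff_mem

end SimplicialAlg

end

section

/-! ## Fibrations induced by square-zero and tiny acyclic extensions -/

variable {R : Type u} [CommRing R]

namespace SimplicialAlg

open QuasiComonoid

section Nerve

variable {E : CommAlgCat.{u} R ⥤ QuasiComonoid.{w}} (hE : IsHomogeneousQM R E)
  (hs : ∀ n, IsFormallySmooth R (E ⋙ level n)) {A B : SimplicialObject (CommAlgCat.{u} R)}
  {Q : Type u} [CommRing Q] [Algebra R Q]

include hE hs

theorem nerve_rlp_J_of_squareZero (N : ℕ) (p : A ⟶ B) (β : Augmentation B Q)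
    (hp : ∀ m, Function.Surjective (p.app m).hom) (hβ : ∀ m, Function.Surjective (β.hom m))
    (hsq : ∀ m x y, (p.app m).hom x = 0 → (p.app m).hom y = 0 → x * y = 0)
    (I : ∀ m, Ideal (A.obj m)) (hI : ∀ m, I m ^ N = ⊥)
    (h : ∀ m, RingHom.ker ((β.hom m).comp (p.app m).hom) ≤ I m ⊔ RingHom.ker (p.app m).hom) :
    IsKanFibration (derivedDeligneNerve.map (Functor.whiskerRight p E)) ∧
      IsKanFibration (deligneNerve.map (Functor.whiskerRight p E)) := by
  have : ∀ n, HomogeneousFunctor (E ⋙ level n) := fun n => ⟨hE n⟩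
  exact ⟨of_squareZero (SSet.modelCategoryQuillen.J.rlp.inverseImage
      ((SimplicialObject.whiskering _ _).obj E ⋙ derivedDeligneNerve)) N p β
      (fun _ _ h => h.derivedDeligneNerve_rlp_J hs) hp hβ hsq I hI h,
    of_squareZero (SSet.modelCategoryQuillen.J.rlp.inverseImage
      ((SimplicialObject.whiskering _ _).obj E ⋙ deligneNerve)) N p β
      (fun _ _ h => h.deligneNerve_rlp_J hs) hp hβ hsq I hI h⟩

theorem nerve_of_isKerAcyclic (p : A ⟶ B) (β : Augmentation B Q) (h : IsSmall p β)
    (hA : IsKerAcyclic p) :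
    IsTrivialKanFibration (derivedDeligneNerve.map (Functor.whiskerRight p E)) ∧
      IsSurjectiveKanFibration (deligneNerve.map (Functor.whiskerRight p E)) := by
  have : ∀ n, HomogeneousFunctor (E ⋙ level n) := fun n => ⟨hE n⟩
  exact ⟨h.derivedDeligneNerve_rlp_I hs hA, h.deligneNerve_rlp_J hs,
    deligneNerve_surjective _ ((SSet.rlp_I_iff _).1 (h.maurerCartan_rlp_I hs hA)).1
      (h.surjective_units hs _)⟩

omit hs in
lemma isLevelwisePullback {P A B C : SimplicialObject (CommAlgCat.{u} R)} {a : P ⟶ A} {c : P ⟶ C}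
    {f : A ⟶ B} {g : C ⟶ B} (hf : ∀ k, algSquareZero R (f.app k))
    (h : ∀ k, IsPullback (a.app k) (c.app k) (f.app k) (g.app k)) :
    IsLevelwisePullback (Functor.whiskerRight a E) (Functor.whiskerRight c E)
      (Functor.whiskerRight f E) (Functor.whiskerRight g E) :=
  fun n k => hE n (hf _) (h (op k))

end Nerve

section FiberProduct

variable {A B C : SimplicialObject (CommAlgCat.{u} R)} (f : A ⟶ B) (g : C ⟶ B)

/-- The fibre product of simplicial algebras. -/
def fiberProd : SimplicialObject (CommAlgCat.{u} R) where
  obj m := .of R (AlgHom.equalizer ((f.app m).hom.comp (AlgHom.fst R (A.obj m) (C.obj m)))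
    ((g.app m).hom.comp (AlgHom.snd R (A.obj m) (C.obj m))))
  map {m m'} θ := CommAlgCat.ofHom
    ((((A.map θ).hom.prodMap (C.map θ).hom).comp (Subalgebra.val _)).codRestrict _ fun x => by
      refine (AlgHom.congr_fun (congrArg CommAlgCat.Hom.hom (f.naturality θ)) x.1.1).trans
        (Eq.trans ?_ (AlgHom.congr_fun (congrArg CommAlgCat.Hom.hom (g.naturality θ)) x.1.2).symm)
      exact congrArg (B.map θ).hom x.2)
  map_id m := CommAlgCat.hom_ext (AlgHom.ext fun x => Subtype.ext (Prod.ext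
    (AlgHom.congr_fun (congrArg CommAlgCat.Hom.hom (A.map_id m)) x.1.1)
    (AlgHom.congr_fun (congrArg CommAlgCat.Hom.hom (C.map_id m)) x.1.2)))
  map_comp θ φ := CommAlgCat.hom_ext (AlgHom.ext fun x => Subtype.ext (Prod.ext
    (AlgHom.congr_fun (congrArg CommAlgCat.Hom.hom (A.map_comp θ φ)) x.1.1)
    (AlgHom.congr_fun (congrArg CommAlgCat.Hom.hom (C.map_comp θ φ)) x.1.2)))

/-- The first projection. -/
def fiberProdFst : fiberProd f g ⟶ A where
  app m := CommAlgCat.ofHom ((AlgHom.fst R (A.obj m) (C.obj m)).comp (Subalgebra.val _))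
  naturality _ _ _ := rfl

/-- The second projection. -/
def fiberProdSnd : fiberProd f g ⟶ C where
  app m := CommAlgCat.ofHom ((AlgHom.snd R (A.obj m) (C.obj m)).comp (Subalgebra.val _))
  naturality _ _ _ := rfl

variable {f g}

lemma fiberProd_ext {m : SimplexCategoryᵒᵖ} {x y : (fiberProd f g).obj m}
    (h1 : ((fiberProdFst f g).app m).hom x = ((fiberProdFst f g).app m).hom y)
    (h2 : ((fiberProdSnd f g).app m).hom x = ((fiberProdSnd f g).app m).hom y) : x = y :=
  Subtype.ext (Prod.ext h1 h2)

variable (f g)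

lemma isPullback_fiberProd_app (m : SimplexCategoryᵒᵖ) : IsPullback
    ((fiberProdFst f g).app m) ((fiberProdSnd f g).app m) (f.app m) (g.app m) :=
  CommAlgCat.isPullback_of_forall (CommAlgCat.hom_ext (AlgHom.ext fun x => x.2))
    (fun _ _ h1 h2 => fiberProd_ext h1 h2) fun a c h => ⟨⟨(a, c), h⟩, rfl, rfl⟩

lemma isPullback_fiberProd : IsPullback (fiberProdFst f g) (fiberProdSnd f g) f g :=
  IsPullback.of_forall_isPullback_app (isPullback_fiberProd_app f g)

end FiberProduct

section AugIdeal

variable {A B : SimplicialObject (CommAlgCat.{u} R)} (f : A ⟶ B)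

lemma naturality_apply {m m' : SimplexCategoryᵒᵖ} (θ : m ⟶ m') (x : A.obj m) :
    (f.app m').hom ((A.map θ).hom x) = (B.map θ).hom ((f.app m).hom x) :=
  AlgHom.congr_fun (congrArg CommAlgCat.Hom.hom (f.naturality θ)) x

lemma map_boundaryIdeal_le : (boundaryIdeal A).map (f.app _).hom ≤ boundaryIdeal B := by
  rw [boundaryIdeal, Ideal.map_span, Ideal.span_le]
  rintro _ ⟨_, ⟨x, rfl⟩, rfl⟩
  refine Ideal.subset_span ⟨(f.app _).hom x, ?_⟩
  change _ = (f.app _).hom _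
  rw [map_sub]
  exact congrArg₂ (· - ·) (naturality_apply f _ x).symm (naturality_apply f _ x).symm

lemma boundaryIdeal_le_map (hf : ∀ m, Function.Surjective (f.app m).hom) :
    boundaryIdeal B ≤ (boundaryIdeal A).map (f.app _).hom := by
  rw [boundaryIdeal, Ideal.span_le]
  rintro _ ⟨y, rfl⟩
  obtain ⟨x, rfl⟩ := hf _ y
  have h := Ideal.mem_map_of_mem (f.app (op ⦋0⦌)).hom
    (Ideal.subset_span ⟨x, rfl⟩ : (A.δ 0).hom x - (A.δ 1).hom x ∈ boundaryIdeal A)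
  rw [map_sub] at h
  have e : ∀ i : Fin 2, (f.app (op ⦋0⦌)).hom ((A.δ i).hom x) = (B.δ i).hom ((f.app (op ⦋1⦌)).hom x) :=
    fun i => naturality_apply f _ x
  rw [e, e] at h
  exact h

lemma map_mem_augIdeal {n : ℕ} {x : A.obj (op ⦋n⦌)} (hx : x ∈ augIdeal A n) :
    (f.app _).hom x ∈ augIdeal B n := by
  change (B.map (SimplexCategory.const ⦋0⦌ ⦋n⦌ 0).op).hom _ ∈ boundaryIdeal B
  rw [← naturality_apply]
  exact map_boundaryIdeal_le f (Ideal.mem_map_of_mem _ hx)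

omit f in
lemma mem_normalized_succ {n : ℕ} {x : A.obj (op ⦋n + 1⦌)} :
    x ∈ normalized A (n + 1) ↔ ∀ i : Fin (n + 1), (A.δ i.succ).hom x = 0 := by
  simp only [normalized, Submodule.mem_iInf]
  rfl

lemma map_mem_normalized {n : ℕ} {x : A.obj (op ⦋n⦌)} (hx : x ∈ normalized A n) :
    (f.app _).hom x ∈ normalized B n := by
  cases n with
  | zero => trivial
  | succ n =>
    refine mem_normalized_succ.2 fun i => ?_
    refine (naturality_apply f _ x).symm.trans ?_
    exact (congrArg (f.app _).hom (mem_normalized_succ.1 hx i)).trans (map_zero _)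

end AugIdeal

section Ideals

variable {E : CommAlgCat.{u} R ⥤ QuasiComonoid.{w}} (hE : IsHomogeneousQM R E)
  (hs : ∀ n, IsFormallySmooth R (E ⋙ level n)) {A B : SimplicialObject (CommAlgCat.{u} R)}
  (p : A ⟶ B) (hp : ∀ m, Function.Surjective (p.app m).hom) (L : Ideal (A.obj (op ⦋0⦌)))
  (L' : Ideal (B.obj (op ⦋0⦌))) (hL' : boundaryIdeal B ≤ L') (hLL' : L' ≤ L.map (p.app _).hom)

include hp hLL'

lemma ker_augmentation_le (m : SimplexCategoryᵒᵖ) :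
    RingHom.ker (((augmentation B L' hL').hom m).comp (p.app m).hom) ≤
      L.comap (A.map (SimplexCategory.const ⦋0⦌ m.unop 0).op).hom ⊔ RingHom.ker (p.app m).hom := by
  intro x hx
  have hx : (B.map (SimplexCategory.const ⦋0⦌ m.unop 0).op).hom ((p.app m).hom x) ∈ L' :=
    (augmentation_hom_eq_zero_iff (hL := hL')).1 hx
  rw [← naturality_apply] at hx
  obtain ⟨b, hb, hb'⟩ := (Ideal.mem_map_iff_of_surjective (p.app _).hom (hp _)).1 (hLL' hx)
  let c := (A.map (SimplexCategory.const m.unop ⦋0⦌ 0).op).hom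
    ((A.map (SimplexCategory.const ⦋0⦌ m.unop 0).op).hom x - b)
  rw [← sub_add_cancel x c]
  refine Submodule.add_mem_sup ?_ ?_
  · change (A.map (SimplexCategory.const ⦋0⦌ m.unop 0).op).hom (x - c) ∈ L
    rw [map_sub, map_vertex_map_const, sub_sub_cancel]
    exact hb
  · change (p.app m).hom c = 0
    refine (naturality_apply p (SimplexCategory.const m.unop ⦋0⦌ 0).op _).trans ?_
    rw [map_sub, sub_eq_zero.2 hb'.symm, map_zero]

include hE hs hL' in
theorem nerve_rlp_J_of_nilpotent
    (hsq : ∀ m x y, (p.app m).hom x = 0 → (p.app m).hom y = 0 → x * y = 0) (N : ℕ)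
    (hN : ∀ m : SimplexCategoryᵒᵖ,
      (L.comap (A.map (SimplexCategory.const ⦋0⦌ m.unop 0).op).hom) ^ N = ⊥) :
    IsKanFibration (derivedDeligneNerve.map (Functor.whiskerRight p E)) ∧
      IsKanFibration (deligneNerve.map (Functor.whiskerRight p E)) :=
  nerve_rlp_J_of_squareZero hE hs N p (augmentation B L' hL') hp (augmentation_surjective L' hL')
    hsq _ hN (ker_augmentation_le p hp L L' hL' hLL')

include hE hs hL' in
theorem nerve_of_annihilated (hK : ∀ y, (p.app (op ⦋0⦌)).hom y = 0 → y ∈ L)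
    (hann : ∀ (m : SimplexCategoryᵒᵖ) (x y : A.obj m),
      (A.map (SimplexCategory.const ⦋0⦌ m.unop 0).op).hom x ∈ L → (p.app m).hom y = 0 → x * y = 0)
    (hA : IsKerAcyclic p) :
    IsTrivialKanFibration (derivedDeligneNerve.map (Functor.whiskerRight p E)) ∧
      IsSurjectiveKanFibration (deligneNerve.map (Functor.whiskerRight p E)) := by
  refine nerve_of_isKerAcyclic hE hs p (augmentation B L' hL') (fun m => ⟨hp m,
    augmentation_surjective L' hL' m, fun x y hx hy => hann m x y ?_ hy⟩) hA
  obtain ⟨a, ha, b, hb, rfl⟩ := Submodule.mem_sup.1 (ker_augmentation_le p hp L L' hL' hLL' m hx)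
  rw [map_add]
  refine Ideal.add_mem _ ha (hK _ ?_)
  rw [naturality_apply, show (p.app m).hom b = 0 from hb, map_zero]

end Ideals

end SimplicialAlg

namespace SN

open SimplicialAlg

variable {P A B C : SN R} {a : P ⟶ A} {c : P ⟶ C} {f : A ⟶ B} {g : C ⟶ B}

lemma isNilpotentBounded_fiberProd (f : A ⟶ B) (g : C ⟶ B) :
    isNilpotentBounded (fiberProd f.hom g.hom) := by
  obtain ⟨⟨N, hN⟩, M, hM⟩ := A.property
  obtain ⟨⟨N', hN'⟩, M', hM'⟩ := C.property
  refine ⟨⟨max N N', fun n => ?_⟩, max M M', fun i hi => ?_⟩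
  · have key : ∀ {D : SimplicialObject (CommAlgCat.{u} R)} (q : fiberProd f.hom g.hom ⟶ D) (N : ℕ)
        (_ : augIdeal D n ^ N = ⊥) (N' : ℕ) (_ : N ≤ N'),
        ∀ x ∈ augIdeal (fiberProd f.hom g.hom) n ^ N', (q.app _).hom x = 0 := by
      intro D q N hN N' hNN' x hx
      have h1 : (augIdeal (fiberProd f.hom g.hom) n).map (q.app _).hom ≤ augIdeal D n :=
        Ideal.map_le_iff_le_comap.2 fun _ => map_mem_augIdeal q
      have h2 := Ideal.mem_map_of_mem (q.app _).hom (Ideal.pow_le_pow_right hNN' hx)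
      rw [Ideal.map_pow] at h2
      have h3 := Ideal.pow_right_mono h1 N h2
      rwa [hN] at h3
    rw [eq_bot_iff]
    intro x hx
    exact fiberProd_ext
      ((key (fiberProdFst f.hom g.hom) N (hN n) _ (le_max_left _ _) x hx).trans (map_zero _).symm)
      ((key (fiberProdSnd f.hom g.hom) N' (hN' n) _ (le_max_right _ _) x hx).trans
        (map_zero _).symm)
  · rw [eq_bot_iff]
    intro x hx
    have h1 := map_mem_normalized (fiberProdFst f.hom g.hom) hx
    have h2 := map_mem_normalized (fiberProdSnd f.hom g.hom) hx
    rw [hM i (le_trans (le_max_left _ _) hi)] at h1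
    rw [hM' i (le_trans (le_max_right _ _) hi)] at h2
    exact fiberProd_ext (Eq.trans h1 (map_zero _).symm) (Eq.trans h2 (map_zero _).symm)

lemma isPullback_app (h : IsPullback a c f g) (k : SimplexCategoryᵒᵖ) :
    IsPullback (a.hom.app k) (c.hom.app k) (f.hom.app k) (g.hom.app k) := by
  let P' : SN R := ⟨fiberProd f.hom g.hom, isNilpotentBounded_fiberProd f g⟩
  let a' : P' ⟶ A := ObjectProperty.homMk (fiberProdFst f.hom g.hom)
  let c' : P' ⟶ C := ObjectProperty.homMk (fiberProdSnd f.hom g.hom)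
  have h0 := isPullback_fiberProd f.hom g.hom
  have h' : IsPullback a' c' f g :=
    IsPullback.of_map (ObjectProperty.ι _) (ObjectProperty.hom_ext _ h0.w) h0
  let e := (ObjectProperty.ι _ ⋙ (evaluation _ _).obj k).mapIso (h.isoIsPullback A C h')
  refine IsPullback.of_iso (isPullback_fiberProd_app f.hom g.hom k) e.symm (Iso.refl _)
    (Iso.refl _) (Iso.refl _) ?_ ?_ (by simp) (by simp)
  · rw [Iso.refl_hom, Category.comp_id, Iso.symm_hom, Iso.eq_inv_comp]
    exact congrArg (fun q : P ⟶ A => q.hom.app k)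
      (h.isoIsPullback_hom_fst A C h')
  · rw [Iso.refl_hom, Category.comp_id, Iso.symm_hom, Iso.eq_inv_comp]
    exact congrArg (fun q : P ⟶ C => q.hom.app k)
      (h.isoIsPullback_hom_snd A C h')

variable {E : CommAlgCat.{u} R ⥤ QuasiComonoid.{w}} (hE : IsHomogeneousQM R E)
  (hs : ∀ n, IsFormallySmooth R (E ⋙ QuasiComonoid.level n))

include hE

theorem isHomogeneous_nerve : IsHomogeneous (squareZero R) (underline R E ⋙ derivedDeligneNerve) ∧
    IsHomogeneous (squareZero R) (underline R E ⋙ deligneNerve) :=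
  ⟨fun _ _ _ _ _ _ _ _ hf h => (isLevelwisePullback hE (fun k => hf k.unop.len)
      (isPullback_app h)).isPullback_derivedDeligneNerve,
    fun _ _ _ _ _ _ _ _ hf h => (isLevelwisePullback hE (fun k => hf k.unop.len)
      (isPullback_app h)).isPullback_deligneNerve⟩

include hs

theorem nerve_of_squareZero (hf : squareZero R f) :
    IsKanFibration ((underline R E ⋙ derivedDeligneNerve).map f) ∧
      IsKanFibration ((underline R E ⋙ deligneNerve).map f) := by
  obtain ⟨⟨N, hN⟩, -⟩ := A.property
  exact nerve_rlp_J_of_nilpotent hE hs f.hom (fun m => (hf m.unop.len).1) _ _ le_rfl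
    (boundaryIdeal_le_map f.hom fun m => (hf m.unop.len).1) (fun m => (hf m.unop.len).2) N
    fun m => hN m.unop.len

theorem nerve_of_tinyAcyclic (hf : tinyAcyclic R f) :
    IsTrivialKanFibration ((underline R E ⋙ derivedDeligneNerve).map f) ∧
      IsSurjectiveKanFibration ((underline R E ⋙ deligneNerve).map f) := by
  obtain ⟨hsurj, hann, r, hr, hbij⟩ := hf
  refine nerve_of_annihilated hE hs f.hom (fun m => hsurj m.unop.len) _ _ le_rfl
    (boundaryIdeal_le_map f.hom fun m => hsurj m.unop.len) (fun y hy => ?_)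
    (fun m => hann m.unop.len) fun n z hz hz' => ?_
  · have hy' : y ∈ kerNormalized f.hom 0 := ⟨trivial, hy⟩
    rcases Nat.eq_zero_or_pos r with rfl | hr0
    · obtain ⟨x, hx, rfl⟩ := hbij.surjOn hy'
      have h1 : (A.obj.δ 1).hom x = 0 := mem_normalized_succ.1 hx.1 0
      rw [← sub_zero ((A.obj.δ 0).hom x), ← h1]
      exact Ideal.subset_span ⟨x, rfl⟩
    · rw [hr 0 (by omega) (by omega)] at hy'
      rw [show y = 0 from hy']
      exact zero_mem _
  · have hzn : z ∈ kerNormalized f.hom n := by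
      refine ⟨?_, hz⟩
      cases n with
      | zero => trivial
      | succ n =>
        exact mem_normalized_succ.2 fun i => hz' n rfl (SimplexCategory.δ i.succ) inferInstance
    have hzero : z = 0 → ∃ y : A.obj.obj (op ⦋n + 1⦌), (f.hom.app _).hom y = 0 ∧
        (A.obj.δ 0).hom y = z ∧ ∀ i : Fin (n + 1), (A.obj.δ i.succ).hom y = 0 := by
      rintro rfl
      exact ⟨0, map_zero _, map_zero _, fun _ => map_zero _⟩
    by_cases h1 : n = r
    · subst h1
      obtain ⟨y, hy, hyz⟩ := hbij.surjOn hzn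
      exact ⟨y, hy.2, hyz, mem_normalized_succ.1 hy.1⟩
    · by_cases h2 : n = r + 1
      · subst h2
        refine hzero (hbij.injOn hzn (zero_mem _) ?_)
        rw [map_zero]
        exact hz' r rfl (SimplexCategory.δ 0) inferInstance
      · rw [hr n h1 h2] at hzn
        exact hzero hzn

end SN

end

section

/-! ## The Poincaré lemma for polynomial forms -/

namespace PolyForms

open scoped TensorProduct DirectSum
open MvPolynomial

variable {R : Type u} [CommRing R] {n : ℕ}

/-- A basis of the exterior algebra consisting of homogeneous elements. -/
noncomputable def extBasis (R : Type u) [CommRing R] (n : ℕ) :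
    Module.Basis (Σ q : ℕ, Module.Free.ChooseBasisIndex R (⋀[R]^q (Fin n → R))) R
      (ExteriorAlgebra R (Fin n → R)) :=
  (DirectSum.Decomposition.isInternal (fun q : ℕ => ⋀[R]^q (Fin n → R))).collectedBasis
    fun q => Module.Free.chooseBasis R (⋀[R]^q (Fin n → R))

/-- The index set of a homogeneous basis of `Ω_n`. -/
abbrev FormIndex (R : Type u) [CommRing R] (n : ℕ) : Type u :=
  (Fin n →₀ ℕ) × Σ q : ℕ, Module.Free.ChooseBasisIndex R (⋀[R]^q (Fin n → R))

/-- The degree of a basis element. -/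
def FormIndex.deg (i : FormIndex R n) : ℕ := i.2.1

/-- The weight of a basis element. -/
noncomputable def FormIndex.weight (i : FormIndex R n) : ℕ := i.1.degree + i.2.1

/-- A basis of `Ω_n` consisting of homogeneous elements. -/
noncomputable def formBasis (R : Type u) [CommRing R] (n : ℕ) :
    Module.Basis (FormIndex R n) R (Ω R n) :=
  (basisMonomials (Fin n) R).tensorProduct (extBasis R n)

lemma extBasis_mem (j : Σ q : ℕ, Module.Free.ChooseBasisIndex R (⋀[R]^q (Fin n → R))) :
    extBasis R n j ∈ ⋀[R]^j.1 (Fin n → R) :=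
  DirectSum.IsInternal.collectedBasis_mem _ _ _

lemma formBasis_apply (i : FormIndex R n) :
    formBasis R n i = monomial i.1 1 ⊗ₜ extBasis R n i.2 := by
  rw [formBasis, Module.Basis.tensorProduct_apply]
  simp

lemma formBasis_mem (i : FormIndex R n) : formBasis R n i ∈ gr R n i.deg := by
  rw [formBasis_apply]
  exact tmul_mem _ (extBasis_mem _)

lemma formBasis_repr_eq_zero {j : ℕ} {ω : Ω R n} (hω : ω ∈ gr R n j) {i : FormIndex R n}
    (hi : i.deg ≠ j) : (formBasis R n).repr ω i = 0 := by
  rw [gr_eq_span] at hω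
  induction hω using Submodule.span_induction with
  | mem x h =>
    obtain ⟨p, x, h, rfl⟩ := h
    rw [formBasis, Module.Basis.tensorProduct_repr_tmul_apply]
    have : (extBasis R n).repr x i.2 = 0 :=
      DirectSum.IsInternal.collectedBasis_repr_of_mem_ne _ _ (Ne.symm hi) h
    rw [this, zero_smul]
  | zero => simp
  | add x y _ _ hx hy => simp [hx, hy]
  | smul r x _ hx => simp [hx]

open scoped CliffordAlgebra in
/-- The contraction with the Euler vector field. -/
noncomputable def contractEuler (R : Type u) [CommRing R] (n : ℕ) : Ω R n →ₗ[R] Ω R n :=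
  ∑ i : Fin n, TensorProduct.map (LinearMap.mulLeft R (X i))
    (CliffordAlgebra.contractLeft (Q := 0) (LinearMap.proj i : (Fin n → R) →ₗ[R] R))

lemma contractEuler_tmul (p : MvPolynomial (Fin n) R) (x : ExteriorAlgebra R (Fin n → R)) :
    contractEuler R n (p ⊗ₜ x) = ∑ i : Fin n, (X i * p) ⊗ₜ
      (CliffordAlgebra.contractLeft (Q := 0) (LinearMap.proj i : (Fin n → R) →ₗ[R] R) x) := by
  simp [contractEuler, LinearMap.sum_apply]

lemma contractLeft_mem (f : Module.Dual R (Fin n → R)) {q : ℕ}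
    {x : ExteriorAlgebra R (Fin n → R)} (hx : x ∈ ⋀[R]^q (Fin n → R)) :
    (q = 0 → CliffordAlgebra.contractLeft (Q := 0) f x = 0) ∧
      CliffordAlgebra.contractLeft (Q := 0) f x ∈ ⋀[R]^(q - 1) (Fin n → R) := by
  change x ∈ LinearMap.range (ExteriorAlgebra.ι R) ^ q at hx
  induction hx using Submodule.pow_induction_on_left' with
  | algebraMap r =>
    rw [CliffordAlgebra.contractLeft_algebraMap]
    exact ⟨fun _ => rfl, zero_mem _⟩
  | add x y i hx hy ihx ihy =>
    rw [map_add]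
    exact ⟨fun h => by rw [ihx.1 h, ihy.1 h, add_zero], add_mem ihx.2 ihy.2⟩
  | mem_mul v hv i x hx ih =>
    obtain ⟨v, rfl⟩ := hv
    refine ⟨fun h => by omega, ?_⟩
    rw [CliffordAlgebra.contractLeft_ι_mul]
    refine sub_mem (Submodule.smul_mem _ _ hx) ?_
    rcases Nat.eq_zero_or_pos i with rfl | hi
    · rw [ih.1 rfl, mul_zero]
      exact zero_mem _
    · obtain ⟨i, rfl⟩ : ∃ i', i = i' + 1 := ⟨i - 1, by omega⟩
      change _ ∈ LinearMap.range (ExteriorAlgebra.ι R) ^ (i + 1)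
      rw [pow_succ']
      exact Submodule.mul_mem_mul ⟨_, rfl⟩ ih.2

lemma sum_ι_mul_contractLeft {q : ℕ} {x : ExteriorAlgebra R (Fin n → R)}
    (hx : x ∈ ⋀[R]^q (Fin n → R)) :
    ∑ i : Fin n, ExteriorAlgebra.ι R (Pi.single i (1 : R)) *
      CliffordAlgebra.contractLeft (Q := 0) (LinearMap.proj i : (Fin n → R) →ₗ[R] R) x =
        (q : R) • x := by
  change x ∈ LinearMap.range (ExteriorAlgebra.ι R) ^ q at hx
  induction hx using Submodule.pow_induction_on_left' with
  | algebraMap r => simp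
  | add x y i hx hy ihx ihy => simp only [map_add, mul_add, Finset.sum_add_distrib, ihx, ihy, smul_add]
  | mem_mul v hv i x hx ih =>
    obtain ⟨v, rfl⟩ := hv
    have h2 : ∑ k, v k • Pi.single (M := fun _ => R) k 1 = v := by
      ext k; simp [Finset.sum_apply, Pi.single_apply]
    have h3 : ∀ k : Fin n, ExteriorAlgebra.ι R (Pi.single k (1 : R)) * (ExteriorAlgebra.ι R v *
        CliffordAlgebra.contractLeft (Q := 0) (LinearMap.proj k : (Fin n → R) →ₗ[R] R) x) =
        - (ExteriorAlgebra.ι R v * (ExteriorAlgebra.ι R (Pi.single k (1 : R)) *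
        CliffordAlgebra.contractLeft (Q := 0) (LinearMap.proj k : (Fin n → R) →ₗ[R] R) x)) := by
      intro k
      have h := eq_neg_of_add_eq_zero_left
        (ExteriorAlgebra.ι_add_mul_swap (R := R) (Pi.single k (1 : R)) v)
      rw [← mul_assoc, h, neg_mul, mul_assoc]
    have h4 : ∑ k : Fin n, v k • ExteriorAlgebra.ι R (Pi.single k (1 : R)) =
        ExteriorAlgebra.ι R v := by
      conv_rhs => rw [← h2, map_sum]
      simp only [map_smul]
    simp only [CliffordAlgebra.contractLeft_ι_mul, LinearMap.proj_apply, mul_sub, h3, sub_neg_eq_add,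
      Finset.sum_add_distrib, ← Finset.mul_sum, ih, mul_smul_comm, ← smul_mul_assoc]
    rw [← Finset.sum_mul, h4]
    push_cast
    rw [add_smul, one_smul, smul_mul_assoc, add_comm, add_mul, smul_mul_assoc]

lemma dΩ_contractEuler {k q : ℕ} {p : MvPolynomial (Fin n) R} (hp : p.IsHomogeneous k)
    {x : ExteriorAlgebra R (Fin n → R)} (hx : x ∈ ⋀[R]^q (Fin n → R)) :
    dΩ R n (contractEuler R n (p ⊗ₜ x)) + contractEuler R n (dΩ R n (p ⊗ₜ x)) =
      ((k + q : ℕ) : R) • (p ⊗ₜ[R] x) := by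
  have h1 : dΩ R n (contractEuler R n (p ⊗ₜ x)) = (p ⊗ₜ[R] ((q : R) • x)) +
      ∑ i : Fin n, ∑ j : Fin n, (X i * pderiv j p) ⊗ₜ[R] (ExteriorAlgebra.ι R (Pi.single j (1 : R)) *
        CliffordAlgebra.contractLeft (Q := 0) (LinearMap.proj i : (Fin n → R) →ₗ[R] R) x) := by
    rw [contractEuler_tmul, map_sum, ← sum_ι_mul_contractLeft hx, TensorProduct.tmul_sum,
      ← Finset.sum_add_distrib]
    refine Finset.sum_congr rfl fun i _ => ?_
    rw [dΩ_tmul]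
    simp only [Derivation.leibniz, smul_eq_mul, TensorProduct.add_tmul, Finset.sum_add_distrib,
      pderiv_X]
    rw [add_comm]
    congr 1
    rw [Finset.sum_eq_single i]
    · simp
    · intro j _ hj
      simp [Pi.single_apply, hj.symm]
    · simp
  have h2 : contractEuler R n (dΩ R n (p ⊗ₜ x)) = (((k : R) • p) ⊗ₜ[R] x) -
      ∑ i : Fin n, ∑ j : Fin n, (X i * pderiv j p) ⊗ₜ[R] (ExteriorAlgebra.ι R (Pi.single j (1 : R)) *
        CliffordAlgebra.contractLeft (Q := 0) (LinearMap.proj i : (Fin n → R) →ₗ[R] R) x) := by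
    have h3 := hp.sum_X_mul_pderiv
    rw [nsmul_eq_mul, ← C_eq_coe_nat, ← smul_eq_C_mul] at h3
    rw [dΩ_tmul, map_sum, ← h3, TensorProduct.sum_tmul, Finset.sum_comm, ← Finset.sum_sub_distrib]
    refine Finset.sum_congr rfl fun j _ => ?_
    rw [contractEuler_tmul]
    simp only [CliffordAlgebra.contractLeft_ι_mul, TensorProduct.tmul_sub, Finset.sum_sub_distrib]
    congr 1
    rw [Finset.sum_eq_single j]
    · simp
    · intro i _ hi
      simp [Pi.single_apply, hi]
    · simp
  rw [h1, h2, add_add_sub_cancel, TensorProduct.tmul_smul, ← TensorProduct.smul_tmul', ← add_smul]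
  push_cast
  rw [add_comm]

lemma dΩ_contractEuler_formBasis (i : FormIndex R n) :
    dΩ R n (contractEuler R n (formBasis R n i)) + contractEuler R n (dΩ R n (formBasis R n i)) =
      (i.weight : R) • formBasis R n i := by
  rw [formBasis_apply]
  exact dΩ_contractEuler (isHomogeneous_monomial _ rfl) (extBasis_mem _)

variable [Algebra ℚ R]

lemma eq_zero_of_natCast_smul_eq {M : Type*} [AddCommGroup M] [Module R M] {x : M} {k l : ℕ}
    (hkl : k ≠ l) (h : (k : R) • x = (l : R) • x) : x = 0 := by
  have h1 : algebraMap ℚ R ((k : ℚ) - l)⁻¹ * ((k : R) - l) = 1 := by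
    rw [← map_natCast (algebraMap ℚ R), ← map_natCast (algebraMap ℚ R) l, ← map_sub, ← map_mul,
      inv_mul_cancel₀ (sub_ne_zero.2 (by exact_mod_cast hkl)), map_one]
  rw [← one_smul R x, ← h1, mul_smul, sub_smul, h, sub_self, smul_zero]

omit [Algebra ℚ R] in
lemma pderiv_pderiv_comm (i j : Fin n) (p : MvPolynomial (Fin n) R) :
    pderiv i (pderiv j p) = pderiv j (pderiv i p) := by
  let D : Fin n → Derivation R (MvPolynomial (Fin n) R) (MvPolynomial (Fin n) R) := pderiv
  have h : ⁅D i, D j⁆ = 0 := by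
    refine MvPolynomial.derivation_ext fun k => ?_
    change pderiv (R := R) i (pderiv j (X k)) - pderiv j (pderiv i (X k : MvPolynomial (Fin n) R)) = 0
    rw [pderiv_X, pderiv_X, Pi.single_apply, Pi.single_apply]
    split_ifs <;> simp
  have h' := congrArg (fun D' : Derivation R _ _ => D' p) h
  rwa [Derivation.commutator_apply, Derivation.zero_apply, sub_eq_zero] at h'

lemma dΩ_dΩ (ω : Ω R n) : dΩ R n (dΩ R n ω) = 0 := by
  induction ω using TensorProduct.induction_on with
  | zero => simp
  | add x y hx hy => simp only [map_add, hx, hy, add_zero]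
  | tmul p x =>
    refine eq_zero_of_natCast_smul_eq (R := R) two_ne_zero ?_
    rw [Nat.cast_ofNat, two_smul, Nat.cast_zero, zero_smul]
    simp only [dΩ_tmul, map_sum]
    nth_rw 1 [Finset.sum_comm]
    rw [← Finset.sum_add_distrib]
    refine Finset.sum_eq_zero fun i _ => ?_
    rw [← Finset.sum_add_distrib]
    refine Finset.sum_eq_zero fun j _ => ?_
    have h := eq_neg_of_add_eq_zero_left
      (ExteriorAlgebra.ι_add_mul_swap (R := R) (Pi.single (M := fun _ => R) i 1) (Pi.single j (1 : R)))
    rw [← mul_assoc, ← mul_assoc, h, pderiv_pderiv_comm, neg_mul, TensorProduct.tmul_neg, neg_add_cancel]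

/-- The inverse of the weight operator. -/
noncomputable def weightInv (R : Type u) [CommRing R] [Algebra ℚ R] (n : ℕ) : Ω R n →ₗ[R] Ω R n :=
  (formBasis R n).constr R fun i => algebraMap ℚ R (i.weight : ℚ)⁻¹ • formBasis R n i

lemma weightInv_formBasis (i : FormIndex R n) : weightInv R n (formBasis R n i) =
    algebraMap ℚ R (i.weight : ℚ)⁻¹ • formBasis R n i :=
  (formBasis R n).constr_basis R _ i

lemma weightInv_eq_smul {w : ℕ} {ω : Ω R n}
    (h : ∀ i : FormIndex R n, i.weight ≠ w → (formBasis R n).repr ω i = 0) :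
    weightInv R n ω = algebraMap ℚ R (w : ℚ)⁻¹ • ω := by
  conv_lhs => rw [← (formBasis R n).linearCombination_repr ω]
  conv_rhs => rw [← (formBasis R n).linearCombination_repr ω]
  rw [Finsupp.linearCombination_apply, Finsupp.sum, map_sum, Finset.smul_sum]
  refine Finset.sum_congr rfl fun i hi => ?_
  have hw : i.weight = w := by
    by_contra hw
    exact Finsupp.mem_support_iff.1 hi (h i hw)
  rw [map_smul, weightInv_formBasis, hw, smul_comm]

lemma weightInv_mem {j : ℕ} {ω : Ω R n} (hω : ω ∈ gr R n j) : weightInv R n ω ∈ gr R n j := by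
  rw [← (formBasis R n).linearCombination_repr ω, Finsupp.linearCombination_apply, Finsupp.sum,
    map_sum]
  refine Submodule.sum_mem _ fun i hi => ?_
  have hw : i.deg = j := by
    by_contra hw
    exact Finsupp.mem_support_iff.1 hi (formBasis_repr_eq_zero hω hw)
  rw [map_smul, weightInv_formBasis, ← hw]
  exact Submodule.smul_mem _ _ (Submodule.smul_mem _ _ (formBasis_mem i))

omit [Algebra ℚ R] in
lemma repr_dΩ_contractEuler (ω : Ω R n) (i : FormIndex R n) : (formBasis R n).repr
    (dΩ R n (contractEuler R n ω) + contractEuler R n (dΩ R n ω)) i =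
      (i.weight : R) • (formBasis R n).repr ω i := by
  have h : Finsupp.lapply i ∘ₗ (formBasis R n).repr.toLinearMap ∘ₗ
      (dΩ R n ∘ₗ contractEuler R n + contractEuler R n ∘ₗ dΩ R n) =
      (i.weight : R) • (Finsupp.lapply i ∘ₗ (formBasis R n).repr.toLinearMap) := by
    refine (formBasis R n).ext fun j => ?_
    change (formBasis R n).repr (dΩ R n (contractEuler R n (formBasis R n j)) +
      contractEuler R n (dΩ R n (formBasis R n j))) i = (i.weight : R) • (formBasis R n).repr _ i
    rw [dΩ_contractEuler_formBasis, map_smul, Module.Basis.repr_self, Finsupp.smul_apply]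
    by_cases hij : j = i
    · rw [hij]
    · rw [Finsupp.single_eq_of_ne' hij, smul_zero, smul_zero]
  exact LinearMap.congr_fun h ω

lemma weightInv_dΩ (ω : Ω R n) : weightInv R n (dΩ R n ω) = dΩ R n (weightInv R n ω) := by
  have h : weightInv R n ∘ₗ dΩ R n = dΩ R n ∘ₗ weightInv R n := by
    refine (formBasis R n).ext fun i => ?_
    rw [LinearMap.comp_apply, LinearMap.comp_apply, weightInv_formBasis, map_smul]
    refine weightInv_eq_smul fun j hj => eq_zero_of_natCast_smul_eq (R := R) hj ?_
    rw [← repr_dΩ_contractEuler, dΩ_dΩ, map_zero, add_zero, ← Finsupp.smul_apply, ← map_smul,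
      ← map_smul, ← dΩ_contractEuler_formBasis, map_add, dΩ_dΩ, zero_add]
  exact LinearMap.congr_fun h ω

/-- The contracting homotopy of the Poincaré lemma. -/
noncomputable def homotopy (R : Type u) [CommRing R] [Algebra ℚ R] (n : ℕ) : Ω R n →ₗ[R] Ω R n :=
  contractEuler R n ∘ₗ weightInv R n

omit [Algebra ℚ R] in
lemma contractEuler_mem {j : ℕ} {ω : Ω R n} (hω : ω ∈ gr R n j) :
    (j = 0 → contractEuler R n ω = 0) ∧ contractEuler R n ω ∈ gr R n (j - 1) := by
  rw [gr_eq_span] at hω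
  induction hω using Submodule.span_induction with
  | mem x h =>
    obtain ⟨p, x, h, rfl⟩ := h
    rw [contractEuler_tmul]
    exact ⟨fun hj => Finset.sum_eq_zero fun i _ => by
        rw [(contractLeft_mem _ h).1 hj, TensorProduct.tmul_zero],
      Submodule.sum_mem _ fun i _ => tmul_mem _ (contractLeft_mem _ h).2⟩
  | zero => simp
  | add x y _ _ hx hy =>
    rw [map_add]
    exact ⟨fun h => by rw [hx.1 h, hy.1 h, add_zero], add_mem hx.2 hy.2⟩
  | smul r x _ hx =>
    rw [map_smul]
    exact ⟨fun h => by rw [hx.1 h, smul_zero], Submodule.smul_mem _ _ hx.2⟩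

lemma homotopy_eq_zero {ω : Ω R n} (hω : ω ∈ gr R n 0) : homotopy R n ω = 0 :=
  (contractEuler_mem (weightInv_mem hω)).1 rfl

lemma homotopy_mem {j : ℕ} {ω : Ω R n} (hω : ω ∈ gr R n (j + 1)) : homotopy R n ω ∈ gr R n j :=
  (contractEuler_mem (weightInv_mem hω)).2

omit [Algebra ℚ R] in
lemma pull_const_formBasis (i : FormIndex R n) :
    pull R (fun _ : Fin (n + 1) => (0 : Fin (n + 1))) (formBasis R n i) =
      if i.weight = 0 then formBasis R n i else 0 := by
  have h1 : pullT (R := R) (fun _ : Fin (n + 1) => (0 : Fin (n + 1))) = 0 := by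
    funext k
    simp [pullT, (Fin.succ_ne_zero k).symm]
  have h2 : pullDt (R := R) (fun _ : Fin (n + 1) => (0 : Fin (n + 1))) = 0 := by
    refine LinearMap.pi_ext' fun k => LinearMap.ext_ring ?_
    rw [LinearMap.comp_apply, LinearMap.coe_single, pullDt_single]
    simp [(Fin.succ_ne_zero k).symm]
  rw [formBasis_apply, pull_tmul, h1, h2, aeval_monomial]
  obtain ⟨m, q, k⟩ := i
  have h3 : ∀ (q : ℕ) (x : ExteriorAlgebra R (Fin n → R)), x ∈ ⋀[R]^q (Fin n → R) →
      ExteriorAlgebra.map (0 : (Fin n → R) →ₗ[R] (Fin n → R)) x = if q = 0 then x else 0 := by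
    intro q x hx
    change x ∈ LinearMap.range (ExteriorAlgebra.ι R) ^ q at hx
    induction hx using Submodule.pow_induction_on_left' with
    | algebraMap r => simp
    | add x y i hx hy ihx ihy =>
      rw [map_add, ihx, ihy]
      split_ifs <;> simp
    | mem_mul v hv i x hx ih =>
      obtain ⟨v, rfl⟩ := hv
      simp
  rw [h3 q _ (extBasis_mem ⟨q, k⟩)]
  change _ = if m.degree + q = 0 then _ else _
  by_cases hq : q = 0
  · by_cases hm : m = 0
    · subst hm
      simp [hq]
    · have hm' : m.degree ≠ 0 := fun h => hm ((Finsupp.degree_eq_zero_iff m).1 h)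
      obtain ⟨k, hk⟩ := Finsupp.ne_iff.1 hm
      have : (m.prod fun i k => (0 : Fin n → MvPolynomial (Fin n) R) i ^ k) = 0 :=
        Finset.prod_eq_zero (Finsupp.mem_support_iff.2 hk) (by
          simp only [Pi.zero_apply]
          exact zero_pow hk)
      rw [this, mul_zero, TensorProduct.zero_tmul, if_neg (by omega)]
  · rw [if_neg hq, if_neg (by omega), TensorProduct.tmul_zero]

theorem dΩ_homotopy (ω : Ω R n) : dΩ R n (homotopy R n ω) + homotopy R n (dΩ R n ω) =
    ω - pull R (fun _ : Fin (n + 1) => (0 : Fin (n + 1))) ω := by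
  have h : dΩ R n ∘ₗ homotopy R n + homotopy R n ∘ₗ dΩ R n = LinearMap.id -
      (pull R (fun _ : Fin (n + 1) => (0 : Fin (n + 1)))).toLinearMap := by
    refine (formBasis R n).ext fun i => ?_
    change dΩ R n (contractEuler R n (weightInv R n (formBasis R n i))) +
      contractEuler R n (weightInv R n (dΩ R n (formBasis R n i))) = formBasis R n i - pull R _ _
    rw [weightInv_dΩ, weightInv_formBasis]
    simp only [map_smul]
    rw [← smul_add, dΩ_contractEuler_formBasis, pull_const_formBasis]
    split_ifs with hw
    · simp [hw]
    · rw [sub_zero, smul_smul, ← map_natCast (algebraMap ℚ R), ← map_mul,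
        inv_mul_cancel₀ (by exact_mod_cast hw), map_one, one_smul]
  exact LinearMap.congr_fun h ω

end PolyForms

end

section

/-! ## Coefficients of forms -/

namespace DGAlg

open scoped TensorProduct
open PolyForms

variable {R : Type u} [CommRing R] {A B C : DGAlg R} {n m : ℕ}

section Coefficients

open Classical in
variable (A n) in
/-- The coefficients of a form with respect to the basis of `Ω_n`. -/
noncomputable def coeffs : A.Forms n ≃ₗ[R] FormIndex R n →₀ A.carrier :=
  (GradedTensorProduct.of R A.gr (PolyForms.gr R n)).symm ≪≫ₗ
    TensorProduct.equivFinsuppOfBasisRight (formBasis R n)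

lemma coeffs_tmul (a : A.carrier) (ω : Ω R n) (i : FormIndex R n) :
    A.coeffs n (a ᵍ⊗ₜ ω) i = (formBasis R n).repr ω i • a := by
  classical
  exact TensorProduct.equivFinsuppOfBasisRight_apply_tmul_apply (formBasis R n) a ω i

lemma sum_coeffs (x : A.Forms n) : ((A.coeffs n x).sum fun i a => (a ᵍ⊗ₜ formBasis R n i : A.Forms n)) = x := by
  classical
  refine Eq.trans ?_ ((A.coeffs n).symm_apply_apply x)
  exact (TensorProduct.equivFinsuppOfBasisRight_symm_apply (formBasis R n) _).symm

lemma forms_ext {x y : A.Forms n} (h : ∀ i, A.coeffs n x i = A.coeffs n y i) : x = y :=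
  (A.coeffs n).injective (Finsupp.ext h)

lemma forms_hom_ext {M : Type*} [AddCommGroup M] [Module R M] {f g : A.Forms n →ₗ[R] M}
    (h : ∀ (i j : ℕ) (a : A.carrier) (ω : Ω R n), a ∈ A.gr i → ω ∈ PolyForms.gr R n j →
      f (a ᵍ⊗ₜ ω) = g (a ᵍ⊗ₜ ω)) (x : A.Forms n) : f x = g x := by
  have h1 : ∀ (a : A.carrier) (ω : Ω R n), f (a ᵍ⊗ₜ ω) = g (a ᵍ⊗ₜ ω) := by
    intro a ω
    induction a using DirectSum.Decomposition.inductionOn A.gr with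
    | zero => rw [zero_gtmul, map_zero, map_zero]
    | add a b ha hb => rw [add_gtmul, map_add, map_add, ha, hb]
    | homogeneous a =>
      induction ω using DirectSum.Decomposition.inductionOn (PolyForms.gr R n) with
      | zero => rw [gtmul_zero, map_zero, map_zero]
      | add ω η hω hη => rw [gtmul_add, map_add, map_add, hω, hη]
      | homogeneous ω => exact h _ _ _ _ a.2 ω.2
  have h2 : f = g := GradedTensorProduct.hom_ext _ _ (TensorProduct.ext' h1)
  rw [h2]

variable (n) in
/-- The forms `∑ a ⊗ ω` with `a ∈ S_i` and `ω` an `i`-form. -/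
noncomputable def formsIn (S : ℕ → Submodule R A.carrier) : Submodule R (A.Forms n) :=
  Submodule.span R {x | ∃ (i : ℕ) (a : A.carrier) (ω : Ω R n),
    a ∈ S i ∧ ω ∈ PolyForms.gr R n i ∧ a ᵍ⊗ₜ ω = x}

variable {S T U : ℕ → Submodule R A.carrier}

lemma tmul_mem_formsIn {i : ℕ} {a : A.carrier} {ω : Ω R n} (ha : a ∈ S i)
    (hω : ω ∈ PolyForms.gr R n i) : (a ᵍ⊗ₜ ω : A.Forms n) ∈ formsIn n S :=
  Submodule.subset_span ⟨i, a, ω, ha, hω, rfl⟩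

lemma formsIn_le {V : Submodule R (A.Forms n)} (h : ∀ (i : ℕ) (a : A.carrier) (ω : Ω R n),
    a ∈ S i → ω ∈ PolyForms.gr R n i → a ᵍ⊗ₜ ω ∈ V) : formsIn n S ≤ V := by
  rw [formsIn, Submodule.span_le]
  rintro _ ⟨i, a, ω, ha, hω, rfl⟩
  exact h i a ω ha hω

lemma formsIn_mono (h : ∀ i, S i ≤ T i) : formsIn n S ≤ formsIn n T :=
  formsIn_le fun i _ _ ha hω => tmul_mem_formsIn (h i ha) hω

lemma mem_formsIn_iff {x : A.Forms n} : x ∈ formsIn n S ↔ ∀ i, A.coeffs n x i ∈ S i.deg := by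
  constructor
  · intro hx i
    refine (formsIn_le (V := (S i.deg).comap (Finsupp.lapply i ∘ₗ (A.coeffs n).toLinearMap))
      fun j a ω ha hω => ?_) hx
    change A.coeffs n (a ᵍ⊗ₜ ω) i ∈ S i.deg
    rw [coeffs_tmul]
    by_cases hij : i.deg = j
    · subst hij
      exact Submodule.smul_mem _ _ ha
    · rw [formBasis_repr_eq_zero hω hij, zero_smul]
      exact zero_mem _
  · intro h
    rw [← sum_coeffs x]
    exact Submodule.sum_mem _ fun i _ => tmul_mem_formsIn (h i) (formBasis_mem i)

lemma eq_zero_of_mem_formsIn (hS : ∀ i, S i = ⊥) {x : A.Forms n} (hx : x ∈ formsIn n S) : x = 0 := by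
  refine forms_ext fun i => ?_
  have := mem_formsIn_iff.1 hx i
  rw [hS] at this
  rw [show A.coeffs n x i = 0 from this, map_zero, Finsupp.zero_apply]

lemma mul_mem_formsIn (hT : ∀ i, T i ≤ A.gr i)
    (h : ∀ i j, ∀ a ∈ S i, ∀ b ∈ T j, a * b ∈ U (i + j)) {x y : A.Forms n}
    (hx : x ∈ formsIn n S) (hy : y ∈ formsIn n T) : x * y ∈ formsIn n U := by
  rw [formsIn] at hx hy
  induction hx, hy using Submodule.span_induction₂ with
  | mem_mem x y hx hy =>
    obtain ⟨i, a, ω, ha, hω, rfl⟩ := hx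
    obtain ⟨j, b, η, hb, hη, rfl⟩ := hy
    rw [tmul_mul_tmul' a hω (hT j hb) η]
    exact Submodule.smul_mem _ _ (tmul_mem_formsIn (h i j a ha b hb)
      (SetLike.GradedMul.mul_mem hω hη))
  | zero_left y hy => rw [zero_mul]; exact Submodule.zero_mem _
  | zero_right x hx => rw [mul_zero]; exact Submodule.zero_mem _
  | add_left x y z _ _ _ hx hy => rw [add_mul]; exact Submodule.add_mem _ hx hy
  | add_right x y z _ _ _ hx hy => rw [mul_add]; exact Submodule.add_mem _ hx hy
  | smul_left r x y _ _ h => rw [smul_mul_assoc]; exact Submodule.smul_mem _ _ h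
  | smul_right r x y _ _ h => rw [mul_smul_comm]; exact Submodule.smul_mem _ _ h

lemma totalD_mem_formsIn (hS : ∀ i, ∃ k, S i ≤ A.gr k) (h1 : ∀ i, ∀ a ∈ S i, A.d a ∈ T i)
    (h2 : ∀ i, S i ≤ T (i + 1)) {x : A.Forms n} (hx : x ∈ formsIn n S) :
    A.totalD n x ∈ formsIn n T := by
  refine (formsIn_le (V := (formsIn n T).comap (A.totalD n)) fun i a ω ha hω => ?_) hx
  obtain ⟨k, hk⟩ := hS i
  change A.totalD n (a ᵍ⊗ₜ ω) ∈ formsIn n T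
  rw [totalD_tmul (hk ha)]
  exact add_mem (tmul_mem_formsIn (h1 i a ha) hω)
    (Submodule.smul_mem _ _ (tmul_mem_formsIn (h2 i ha) (dΩ_mem hω)))

lemma formsMap_mem_formsIn (f : A ⟶ B) (θ : Fin (m + 1) → Fin (n + 1))
    {T : ℕ → Submodule R B.carrier} (h : ∀ i, ∀ a ∈ S i, DGAlg.Hom.hom f a ∈ T i) {x : A.Forms n}
    (hx : x ∈ formsIn n S) : formsMap f θ x ∈ formsIn m T :=
  (formsIn_le (V := (formsIn m T).comap (formsMap f θ)) fun i a _ ha hω =>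
    tmul_mem_formsIn (h i a ha) (pull_mem θ hω)) hx

lemma coeffs_formsMap_id (f : A ⟶ B) (x : A.Forms n) (i : FormIndex R n) :
    B.coeffs n (formsMap f id x) i = DGAlg.Hom.hom f (A.coeffs n x i) := by
  refine forms_hom_ext (f := Finsupp.lapply i ∘ₗ (B.coeffs n).toLinearMap ∘ₗ formsMap f id)
    (g := (DGAlg.Hom.hom f).toLinearMap ∘ₗ Finsupp.lapply i ∘ₗ (A.coeffs n).toLinearMap)
    (fun _ _ a ω _ _ => ?_) x
  change B.coeffs n (formsMap f id (a ᵍ⊗ₜ ω)) i = DGAlg.Hom.hom f (A.coeffs n (a ᵍ⊗ₜ ω) i)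
  rw [formsMap_tmul, coeffs_tmul, coeffs_tmul, pull_id, map_smul]
  rfl

lemma exists_formsMap_eq (f : A ⟶ B) {T : ℕ → Submodule R B.carrier}
    (h : ∀ i, ∀ b ∈ T i, ∃ a ∈ S i, DGAlg.Hom.hom f a = b) {y : B.Forms n} (hy : y ∈ formsIn n T) :
    ∃ x ∈ formsIn n S, formsMap f id x = y := by
  refine (formsIn_le (V := (formsIn n S).map (formsMap f id)) fun i b ω hb hω => ?_) hy
  obtain ⟨a, ha, rfl⟩ := h i b hb
  exact ⟨a ᵍ⊗ₜ ω, tmul_mem_formsIn ha hω, by rw [formsMap_tmul, pull_id]; rfl⟩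

lemma totalD_formsMap' (f : A ⟶ B) (θ : Fin (m + 1) → Fin (n + 1)) (x : A.Forms n) :
    B.totalD m (formsMap f θ x) = formsMap f θ (A.totalD n x) := by
  refine forms_hom_ext (f := B.totalD m ∘ₗ formsMap f θ) (g := formsMap f θ ∘ₗ A.totalD n)
    (fun i _ a ω ha _ => ?_) x
  change B.totalD m (formsMap f θ (a ᵍ⊗ₜ ω)) = formsMap f θ (A.totalD n (a ᵍ⊗ₜ ω))
  rw [formsMap_tmul, totalD_tmul (f.map_mem i a ha), totalD_tmul ha, map_add, map_smul,
    formsMap_tmul, formsMap_tmul, f.map_d, pull_dΩ]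

end Coefficients

section Homotopy

variable [Algebra ℚ R]

lemma totalD_totalD (x : A.Forms n) : A.totalD n (A.totalD n x) = 0 := by
  refine forms_hom_ext (f := A.totalD n ∘ₗ A.totalD n) (g := 0) (fun i _ a ω ha _ => ?_) x
  change A.totalD n (A.totalD n (a ᵍ⊗ₜ ω)) = 0
  rw [totalD_tmul ha, map_add, map_smul, totalD_tmul ha, dΩ_dΩ, gtmul_zero, smul_zero, add_zero]
  rcases i with _ | i
  · rw [A.d_zero a ha, zero_gtmul, zero_gtmul, map_zero, smul_zero, add_zero]
  · rw [totalD_tmul (A.d_mem i a ha), A.d_d, zero_gtmul, zero_add, ← add_smul, pow_succ]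
    rw [mul_neg_one, add_neg_cancel, zero_smul]

variable (A n) in
/-- The contracting homotopy of `A ⊗ Ω_n`. -/
noncomputable def totalH : A.Forms n →ₗ[R] A.Forms n :=
  (GradedTensorProduct.of R A.gr (PolyForms.gr R n)).toLinearMap ∘ₗ
    TensorProduct.map A.sign (homotopy R n) ∘ₗ
    (GradedTensorProduct.of R A.gr (PolyForms.gr R n)).symm.toLinearMap

lemma totalH_tmul {i : ℕ} {a : A.carrier} (ha : a ∈ A.gr i) (ω : Ω R n) :
    A.totalH n (a ᵍ⊗ₜ ω) = (-1 : R) ^ i • (a ᵍ⊗ₜ homotopy R n ω) := by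
  rw [← smul_gtmul, ← A.sign_apply ha]
  rfl

lemma totalD_totalH (x : A.Forms n) : A.totalD n (A.totalH n x) + A.totalH n (A.totalD n x) =
    x - formsMap (𝟙 A) (fun _ : Fin (n + 1) => (0 : Fin (n + 1))) x := by
  refine forms_hom_ext (f := A.totalD n ∘ₗ A.totalH n + A.totalH n ∘ₗ A.totalD n)
    (g := LinearMap.id - formsMap (𝟙 A) (fun _ : Fin (n + 1) => (0 : Fin (n + 1))))
    (fun i _ a ω ha _ => ?_) x
  change A.totalD n (A.totalH n (a ᵍ⊗ₜ ω)) + A.totalH n (A.totalD n (a ᵍ⊗ₜ ω)) =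
    a ᵍ⊗ₜ ω - formsMap (𝟙 A) _ (a ᵍ⊗ₜ ω)
  have h1 : A.totalH n (A.d a ᵍ⊗ₜ ω) = -((-1 : R) ^ i • (A.d a ᵍ⊗ₜ homotopy R n ω)) := by
    rcases i with _ | i
    · rw [A.d_zero a ha, zero_gtmul, zero_gtmul, map_zero, smul_zero, neg_zero]
    · rw [totalH_tmul (A.d_mem i a ha), pow_succ, mul_neg_one, neg_smul, neg_neg]
  have h2 : (-1 : R) ^ i * (-1) ^ i = 1 := by
    rw [← mul_pow, neg_one_mul, neg_neg, one_pow]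
  have h3 : (a ᵍ⊗ₜ ω - formsMap (𝟙 A) (fun _ : Fin (n + 1) => (0 : Fin (n + 1))) (a ᵍ⊗ₜ ω) :
      A.Forms n) = a ᵍ⊗ₜ (dΩ R n (homotopy R n ω)) + a ᵍ⊗ₜ (homotopy R n (dΩ R n ω)) := by
    rw [← gtmul_add, dΩ_homotopy, sub_eq_iff_eq_add, formsMap_tmul]
    refine Eq.trans ?_ (gtmul_add a _ _)
    rw [sub_add_cancel]
  rw [h3, totalH_tmul ha, map_smul, totalD_tmul ha, totalD_tmul ha, map_add, map_smul, h1,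
    totalH_tmul ha, smul_add, smul_smul, smul_smul, h2, one_smul, one_smul]
  abel

lemma totalH_mem_formsIn {S T : ℕ → Submodule R A.carrier} (hS : ∀ i, ∃ k, S i ≤ A.gr k)
    (h : ∀ i, S (i + 1) ≤ T i) {x : A.Forms n}
    (hx : x ∈ formsIn n S) : A.totalH n x ∈ formsIn n T := by
  refine (formsIn_le (V := (formsIn n T).comap (A.totalH n)) fun i a ω ha hω => ?_) hx
  obtain ⟨k, hk⟩ := hS i
  change A.totalH n (a ᵍ⊗ₜ ω) ∈ formsIn n T
  rw [totalH_tmul (hk ha)]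
  refine Submodule.smul_mem _ _ ?_
  rcases i with _ | i
  · rw [homotopy_eq_zero hω, gtmul_zero]
    exact zero_mem _
  · exact tmul_mem_formsIn (h i ha) (homotopy_mem hω)

end Homotopy

/-! ### Forms on the point -/

section Point

variable (R) in
/-- The isomorphism `Ω_0 ≅ R`. -/
noncomputable def evalΩ : Ω R 0 →ₐ[R] R :=
  Algebra.TensorProduct.lift (MvPolynomial.aeval 0) ExteriorAlgebra.algebraMapInv
    fun _ _ => Commute.all _ _

lemma algebraMap_evalΩ (ω : Ω R 0) : algebraMap R (Ω R 0) (evalΩ R ω) = ω := by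
  have h : (Algebra.ofId R (Ω R 0)).comp (evalΩ R) = AlgHom.id R _ := by
    refine Algebra.TensorProduct.ext (MvPolynomial.algHom_ext fun i => i.elim0)
      (ExteriorAlgebra.hom_ext ?_)
    refine LinearMap.ext fun v => ?_
    rw [Subsingleton.elim v 0, map_zero, map_zero]
  exact AlgHom.congr_fun h ω

lemma dΩ_zero (ω : Ω R 0) : dΩ R 0 ω = 0 := by
  simp [dΩ]

variable (A) in
/-- The isomorphism `A ⊗ Ω_0 ≅ A`. -/
noncomputable def evalForms : A.Forms 0 →ₗ[R] A.carrier :=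
  (TensorProduct.rid R A.carrier).toLinearMap ∘ₗ
    TensorProduct.map LinearMap.id (evalΩ R).toLinearMap ∘ₗ
    (GradedTensorProduct.of R A.gr (PolyForms.gr R 0)).symm.toLinearMap

lemma evalForms_tmul (a : A.carrier) (ω : Ω R 0) : A.evalForms (a ᵍ⊗ₜ ω) = evalΩ R ω • a := rfl

lemma evalForms_one (a : A.carrier) : A.evalForms (a ᵍ⊗ₜ 1) = a := by
  rw [evalForms_tmul, map_one, one_smul]

lemma evalForms_tmul_one (x : A.Forms 0) : A.evalForms x ᵍ⊗ₜ 1 = x := by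
  refine forms_hom_ext (f := (GradedTensorProduct.of R A.gr (PolyForms.gr R 0)).toLinearMap ∘ₗ
    (TensorProduct.mk R A.carrier (Ω R 0)).flip 1 ∘ₗ A.evalForms) (g := LinearMap.id)
    (fun i _ a ω ha _ => ?_) x
  change A.evalForms (a ᵍ⊗ₜ ω) ᵍ⊗ₜ 1 = a ᵍ⊗ₜ ω
  rw [evalForms_tmul, smul_gtmul, ← gtmul_smul, ← Algebra.algebraMap_eq_smul_one, algebraMap_evalΩ]

lemma evalForms_totalD (x : A.Forms 0) : A.evalForms (A.totalD 0 x) = A.d (A.evalForms x) := by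
  refine forms_hom_ext (f := A.evalForms ∘ₗ A.totalD 0) (g := A.d ∘ₗ A.evalForms)
    (fun i _ a ω ha _ => ?_) x
  change A.evalForms (A.totalD 0 (a ᵍ⊗ₜ ω)) = A.d (A.evalForms (a ᵍ⊗ₜ ω))
  rw [totalD_tmul ha, dΩ_zero, gtmul_zero, smul_zero, add_zero, evalForms_tmul, evalForms_tmul,
    map_smul]

lemma eq_zero_of_mem_gr_succ {j : ℕ} {ω : Ω R 0} (hω : ω ∈ PolyForms.gr R 0 (j + 1)) : ω = 0 := by
  have h1 : ω ∈ PolyForms.gr R 0 0 := by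
    rw [← algebraMap_evalΩ ω, Algebra.algebraMap_eq_smul_one]
    exact Submodule.smul_mem _ _ SetLike.GradedOne.one_mem
  by_contra h
  exact absurd (DirectSum.degree_eq_of_mem_mem (PolyForms.gr R 0) h1 hω h) (by omega)

end Point

end DGAlg

end

section

/-! ## Square-zero extensions of differential graded algebras -/

namespace DGAlg

open scoped TensorProduct
open PolyForms SimplicialAlg

variable {R : Type u} [CommRing R] {A B C : DGAlg R} {n m : ℕ}

lemma hom_proj (f : A ⟶ B) (i : ℕ) (a : A.carrier) :
    DGAlg.Hom.hom f (GradedAlgebra.proj A.gr i a) = GradedAlgebra.proj B.gr i (DGAlg.Hom.hom f a) := by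
  induction a using DirectSum.Decomposition.inductionOn A.gr with
  | zero => simp
  | add a b ha hb => simp only [map_add, ha, hb]
  | @homogeneous j a =>
    simp only [GradedAlgebra.proj_apply]
    by_cases h : j = i
    · subst h
      rw [DirectSum.decompose_of_mem_same _ a.2, DirectSum.decompose_of_mem_same _ (f.map_mem j a a.2)]
    · rw [DirectSum.decompose_of_mem_ne _ a.2 h,
        DirectSum.decompose_of_mem_ne _ (f.map_mem j a a.2) h, map_zero]

lemma exists_mem_gr (f : A ⟶ B) (hf : Function.Surjective (DGAlg.Hom.hom f)) (i : ℕ)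
    {b : B.carrier} (hb : b ∈ B.gr i) : ∃ a ∈ A.gr i, DGAlg.Hom.hom f a = b := by
  obtain ⟨a, rfl⟩ := hf b
  refine ⟨GradedAlgebra.proj A.gr i a, SetLike.coe_mem _, ?_⟩
  rw [hom_proj, GradedAlgebra.proj_apply, DirectSum.decompose_of_mem_same _ hb]

lemma map_d_le_gr : (A.gr 1).map A.d ≤ A.gr 0 := by
  rintro _ ⟨a, ha, rfl⟩
  exact A.d_mem 0 a ha

lemma map_d_le_augIdeal : (A.gr 1).map A.d ≤ A.augIdeal := by
  intro a ha
  change GradedAlgebra.proj A.gr 0 a ∈ (A.gr 1).map A.d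
  rwa [GradedAlgebra.proj_apply, DirectSum.decompose_of_mem_same _ (map_d_le_gr ha)]

lemma gr_succ_le_augIdeal (i : ℕ) : A.gr (i + 1) ≤ A.augIdeal := by
  intro a ha
  change GradedAlgebra.proj A.gr 0 a ∈ (A.gr 1).map A.d
  rw [GradedAlgebra.proj_apply, DirectSum.decompose_of_mem_ne _ ha (by omega)]
  exact zero_mem _

lemma evalForms_mem {S : ℕ → Submodule R A.carrier} {x : A.Forms 0} (hx : x ∈ formsIn 0 S) :
    A.evalForms x ∈ S 0 := by
  refine (formsIn_le (V := (S 0).comap A.evalForms) fun i a ω ha hω => ?_) hx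
  rcases i with _ | i
  · exact Submodule.smul_mem _ _ ha
  · rw [eq_zero_of_mem_gr_succ hω, gtmul_zero]
    exact zero_mem _

/-- The value of a form at the initial vertex. -/
noncomputable def vertexValue (x : A.Forms n) : A.carrier :=
  A.evalForms (formsMap (𝟙 A) (fun _ : Fin 1 => (0 : Fin (n + 1))) x)

lemma vertexValue_mem {x : A.Forms n} (hx : x ∈ A.degZero n) : vertexValue x ∈ A.gr 0 :=
  evalForms_mem (formsMap_mem _ _ hx)

lemma formsMap_const (θ : Fin (m + 1) → Fin 1) (x : A.Forms n) :
    formsMap (𝟙 A) (fun _ : Fin (m + 1) => (0 : Fin (n + 1))) x = vertexValue x ᵍ⊗ₜ 1 := by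
  obtain ⟨a, ha⟩ : ∃ a : A.carrier, (a ᵍ⊗ₜ 1 : A.Forms 0) =
    formsMap (𝟙 A) (fun _ : Fin 1 => (0 : Fin (n + 1))) x := ⟨_, evalForms_tmul_one _⟩
  have h := formsMap_comp (𝟙 A) (𝟙 A) (fun _ : Fin 1 => (0 : Fin (n + 1))) θ x
  rw [Category.comp_id, ← ha, formsMap_tmul, map_one] at h
  rw [vertexValue, ← ha, evalForms_one]
  exact h

lemma totalD_tmul_one {a : A.carrier} (ha : a ∈ A.gr 0) : A.totalD n (a ᵍ⊗ₜ 1) = 0 := by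
  have h2 : dΩ R n 1 = 0 := by
    rw [Algebra.TensorProduct.one_def, dΩ_tmul]
    simp
  rw [totalD_tmul ha, A.d_zero a ha, zero_gtmul, h2, gtmul_zero, smul_zero, add_zero]

/-- Constant cycles. -/
noncomputable def constCycle (n : ℕ) {a : A.carrier} (ha : a ∈ A.gr 0) : A.cycles n :=
  ⟨a ᵍ⊗ₜ 1, tmul_mem_formsIn ha SetLike.GradedOne.one_mem, totalD_tmul_one ha⟩

variable (A) in
/-- The ideal of boundaries in `Z_0(A ⊗ Ω_0) ≅ A_0`. -/
noncomputable def boundaryCycles : Ideal (((simplicialCycles R).obj A).obj (op ⦋0⦌)) where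
  carrier := {x | A.evalForms (x : A.cycles 0).1 ∈ (A.gr 1).map A.d}
  add_mem' {x y} hx hy := by
    change A.evalForms ((x : A.cycles 0).1 + (y : A.cycles 0).1) ∈ (A.gr 1).map A.d
    rw [map_add]
    exact add_mem hx hy
  zero_mem' := by
    change A.evalForms (0 : A.Forms 0) ∈ (A.gr 1).map A.d
    rw [map_zero]
    exact zero_mem _
  smul_mem' x y hy := by
    change A.cycles 0 at x
    change A.cycles 0 at y
    obtain ⟨c, hc, hc'⟩ := hy
    have hx : A.evalForms x.1 ∈ A.gr 0 := evalForms_mem x.2.1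
    refine ⟨A.evalForms x.1 * c, ?_, ?_⟩
    · have := SetLike.GradedMul.mul_mem hx hc
      rwa [zero_add] at this
    · rw [A.leibniz 0 _ hx, A.d_zero _ hx, zero_mul, zero_add, pow_zero, one_smul, hc']
      change _ = A.evalForms (x.1 * y.1)
      rw [← evalForms_tmul_one x.1, ← evalForms_tmul_one y.1,
        tmul_mul_tmul' _ (SetLike.GradedOne.one_mem : (1 : Ω R 0) ∈ PolyForms.gr R 0 0)
          (evalForms_mem y.2.1), mul_one, evalForms_one, evalForms_one, zero_mul, pow_zero, one_smul,
        evalForms_one]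

lemma boundaryCycles_le_map (f : A ⟶ B) (hf : Function.Surjective (DGAlg.Hom.hom f)) :
    B.boundaryCycles ≤ (A.boundaryCycles).map (((simplicialCycles R).map f).app (op ⦋0⦌)).hom := by
  rintro x ⟨c, hc, hx⟩
  change B.cycles 0 at x
  obtain ⟨c, hc', rfl⟩ := exists_mem_gr f hf 1 hc
  have h : (((simplicialCycles R).map f).app (op ⦋0⦌)).hom (constCycle 0 (A.d_mem 0 c hc')) = x := by
    refine Subtype.ext ?_
    change formsMap f _ (A.d c ᵍ⊗ₜ 1) = x.1
    rw [← evalForms_tmul_one x.1, ← hx, formsMap_tmul, map_one, f.map_d]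
  rw [← h]
  refine Ideal.mem_map_of_mem _ ?_
  change A.evalForms (A.d c ᵍ⊗ₜ 1) ∈ (A.gr 1).map A.d
  rw [evalForms_one]
  exact ⟨c, hc', rfl⟩

section Rational

variable [Algebra ℚ R]

lemma totalH_cycles_mem (x : A.cycles n) :
    A.totalH n x.1 ∈ formsIn n fun i => A.gr (i + 1) :=
  totalH_mem_formsIn (fun i => ⟨i, le_rfl⟩) (fun _ => le_rfl) x.2.1

lemma cycles_eq (x : A.cycles n) :
    x.1 = vertexValue x.1 ᵍ⊗ₜ 1 + A.totalD n (A.totalH n x.1) := by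
  have h := totalD_totalH x.1
  rw [x.2.2, map_zero, add_zero, formsMap_const fun _ => 0] at h
  rw [h, add_sub_cancel]

omit [Algebra ℚ R] in
lemma totalD_mem_degZero {x : A.Forms n} (hx : x ∈ formsIn n fun i => A.gr (i + 1)) :
    A.totalD n x ∈ A.degZero n :=
  totalD_mem_formsIn (fun i => ⟨i + 1, le_rfl⟩) (fun i a ha => A.d_mem i a ha) (fun _ => le_rfl) hx

lemma cyclesMap_surjective (f : A ⟶ B) (hf : Function.Surjective (DGAlg.Hom.hom f)) (n : ℕ) :
    Function.Surjective (cyclesMap f (id : Fin (n + 1) → Fin (n + 1))) := by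
  intro y
  obtain ⟨a, ha, ha'⟩ := exists_mem_gr f hf 0 (vertexValue_mem y.2.1)
  obtain ⟨h, hh, hh'⟩ := exists_formsMap_eq f (fun i _ => exists_mem_gr f hf (i + 1))
    (totalH_cycles_mem y)
  refine ⟨constCycle n ha + ⟨A.totalD n h, totalD_mem_degZero hh, totalD_totalD h⟩, Subtype.ext ?_⟩
  change formsMap f id (a ᵍ⊗ₜ 1 + A.totalD n h) = y.1
  rw [map_add, ← totalD_formsMap', hh', formsMap_tmul, map_one, ha']
  exact (cycles_eq y).symm

lemma boundaryIdeal_le_boundaryCycles :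
    boundaryIdeal ((simplicialCycles R).obj A) ≤ A.boundaryCycles := by
  refine Ideal.span_le.2 ?_
  rintro _ ⟨x, rfl⟩
  have h : ∀ i : Fin 2, A.evalForms ((((simplicialCycles R).obj A).δ i).hom x).1 =
      vertexValue x.1 + A.d (A.evalForms (formsMap (𝟙 A) (Fin.succAbove i) (A.totalH 1 x.1))) := by
    intro i
    refine (congrArg (fun y => A.evalForms (formsMap (𝟙 A) (Fin.succAbove i) y)) (cycles_eq x)).trans ?_
    rw [map_add, map_add, formsMap_tmul, map_one, ← totalD_formsMap', evalForms_totalD]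
    exact congrArg (· + _) (evalForms_one _)
  have hw : ∀ i : Fin 2, A.evalForms (formsMap (𝟙 A) (Fin.succAbove i) (A.totalH 1 x.1)) ∈ A.gr 1 :=
    fun i => evalForms_mem (S := fun i => A.gr (i + 1))
      (formsMap_mem_formsIn (𝟙 A) _ (fun _ _ ha => ha) (totalH_cycles_mem x))
  refine ⟨_, sub_mem (hw 0) (hw 1), ?_⟩
  rw [map_sub, ← add_sub_add_left_eq_sub _ _ (vertexValue x.1), ← h, ← h, ← map_sub]
  rfl

lemma mem_formsIn_of_vertexValue_mem {x : A.cycles n} (hx : vertexValue x.1 ∈ (A.gr 1).map A.d) :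
    x.1 ∈ formsIn n fun i => A.augIdeal ⊓ A.gr i := by
  rw [cycles_eq x]
  refine add_mem (tmul_mem_formsIn ⟨map_d_le_augIdeal hx, vertexValue_mem x.2.1⟩
    SetLike.GradedOne.one_mem) ?_
  refine totalD_mem_formsIn (T := fun i => A.augIdeal ⊓ A.gr i) (fun i => ⟨i + 1, le_rfl⟩)
    (fun i a ha => ⟨?_, A.d_mem i a ha⟩) (fun i => le_inf (gr_succ_le_augIdeal i) le_rfl) (totalH_cycles_mem x)
  rcases i with _ | i
  · exact map_d_le_augIdeal ⟨a, ha, rfl⟩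
  · exact gr_succ_le_augIdeal i (A.d_mem _ a ha)

lemma mem_of_mem_ideal_pow_succ {S : Type*} [CommRing S] {I : Ideal S} {P : ℕ → S → Prop}
    (h : ∀ x ∈ I, P 0 x) (hadd : ∀ k x y, P k x → P k y → P k (x + y))
    (hmul : ∀ k x y, P k x → y ∈ I → P (k + 1) (x * y)) (k : ℕ) :
    ∀ x ∈ I ^ (k + 1), P k x := by
  induction k with
  | zero =>
    intro x hx
    rw [zero_add, pow_one] at hx
    exact h x hx
  | succ k ih =>
    intro x hx
    rw [pow_succ] at hx
    induction hx using Submodule.mul_induction_on' with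
    | mem_mul_mem x hx y hy => exact hmul k x y (ih x hx) hy
    | add x hx y hy ihx ihy => exact hadd _ _ _ ihx ihy

variable (A) in
/-- The cycles on `Δ^n` whose class in `H_0 A` vanishes. -/
noncomputable def augCycles (m : SimplexCategoryᵒᵖ) : Ideal (((simplicialCycles R).obj A).obj m) :=
  Ideal.comap (((simplicialCycles R).obj A).map (SimplexCategory.const ⦋0⦌ m.unop 0).op).hom
    A.boundaryCycles

lemma augCycles_pow_eq_bot {N : ℕ} (hN : A.augIdeal ^ N = ⊥) (m : SimplexCategoryᵒᵖ) :
    A.augCycles m ^ (N + 1) = ⊥ := by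
  rw [eq_bot_iff]
  intro x hx
  have h : (x : A.cycles m.unop.len).1 ∈ formsIn m.unop.len fun _ => A.augIdeal ^ (N + 1) := by
    refine mem_of_mem_ideal_pow_succ (I := A.augCycles m) (P := fun k x =>
      (x : A.cycles m.unop.len).1 ∈ formsIn m.unop.len fun _ => A.augIdeal ^ (k + 1))
      (fun x hx => ?_) (fun k x y hx hy => add_mem hx hy) (fun k x y hx hy => ?_) N x hx
    · rw [zero_add, pow_one]
      exact formsIn_mono (fun _ => inf_le_left)
        (mem_formsIn_of_vertexValue_mem (n := m.unop.len) (x := x) hx)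
    · refine mul_mem_formsIn (fun _ => inf_le_right) (fun i j a ha b hb => ?_) hx
        (mem_formsIn_of_vertexValue_mem (n := m.unop.len) (x := y) hy)
      rw [pow_succ]
      exact Submodule.mul_mem_mul ha hb.1
  refine Subtype.ext (eq_zero_of_mem_formsIn (fun _ => ?_) h)
  rw [pow_succ, hN, Submodule.bot_mul]

end Rational

lemma mem_formsIn_ker (f : A ⟶ B) {x : A.cycles n}
    (hx : cyclesMap f (id : Fin (n + 1) → Fin (n + 1)) x = 0) :
    x.1 ∈ formsIn n fun i => DGN.kerGr f i := by
  refine mem_formsIn_iff.2 fun i => ⟨mem_formsIn_iff.1 x.2.1 i, ?_⟩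
  have h := coeffs_formsMap_id f x.1 i
  rw [show formsMap f id x.1 = 0 from congrArg Subtype.val hx, map_zero] at h
  exact h.symm

lemma mul_eq_zero_of_forall (f : A ⟶ B) {S : ℕ → Submodule R A.carrier}
    (h : ∀ i, ∀ a ∈ S i, ∀ b, DGAlg.Hom.hom f b = 0 → a * b = 0) {x y : A.cycles n}
    (hx : x.1 ∈ formsIn n S)
    (hy : cyclesMap f (id : Fin (n + 1) → Fin (n + 1)) y = 0) : x * y = 0 :=
  Subtype.ext (eq_zero_of_mem_formsIn (S := fun _ => ⊥) (fun _ => rfl)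
    (mul_mem_formsIn (fun _ => inf_le_left) (fun i _ a ha b hb => h i a ha b hb.2) hx
      (mem_formsIn_ker f hy)))

end DGAlg

end

section

/-! ## Tiny acyclic extensions of differential graded algebras -/

namespace DGAlg

open scoped TensorProduct
open PolyForms SimplicialAlg

variable {R : Type u} [CommRing R] {A B C : DGAlg R} {n m : ℕ}

section Extension

/-- Multiplication by a polynomial function. -/
noncomputable def mulForm (p : MvPolynomial (Fin n) R) : A.Forms n →ₗ[R] A.Forms n :=
  (GradedTensorProduct.of R A.gr (PolyForms.gr R n)).toLinearMap ∘ₗ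
    TensorProduct.map LinearMap.id (LinearMap.mulLeft R (p ⊗ₜ[R] (1 : ExteriorAlgebra R (Fin n → R)))) ∘ₗ
    (GradedTensorProduct.of R A.gr (PolyForms.gr R n)).symm.toLinearMap

lemma mulForm_tmul (p : MvPolynomial (Fin n) R) (a : A.carrier) (ω : Ω R n) :
    mulForm p (a ᵍ⊗ₜ ω : A.Forms n) = a ᵍ⊗ₜ ((p ⊗ₜ 1) * ω) := rfl

lemma mulForm_one (x : A.Forms n) : mulForm 1 x = x := by
  refine forms_hom_ext (f := mulForm 1) (g := LinearMap.id) (fun _ _ a ω _ _ => ?_) x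
  rw [mulForm_tmul, ← Algebra.TensorProduct.one_def, one_mul]
  rfl

lemma mulForm_zero (x : A.Forms n) : mulForm 0 x = 0 := by
  refine forms_hom_ext (f := mulForm 0) (g := 0) (fun _ _ a ω _ _ => ?_) x
  rw [mulForm_tmul, TensorProduct.zero_tmul, zero_mul, gtmul_zero]
  rfl

lemma mulForm_mem {S : ℕ → Submodule R A.carrier} (p : MvPolynomial (Fin n) R) {x : A.Forms n}
    (hx : x ∈ formsIn n S) : mulForm p x ∈ formsIn n S := by
  refine (formsIn_le (V := (formsIn n S).comap (mulForm p)) fun i a ω ha hω => ?_) hx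
  refine tmul_mem_formsIn (i := i) ha ?_
  rw [← zero_add i]
  exact SetLike.GradedMul.mul_mem (tmul_mem p SetLike.GradedOne.one_mem) hω

lemma formsMap_mulForm (θ : Fin (m + 1) → Fin (n + 1)) (p : MvPolynomial (Fin n) R)
    (x : A.Forms n) : formsMap (𝟙 A) θ (mulForm p x) =
      mulForm (MvPolynomial.aeval (pullT θ) p) (formsMap (𝟙 A) θ x) := by
  refine forms_hom_ext (f := formsMap (𝟙 A) θ ∘ₗ mulForm p)
    (g := mulForm (MvPolynomial.aeval (pullT θ) p) ∘ₗ formsMap (𝟙 A) θ) (fun _ _ a ω _ _ => ?_) x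
  change formsMap (𝟙 A) θ (mulForm p (a ᵍ⊗ₜ ω)) = mulForm _ (formsMap (𝟙 A) θ (a ᵍ⊗ₜ ω))
  rw [mulForm_tmul, formsMap_tmul, formsMap_tmul, mulForm_tmul, map_mul, pull_tmul, map_one]

variable (R n) in
/-- The function `t_l + ⋯ + t_n`. -/
noncomputable def tailSum (l : ℕ) : MvPolynomial (Fin n) R :=
  ∑ j ∈ Finset.univ.filter fun j : Fin (n + 1) => l ≤ (j : ℕ), t n j

lemma tailSum_zero : tailSum R n 0 = 1 := by
  simp [tailSum, sum_t]

lemma tailSum_last : tailSum R n (n + 1) = 0 := by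
  rw [tailSum, Finset.sum_eq_zero]
  intro j hj
  have := (Finset.mem_filter.1 hj).2
  omega

lemma val_succAbove (k : Fin (n + 1)) (x : Fin n) :
    (k.succAbove x : ℕ) = if (x : ℕ) < k then (x : ℕ) else x + 1 := by
  simp only [Fin.succAbove, Fin.lt_def, Fin.val_castSucc]
  split_ifs <;> simp

lemma val_predAbove (i : Fin n) (x : Fin (n + 1)) :
    (i.predAbove x : ℕ) = if (i : ℕ) < x then (x : ℕ) - 1 else x := by
  simp only [Fin.predAbove, Fin.lt_def, Fin.val_castSucc]
  split_ifs <;> simp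

lemma aeval_tailSum (k : Fin (n + 2)) (l : ℕ) :
    MvPolynomial.aeval (pullT (R := R) k.succAbove) (tailSum R (n + 1) l) =
      tailSum R n (if (k : ℕ) < l then l - 1 else l) := by
  rw [tailSum, map_sum, Finset.sum_congr rfl fun j _ => aeval_pullT_t _ j,
    Finset.sum_fiberwise_eq_sum_filter, tailSum]
  refine Finset.sum_congr (Finset.filter_congr fun j _ => ?_) fun _ _ => rfl
  simp only [Finset.mem_filter, Finset.mem_univ, true_and, val_succAbove]
  split_ifs <;> omega

lemma formsMap_succAbove_predAbove {u : A.Forms n} (hu : ∀ (m : ℕ) (h : n = m + 1)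
      (k : Fin (m + 2)), formsMap (𝟙 A) (fun x => (k.succAbove x).cast (by omega)) u =
        (0 : A.Forms m)) (k : Fin (n + 2)) (i : Fin (n + 1)) :
    formsMap (𝟙 A) k.succAbove (formsMap (𝟙 A) i.predAbove u) =
      if (k : ℕ) = i ∨ (k : ℕ) = i + 1 then u else 0 := by
  rw [← formsMap_comp, Category.comp_id]
  split_ifs with h
  · have e : i.predAbove ∘ k.succAbove = id := funext fun x => Fin.ext (by
      simp only [Function.comp_apply, val_predAbove, val_succAbove, id]
      split_ifs <;> omega)
    rw [e, formsMap_id]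
  · obtain ⟨n, rfl⟩ : ∃ n', n = n' + 1 := ⟨n - 1, by omega⟩
    have hk := hu n rfl
    have key : ∀ (k' : Fin (n + 2)) (i' : Fin (n + 1)), i.predAbove ∘ k.succAbove =
        k'.succAbove ∘ i'.predAbove → formsMap (𝟙 A) (i.predAbove ∘ k.succAbove) u = 0 := by
      intro k' i' e
      have h1 := formsMap_comp (𝟙 A) (𝟙 A) k'.succAbove i'.predAbove u
      rw [Category.comp_id] at h1
      rw [e, h1]
      exact (congrArg _ (hk k')).trans (map_zero _)
    by_cases hki : (k : ℕ) < i
    · refine key ⟨k, by omega⟩ ⟨i - 1, by omega⟩ (funext fun x => Fin.ext ?_)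
      simp only [Function.comp_apply, val_predAbove, val_succAbove]
      split_ifs <;> omega
    · refine key ⟨k - 1, by omega⟩ ⟨i, by omega⟩ (funext fun x => Fin.ext ?_)
      simp only [Function.comp_apply, val_predAbove, val_succAbove]
      split_ifs <;> omega

lemma exists_extension {S : ℕ → Submodule R A.carrier} {u : A.Forms n} (hS : u ∈ formsIn n S)
    (hu : ∀ (m : ℕ) (h : n = m + 1) (k : Fin (m + 2)),
      formsMap (𝟙 A) (fun x => (k.succAbove x).cast (by omega)) u = (0 : A.Forms m)) :
    ∃ y ∈ formsIn (n + 1) S, formsMap (𝟙 A) (Fin.succAbove 0) y = u ∧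
      ∀ k : Fin (n + 1), formsMap (𝟙 A) k.succ.succAbove y = 0 := by
  let y : A.Forms (n + 1) := ∑ i : Fin (n + 1), (-1 : R) ^ (i : ℕ) •
    mulForm (tailSum R (n + 1) (i + 1)) (formsMap (𝟙 A) i.predAbove u)
  have hy : ∀ k : Fin (n + 2), formsMap (𝟙 A) k.succAbove y = ∑ i : Fin (n + 1),
      if (k : ℕ) = i ∨ (k : ℕ) = i + 1 then (-1 : R) ^ (i : ℕ) • mulForm (tailSum R n k) u else 0 := by
    intro k
    rw [map_sum]
    refine Finset.sum_congr rfl fun i _ => ?_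
    rw [map_smul, formsMap_mulForm, formsMap_succAbove_predAbove hu, aeval_tailSum]
    by_cases h : (k : ℕ) = i ∨ (k : ℕ) = i + 1
    · rw [if_pos h, if_pos h]
      congr 4
      split_ifs <;> omega
    · rw [if_neg h, if_neg h, map_zero, smul_zero]
  refine ⟨y, Submodule.sum_mem _ fun i _ => Submodule.smul_mem _ _ (mulForm_mem _
    (formsMap_mem_formsIn _ _ (fun _ _ h => h) hS)), ?_, fun k => ?_⟩
  · rw [hy, Finset.sum_eq_single 0]
    · simp [tailSum_zero, mulForm_one]
    · intro i _ hi
      rw [if_neg]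
      have : (i : ℕ) ≠ 0 := fun h => hi (Fin.ext h)
      rw [Fin.val_zero]
      omega
    · simp
  · rw [hy]
    induction k using Fin.lastCases with
    | last =>
      refine Finset.sum_eq_zero fun i _ => ?_
      rw [Fin.val_succ, Fin.val_last, tailSum_last, mulForm_zero, smul_zero, ite_self]
    | cast j =>
      rw [Finset.sum_eq_add j.castSucc j.succ (Fin.castSucc_lt_succ).ne]
      · rw [if_pos (by simp), if_pos (by simp), ← add_smul, Fin.val_succ, Fin.val_castSucc, pow_succ,
          mul_neg_one, add_neg_cancel, zero_smul]
      · intro i _ hi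
        rw [if_neg]
        have h1 : (i : ℕ) ≠ j := fun h => hi.1 (Fin.ext h)
        have h2 : (i : ℕ) ≠ j + 1 := fun h => hi.2 (Fin.ext h)
        simp only [Fin.val_succ, Fin.val_castSucc]
        omega
      · simp
      · simp

end Extension

section Primitive

/-- The family of submodules concentrated in one index. -/
def concentrated (q : ℕ) (K : Submodule R A.carrier) (i : ℕ) : Submodule R A.carrier :=
  if i = q then K else ⊥

lemma mem_concentrated {q : ℕ} {K : Submodule R A.carrier} {i : ℕ} {a : A.carrier} :
    a ∈ concentrated q K i ↔ a = 0 ∨ (i = q ∧ a ∈ K) := by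
  unfold concentrated
  split_ifs with h
  · exact ⟨fun ha => .inr ⟨h, ha⟩, fun ha => ha.elim (fun e => e ▸ zero_mem _) And.right⟩
  · simp [h]

lemma eq_zero_of_totalD_eq_zero {q k : ℕ} {K : Submodule R A.carrier} (hK : K ≤ A.gr k)
    (hd : ∀ a ∈ K, A.d a = 0 → a = 0) {x : A.Forms n} (hx : x ∈ formsIn n (concentrated q K))
    (h : A.totalD n x = 0) : x = 0 := by
  have key : ∀ i : FormIndex R n, i.deg = q → A.coeffs n (A.totalD n x) i = A.d (A.coeffs n x i) := by
    intro i hi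
    refine (formsIn_le (V := LinearMap.eqLocus
      (Finsupp.lapply i ∘ₗ (A.coeffs n).toLinearMap ∘ₗ A.totalD n)
      (A.d ∘ₗ Finsupp.lapply i ∘ₗ (A.coeffs n).toLinearMap)) fun j a ω ha hω => ?_) hx
    change A.coeffs n (A.totalD n (a ᵍ⊗ₜ ω)) i = A.d (A.coeffs n (a ᵍ⊗ₜ ω) i)
    rcases mem_concentrated.1 ha with rfl | ⟨rfl, ha'⟩
    · simp only [zero_gtmul, map_zero, Finsupp.zero_apply]
    · rw [totalD_tmul (hK ha'), map_add, map_smul, Finsupp.add_apply, Finsupp.smul_apply,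
        coeffs_tmul, coeffs_tmul, coeffs_tmul, formBasis_repr_eq_zero (dΩ_mem hω) (by omega),
        zero_smul, smul_zero, add_zero, map_smul]
  refine forms_ext fun i => ?_
  rw [map_zero, Finsupp.zero_apply]
  rcases mem_concentrated.1 (mem_formsIn_iff.1 hx i) with h0 | ⟨hi, hiK⟩
  · exact h0
  · refine hd _ hiK ?_
    rw [← key i hi, h, map_zero, Finsupp.zero_apply]

variable {f : A ⟶ B} {r : ℕ} (hr : ∀ i : ℕ, i ≠ r → i ≠ r + 1 → DGN.kerGr f i = ⊥)
  (hbij : Set.BijOn A.d (DGN.kerGr f (r + 1)) (DGN.kerGr f r))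

include hr hbij

lemma exists_primitive {z : A.Forms n} (hz : z ∈ formsIn n fun i => DGN.kerGr f i) :
    ∃ u ∈ formsIn n (concentrated r (DGN.kerGr f (r + 1))),
      A.totalD n u - z ∈ formsIn n (concentrated (r + 1) (DGN.kerGr f (r + 1))) := by
  suffices h : formsIn n (fun i => DGN.kerGr f i) ≤
      (formsIn n (concentrated r (DGN.kerGr f (r + 1)))).map (A.totalD n) ⊔
        formsIn n (concentrated (r + 1) (DGN.kerGr f (r + 1))) by
    obtain ⟨_, ⟨u, hu, rfl⟩, v, hv, rfl⟩ := Submodule.mem_sup.1 (h hz)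
    exact ⟨u, hu, by rw [sub_add_cancel_left]; exact neg_mem hv⟩
  refine formsIn_le fun j a ω ha hω => ?_
  by_cases h1 : j = r
  · subst h1
    obtain ⟨b, hb, rfl⟩ := hbij.surjOn ha
    have e : (A.d b ᵍ⊗ₜ ω : A.Forms n) = A.totalD n (b ᵍ⊗ₜ ω) +
        -((-1 : R) ^ (j + 1) • (b ᵍ⊗ₜ dΩ R n ω)) := by
      rw [totalD_tmul hb.1, add_neg_cancel_right]
    rw [e]
    refine Submodule.add_mem_sup ⟨_, tmul_mem_formsIn (mem_concentrated.2 (.inr ⟨rfl, hb⟩)) hω, rfl⟩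
      (neg_mem (Submodule.smul_mem _ _
        (tmul_mem_formsIn (mem_concentrated.2 (.inr ⟨rfl, hb⟩)) (dΩ_mem hω))))
  · by_cases h2 : j = r + 1
    · subst h2
      exact Submodule.mem_sup_right (tmul_mem_formsIn (mem_concentrated.2 (.inr ⟨rfl, ha⟩)) hω)
    · rw [hr j h1 h2] at ha
      rw [show a = 0 from ha, zero_gtmul]
      exact zero_mem _

variable [Algebra ℚ R]

theorem isKerAcyclic_simplicialCycles : IsKerAcyclic ((simplicialCycles R).map f) := by
  have hd : ∀ a ∈ DGN.kerGr f (r + 1), A.d a = 0 → a = 0 := fun a ha h =>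
    hbij.injOn ha (zero_mem _) (h.trans (map_zero _).symm)
  have hK : DGN.kerGr f (r + 1) ≤ A.gr (r + 1) := inf_le_left
  intro n z hz hface
  obtain ⟨u, hu, hw⟩ := exists_primitive (n := n) hr hbij (mem_formsIn_ker (n := n) f hz)
  have hDu : A.totalD n u = z.1 := sub_eq_zero.1 (eq_zero_of_totalD_eq_zero hK hd hw (by
    rw [map_sub, totalD_totalD, z.2.2, sub_zero]))
  have hu0 : ∀ (m : ℕ) (h : n = m + 1) (k : Fin (m + 2)),
      formsMap (𝟙 A) (fun x => (k.succAbove x).cast (by omega)) u = (0 : A.Forms m) := by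
    rintro m rfl k
    refine eq_zero_of_totalD_eq_zero hK hd (q := r)
      (formsMap_mem_formsIn _ _ (fun _ _ h => h) hu) ?_
    rw [totalD_formsMap', hDu]
    exact congrArg Subtype.val (hface m rfl (SimplexCategory.δ k) inferInstance)
  obtain ⟨y, hy, hy0, hyk⟩ := exists_extension hu hu0
  have hy1 : y ∈ formsIn (n + 1) fun i => A.gr (i + 1) := by
    refine formsIn_mono (fun i a ha => ?_) hy
    rcases mem_concentrated.1 ha with rfl | ⟨rfl, ha⟩
    · exact zero_mem _
    · exact ha.1
  refine ⟨⟨A.totalD _ y, totalD_mem_degZero hy1, totalD_totalD y⟩, Subtype.ext ?_, Subtype.ext ?_,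
    fun i => Subtype.ext ?_⟩
  · refine (totalD_formsMap' f id y).symm.trans ?_
    have h0 : formsMap f id y = 0 := by
      refine eq_zero_of_mem_formsIn (S := fun _ => ⊥) (fun _ => rfl)
        (formsMap_mem_formsIn f id (fun i a ha => ?_) hy)
      rcases mem_concentrated.1 ha with rfl | ⟨rfl, ha⟩
      · exact map_zero _
      · exact ha.2
    rw [h0, map_zero]
    rfl
  · refine (totalD_formsMap' (𝟙 A) (Fin.succAbove 0) y).symm.trans ?_
    rw [hy0, hDu]
  · refine (totalD_formsMap' (𝟙 A) i.succ.succAbove y).symm.trans ?_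
    rw [hyk, map_zero]
    rfl

end Primitive

end DGAlg

end

section

/-! ## Fibre products of differential graded algebras -/

variable {R : Type u} [CommRing R]

namespace DGAlg

open scoped TensorProduct DirectSum
open PolyForms SimplicialAlg

section FiberProduct

variable {A B C : DGAlg R} (f : A ⟶ B) (g : C ⟶ B)

/-- The underlying algebra of the fibre product. -/
abbrev fiberSubalgebra : Subalgebra R (A.carrier × C.carrier) :=
  AlgHom.equalizer ((DGAlg.Hom.hom f).comp (AlgHom.fst R A.carrier C.carrier))
    ((DGAlg.Hom.hom g).comp (AlgHom.snd R A.carrier C.carrier))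

/-- The grading of the fibre product. -/
def fiberGr (i : ℕ) : Submodule R (fiberSubalgebra f g) :=
  ((A.gr i).prod (C.gr i)).comap (fiberSubalgebra f g).val.toLinearMap

/-- The homogeneous components of an element of the fibre product. -/
def fiberProj (i : ℕ) (x : fiberSubalgebra f g) : fiberGr f g i :=
  ⟨⟨(GradedAlgebra.proj A.gr i x.1.1, GradedAlgebra.proj C.gr i x.1.2), by
    change DGAlg.Hom.hom f _ = DGAlg.Hom.hom g _
    have h : DGAlg.Hom.hom f x.1.1 = DGAlg.Hom.hom g x.1.2 := x.2
    exact (hom_proj f i _).trans ((congrArg _ h).trans (hom_proj g i _).symm)⟩, SetLike.coe_mem _, SetLike.coe_mem _⟩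

lemma fiberProj_self {i : ℕ} (x : fiberGr f g i) : fiberProj f g i x = x :=
  Subtype.ext (Subtype.ext (Prod.ext (DirectSum.decompose_of_mem_same _ x.2.1)
    (DirectSum.decompose_of_mem_same _ x.2.2)))

lemma fiberProj_of_ne {i j : ℕ} (h : j ≠ i) (x : fiberGr f g j) : fiberProj f g i x = 0 :=
  Subtype.ext (Subtype.ext (Prod.ext (DirectSum.decompose_of_mem_ne _ x.2.1 h)
    (DirectSum.decompose_of_mem_ne _ x.2.2 h)))

lemma fiberProj_add (i : ℕ) (x y : fiberSubalgebra f g) :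
    fiberProj f g i (x + y) = fiberProj f g i x + fiberProj f g i y :=
  Subtype.ext (Subtype.ext (Prod.ext (map_add (GradedAlgebra.proj A.gr i) _ _)
    (map_add (GradedAlgebra.proj C.gr i) _ _)))

open Classical in
/-- The support of an element of the fibre product. -/
noncomputable def fiberSupport (x : fiberSubalgebra f g) : Finset ℕ :=
  (DirectSum.decompose A.gr x.1.1).support ∪ (DirectSum.decompose C.gr x.1.2).support

lemma fiberProj_eq_zero {x : fiberSubalgebra f g} {i : ℕ} (hi : i ∉ fiberSupport f g x) :
    fiberProj f g i x = 0 := by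
  classical
  rw [fiberSupport, Finset.mem_union, not_or, DFinsupp.notMem_support_iff,
    DFinsupp.notMem_support_iff] at hi
  refine Subtype.ext (Subtype.ext (Prod.ext ?_ ?_))
  · exact congrArg Subtype.val hi.1
  · exact congrArg Subtype.val hi.2

lemma sum_fiberProj (x : fiberSubalgebra f g) :
    ∑ i ∈ fiberSupport f g x, (fiberProj f g i x : fiberSubalgebra f g) = x := by
  classical
  have key : ∀ (D : DGAlg R) (q : fiberSubalgebra f g →ₐ[R] D.carrier) (s : Finset ℕ),
      (∀ i, (q (fiberProj f g i x) : D.carrier) = DirectSum.decompose D.gr (q x) i) →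
      (DirectSum.decompose D.gr (q x)).support ⊆ s →
      q (∑ i ∈ s, (fiberProj f g i x : fiberSubalgebra f g)) = q x := by
    intro D q s h hs
    conv_rhs => rw [← DirectSum.sum_support_decompose D.gr (q x)]
    rw [map_sum, Finset.sum_congr rfl fun i _ => h i]
    refine (Finset.sum_subset hs fun i _ hi => ?_).symm
    rw [DFinsupp.notMem_support_iff.1 hi, ZeroMemClass.coe_zero]
  refine Subtype.ext (Prod.ext ?_ ?_)
  · refine key A ((AlgHom.fst R _ _).comp (Subalgebra.val _)) _ (fun _ => rfl) ?_
    rw [fiberSupport]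
    convert Finset.subset_union_left using 1
    congr
  · refine key C ((AlgHom.snd R _ _).comp (Subalgebra.val _)) _ (fun _ => rfl) ?_
    rw [fiberSupport]
    convert Finset.subset_union_right using 1
    congr

open Classical in
noncomputable instance : GradedAlgebra (fiberGr f g) where
  one_mem := ⟨SetLike.GradedOne.one_mem, SetLike.GradedOne.one_mem⟩
  mul_mem _ _ _ _ hx hy := ⟨SetLike.GradedMul.mul_mem hx.1 hy.1, SetLike.GradedMul.mul_mem hx.2 hy.2⟩
  decompose' x := ∑ i ∈ fiberSupport f g x, DirectSum.of (fun i => fiberGr f g i) i (fiberProj f g i x)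
  left_inv x := by
    conv_rhs => rw [← sum_fiberProj f g x]
    rw [map_sum]
    simp only [DirectSum.coeAddMonoidHom_of]
  right_inv x := by
    refine DFinsupp.ext fun i => ?_
    have h1 : ∀ y : fiberSubalgebra f g, (∑ i ∈ fiberSupport f g y,
        DirectSum.of (fun i => fiberGr f g i) i (fiberProj f g i y)) i = fiberProj f g i y := by
      intro y
      rw [DirectSum.sum_apply, Finset.sum_eq_single i]
      · exact DirectSum.of_eq_same _ _
      · exact fun j _ hj => DirectSum.of_eq_of_ne _ _ _ (Ne.symm hj)
      · intro hi
        rw [fiberProj_eq_zero f g hi, map_zero, DirectSum.zero_apply]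
    rw [h1]
    induction x using DirectSum.induction_on with
    | zero =>
      rw [map_zero]
      exact Subtype.ext (Subtype.ext (Prod.ext (map_zero (GradedAlgebra.proj A.gr i))
        (map_zero (GradedAlgebra.proj C.gr i))))
    | of j x =>
      rw [DirectSum.coeAddMonoidHom_of]
      by_cases h : j = i
      · subst h
        rw [fiberProj_self, DirectSum.of_eq_same]
      · rw [fiberProj_of_ne f g h, DirectSum.of_eq_of_ne _ _ _ (Ne.symm h)]
    | add x y hx hy => rw [map_add, fiberProj_add, hx, hy, DirectSum.add_apply]

/-- The fibre product of differential graded algebras. -/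
noncomputable def fiberProd : DGAlg R where
  carrier := fiberSubalgebra f g
  gr := fiberGr f g
  d := ((A.d.prodMap C.d).comp (fiberSubalgebra f g).val.toLinearMap).codRestrict
    (Subalgebra.toSubmodule (fiberSubalgebra f g)) fun x => by
      change DGAlg.Hom.hom f (A.d x.1.1) = DGAlg.Hom.hom g (C.d x.1.2)
      rw [f.map_d, g.map_d]
      exact congrArg B.d x.2
  d_zero x hx := Subtype.ext (Prod.ext (A.d_zero _ hx.1) (C.d_zero _ hx.2))
  d_mem n x hx := ⟨A.d_mem n _ hx.1, C.d_mem n _ hx.2⟩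
  d_d x := Subtype.ext (Prod.ext (A.d_d _) (C.d_d _))
  leibniz n x hx y := Subtype.ext (Prod.ext (A.leibniz n _ hx.1 _) (C.leibniz n _ hx.2 _))
  comm m n x hx y hy := Subtype.ext (Prod.ext (A.comm m n _ hx.1 _ hy.1) (C.comm m n _ hx.2 _ hy.2))

/-- The first projection. -/
noncomputable def fiberProdFst : fiberProd f g ⟶ A where
  hom := (AlgHom.fst R A.carrier C.carrier).comp (fiberSubalgebra f g).val
  map_mem _ _ h := h.1
  map_d _ := rfl

/-- The second projection. -/
noncomputable def fiberProdSnd : fiberProd f g ⟶ C where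
  hom := (AlgHom.snd R A.carrier C.carrier).comp (fiberSubalgebra f g).val
  map_mem _ _ h := h.2
  map_d _ := rfl

variable {f g}

lemma fiberProd_ext {x y : (fiberProd f g).carrier}
    (h1 : DGAlg.Hom.hom (fiberProdFst f g) x = DGAlg.Hom.hom (fiberProdFst f g) y)
    (h2 : DGAlg.Hom.hom (fiberProdSnd f g) x = DGAlg.Hom.hom (fiberProdSnd f g) y) : x = y :=
  Subtype.ext (Prod.ext h1 h2)

lemma hom_ext' {A B : DGAlg R} {f g : A ⟶ B}
    (h : ∀ x, DGAlg.Hom.hom f x = DGAlg.Hom.hom g x) : f = g :=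
  DGAlg.Hom.ext (AlgHom.ext h)

variable (f g)

lemma fiberProd_condition : fiberProdFst f g ≫ f = fiberProdSnd f g ≫ g :=
  hom_ext' fun x => x.2

lemma isPullback_fiberProd : IsPullback (fiberProdFst f g) (fiberProdSnd f g) f g :=
  ⟨⟨fiberProd_condition f g⟩, ⟨Limits.PullbackCone.IsLimit.mk _
    (fun s =>
      { hom := ((DGAlg.Hom.hom s.fst).prod (DGAlg.Hom.hom s.snd)).codRestrict _ fun x =>
          AlgHom.congr_fun (congrArg DGAlg.Hom.hom s.condition) x
        map_mem := fun n a ha => ⟨s.fst.map_mem n a ha, s.snd.map_mem n a ha⟩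
        map_d := fun a => Subtype.ext (Prod.ext (s.fst.map_d a) (s.snd.map_d a)) })
    (fun _ => rfl) (fun _ => rfl)
    (fun _ _ h1 h2 => hom_ext' fun x => Subtype.ext (Prod.ext
      (AlgHom.congr_fun (congrArg DGAlg.Hom.hom h1) x)
      (AlgHom.congr_fun (congrArg DGAlg.Hom.hom h2) x)))⟩⟩

lemma map_mem_augIdeal {A B : DGAlg R} (f : A ⟶ B) {x : A.carrier} (hx : x ∈ A.augIdeal) :
    DGAlg.Hom.hom f x ∈ B.augIdeal := by
  obtain ⟨c, hc, hx⟩ := hx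
  refine ⟨DGAlg.Hom.hom f c, f.map_mem 1 c hc, ?_⟩
  rw [← f.map_d, hx, hom_proj]

lemma map_augIdeal_pow_eq_zero {A B : DGAlg R} (f : A ⟶ B) {N N' : ℕ} (hN : B.augIdeal ^ N = ⊥)
    (h : N ≤ N') {x : A.carrier} (hx : x ∈ A.augIdeal ^ N') : DGAlg.Hom.hom f x = 0 := by
  have h1 : A.augIdeal.map (DGAlg.Hom.hom f).toLinearMap ≤ B.augIdeal := by
    rintro _ ⟨x, hx, rfl⟩
    exact map_mem_augIdeal f hx
  have h2 := pow_le_pow_left' h1 N'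
  have h3 : B.augIdeal ^ N' = ⊥ := by
    rw [← Nat.add_sub_cancel' h, pow_add, hN, Submodule.bot_mul]
  rw [← Submodule.map_pow, h3] at h2
  exact h2 ⟨x, hx, rfl⟩

lemma isPullback_cycles (k : SimplexCategoryᵒᵖ) : IsPullback
    (((simplicialCycles R).map (fiberProdFst f g)).app k)
    (((simplicialCycles R).map (fiberProdSnd f g)).app k)
    (((simplicialCycles R).map f).app k) (((simplicialCycles R).map g).app k) := by
  have hext : ∀ {n : ℕ} {x y : (fiberProd f g).Forms n},
      formsMap (fiberProdFst f g) id x = formsMap (fiberProdFst f g) id y →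
      formsMap (fiberProdSnd f g) id x = formsMap (fiberProdSnd f g) id y → x = y := by
    intro n x y h1 h2
    refine forms_ext fun i => fiberProd_ext ?_ ?_
    · rw [← coeffs_formsMap_id, ← coeffs_formsMap_id, h1]
    · rw [← coeffs_formsMap_id, ← coeffs_formsMap_id, h2]
  refine CommAlgCat.isPullback_of_forall ?_ (fun x y h1 h2 => Subtype.ext
    (hext (congrArg Subtype.val h1) (congrArg Subtype.val h2))) fun a c h => ?_
  · rw [← NatTrans.comp_app, ← NatTrans.comp_app, ← Functor.map_comp, ← Functor.map_comp,
      fiberProd_condition]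
  · classical
    change A.cycles k.unop.len at a
    change C.cycles k.unop.len at c
    have h' : formsMap f id a.1 = formsMap g id c.1 := congrArg Subtype.val h
    let z : FormIndex R k.unop.len →₀ (fiberProd f g).carrier :=
      Finsupp.onFinset ((A.coeffs _ a.1).support ∪ (C.coeffs _ c.1).support)
        (fun i => (⟨(A.coeffs _ a.1 i, C.coeffs _ c.1 i), by
          change DGAlg.Hom.hom f (A.coeffs _ a.1 i) = DGAlg.Hom.hom g (C.coeffs _ c.1 i)
          rw [← coeffs_formsMap_id, ← coeffs_formsMap_id, h']⟩ : fiberSubalgebra f g)) fun i hi => by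
          by_contra hn
          rw [Finset.mem_union, not_or, Finsupp.notMem_support_iff, Finsupp.notMem_support_iff] at hn
          exact hi (Subtype.ext (Prod.ext hn.1 hn.2))
    let x : (fiberProd f g).Forms k.unop.len := ((fiberProd f g).coeffs _).symm z
    have hx : (fiberProd f g).coeffs _ x = z := LinearEquiv.apply_symm_apply _ _
    have h1 : formsMap (fiberProdFst f g) id x = a.1 := forms_ext fun i => by
      rw [coeffs_formsMap_id, hx]
      rfl
    have h2 : formsMap (fiberProdSnd f g) id x = c.1 := forms_ext fun i => by
      rw [coeffs_formsMap_id, hx]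
      rfl
    refine ⟨(⟨x, mem_formsIn_iff.2 fun i => ?_, hext ?_ ?_⟩ : (fiberProd f g).cycles _),
      Subtype.ext h1, Subtype.ext h2⟩
    · rw [hx]
      exact ⟨mem_formsIn_iff.1 a.2.1 i, mem_formsIn_iff.1 c.2.1 i⟩
    · rw [← totalD_formsMap', h1, a.2.2, map_zero]
    · rw [← totalD_formsMap', h2, c.2.2, map_zero]

end FiberProduct

end DGAlg

section Transfer

variable {D D' : Type*} [Category D] [Category D'] {T : D ⥤ D'}
  {T' : D' ⥤ SimplicialObject (CommAlgCat.{u} R)} {E : CommAlgCat.{u} R ⥤ QuasiComonoid.{w}}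
  {N : SimplicialObject QuasiComonoid.{w} ⥤ SSet.{w}}

lemma SimplicialAlg.property_map (W : MorphismProperty SSet.{w}) {A B : D} {f : A ⟶ B}
    (h : W (N.map (Functor.whiskerRight (T'.map (T.map f)) E))) :
    W (((T ⋙ T' ⋙ (SimplicialObject.whiskering _ _).obj E) ⋙ N).map f) := h

lemma SimplicialAlg.isHomogeneous_nerve_comp (hE : IsHomogeneousQM R E) {sq : MorphismProperty D}
    (hsq : ∀ ⦃A B : D⦄ ⦃f : A ⟶ B⦄, sq f → ∀ k, algSquareZero R ((T'.map (T.map f)).app k))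
    (hpb : ∀ ⦃P A B C : D⦄ ⦃a : P ⟶ A⦄ ⦃c : P ⟶ C⦄ ⦃f : A ⟶ B⦄ ⦃g : C ⟶ B⦄, IsPullback a c f g →
      ∀ k, IsPullback ((T'.map (T.map a)).app k) ((T'.map (T.map c)).app k)
        ((T'.map (T.map f)).app k) ((T'.map (T.map g)).app k)) :
    IsHomogeneous sq ((T ⋙ T' ⋙ (SimplicialObject.whiskering _ _).obj E) ⋙ derivedDeligneNerve) ∧
      IsHomogeneous sq ((T ⋙ T' ⋙ (SimplicialObject.whiskering _ _).obj E) ⋙ deligneNerve) :=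
  ⟨fun _ _ _ _ _ _ _ _ hf h =>
      (isLevelwisePullback hE (hsq hf) (hpb h)).isPullback_derivedDeligneNerve,
    fun _ _ _ _ _ _ _ _ hf h => (isLevelwisePullback hE (hsq hf) (hpb h)).isPullback_deligneNerve⟩

end Transfer

namespace DGN

open SimplicialAlg DGAlg

variable {P A B C : DGN R} {a : P ⟶ A} {c : P ⟶ C} {f : A ⟶ B} {g : C ⟶ B}

lemma isNilpotentBounded_fiberProd (f : A ⟶ B) (g : C ⟶ B) :
    DGAlg.isNilpotentBounded (DGAlg.fiberProd f.hom g.hom) := by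
  obtain ⟨⟨N, hN⟩, M, hM⟩ := A.property
  obtain ⟨⟨N', hN'⟩, M', hM'⟩ := C.property
  refine ⟨⟨max N N', ?_⟩, max M M', fun i hi => ?_⟩
  · rw [eq_bot_iff]
    intro x hx
    exact DGAlg.fiberProd_ext
      ((map_augIdeal_pow_eq_zero _ hN (le_max_left _ _) hx).trans (map_zero _).symm)
      ((map_augIdeal_pow_eq_zero _ hN' (le_max_right _ _) hx).trans (map_zero _).symm)
  · rw [eq_bot_iff]
    intro x hx
    have h1 := (DGAlg.fiberProdFst f.hom g.hom).map_mem i x hx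
    have h2 := (DGAlg.fiberProdSnd f.hom g.hom).map_mem i x hx
    rw [hM i (le_trans (le_max_left _ _) hi)] at h1
    rw [hM' i (le_trans (le_max_right _ _) hi)] at h2
    exact DGAlg.fiberProd_ext (Eq.trans h1 (map_zero _).symm) (Eq.trans h2 (map_zero _).symm)

lemma isPullback_app (h : IsPullback a c f g) (k : SimplexCategoryᵒᵖ) :
    IsPullback (((simplicialCycles R).map a.hom).app k) (((simplicialCycles R).map c.hom).app k)
      (((simplicialCycles R).map f.hom).app k) (((simplicialCycles R).map g.hom).app k) := by
  let P' : DGN R := ⟨DGAlg.fiberProd f.hom g.hom, isNilpotentBounded_fiberProd f g⟩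
  let a' : P' ⟶ A := ObjectProperty.homMk (DGAlg.fiberProdFst f.hom g.hom)
  let c' : P' ⟶ C := ObjectProperty.homMk (DGAlg.fiberProdSnd f.hom g.hom)
  have h0 := DGAlg.isPullback_fiberProd f.hom g.hom
  have h' : IsPullback a' c' f g :=
    IsPullback.of_map (ObjectProperty.ι _) (ObjectProperty.hom_ext _ h0.w) h0
  let T : DGN R ⥤ CommAlgCat.{u} R :=
    ObjectProperty.ι _ ⋙ simplicialCycles R ⋙ (evaluation _ _).obj k
  refine IsPullback.of_iso (DGAlg.isPullback_cycles f.hom g.hom k)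
    (T.mapIso (h.isoIsPullback A C h')).symm (Iso.refl _) (Iso.refl _) (Iso.refl _) ?_ ?_
    (by simp) (by simp)
  · rw [Iso.refl_hom, Category.comp_id, Iso.symm_hom, Iso.eq_inv_comp]
    exact (T.map_comp _ a').symm.trans (congrArg (fun q => T.map q) (h.isoIsPullback_hom_fst A C h'))
  · rw [Iso.refl_hom, Category.comp_id, Iso.symm_hom, Iso.eq_inv_comp]
    exact (T.map_comp _ c').symm.trans (congrArg (fun q => T.map q) (h.isoIsPullback_hom_snd A C h'))

variable {E : CommAlgCat.{u} R ⥤ QuasiComonoid.{w}} (hE : IsHomogeneousQM R E)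
  (hs : ∀ n, IsFormallySmooth R (E ⋙ QuasiComonoid.level n)) [Algebra ℚ R]

omit [Algebra ℚ R] in
lemma mul_eq_zero_of_squareZero (hf : squareZero R f) (m : SimplexCategoryᵒᵖ)
    (x y : ((simplicialCycles R).obj A.obj).obj m)
    (hx : (((simplicialCycles R).map f.hom).app m).hom x = 0)
    (hy : (((simplicialCycles R).map f.hom).app m).hom y = 0) : x * y = 0 :=
  mul_eq_zero_of_forall (n := m.unop.len) f.hom (S := fun i => kerGr f.hom i)
    (fun _ a ha b hb => hf.2 a b ha.2 hb) (mem_formsIn_ker (n := m.unop.len) f.hom hx) hy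

include hE

theorem isHomogeneous_nerve : IsHomogeneous (squareZero R) (underline R E ⋙ derivedDeligneNerve) ∧
    IsHomogeneous (squareZero R) (underline R E ⋙ deligneNerve) :=
  isHomogeneous_nerve_comp (T := ObjectProperty.ι _) (T' := simplicialCycles R) hE
    (fun _ _ f hf k => ⟨cyclesMap_surjective f.hom hf.1 k.unop.len, mul_eq_zero_of_squareZero hf k⟩)
    fun _ _ _ _ _ _ _ _ h => isPullback_app h

include hs

theorem nerve_of_squareZero (hf : squareZero R f) :
    IsKanFibration ((underline R E ⋙ derivedDeligneNerve).map f) ∧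
      IsKanFibration ((underline R E ⋙ deligneNerve).map f) := by
  obtain ⟨⟨N, hN⟩, -⟩ := A.property
  have h := nerve_rlp_J_of_nilpotent hE hs ((simplicialCycles R).map f.hom)
    (fun m => cyclesMap_surjective f.hom hf.1 m.unop.len) A.obj.boundaryCycles B.obj.boundaryCycles
    boundaryIdeal_le_boundaryCycles (boundaryCycles_le_map f.hom hf.1)
    (mul_eq_zero_of_squareZero hf) (N + 1) (augCycles_pow_eq_bot hN)
  exact ⟨property_map (T := ObjectProperty.ι _) (T' := simplicialCycles R)
      (fun _ _ p => IsKanFibration p) h.1,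
    property_map (T := ObjectProperty.ι _) (T' := simplicialCycles R)
      (fun _ _ p => IsKanFibration p) h.2⟩

theorem nerve_of_tinyAcyclic (hf : tinyAcyclic R f) :
    IsTrivialKanFibration ((underline R E ⋙ derivedDeligneNerve).map f) ∧
      IsSurjectiveKanFibration ((underline R E ⋙ deligneNerve).map f) := by
  obtain ⟨hsurj, hann, r, hr, hbij⟩ := hf
  suffices h : IsTrivialKanFibration (derivedDeligneNerve.map
      (Functor.whiskerRight ((simplicialCycles R).map f.hom) E)) ∧ IsSurjectiveKanFibration
        (deligneNerve.map (Functor.whiskerRight ((simplicialCycles R).map f.hom) E)) from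
    ⟨property_map (T := ObjectProperty.ι _) (T' := simplicialCycles R)
        (fun _ _ p => IsTrivialKanFibration p) h.1,
      property_map (T := ObjectProperty.ι _) (T' := simplicialCycles R)
        (fun _ _ p => IsSurjectiveKanFibration p) h.2⟩
  refine nerve_of_annihilated hE hs ((simplicialCycles R).map f.hom)
    (fun m => cyclesMap_surjective f.hom hsurj m.unop.len) A.obj.boundaryCycles B.obj.boundaryCycles
    boundaryIdeal_le_boundaryCycles (boundaryCycles_le_map f.hom hsurj) (fun y hy => ?_)
    (fun m x y hx hy => ?_) (isKerAcyclic_simplicialCycles hr hbij)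
  · have hy' : A.obj.evalForms y.1 ∈ kerGr f.hom 0 :=
      evalForms_mem (S := fun i => kerGr f.hom i) (mem_formsIn_ker (n := 0) f.hom hy)
    change A.obj.evalForms y.1 ∈ (A.obj.gr 1).map A.obj.d
    rcases Nat.eq_zero_or_pos r with rfl | hr0
    · obtain ⟨c, hc, hc'⟩ := hbij.surjOn hy'
      exact ⟨c, hc.1, hc'⟩
    · rw [hr 0 (by omega) (by omega)] at hy'
      rw [show A.obj.evalForms y.1 = 0 from hy']
      exact zero_mem _
  · exact mul_eq_zero_of_forall (n := m.unop.len) f.hom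
      (S := fun i => A.obj.augIdeal ⊓ A.obj.gr i) (fun _ a ha b hb => hann a b ha.1 hb)
      (mem_formsIn_of_vertexValue_mem (n := m.unop.len) (x := x) hx) hy

end DGN

end

theorem mainTheorem9 (R : Type u) [CommRing R] (E : CommAlgCat.{u} R ⥤ QuasiComonoid.{w})
    (hE : IsHomogeneousQM R E)
    (hsm : ∀ n : ℕ, IsFormallySmooth R (E ⋙ QuasiComonoid.level n)) :
    ((IsHomogeneous (SN.squareZero R) (SN.underline R E ⋙ derivedDeligneNerve) ∧
        IsFormallyQuasiSmooth (SN.squareZero R) (SN.tinyAcyclic R)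
          (SN.underline R E ⋙ derivedDeligneNerve)) ∧
      (IsHomogeneous (SN.squareZero R) (SN.underline R E ⋙ deligneNerve) ∧
        IsPreHomotopic (SN.tinyAcyclic R) (SN.underline R E ⋙ deligneNerve) ∧
        IsFormallyQuasiPresmooth (SN.squareZero R) (SN.underline R E ⋙ deligneNerve))) ∧
    (∀ [Algebra ℚ R],
      (IsHomogeneous (DGN.squareZero R) (DGN.underline R E ⋙ derivedDeligneNerve) ∧
        IsFormallyQuasiSmooth (DGN.squareZero R) (DGN.tinyAcyclic R)
          (DGN.underline R E ⋙ derivedDeligneNerve)) ∧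
      (IsHomogeneous (DGN.squareZero R) (DGN.underline R E ⋙ deligneNerve) ∧
        IsPreHomotopic (DGN.tinyAcyclic R) (DGN.underline R E ⋙ deligneNerve) ∧
        IsFormallyQuasiPresmooth (DGN.squareZero R) (DGN.underline R E ⋙ deligneNerve))) := by
  refine ⟨⟨⟨(SN.isHomogeneous_nerve hE).1, ?_, ?_⟩, (SN.isHomogeneous_nerve hE).2, ?_, ?_⟩, ?_⟩
  · exact fun _ _ _ hf => (SN.nerve_of_squareZero hE hsm hf).1
  · exact fun _ _ _ hf => (SN.nerve_of_tinyAcyclic hE hsm hf).1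
  · exact fun _ _ _ hf => (SN.nerve_of_tinyAcyclic hE hsm hf).2
  · exact fun _ _ _ hf => (SN.nerve_of_squareZero hE hsm hf).2
  · intro _
    refine ⟨⟨(DGN.isHomogeneous_nerve hE).1, ?_, ?_⟩, (DGN.isHomogeneous_nerve hE).2, ?_, ?_⟩
    · exact fun _ _ _ hf => (DGN.nerve_of_squareZero hE hsm hf).1
    · exact fun _ _ _ hf => (DGN.nerve_of_tinyAcyclic hE hsm hf).1
    · exact fun _ _ _ hf => (DGN.nerve_of_tinyAcyclic hE hsm hf).2
    · exact fun _ _ _ hf => (DGN.nerve_of_squareZero hE hsm hf).2
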